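/- Let $F:\mathbb R\to\mathbb R$ be even and of class $C^{7}$, and suppose that there are $\alpha\in(0,1)$ and $C,M>0$ with $|F^{(\ell)}(u)|\le C(1+|u|)^M$ for $0\le \ell\le 7$ and $|F^{(7)}(u+h)-F^{(7)}(u)|\le C(1+|u|)^M|h|^\alpha$ for all $u\in\mathbb R$, $|h|<1$. Let $\rho:\mathbb R^2\to\mathbb R$ be smooth and compactly supported, with $\rho(t,-x)=\rho(t,x)$ and $\int\rho=1$, and put $\rho_\varepsilon(t,x)=\varepsilon^{-3}\rho(t/\varepsilon^2,x/\varepsilon)$. For a heat kernel $P$ (of $\partial_t-\partial_x^2$, set to $0$ for $t\le 0$) write $P'=\partial_xP$. Let $\hat\Psi=P'*\rho*\hat\xi$, where $P$ is the heat kernel on $\mathbb R$ and $\hat\xi$ is space-time white noise on $\mathbb R\times\mathbb R$. Let $a=\frac12\mathbb E F''(\hat\Psi(0))$ and assume $a\neq0$. For $\varepsilon\in(0,1)$ let $\Psi_\varepsilon=P'*\rho_\varepsilon*\xi$, where now $P$ is the heat kernel on the circle $\mathbb T=\mathbb R/\mathbb Z$ and $\xi$ is space-time white noise on $\mathbb R\times\mathbb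 T$; $\Psi_\varepsilon$ is regarded as a field on $\mathbb R^2$ that is $1$-periodic in space. Let $K:\mathbb R^2\to\mathbb R$ be a truncation of the heat kernel: smooth away from the origin, compactly supported, even in $x$, and equal near the origin to the heat kernel (of $\mathbb T$ or of $\mathbb R$); write $K'=\partial_xK$. For space-time points $x,y,z\in\mathbb R^2$ write $X=\varepsilon^{1/2}\Psi_\varepsilon(x)$, $Y=\varepsilon^{1/2}\Psi_\varepsilon(y)$, $Z=\varepsilon^{1/2}\Psi_\varepsilon(z)$, and $\overline W=W-\mathbb E W$ for a random variable $W$, and define $$C^{(\varepsilon)}_{2'2'0}=\frac1{a^2\varepsilon^2}\int K'(x-y)K'(x-z)\,\mathbb E\big(\overline{F(Y)}\;\overline{F(Z)}\big)\,dy\,dz,$$ $$C^{(\varepsilon)}_{2'1'1'}=\frac1{4a^3\varepsilon^2}\int K'(x-y)K'(y-z)\,\mathbb E\big(F'(X)F'(Y)\overline{F(Z)}\big)\,dy\,dz,$$ where the integrals run over $\mathbb R^2\times\mathbb R^2$ (by stationarity the constants do not depend on $x$). Then these integrals converge absolutely, and $$\sup_{\varepsilon\in(0,1)}\big|C^{(\varepsilon)}_{2'2'0}+4\,C^{(\varepsilon)}_{2'1'1'}\big|<\infty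 .$$ -/

import Mathlib

open MeasureTheory ProbabilityTheory Filter Topology Set
open scoped ContDiff

/-- The assumption on the nonlinearity: `F` is even, of class `C^{7+α}` for some `α ∈ (0,1)`, and
its derivatives of order at most seven, as well as the local `α`-Hölder seminorm of the seventh one,
grow at most polynomially. -/
structure IsAdmissibleNonlinearity (F : ℝ → ℝ) : Prop where
  even : ∀ u, F (-u) = F u
  contDiff : ContDiff ℝ 7 F
  growth : ∃ α C M : ℝ, 0 < α ∧ α < 1 ∧ 0 < C ∧ 0 < M ∧
    (∀ l : ℕ, l ≤ 7 → ∀ u : ℝ, |iteratedDeriv l F u| ≤ C * (1 + |u|) ^ M) ∧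
    (∀ u h : ℝ, |h| < 1 →
      |iteratedDeriv 7 F (u + h) - iteratedDeriv 7 F u| ≤ C * (1 + |u|) ^ M * |h| ^ α)

/-- The assumption on the space-time mollifier `ρ`. Space-time points are pairs `z = (t, x)`. -/
structure IsNoiseMollifier (ρ : ℝ × ℝ → ℝ) : Prop where
  contDiff : ContDiff ℝ ∞ ρ
  compactSupport : HasCompactSupport ρ
  symm : ∀ t x, ρ (t, -x) = ρ (t, x)
  integral_eq_one : ∫ z, ρ z = 1

/-- `ρ_ε(t, x) = ε⁻³ ρ(t / ε², x / ε)`. -/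
noncomputable def rescale (ε : ℝ) (ρ : ℝ × ℝ → ℝ) (z : ℝ × ℝ) : ℝ :=
  (ε ^ 3)⁻¹ * ρ (z.1 / ε ^ 2, z.2 / ε)

/-- The heat kernel of `∂_t - ∂_x²` on the line, extended by `0` to non-positive times. -/
noncomputable def heatKernelLine (z : ℝ × ℝ) : ℝ :=
  if 0 < z.1 then (Real.sqrt (4 * Real.pi * z.1))⁻¹ * Real.exp (-z.2 ^ 2 / (4 * z.1)) else 0

/-- The heat kernel on the circle of length one, as a function that is 1-periodic in space. -/
noncomputable def heatKernelCircle (z : ℝ × ℝ) : ℝ :=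
  ∑' n : ℤ, heatKernelLine (z.1, z.2 + n)

/-- The derivative in the space variable. -/
noncomputable def spaceDeriv (G : ℝ × ℝ → ℝ) (z : ℝ × ℝ) : ℝ :=
  deriv (fun x => G (z.1, x)) z.2

/-- Space-time convolution. If `f` is 1-periodic in space, this is the convolution on
`ℝ × (ℝ / ℤ)` of `f` with the periodisation of `g`. -/
noncomputable def spaceTimeConv (f g : ℝ × ℝ → ℝ) (z : ℝ × ℝ) : ℝ :=
  ∫ w, f (z - w) * g w

/-- `K` is a truncation of the heat kernel `P`: it is smooth away from the origin, compactly
supported, even in space, and it coincides with `P` near the origin. -/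
structure IsTruncation (P K : ℝ × ℝ → ℝ) : Prop where
  contDiffOn : ContDiffOn ℝ ∞ K {0}ᶜ
  compactSupport : HasCompactSupport K
  symm : ∀ t x, K (t, -x) = K (t, x)
  eq_near_origin : ∀ᶠ z in 𝓝[≠] (0 : ℝ × ℝ), K z = P z

/-- Gaussian white noise on `E` with intensity `ν`: a centred Gaussian process indexed by the
square integrable functions `g`, where `ξ g` stands for `∫ g dξ`, and whose covariance is the
`L²(ν)` scalar product. The values of `ξ` on other functions are irrelevant. -/
structure IsWhiteNoise {E Ω : Type*} [MeasurableSpace E] [MeasurableSpace Ω]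
    (ν : Measure E) (μ : Measure Ω) (ξ : (E → ℝ) → Ω → ℝ) : Prop where
  gaussian : IsGaussianProcess (fun g : {g : E → ℝ // MemLp g 2 ν} => ξ g.1) μ
  mean_zero : ∀ g, MemLp g 2 ν → ∫ η, ξ g η ∂μ = 0
  covariance : ∀ g h, MemLp g 2 ν → MemLp h 2 ν →
    ∫ η, ξ g η * ξ h η ∂μ = ∫ e, g e * h e ∂ν

/-- Lebesgue measure on `ℝ × (ℝ / ℤ)`, the circle being identified with `[0, 1)`. -/
noncomputable def circleVolume : Measure (ℝ × ℝ) :=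
  (volume : Measure (ℝ × ℝ)).restrict (univ ×ˢ Ico (0 : ℝ) 1)

section Fields

variable {Ω : Type*}

/-- The field `P' * ξ * ρ` on the whole line, for a white noise `ξ` on `ℝ × ℝ`. -/
noncomputable def fieldLine (ρ : ℝ × ℝ → ℝ) (ξ : (ℝ × ℝ → ℝ) → Ω → ℝ) (z : ℝ × ℝ) : Ω → ℝ :=
  ξ (fun w => spaceTimeConv (spaceDeriv heatKernelLine) ρ (z - w))

/-- The field `Ψ_ε = P' * ξ_ε`, `ξ_ε = ξ * ρ_ε`, on the circle, for a white noise `ξ` on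
`ℝ × (ℝ / ℤ)`, as a field that is 1-periodic in space. -/
noncomputable def fieldCircle (ρ : ℝ × ℝ → ℝ) (ξ : (ℝ × ℝ → ℝ) → Ω → ℝ) (ε : ℝ) (z : ℝ × ℝ) :
    Ω → ℝ :=
  ξ (fun w => spaceTimeConv (spaceDeriv heatKernelCircle) (rescale ε ρ) (z - w))

variable [MeasurableSpace Ω]

/-- The coupling constant `a = ½ E F''(P' * ξ * ρ)`, with the field on the whole line. -/
noncomputable def couplingConst (μ : Measure Ω) (F : ℝ → ℝ) (ρ : ℝ × ℝ → ℝ)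
    (ξ : (ℝ × ℝ → ℝ) → Ω → ℝ) : ℝ :=
  (1 / 2) * ∫ η, iteratedDeriv 2 F (fieldLine ρ ξ 0 η) ∂μ

/-- The recentred random variable `X - E X`. -/
noncomputable def centred (μ : Measure Ω) (X : Ω → ℝ) (η : Ω) : ℝ :=
  X η - ∫ η', X η' ∂μ

/-- `K'(x - y) K'(x - z) E (⟦F(Y)⟧ ⟦F(Z)⟧)` with `p = (y, z)`, where `Φ` is the field
`√ε Ψ_ε`, `Y = Φ y`, `Z = Φ z` and `⟦·⟧` is recentring. -/
noncomputable def integrand220 (μ : Measure Ω) (F : ℝ → ℝ) (K : ℝ × ℝ → ℝ)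
    (Φ : ℝ × ℝ → Ω → ℝ) (x : ℝ × ℝ) (p : (ℝ × ℝ) × (ℝ × ℝ)) : ℝ :=
  spaceDeriv K (x - p.1) * spaceDeriv K (x - p.2) *
    ∫ η, centred μ (fun η' => F (Φ p.1 η')) η * centred μ (fun η' => F (Φ p.2 η')) η ∂μ

/-- `K'(x - y) K'(y - z) E (F'(X) F'(Y) ⟦F(Z)⟧)` with `p = (y, z)`. -/
noncomputable def integrand211 (μ : Measure Ω) (F : ℝ → ℝ) (K : ℝ × ℝ → ℝ)
    (Φ : ℝ × ℝ → Ω → ℝ) (x : ℝ × ℝ) (p : (ℝ × ℝ) × (ℝ × ℝ)) : ℝ :=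
  spaceDeriv K (x - p.1) * spaceDeriv K (p.1 - p.2) *
    ∫ η, deriv F (Φ x η) * deriv F (Φ p.1 η) * centred μ (fun η' => F (Φ p.2 η')) η ∂μ

/-- The rescaled field `√ε Ψ_ε`. -/
noncomputable def scaledField (ρ : ℝ × ℝ → ℝ) (ξ : (ℝ × ℝ → ℝ) → Ω → ℝ) (ε : ℝ) (z : ℝ × ℝ)
    (η : Ω) : ℝ :=
  Real.sqrt ε * fieldCircle ρ ξ ε z η

/-- The renormalisation constant `C_{2'2'0}`, computed at the space-time point `x`. -/
noncomputable def renormConst220 (μ : Measure Ω) (F : ℝ → ℝ) (K ρ : ℝ × ℝ → ℝ)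
    (ξ : (ℝ × ℝ → ℝ) → Ω → ℝ) (a ε : ℝ) (x : ℝ × ℝ) : ℝ :=
  1 / (a ^ 2 * ε ^ 2) * ∫ p, integrand220 μ F K (scaledField ρ ξ ε) x p

/-- The renormalisation constant `C_{2'1'1'}`, computed at the space-time point `x`. -/
noncomputable def renormConst211 (μ : Measure Ω) (F : ℝ → ℝ) (K ρ : ℝ × ℝ → ℝ)
    (ξ : (ℝ × ℝ → ℝ) → Ω → ℝ) (a ε : ℝ) (x : ℝ × ℝ) : ℝ :=
  1 / (4 * a ^ 3 * ε ^ 2) * ∫ p, integrand211 μ F K (scaledField ρ ξ ε) x p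

end Fields

/-!
Write `k = K'`, let `C` be the covariance of the stationary Gaussian field `Φ = √ε Ψ_ε`, and put
`2 a_ε = E F''(Φ)`. Since `F` is even, the expansion of the two expectations in powers of the
covariances starts with `2 a_ε² C(y - z)²` in the first integral and with
`8 a_ε³ C(x - z) C(y - z)` in the second one. The leading terms of the two integrals are thus
`2 a_ε² ∫ C² (k ⋆ k)` and `8 a_ε³ ∫ k C (k ⋆ C)`. As `∫ (∂_x P)(z) (∂_x P)(z + w) dz` is
`½ (P(|t|, x) - 1)` for `w = (t, x)`, `C(w)` is, up to averaging on the scale `ε`, of size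
`ε / (|w| + ε)` in the parabolic distance, and both terms are of order `ε² |log ε|` by power
counting: the logarithms have to cancel.

They cancel for the following reason. Let `D = (2 / ε) ∂_x C`, which is close to `∂_x P`, hence to
`k`, at positive times and distances larger than `ε`. The function `C² (k ⋆ k)` is even, so its
integral is twice the integral over positive times. Replacing `k` by `D` where this is harmless,
one is left with the integral over positive times of
`4 D C (k ⋆ C) + 2 C² (k ⋆ D) = (4 / ε) ∂_x (C² (k ⋆ C))`, an exact space derivative, whose
integral over the slab `|x| < 1/2` consists of boundary terms of order `ε²`
(`exists_integral_slab_le`); `exists_cancellation` collects the replacements, which are controlled by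
the closeness of `k` and `D` (`exists_covKernel`).

The remainders in the Gaussian expansions come from interpolating between a Gaussian triple and one
with some covariances removed, along which the derivative is again a Gaussian expectation, by
integration by parts (`integral_mul_eq_of_hasGaussianLaw`). For the first integral the remainder is
of order `C⁴` (`gExpansion_covariance`). For the second one, the oddness of `k` makes it enough to
consider the increment of the expectation under a spatial reflection of one variable, and the
remainder keeps the increment of `C` as a factor (`exists_abs_gExp_sub_le_of_cov`); without it the
integrals of the remainders would diverge logarithmically. The integrals of the remainders are
`O(ε²)` by power counting for the parabolic distance on `ℝ × (ℝ / ℤ)`, whose volume growth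
is that of a three-dimensional space (`exists_riesz`, `exists_lintegral_conv_le`).

Finally `Var Φ` converges at rate `ε` to the variance of the field on the whole line
(`exists_covFun_zero_sub_le`), so that `a_ε - a = O(ε)`, which is more than enough to replace `a_ε` by
`a` in integrals of order `ε² |log ε|` (`abs_combination_le`).
-/

/-! ### Functions of polynomial growth and random variables with all moments -/

/-- `f` is bounded by a polynomial in `|u|`. -/
def PolyGrowth (f : ℝ → ℝ) : Prop := ∃ C : ℝ, ∃ m : ℕ, ∀ u, |f u| ≤ C * (1 + |u|) ^ m

/-- `f` is of class `C^n`, with derivatives of order at most `n` of polynomial growth. -/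
def PolyC (n : ℕ) (f : ℝ → ℝ) : Prop :=
  ContDiff ℝ n f ∧ ∀ l ≤ n, PolyGrowth (iteratedDeriv l f)

lemma PolyC.growth {n : ℕ} {f : ℝ → ℝ} (h : PolyC n f) : PolyGrowth f := by
  simpa using h.2 0 (Nat.zero_le _)

lemma PolyC.continuous {n : ℕ} {f : ℝ → ℝ} (h : PolyC n f) : Continuous f := h.1.continuous

lemma PolyC.differentiable {n : ℕ} {f : ℝ → ℝ} (h : PolyC (n + 1) f) : Differentiable ℝ f :=
  h.1.differentiable (by simp)

lemma PolyC.hasDerivAt {n : ℕ} {f : ℝ → ℝ} (h : PolyC (n + 1) f) (x : ℝ) :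
    HasDerivAt f (deriv f x) x := (h.differentiable x).hasDerivAt

lemma PolyC.deriv {n : ℕ} {f : ℝ → ℝ} (h : PolyC (n + 1) f) : PolyC n (deriv f) := by
  refine ⟨?_, fun l hl => ?_⟩
  · have := h.1
    rw [show ((n + 1 : ℕ) : WithTop ℕ∞) = (n : WithTop ℕ∞) + 1 by simp,
      contDiff_succ_iff_deriv] at this
    exact this.2.2
  · rw [← iteratedDeriv_succ']
    exact h.2 (l + 1) (by omega)

lemma PolyC.mono {n m : ℕ} {f : ℝ → ℝ} (h : PolyC n f) (hm : m ≤ n) : PolyC m f :=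
  ⟨h.1.of_le (by exact_mod_cast hm), fun l hl => h.2 l (hl.trans hm)⟩

lemma PolyGrowth.nonneg {f : ℝ → ℝ} (h : PolyGrowth f) :
    ∃ C : ℝ, ∃ m : ℕ, 0 ≤ C ∧ ∀ u, |f u| ≤ C * (1 + |u|) ^ m := by
  obtain ⟨C, m, h⟩ := h
  have := (abs_nonneg _).trans (h 0)
  simp at this
  exact ⟨C, m, this, h⟩

lemma PolyGrowth.mul {f g : ℝ → ℝ} (hf : PolyGrowth f) (hg : PolyGrowth g) :
    PolyGrowth (fun u => f u * g u) := by
  obtain ⟨C, m, hC, hf⟩ := hf.nonneg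
  obtain ⟨D, n, hD, hg⟩ := hg.nonneg
  refine ⟨C * D, m + n, fun u => ?_⟩
  rw [abs_mul, pow_add]
  calc |f u| * |g u| ≤ (C * (1 + |u|) ^ m) * (D * (1 + |u|) ^ n) :=
        mul_le_mul (hf u) (hg u) (abs_nonneg _) (by positivity)
    _ = _ := by ring

lemma PolyGrowth.add {f g : ℝ → ℝ} (hf : PolyGrowth f) (hg : PolyGrowth g) :
    PolyGrowth (fun u => f u + g u) := by
  obtain ⟨C, m, hC, hf⟩ := hf.nonneg
  obtain ⟨D, n, hD, hg⟩ := hg.nonneg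
  refine ⟨C + D, m + n, fun u => ?_⟩
  have h1 : (1 : ℝ) ≤ 1 + |u| := by linarith [abs_nonneg u]
  calc |f u + g u| ≤ |f u| + |g u| := abs_add_le _ _
    _ ≤ C * (1 + |u|) ^ m + D * (1 + |u|) ^ n := add_le_add (hf u) (hg u)
    _ ≤ C * (1 + |u|) ^ (m + n) + D * (1 + |u|) ^ (m + n) := by
        gcongr <;> first | exact h1 | omega
    _ = _ := by ring

lemma PolyGrowth.const (c : ℝ) : PolyGrowth (fun _ => c) := ⟨|c|, 0, fun u => by simp⟩

lemma PolyGrowth.const_mul {f : ℝ → ℝ} (hf : PolyGrowth f) (c : ℝ) :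
    PolyGrowth (fun u => c * f u) := (PolyGrowth.const c).mul hf

lemma PolyGrowth.comp_affine {f : ℝ → ℝ} (hf : PolyGrowth f) (α x : ℝ) :
    PolyGrowth (fun u => f (α * u + x)) := by
  obtain ⟨C, m, hC, hf⟩ := hf.nonneg
  refine ⟨C * (1 + |α| + |x|) ^ m, m, fun u => (hf _).trans ?_⟩
  rw [mul_assoc, ← mul_pow]
  gcongr
  have := abs_add_le (α * u) x
  rw [abs_mul] at this
  nlinarith [abs_nonneg α, abs_nonneg x, abs_nonneg u, mul_nonneg (abs_nonneg x) (abs_nonneg u)]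

/-- The random variable `U` has moments of all orders. -/
def AllLp {Ω : Type*} [MeasurableSpace Ω] (μ : Measure Ω) (U : Ω → ℝ) : Prop :=
  ∀ p : ENNReal, p ≠ ⊤ → MemLp U p μ

section AllLp

variable {Ω : Type*} [MeasurableSpace Ω] {μ : Measure Ω}

lemma AllLp.integrable {U : Ω → ℝ} (h : AllLp μ U) : Integrable U μ :=
  memLp_one_iff_integrable.1 (h 1 (by simp))

lemma AllLp.aestronglyMeasurable {U : Ω → ℝ} (h : AllLp μ U) : AEStronglyMeasurable U μ :=
  (h 1 (by simp)).1

lemma AllLp.mul {U V : Ω → ℝ} (hU : AllLp μ U) (hV : AllLp μ V) :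
    AllLp μ (fun η => U η * V η) := by
  intro p hp
  have : ENNReal.HolderTriple (2 * p) (2 * p) p := by
    constructor
    rcases eq_or_ne p 0 with rfl | h0
    · simp
    · rw [ENNReal.mul_inv (by simp) (by simp), ← two_mul, ← mul_assoc,
        ENNReal.mul_inv_cancel (by simp) (by simp), one_mul]
  exact MemLp.mul' (p := 2 * p) (q := 2 * p) (hV _ (ENNReal.mul_ne_top (by simp) hp))
    (hU _ (ENNReal.mul_ne_top (by simp) hp))

lemma AllLp.add {U V : Ω → ℝ} (hU : AllLp μ U) (hV : AllLp μ V) :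
    AllLp μ (fun η => U η + V η) := fun p hp => (hU p hp).add (hV p hp)

lemma AllLp.const_mul {U : Ω → ℝ} (hU : AllLp μ U) (c : ℝ) : AllLp μ (fun η => c * U η) :=
  fun p hp => (hU p hp).const_mul c

lemma AllLp.abs {U : Ω → ℝ} (hU : AllLp μ U) : AllLp μ (fun η => |U η|) :=
  fun p hp => (hU p hp).abs

lemma AllLp.const [IsFiniteMeasure μ] (c : ℝ) : AllLp μ (fun _ => c) :=
  fun _ _ => memLp_const c

lemma AllLp.pow [IsFiniteMeasure μ] {U : Ω → ℝ} (hU : AllLp μ U) (m : ℕ) :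
    AllLp μ (fun η => U η ^ m) := by
  induction m with
  | zero => simpa using AllLp.const (μ := μ) 1
  | succ m ih => simpa [pow_succ] using ih.mul hU

lemma AllLp.growth [IsFiniteMeasure μ] {U : Ω → ℝ} (hU : AllLp μ U) (m : ℕ) :
    AllLp μ (fun η => (1 + |U η|) ^ m) :=
  ((AllLp.const (μ := μ) 1).add hU.abs).pow m

lemma AllLp.comp [IsFiniteMeasure μ] {U : Ω → ℝ} (hU : AllLp μ U) {f : ℝ → ℝ} (hf : PolyGrowth f)
    (hc : Continuous f) : AllLp μ (fun η => f (U η)) := by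
  obtain ⟨C, m, hC, hf⟩ := hf.nonneg
  intro p hp
  refine MemLp.mono (((hU.growth m).const_mul C) p hp)
    (hc.comp_aestronglyMeasurable hU.aestronglyMeasurable) (ae_of_all _ fun η => ?_)
  rw [Real.norm_eq_abs, Real.norm_eq_abs]
  exact (hf _).trans (le_abs_self _)

end AllLp

/-! ### Gaussian integration by parts -/

lemma allLp_id_gaussianReal (m : ℝ) (v : NNReal) : AllLp (gaussianReal m v) (fun x => x) :=
  fun p hp => memLp_id_gaussianReal' p hp

lemma integrable_gaussianPDFReal_mul {v : NNReal} (hv : v ≠ 0) {f : ℝ → ℝ}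
    (hf : Integrable f (gaussianReal 0 v)) :
    Integrable (fun x => gaussianPDFReal 0 v x * f x) := by
  rw [gaussianReal_of_var_ne_zero _ hv] at hf
  have := (integrable_withDensity_iff_integrable_smul' (measurable_gaussianPDF 0 v)
    (ae_of_all _ fun _ => gaussianPDF_lt_top)).1 hf
  simpa [toReal_gaussianPDF] using this

lemma hasDerivAt_gaussianPDFReal {v : NNReal} (hv : v ≠ 0) (x : ℝ) :
    HasDerivAt (gaussianPDFReal 0 v) (-(x / v) * gaussianPDFReal 0 v x) x := by
  have hv' : (v : ℝ) ≠ 0 := by exact_mod_cast hv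
  have h1 : HasDerivAt (fun y : ℝ => -(y - 0) ^ 2 / (2 * v)) (-(x / v)) x := by
    have := (((hasDerivAt_id x).sub_const 0).pow 2).neg.div_const (2 * (v : ℝ))
    convert! this using 1
    simp
    field_simp
  have h2 := (h1.exp).const_mul ((Real.sqrt (2 * Real.pi * v))⁻¹)
  unfold gaussianPDFReal
  convert! h2 using 1
  ring

/-- Stein's identity in one dimension, the Dirac mass at `0` included. -/
lemma integral_id_mul_gaussianReal (v : NNReal) {ψ : ℝ → ℝ} (hψ : Differentiable ℝ ψ)
    (hg : PolyGrowth ψ) (hg' : PolyGrowth (deriv ψ)) (hc : Continuous (deriv ψ)) :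
    ∫ x, x * ψ x ∂(gaussianReal 0 v) = v * ∫ x, deriv ψ x ∂(gaussianReal 0 v) := by
  rcases eq_or_ne v 0 with rfl | hv
  · simp
  have hv' : (v : ℝ) ≠ 0 := by exact_mod_cast hv
  have hid := allLp_id_gaussianReal 0 v
  have i1 := integrable_gaussianPDFReal_mul hv (hid.mul (hid.comp hg hψ.continuous)).integrable
  have i2 := integrable_gaussianPDFReal_mul hv (hid.comp hg' hc).integrable
  have i3 := integrable_gaussianPDFReal_mul hv (hid.comp hg hψ.continuous).integrable
  rw [integral_gaussianReal_eq_integral_smul hv, integral_gaussianReal_eq_integral_smul hv]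
  have := integral_mul_deriv_eq_deriv_mul_of_integrable (u := ψ) (v := gaussianPDFReal 0 v)
    (u' := deriv ψ) (v' := fun x => -(x / v) * gaussianPDFReal 0 v x)
    (fun x _ => (hψ x).hasDerivAt) (fun x _ => hasDerivAt_gaussianPDFReal hv x)
    ((i1.const_mul (-(v : ℝ)⁻¹)).congr (ae_of_all _ fun x => by
      simp only [Pi.mul_apply]; field_simp))
    (i2.congr (ae_of_all _ fun x => by simp only [Pi.mul_apply]; ring))
    (i3.congr (ae_of_all _ fun x => by simp only [Pi.mul_apply]; ring))
  simp only [smul_eq_mul]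
  have e1 : ∫ x, gaussianPDFReal 0 v x * (x * ψ x)
      = -(v : ℝ) * ∫ x, ψ x * (-(x / v) * gaussianPDFReal 0 v x) := by
    rw [← integral_const_mul]
    congr 1; ext x; field_simp
  have e2 : ∫ x, gaussianPDFReal 0 v x * deriv ψ x = ∫ x, deriv ψ x * gaussianPDFReal 0 v x := by
    congr 1; ext x; ring
  rw [e1, this, e2]; ring

section Stein

variable {Ω : Type*} [MeasurableSpace Ω] {μ : Measure Ω}

/-- A centred jointly Gaussian triple whose entries all have variance `v`, and whose covariances
are `p = E[XY]`, `q = E[XZ]` and `r = E[YZ]`. -/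
structure GTriple (μ : Measure Ω) (X Y Z : Ω → ℝ) (v p q r : ℝ) : Prop where
  law : HasGaussianLaw (fun η => (X η, Y η, Z η)) μ
  mX : ∫ η, X η ∂μ = 0
  mY : ∫ η, Y η ∂μ = 0
  mZ : ∫ η, Z η ∂μ = 0
  vX : ∫ η, X η * X η ∂μ = v
  vY : ∫ η, Y η * Y η ∂μ = v
  vZ : ∫ η, Z η * Z η ∂μ = v
  cXY : ∫ η, X η * Y η ∂μ = p
  cXZ : ∫ η, X η * Z η ∂μ = q
  cYZ : ∫ η, Y η * Z η ∂μ = r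

lemma ProbabilityTheory.HasGaussianLaw.allLp {X : Ω → ℝ} (h : HasGaussianLaw X μ) : AllLp μ X := fun _ hp => h.memLp hp

/-- Gaussian integration by parts along a direction `V` that is jointly Gaussian with the
arguments of the function. -/
lemma integral_mul_eq_of_hasGaussianLaw {V X Y Z : Ω → ℝ}
    (hlaw : HasGaussianLaw (fun η => (V η, X η, Y η, Z η)) μ) (mV : ∫ η, V η ∂μ = 0)
    {f g h : ℝ → ℝ} (hf : PolyC 1 f) (hg : PolyC 1 g) (hh : PolyC 1 h) :
    ∫ η, V η * (f (X η) * g (Y η) * h (Z η)) ∂μ =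
      (∫ η, V η * X η ∂μ) * ∫ η, deriv f (X η) * g (Y η) * h (Z η) ∂μ
      + (∫ η, V η * Y η ∂μ) * ∫ η, f (X η) * deriv g (Y η) * h (Z η) ∂μ
      + (∫ η, V η * Z η ∂μ) * ∫ η, f (X η) * g (Y η) * deriv h (Z η) ∂μ := by
  have hprob := hlaw.isProbabilityMeasure
  have lV := hlaw.fst.allLp
  have lX := hlaw.snd.fst.allLp
  have lY := hlaw.snd.snd.fst.allLp
  have lZ := hlaw.snd.snd.snd.allLp
  set s := ∫ η, V η * V η ∂μ with hs
  have hs0 : 0 ≤ s := integral_nonneg fun η => mul_self_nonneg _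
  -- the regression coefficients, also valid when `V` is degenerate, by division by zero
  have key : ∀ U : Ω → ℝ, AllLp μ U → (∫ η, V η * U η ∂μ) / s * s = ∫ η, V η * U η ∂μ := by
    intro U hU
    rcases eq_or_ne s 0 with h0 | h0
    · rw [h0, mul_zero]
      have : (fun η => V η * V η) =ᵐ[μ] 0 :=
        (integral_eq_zero_iff_of_nonneg (fun η => mul_self_nonneg _) (lV.mul lV).integrable).1 h0
      symm
      rw [← integral_zero Ω ℝ (μ := μ)]
      refine integral_congr_ae ?_
      filter_upwards [this] with η hη
      have : V η = 0 := by simpa using hη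
      simp [this]
    · field_simp
  obtain ⟨a, ha⟩ : ∃ a, a * s = ∫ η, V η * X η ∂μ := ⟨_, key X lX⟩
  obtain ⟨b, hb⟩ : ∃ b, b * s = ∫ η, V η * Y η ∂μ := ⟨_, key Y lY⟩
  obtain ⟨c, hc⟩ : ∃ c, c * s = ∫ η, V η * Z η ∂μ := ⟨_, key Z lZ⟩
  -- The residuals of the regression on `V` are uncorrelated with `V`, hence independent of it; this
  -- reduces the claim to the one-dimensional identity in the variable `V`, the residuals being
  -- frozen.
  set W : Ω → ℝ × ℝ × ℝ := fun η => (X η - a * V η, Y η - b * V η, Z η - c * V η) with hW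
  have hVW : HasGaussianLaw (fun η => (V η, W η)) μ := by
    let Lc : (ℝ × ℝ × ℝ × ℝ) →L[ℝ] ℝ × (ℝ × ℝ × ℝ) :=
      { toFun := fun w => (w.1, w.2.1 - a * w.1, w.2.2.1 - b * w.1, w.2.2.2 - c * w.1)
        map_add' := by intro x y; ext <;> simp <;> ring
        map_smul' := by intro m x; ext <;> simp <;> ring
        cont := by fun_prop }
    exact hlaw.map_fun Lc
  have covz : ∀ (U : Ω → ℝ) (k : ℝ), AllLp μ U → k * s = ∫ η, V η * U η ∂μ →
      ∫ η, V η * (U η - k * V η) ∂μ = 0 := by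
    intro U k hU hk
    have : ∀ η, V η * (U η - k * V η) = V η * U η - k * (V η * V η) := fun η => by ring
    simp_rw [this]
    rw [integral_sub (lV.mul hU).integrable ((lV.mul lV).integrable.const_mul _),
      integral_const_mul, ← hs, hk, sub_self]
  have lW : ∀ (U : Ω → ℝ) (k : ℝ), AllLp μ U → AllLp μ (fun η => U η - k * V η) := by
    intro U k hU
    simpa [sub_eq_add_neg] using hU.add (lV.const_mul (-k))
  have hind : IndepFun V W μ := by
    refine hVW.indepFun_of_covariance_strongDual fun L₁ L₂ => ?_
    have e1 : (L₁ ∘ V) = fun η => L₁ 1 * V η := by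
      ext η
      have := L₁.map_smul (V η) 1
      simpa [mul_comm] using this
    have e2 : (L₂ ∘ W) = fun η => L₂ (1, 0, 0) * (X η - a * V η)
        + L₂ (0, 1, 0) * (Y η - b * V η) + L₂ (0, 0, 1) * (Z η - c * V η) := by
      ext η
      have : W η = (X η - a * V η) • ((1 : ℝ), (0 : ℝ), (0 : ℝ))
          + (Y η - b * V η) • ((0 : ℝ), (1 : ℝ), (0 : ℝ))
          + (Z η - c * V η) • ((0 : ℝ), (0 : ℝ), (1 : ℝ)) := by
        ext <;> simp [hW]
      simp only [Function.comp_apply]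
      rw [this, map_add, map_add, map_smul, map_smul, map_smul]
      simp only [smul_eq_mul]
      ring
    have l1 := (lW X a lX).const_mul (L₂ (1, 0, 0))
    have l2 := (lW Y b lY).const_mul (L₂ (0, 1, 0))
    have l3 := (lW Z c lZ).const_mul (L₂ (0, 0, 1))
    rw [e1, e2, covariance_eq_sub ((lV.const_mul _) 2 (by simp))
      (((l1.add l2).add l3) 2 (by simp))]
    have z1 : ∫ η, L₁ 1 * V η ∂μ = 0 := by rw [integral_const_mul, mV, mul_zero]
    rw [z1, zero_mul, sub_zero]
    have : ∀ η, ((fun η => L₁ 1 * V η) * fun η => L₂ (1, 0, 0) * (X η - a * V η)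
        + L₂ (0, 1, 0) * (Y η - b * V η) + L₂ (0, 0, 1) * (Z η - c * V η)) η
        = (L₁ 1 * L₂ (1, 0, 0)) * (V η * (X η - a * V η))
        + (L₁ 1 * L₂ (0, 1, 0)) * (V η * (Y η - b * V η))
        + (L₁ 1 * L₂ (0, 0, 1)) * (V η * (Z η - c * V η)) := fun η => by
      simp only [Pi.mul_apply]; ring
    rw [integral_congr_ae (ae_of_all _ this)]
    have m1 := (lV.mul (lW X a lX)).const_mul (L₁ 1 * L₂ (1, 0, 0))
    have m2 := (lV.mul (lW Y b lY)).const_mul (L₁ 1 * L₂ (0, 1, 0))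
    have m3 := (lV.mul (lW Z c lZ)).const_mul (L₁ 1 * L₂ (0, 0, 1))
    rw [integral_add (m1.add m2).integrable m3.integrable, integral_add m1.integrable m2.integrable,
      integral_const_mul, integral_const_mul, integral_const_mul, covz X a lX ha, covz Y b lY hb,
      covz Z c lZ hc]
    simp
  have hmV : AEMeasurable V μ := hVW.fst.aemeasurable
  have hmW : AEMeasurable W μ := hVW.snd.aemeasurable
  have hmap := (indepFun_iff_map_prod_eq_prod_map_map hmV hmW).1 hind
  have hVlaw : μ.map V = gaussianReal 0 s.toNNReal := by
    rw [hVW.fst.map_eq_gaussianReal, mV, variance_of_integral_eq_zero hmV mV]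
    congr 2
    rw [hs]
    congr 1; ext η; ring
  have transfer : ∀ G : ℝ × ℝ × ℝ × ℝ → ℝ, Continuous G →
      Integrable (fun η => G (V η, W η)) μ →
      ∫ η, G (V η, W η) ∂μ = ∫ w, ∫ x, G (x, w) ∂(gaussianReal 0 s.toNNReal) ∂(μ.map W) := by
    intro G hG hGi
    have hm : AEMeasurable (fun η => (V η, W η)) μ := hVW.aemeasurable
    have hp1 : IsProbabilityMeasure (μ.map W) := Measure.isProbabilityMeasure_map hmW
    rw [← integral_map (f := G) hm hG.aestronglyMeasurable, hmap, hVlaw, integral_prod_symm]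
    rw [← hVlaw, ← hmap]
    exact (integrable_map_measure hG.aestronglyMeasurable hm).2 hGi
  have rX : ∀ η, a * V η + (W η).1 = X η := fun η => by simp [hW]
  have rY : ∀ η, b * V η + (W η).2.1 = Y η := fun η => by simp [hW]
  have rZ : ∀ η, c * V η + (W η).2.2 = Z η := fun η => by simp [hW]
  have cf := hf.continuous
  have cg := hg.continuous
  have ch := hh.continuous
  have cf' := hf.deriv.continuous
  have cg' := hg.deriv.continuous
  have ch' := hh.deriv.continuous
  have lf := lX.comp hf.growth cf
  have lg := lY.comp hg.growth cg
  have lh := lZ.comp hh.growth ch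
  have lf' := lX.comp hf.deriv.growth cf'
  have lg' := lY.comp hg.deriv.growth cg'
  have lh' := lZ.comp hh.deriv.growth ch'
  have t1 := transfer (fun w => w.1 * (f (a * w.1 + w.2.1) * g (b * w.1 + w.2.2.1)
      * h (c * w.1 + w.2.2.2))) (by fun_prop) (by
    simp only [rX, rY, rZ]
    exact (lV.mul ((lf.mul lg).mul lh)).integrable)
  have t2 := transfer (fun w =>
      a * (deriv f (a * w.1 + w.2.1) * g (b * w.1 + w.2.2.1) * h (c * w.1 + w.2.2.2))
      + b * (f (a * w.1 + w.2.1) * deriv g (b * w.1 + w.2.2.1) * h (c * w.1 + w.2.2.2))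
      + c * (f (a * w.1 + w.2.1) * g (b * w.1 + w.2.2.1) * deriv h (c * w.1 + w.2.2.2)))
      (by fun_prop) (by
    simp only [rX, rY, rZ]
    exact ((((lf'.mul lg).mul lh).const_mul a).add (((lf.mul lg').mul lh).const_mul b)).add
      (((lf.mul lg).mul lh').const_mul c) |>.integrable)
  simp only [rX, rY, rZ] at t1 t2
  have i1 := ((lf'.mul lg).mul lh).const_mul a
  have i2 := ((lf.mul lg').mul lh).const_mul b
  have i3 := ((lf.mul lg).mul lh').const_mul c
  rw [integral_add (i1.add i2).integrable i3.integrable, integral_add i1.integrable i2.integrable,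
    integral_const_mul, integral_const_mul, integral_const_mul] at t2
  have inner : ∀ w : ℝ × ℝ × ℝ,
      ∫ x, x * (f (a * x + w.1) * g (b * x + w.2.1) * h (c * x + w.2.2))
        ∂(gaussianReal 0 s.toNNReal) = s * ∫ x,
      (a * (deriv f (a * x + w.1) * g (b * x + w.2.1) * h (c * x + w.2.2))
      + b * (f (a * x + w.1) * deriv g (b * x + w.2.1) * h (c * x + w.2.2))
      + c * (f (a * x + w.1) * g (b * x + w.2.1) * deriv h (c * x + w.2.2)))
        ∂(gaussianReal 0 s.toNNReal) := by
    intro w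
    have hd : ∀ (k : ℝ → ℝ) (d y x : ℝ), PolyC 1 k →
        HasDerivAt (fun x => k (d * x + y)) (deriv k (d * x + y) * d) x := by
      intro k d y x hk
      have h1 : HasDerivAt (fun x => d * x + y) d x := by
        simpa using ((hasDerivAt_id x).const_mul d).add_const y
      exact (PolyC.hasDerivAt (n := 0) hk _).comp x h1
    have hD : ∀ x, HasDerivAt
        (fun x => f (a * x + w.1) * g (b * x + w.2.1) * h (c * x + w.2.2))
        (a * (deriv f (a * x + w.1) * g (b * x + w.2.1) * h (c * x + w.2.2))
      + b * (f (a * x + w.1) * deriv g (b * x + w.2.1) * h (c * x + w.2.2))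
      + c * (f (a * x + w.1) * g (b * x + w.2.1) * deriv h (c * x + w.2.2))) x := by
      intro x
      have := ((hd f a w.1 x hf).mul (hd g b w.2.1 x hg)).mul (hd h c w.2.2 x hh)
      convert! this using 1
      simp only [Pi.mul_apply]
      ring
    have e := fun x => (hD x).deriv
    have e' := funext e
    have := integral_id_mul_gaussianReal s.toNNReal
      (ψ := fun x => f (a * x + w.1) * g (b * x + w.2.1) * h (c * x + w.2.2))
      (fun x => (hD x).differentiableAt)
      (((hf.growth.comp_affine _ _).mul (hg.growth.comp_affine _ _)).mul
        (hh.growth.comp_affine _ _))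
      (by
        rw [e']
        exact (((((hf.deriv.growth.comp_affine _ _).mul (hg.growth.comp_affine _ _)).mul
          (hh.growth.comp_affine _ _)).const_mul a).add
          ((((hf.growth.comp_affine _ _).mul (hg.deriv.growth.comp_affine _ _)).mul
          (hh.growth.comp_affine _ _)).const_mul b)).add
          ((((hf.growth.comp_affine _ _).mul (hg.growth.comp_affine _ _)).mul
          (hh.deriv.growth.comp_affine _ _)).const_mul c))
      (by rw [e']; fun_prop)
    rw [e', Real.coe_toNNReal _ hs0] at this
    exact this
  rw [t1]
  simp_rw [inner]
  rw [integral_const_mul, ← t2, ← ha, ← hb, ← hc]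
  ring

end Stein

section Interpolation

variable {Ω₀ Ω₁ : Type*}

/-- The rotation `cos α X₀ + sin α X₁` of two random variables on a product space. -/
noncomputable def rot (α : ℝ) (X₀ : Ω₀ → ℝ) (X₁ : Ω₁ → ℝ) (η : Ω₀ × Ω₁) : ℝ :=
  Real.cos α * X₀ η.1 + Real.sin α * X₁ η.2

/-- The derivative of `rot` with respect to the angle. -/
noncomputable def rotDeriv (α : ℝ) (X₀ : Ω₀ → ℝ) (X₁ : Ω₁ → ℝ) (η : Ω₀ × Ω₁) : ℝ :=
  -Real.sin α * X₀ η.1 + Real.cos α * X₁ η.2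

lemma hasDerivAt_rot (α : ℝ) (X₀ : Ω₀ → ℝ) (X₁ : Ω₁ → ℝ) (η : Ω₀ × Ω₁) :
    HasDerivAt (fun α => rot α X₀ X₁ η) (rotDeriv α X₀ X₁ η) α :=
  ((Real.hasDerivAt_cos α).mul_const _).add ((Real.hasDerivAt_sin α).mul_const _)

variable [MeasurableSpace Ω₀] [MeasurableSpace Ω₁] {μ₀ : Measure Ω₀} {μ₁ : Measure Ω₁}

lemma GTriple.allLpX {Ω : Type*} [MeasurableSpace Ω] {μ : Measure Ω} {X Y Z : Ω → ℝ}
    {v p q r : ℝ} (h : GTriple μ X Y Z v p q r) : AllLp μ X := h.law.fst.allLp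

lemma GTriple.allLpY {Ω : Type*} [MeasurableSpace Ω] {μ : Measure Ω} {X Y Z : Ω → ℝ}
    {v p q r : ℝ} (h : GTriple μ X Y Z v p q r) : AllLp μ Y := h.law.snd.fst.allLp

lemma GTriple.allLpZ {Ω : Type*} [MeasurableSpace Ω] {μ : Measure Ω} {X Y Z : Ω → ℝ}
    {v p q r : ℝ} (h : GTriple μ X Y Z v p q r) : AllLp μ Z := h.law.snd.snd.allLp

/-- A pair of independent Gaussian vectors, realised on a product space, is a Gaussian vector. -/
lemma hasGaussianLaw_prod {E F : Type*}
    [NormedAddCommGroup E] [MeasurableSpace E] [CompleteSpace E] [BorelSpace E]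
    [SecondCountableTopology E] [NormedAddCommGroup F] [MeasurableSpace F]
    [CompleteSpace F] [BorelSpace F] [SecondCountableTopology F] [NormedSpace ℝ E]
    [NormedSpace ℝ F] {U : Ω₀ → E} {V : Ω₁ → F} (hU : HasGaussianLaw U μ₀)
    (hV : HasGaussianLaw V μ₁) :
    HasGaussianLaw (fun η : Ω₀ × Ω₁ => (U η.1, V η.2)) (μ₀.prod μ₁) := by
  have h0 := hU.isProbabilityMeasure
  have h1 := hV.isProbabilityMeasure
  have e0 : HasGaussianLaw (fun η : Ω₀ × Ω₁ => U η.1) (μ₀.prod μ₁) := by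
    constructor
    have : (μ₀.prod μ₁).map (fun η : Ω₀ × Ω₁ => U η.1) = μ₀.map U := by
      have h2 : (μ₀.prod μ₁).map Prod.fst = μ₀ := by simp
      conv_rhs => rw [← h2]
      rw [AEMeasurable.map_map_of_aemeasurable (by rw [h2]; exact hU.aemeasurable)
        measurable_fst.aemeasurable]
      rfl
    rw [this]; exact hU.isGaussian_map
  have e1 : HasGaussianLaw (fun η : Ω₀ × Ω₁ => V η.2) (μ₀.prod μ₁) := by
    constructor
    have : (μ₀.prod μ₁).map (fun η : Ω₀ × Ω₁ => V η.2) = μ₁.map V := by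
      have h2 : (μ₀.prod μ₁).map Prod.snd = μ₁ := by simp
      conv_rhs => rw [← h2]
      rw [AEMeasurable.map_map_of_aemeasurable (by rw [h2]; exact hV.aemeasurable)
        measurable_snd.aemeasurable]
      rfl
    rw [this]; exact hV.isGaussian_map
  exact IndepFun.hasGaussianLaw e0 e1 (indepFun_prod₀ hU.aemeasurable hV.aemeasurable)

lemma allLp_fst [IsProbabilityMeasure μ₁] [SFinite μ₀] {U : Ω₀ → ℝ} (h : AllLp μ₀ U) :
    AllLp (μ₀.prod μ₁) (fun η => U η.1) := fun p hp =>
  (h p hp).comp_measurePreserving measurePreserving_fst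

lemma allLp_snd [IsProbabilityMeasure μ₀] [SFinite μ₁] {U : Ω₁ → ℝ} (h : AllLp μ₁ U) :
    AllLp (μ₀.prod μ₁) (fun η => U η.2) := fun p hp =>
  (h p hp).comp_measurePreserving measurePreserving_snd

lemma integral_rot_combination [IsProbabilityMeasure μ₀] [IsProbabilityMeasure μ₁]
    {X₀ Y₀ : Ω₀ → ℝ} {X₁ Y₁ : Ω₁ → ℝ} (hX₀ : AllLp μ₀ X₀) (hY₀ : AllLp μ₀ Y₀)
    (hX₁ : AllLp μ₁ X₁) (hY₁ : AllLp μ₁ Y₁) (mX₀ : ∫ η, X₀ η ∂μ₀ = 0)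
    (mY₀ : ∫ η, Y₀ η ∂μ₀ = 0) (a b c d : ℝ) :
    ∫ η, (a * X₀ η.1 + b * X₁ η.2) * (c * Y₀ η.1 + d * Y₁ η.2) ∂(μ₀.prod μ₁)
      = a * c * ∫ η, X₀ η * Y₀ η ∂μ₀ + b * d * ∫ η, X₁ η * Y₁ η ∂μ₁ := by
  have e : ∀ η : Ω₀ × Ω₁, (a * X₀ η.1 + b * X₁ η.2) * (c * Y₀ η.1 + d * Y₁ η.2)
      = ((a * c) * (X₀ η.1 * Y₀ η.1) + (b * d) * (X₁ η.2 * Y₁ η.2))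
        + ((a * d) * (X₀ η.1 * Y₁ η.2) + (b * c) * (Y₀ η.1 * X₁ η.2)) := fun η => by ring
  simp_rw [e]
  have l1 := (allLp_fst (μ₁ := μ₁) (hX₀.mul hY₀)).const_mul (a * c)
  have l2 := (allLp_snd (μ₀ := μ₀) (hX₁.mul hY₁)).const_mul (b * d)
  have l3 := ((allLp_fst (μ₁ := μ₁) hX₀).mul (allLp_snd (μ₀ := μ₀) hY₁)).const_mul (a * d)
  have l4 := ((allLp_fst (μ₁ := μ₁) hY₀).mul (allLp_snd (μ₀ := μ₀) hX₁)).const_mul (b * c)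
  rw [integral_add (l1.add l2).integrable (l3.add l4).integrable,
    integral_add l1.integrable l2.integrable, integral_add l3.integrable l4.integrable,
    integral_const_mul, integral_const_mul, integral_const_mul, integral_const_mul,
    integral_prod_mul X₀ Y₁, integral_prod_mul Y₀ X₁, mX₀, mY₀, 
    integral_fun_fst (fun η => X₀ η * Y₀ η), integral_fun_snd (fun η => X₁ η * Y₁ η)]
  simp

lemma integral_rot_combination_zero [IsProbabilityMeasure μ₀] [IsProbabilityMeasure μ₁]
    {X₀ : Ω₀ → ℝ} {X₁ : Ω₁ → ℝ} (hX₀ : AllLp μ₀ X₀) 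
    (hX₁ : AllLp μ₁ X₁) (mX₀ : ∫ η, X₀ η ∂μ₀ = 0) (mX₁ : ∫ η, X₁ η ∂μ₁ = 0) (a b : ℝ) :
    ∫ η, (a * X₀ η.1 + b * X₁ η.2) ∂(μ₀.prod μ₁) = 0 := by
  rw [integral_add ((allLp_fst hX₀).const_mul a).integrable ((allLp_snd hX₁).const_mul b).integrable,
    integral_const_mul, integral_const_mul, integral_fun_fst X₀, integral_fun_snd X₁, mX₀, mX₁]
  simp

variable {X₀ Y₀ Z₀ : Ω₀ → ℝ} {X₁ Y₁ Z₁ : Ω₁ → ℝ} {v₀ p₀ q₀ r₀ v₁ p₁ q₁ r₁ : ℝ}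

/-- The rotation of two centred Gaussian triples interpolates linearly, in `sin² α`, between their
covariances. -/
lemma GTriple.rot (h₀ : GTriple μ₀ X₀ Y₀ Z₀ v₀ p₀ q₀ r₀) (h₁ : GTriple μ₁ X₁ Y₁ Z₁ v₁ p₁ q₁ r₁)
    (α : ℝ) : GTriple (μ₀.prod μ₁) (rot α X₀ X₁) (rot α Y₀ Y₁) (rot α Z₀ Z₁)
      (Real.cos α ^ 2 * v₀ + Real.sin α ^ 2 * v₁) (Real.cos α ^ 2 * p₀ + Real.sin α ^ 2 * p₁)
      (Real.cos α ^ 2 * q₀ + Real.sin α ^ 2 * q₁) (Real.cos α ^ 2 * r₀ + Real.sin α ^ 2 * r₁) := by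
  have i0 := h₀.law.isProbabilityMeasure
  have i1 := h₁.law.isProbabilityMeasure
  let Lc : ((ℝ × ℝ × ℝ) × (ℝ × ℝ × ℝ)) →L[ℝ] ℝ × ℝ × ℝ :=
      { toFun := fun w => (Real.cos α * w.1.1 + Real.sin α * w.2.1,
          Real.cos α * w.1.2.1 + Real.sin α * w.2.2.1, Real.cos α * w.1.2.2 + Real.sin α * w.2.2.2)
        map_add' := by intro x y; ext <;> simp <;> ring
        map_smul' := by intro m x; ext <;> simp <;> ring
        cont := by fun_prop }
  have a0 := h₀.allLpX
  have a1 := h₀.allLpY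
  have a2 := h₀.allLpZ
  have b0 := h₁.allLpX
  have b1 := h₁.allLpY
  have b2 := h₁.allLpZ
  constructor
  · exact (hasGaussianLaw_prod h₀.law h₁.law).map_fun Lc
  · exact integral_rot_combination_zero a0 b0 h₀.mX h₁.mX _ _
  · exact integral_rot_combination_zero a1 b1 h₀.mY h₁.mY _ _
  · exact integral_rot_combination_zero a2 b2 h₀.mZ h₁.mZ _ _
  · exact (integral_rot_combination a0 a0 b0 b0 h₀.mX h₀.mX _ _ _ _).trans
      (by rw [h₀.vX, h₁.vX]; ring)
  · exact (integral_rot_combination a1 a1 b1 b1 h₀.mY h₀.mY _ _ _ _).trans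
      (by rw [h₀.vY, h₁.vY]; ring)
  · exact (integral_rot_combination a2 a2 b2 b2 h₀.mZ h₀.mZ _ _ _ _).trans
      (by rw [h₀.vZ, h₁.vZ]; ring)
  · exact (integral_rot_combination a0 a1 b0 b1 h₀.mX h₀.mY _ _ _ _).trans
      (by rw [h₀.cXY, h₁.cXY]; ring)
  · exact (integral_rot_combination a0 a2 b0 b2 h₀.mX h₀.mZ _ _ _ _).trans
      (by rw [h₀.cXZ, h₁.cXZ]; ring)
  · exact (integral_rot_combination a1 a2 b1 b2 h₀.mY h₀.mZ _ _ _ _).trans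
      (by rw [h₀.cYZ, h₁.cYZ]; ring)

lemma abs_trig_combination_le {c s x y : ℝ} (hc : |c| ≤ 1) (hs : |s| ≤ 1) :
    |c * x + s * y| ≤ |x| + |y| := by
  refine (abs_add_le _ _).trans ?_
  rw [abs_mul, abs_mul]
  nlinarith [abs_nonneg x, abs_nonneg y]

/-- The derivative of a Gaussian expectation along the interpolation of two covariances. -/
lemma hasDerivAt_integral_rot (h₀ : GTriple μ₀ X₀ Y₀ Z₀ v₀ p₀ q₀ r₀)
    (h₁ : GTriple μ₁ X₁ Y₁ Z₁ v₁ p₁ q₁ r₁) {f g h : ℝ → ℝ} (hf : PolyC 2 f) (hg : PolyC 2 g)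
    (hh : PolyC 2 h) (α : ℝ) :
    HasDerivAt (fun α => ∫ η, f (rot α X₀ X₁ η) * g (rot α Y₀ Y₁ η) * h (rot α Z₀ Z₁ η)
        ∂(μ₀.prod μ₁))
      (Real.sin α * Real.cos α * (
        (v₁ - v₀) * ((∫ η, deriv (deriv f) (rot α X₀ X₁ η) * g (rot α Y₀ Y₁ η)
            * h (rot α Z₀ Z₁ η) ∂(μ₀.prod μ₁))
          + (∫ η, f (rot α X₀ X₁ η) * deriv (deriv g) (rot α Y₀ Y₁ η)
            * h (rot α Z₀ Z₁ η) ∂(μ₀.prod μ₁))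
          + (∫ η, f (rot α X₀ X₁ η) * g (rot α Y₀ Y₁ η)
            * deriv (deriv h) (rot α Z₀ Z₁ η) ∂(μ₀.prod μ₁)))
        + 2 * ((p₁ - p₀) * (∫ η, deriv f (rot α X₀ X₁ η) * deriv g (rot α Y₀ Y₁ η)
            * h (rot α Z₀ Z₁ η) ∂(μ₀.prod μ₁))
          + (q₁ - q₀) * (∫ η, deriv f (rot α X₀ X₁ η) * g (rot α Y₀ Y₁ η)
            * deriv h (rot α Z₀ Z₁ η) ∂(μ₀.prod μ₁))
          + (r₁ - r₀) * (∫ η, f (rot α X₀ X₁ η) * deriv g (rot α Y₀ Y₁ η)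
            * deriv h (rot α Z₀ Z₁ η) ∂(μ₀.prod μ₁))))) α := by
  have i0 := h₀.law.isProbabilityMeasure
  have i1 := h₁.law.isProbabilityMeasure
  have a0 := h₀.allLpX
  have a1 := h₀.allLpY
  have a2 := h₀.allLpZ
  have b0 := h₁.allLpX
  have b1 := h₁.allLpY
  have b2 := h₁.allLpZ
  have lrot : ∀ β, AllLp (μ₀.prod μ₁) (rot β X₀ X₁) ∧ AllLp (μ₀.prod μ₁) (rot β Y₀ Y₁) ∧
      AllLp (μ₀.prod μ₁) (rot β Z₀ Z₁) := fun β =>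
    ⟨(h₀.rot h₁ β).allLpX, (h₀.rot h₁ β).allLpY, (h₀.rot h₁ β).allLpZ⟩
  have ld : ∀ {U₀ : Ω₀ → ℝ} {U₁ : Ω₁ → ℝ}, AllLp μ₀ U₀ → AllLp μ₁ U₁ →
      AllLp (μ₀.prod μ₁) (rotDeriv α U₀ U₁) := fun h0 h1 =>
    ((allLp_fst h0).const_mul _).add ((allLp_snd h1).const_mul _)
  have df := hf.deriv
  have dg := hg.deriv
  have dh := hh.deriv
  have lf := (lrot α).1.comp hf.growth hf.continuous
  have lg := (lrot α).2.1.comp hg.growth hg.continuous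
  have lh := (lrot α).2.2.comp hh.growth hh.continuous
  have lf' := (lrot α).1.comp df.growth df.continuous
  have lg' := (lrot α).2.1.comp dg.growth dg.continuous
  have lh' := (lrot α).2.2.comp dh.growth dh.continuous
  have lX := (ld a0 b0).mul ((lf'.mul lg).mul lh)
  have lY := (ld a1 b1).mul ((lf.mul lg').mul lh)
  have lZ := (ld a2 b2).mul ((lf.mul lg).mul lh')
  obtain ⟨C1, m1, hC1, g1⟩ := hf.growth.nonneg
  obtain ⟨C2, m2, hC2, g2⟩ := hg.growth.nonneg
  obtain ⟨C3, m3, hC3, g3⟩ := hh.growth.nonneg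
  obtain ⟨D1, n1, hD1, k1⟩ := df.growth.nonneg
  obtain ⟨D2, n2, hD2, k2⟩ := dg.growth.nonneg
  obtain ⟨D3, n3, hD3, k3⟩ := dh.growth.nonneg
  set RX : Ω₀ × Ω₁ → ℝ := fun η => |X₀ η.1| + |X₁ η.2| with hRX
  set RY : Ω₀ × Ω₁ → ℝ := fun η => |Y₀ η.1| + |Y₁ η.2| with hRY
  set RZ : Ω₀ × Ω₁ → ℝ := fun η => |Z₀ η.1| + |Z₁ η.2| with hRZ
  have rX : ∀ η, 0 ≤ RX η := fun η => by positivity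
  have rY : ∀ η, 0 ≤ RY η := fun η => by positivity
  have rZ : ∀ η, 0 ≤ RZ η := fun η => by positivity
  have lRX : AllLp (μ₀.prod μ₁) RX := (allLp_fst a0.abs).add (allLp_snd b0.abs)
  have lRY : AllLp (μ₀.prod μ₁) RY := (allLp_fst a1.abs).add (allLp_snd b1.abs)
  have lRZ : AllLp (μ₀.prod μ₁) RZ := (allLp_fst a2.abs).add (allLp_snd b2.abs)
  have lP : ∀ {R : Ω₀ × Ω₁ → ℝ} (C : ℝ) (m : ℕ), AllLp (μ₀.prod μ₁) R →
      AllLp (μ₀.prod μ₁) (fun η => C * (1 + R η) ^ m) := fun C m hR =>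
    (((AllLp.const 1).add hR).pow m).const_mul C
  have bX : ∀ (k : ℝ → ℝ) (C : ℝ) (m : ℕ), 0 ≤ C → (∀ u, |k u| ≤ C * (1 + |u|) ^ m) →
      ∀ (U₀ : Ω₀ → ℝ) (U₁ : Ω₁ → ℝ) β η, |k (_root_.rot β U₀ U₁ η)|
        ≤ C * (1 + (|U₀ η.1| + |U₁ η.2|)) ^ m := by
    intro k C m hC hk U₀ U₁ β η
    refine (hk _).trans ?_
    gcongr
    exact abs_trig_combination_le (Real.abs_cos_le_one _) (Real.abs_sin_le_one _)
  have bD : ∀ (U₀ : Ω₀ → ℝ) (U₁ : Ω₁ → ℝ) β η, |rotDeriv β U₀ U₁ η|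
        ≤ |U₀ η.1| + |U₁ η.2| := by
    intro U₀ U₁ β η
    exact abs_trig_combination_le (by rw [abs_neg]; exact Real.abs_sin_le_one _)
      (Real.abs_cos_le_one _)
  -- Differentiation under the integral sign, dominated uniformly in the angle since `|cos|, |sin| ≤
  -- 1`.
  have key := hasDerivAt_integral_of_dominated_loc_of_deriv_le (μ := μ₀.prod μ₁) (s := univ)
    (x₀ := α)
    (F := fun α η => f (_root_.rot α X₀ X₁ η) * g (_root_.rot α Y₀ Y₁ η) * h (_root_.rot α Z₀ Z₁ η))
    (F' := fun α η =>
      rotDeriv α X₀ X₁ η * (deriv f (_root_.rot α X₀ X₁ η) * g (_root_.rot α Y₀ Y₁ η)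
        * h (_root_.rot α Z₀ Z₁ η))
      + rotDeriv α Y₀ Y₁ η * (f (_root_.rot α X₀ X₁ η) * deriv g (_root_.rot α Y₀ Y₁ η)
        * h (_root_.rot α Z₀ Z₁ η))
      + rotDeriv α Z₀ Z₁ η * (f (_root_.rot α X₀ X₁ η) * g (_root_.rot α Y₀ Y₁ η)
        * deriv h (_root_.rot α Z₀ Z₁ η)))
    (bound := fun η =>
      RX η * ((D1 * (1 + RX η) ^ n1) * (C2 * (1 + RY η) ^ m2) * (C3 * (1 + RZ η) ^ m3))
      + RY η * ((C1 * (1 + RX η) ^ m1) * (D2 * (1 + RY η) ^ n2) * (C3 * (1 + RZ η) ^ m3))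
      + RZ η * ((C1 * (1 + RX η) ^ m1) * (C2 * (1 + RY η) ^ m2) * (D3 * (1 + RZ η) ^ n3)))
    univ_mem
    (Eventually.of_forall fun β => ((((lrot β).1.comp hf.growth hf.continuous).mul
      ((lrot β).2.1.comp hg.growth hg.continuous)).mul
      ((lrot β).2.2.comp hh.growth hh.continuous)).aestronglyMeasurable)
    ((lf.mul lg).mul lh).integrable ((lX.add lY).add lZ).aestronglyMeasurable
    (ae_of_all _ fun η β _ => by
      have x1 := bX f C1 m1 hC1 g1 X₀ X₁ β η
      have x2 := bX g C2 m2 hC2 g2 Y₀ Y₁ β η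
      have x3 := bX h C3 m3 hC3 g3 Z₀ Z₁ β η
      have y1 := bX _ D1 n1 hD1 k1 X₀ X₁ β η
      have y2 := bX _ D2 n2 hD2 k2 Y₀ Y₁ β η
      have y3 := bX _ D3 n3 hD3 k3 Z₀ Z₁ β η
      have z1 := bD X₀ X₁ β η
      have z2 := bD Y₀ Y₁ β η
      have z3 := bD Z₀ Z₁ β η
      rw [Real.norm_eq_abs]
      refine (abs_add_le _ _).trans (add_le_add ((abs_add_le _ _).trans (add_le_add ?_ ?_)) ?_) <;>
      · rw [abs_mul, abs_mul, abs_mul]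
        gcongr)
    ((((lRX.mul (((lP D1 n1 lRX).mul (lP C2 m2 lRY)).mul (lP C3 m3 lRZ)))).add
      (lRY.mul (((lP C1 m1 lRX).mul (lP D2 n2 lRY)).mul (lP C3 m3 lRZ)))).add
      (lRZ.mul (((lP C1 m1 lRX).mul (lP C2 m2 lRY)).mul (lP D3 n3 lRZ)))).integrable
    (ae_of_all _ fun η β _ => by
      have x1 := (hf.hasDerivAt _).comp β (hasDerivAt_rot β X₀ X₁ η)
      have x2 := (hg.hasDerivAt _).comp β (hasDerivAt_rot β Y₀ Y₁ η)
      have x3 := (hh.hasDerivAt _).comp β (hasDerivAt_rot β Z₀ Z₁ η)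
      convert! (x1.mul x2).mul x3 using 1
      simp only [Pi.mul_apply, Function.comp_apply]
      ring)
  convert! key.2 using 1
  rw [integral_add (lX.add lY).integrable lZ.integrable, integral_add lX.integrable lY.integrable]
  have joint : ∀ (A : (ℝ × ℝ × ℝ) → ℝ), IsLinearMap ℝ A → Continuous A →
      HasGaussianLaw (fun η : Ω₀ × Ω₁ => (-Real.sin α * A (X₀ η.1, Y₀ η.1, Z₀ η.1)
        + Real.cos α * A (X₁ η.2, Y₁ η.2, Z₁ η.2), _root_.rot α X₀ X₁ η, _root_.rot α Y₀ Y₁ η,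
          _root_.rot α Z₀ Z₁ η))
        (μ₀.prod μ₁) := by
    intro A hA hAc
    let Lc : ((ℝ × ℝ × ℝ) × (ℝ × ℝ × ℝ)) →L[ℝ] ℝ × ℝ × ℝ × ℝ :=
      { toFun := fun w => (-Real.sin α * A w.1 + Real.cos α * A w.2,
          Real.cos α * w.1.1 + Real.sin α * w.2.1,
          Real.cos α * w.1.2.1 + Real.sin α * w.2.2.1, Real.cos α * w.1.2.2 + Real.sin α * w.2.2.2)
        map_add' := by intro x y; ext <;> simp [hA.map_add] <;> ring
        map_smul' := by intro m x; ext <;> simp [hA.map_smul] <;> ring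
        cont := by fun_prop }
    exact (hasGaussianLaw_prod h₀.law h₁.law).map_fun Lc
  -- Integration by parts removes the three factors `rotDeriv`.
  have s1 := integral_mul_eq_of_hasGaussianLaw (V := rotDeriv α X₀ X₁)
    (joint (fun w => w.1) ⟨fun _ _ => rfl, fun _ _ => rfl⟩ (by fun_prop))
    (integral_rot_combination_zero a0 b0 h₀.mX h₁.mX _ _) df (hg.mono (by simp))
    (hh.mono (by simp))
  have s2 := integral_mul_eq_of_hasGaussianLaw (V := rotDeriv α Y₀ Y₁)
    (joint (fun w => w.2.1) ⟨fun _ _ => rfl, fun _ _ => rfl⟩ (by fun_prop))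
    (integral_rot_combination_zero a1 b1 h₀.mY h₁.mY _ _) (hf.mono (by simp)) dg
    (hh.mono (by simp))
  have s3 := integral_mul_eq_of_hasGaussianLaw (V := rotDeriv α Z₀ Z₁)
    (joint (fun w => w.2.2) ⟨fun _ _ => rfl, fun _ _ => rfl⟩ (by fun_prop))
    (integral_rot_combination_zero a2 b2 h₀.mZ h₁.mZ _ _) (hf.mono (by simp)) (hg.mono (by simp))
    dh
  rw [s1, s2, s3]
  -- The covariances of `rotDeriv` and `rot` are the increments of the covariances.
  have comb : ∀ {U₀ V₀ : Ω₀ → ℝ} {U₁ V₁ : Ω₁ → ℝ}, AllLp μ₀ U₀ → AllLp μ₀ V₀ → AllLp μ₁ U₁ →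
      AllLp μ₁ V₁ → ∫ η, U₀ η ∂μ₀ = 0 → ∫ η, V₀ η ∂μ₀ = 0 →
      ∫ η, rotDeriv α U₀ U₁ η * _root_.rot α V₀ V₁ η ∂(μ₀.prod μ₁)
      = Real.sin α * Real.cos α * (∫ η, U₁ η * V₁ η ∂μ₁ - ∫ η, U₀ η * V₀ η ∂μ₀) := by
    intro U₀ V₀ U₁ V₁ c1 c2 c3 c4 c5 c6
    exact (integral_rot_combination c1 c2 c3 c4 c5 c6 _ _ _ _).trans (by ring)
  have cm0 : ∀ U V : Ω₀ → ℝ, ∫ η, U η * V η ∂μ₀ = ∫ η, V η * U η ∂μ₀ := fun U V => by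
    simp_rw [mul_comm]
  have cm1 : ∀ U V : Ω₁ → ℝ, ∫ η, U η * V η ∂μ₁ = ∫ η, V η * U η ∂μ₁ := fun U V => by
    simp_rw [mul_comm]
  rw [comb a0 a0 b0 b0 h₀.mX h₀.mX, comb a0 a1 b0 b1 h₀.mX h₀.mY,
    comb a0 a2 b0 b2 h₀.mX h₀.mZ, comb a1 a0 b1 b0 h₀.mY h₀.mX,
    comb a1 a1 b1 b1 h₀.mY h₀.mY, comb a1 a2 b1 b2 h₀.mY h₀.mZ,
    comb a2 a0 b2 b0 h₀.mZ h₀.mX, comb a2 a1 b2 b1 h₀.mZ h₀.mY,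
    comb a2 a2 b2 b2 h₀.mZ h₀.mZ, cm0 Y₀ X₀, cm0 Z₀ X₀, cm0 Z₀ Y₀, cm1 Y₁ X₁,
    cm1 Z₁ X₁, cm1 Z₁ Y₁, h₀.vX, h₁.vX, h₀.vY, h₁.vY, h₀.vZ, h₁.vZ, h₀.cXY, h₁.cXY, h₀.cXZ,
    h₁.cXZ, h₀.cYZ, h₁.cYZ]
  ring

end Interpolation

/-! ### Expansion of Gaussian expectations in small covariances -/

/-- The expectation `E[f(X) g(Y) h(Z)]`. -/
noncomputable def gExp {Ω : Type*} [MeasurableSpace Ω] (μ : Measure Ω) (X Y Z : Ω → ℝ)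
    (f g h : ℝ → ℝ) : ℝ := ∫ η, f (X η) * g (Y η) * h (Z η) ∂μ

/-- The expectation of `f` under the centred Gaussian of variance `v`. -/
noncomputable def gMean (f : ℝ → ℝ) (v : ℝ) : ℝ := ∫ x, f x ∂(gaussianReal 0 v.toNNReal)

universe u

section Triples

variable {Ω : Type u} [MeasurableSpace Ω] {μ : Measure Ω} {X Y Z : Ω → ℝ} {v p q r : ℝ}

lemma GTriple.var_nonneg (h : GTriple μ X Y Z v p q r) : 0 ≤ v := by
  rw [← h.vX]; exact integral_nonneg fun _ => mul_self_nonneg _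

lemma map_eq_gaussianReal_of_centred {U : Ω → ℝ} (hU : HasGaussianLaw U μ)
    (m : ∫ η, U η ∂μ = 0) (hv : ∫ η, U η * U η ∂μ = v) :
    μ.map U = gaussianReal 0 v.toNNReal := by
  rw [hU.map_eq_gaussianReal, m, variance_of_integral_eq_zero hU.aemeasurable m, ← hv]
  congr 2
  congr 1; ext η; ring

lemma integral_comp_of_centred {U : Ω → ℝ} (hU : HasGaussianLaw U μ)
    (m : ∫ η, U η ∂μ = 0) (hv : ∫ η, U η * U η ∂μ = v) {f : ℝ → ℝ} (hf : Continuous f) :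
    ∫ η, f (U η) ∂μ = gMean f v := by
  rw [gMean, ← map_eq_gaussianReal_of_centred hU m hv,
    integral_map hU.aemeasurable hf.aestronglyMeasurable]

lemma gMean_odd {f : ℝ → ℝ} (hf : ∀ u, f (-u) = -f u) (v : ℝ) : gMean f v = 0 := by
  have h1 : gMean f v = -gMean f v := by
    unfold gMean
    conv_lhs => rw [← neg_zero, ← gaussianReal_map_neg]
    change ∫ x, f x ∂(Measure.map (MeasurableEquiv.neg ℝ) _) = _
    rw [integral_map_equiv (MeasurableEquiv.neg ℝ) f, ← integral_neg]
    exact integral_congr_ae (ae_of_all _ fun x => hf x)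
  linarith

lemma GTriple.perm_XY (h : GTriple μ X Y Z v p q r) : GTriple μ Y X Z v p r q where
  law := by
    let Lc : (ℝ × ℝ × ℝ) →L[ℝ] ℝ × ℝ × ℝ :=
      { toFun := fun w => (w.2.1, w.1, w.2.2)
        map_add' := by intro x y; ext <;> simp
        map_smul' := by intro m x; ext <;> simp
        cont := by fun_prop }
    exact h.law.map_fun Lc
  mX := h.mY
  mY := h.mX
  mZ := h.mZ
  vX := h.vY
  vY := h.vX
  vZ := h.vZ
  cXY := by simpa [mul_comm] using h.cXY
  cXZ := h.cYZ
  cYZ := h.cXZ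

lemma GTriple.perm_XZ (h : GTriple μ X Y Z v p q r) : GTriple μ Z Y X v r q p where
  law := by
    let Lc : (ℝ × ℝ × ℝ) →L[ℝ] ℝ × ℝ × ℝ :=
      { toFun := fun w => (w.2.2, w.2.1, w.1)
        map_add' := by intro x y; ext <;> simp
        map_smul' := by intro m x; ext <;> simp
        cont := by fun_prop }
    exact h.law.map_fun Lc
  mX := h.mZ
  mY := h.mY
  mZ := h.mX
  vX := h.vZ
  vY := h.vY
  vZ := h.vX
  cXY := by simpa [mul_comm] using h.cYZ
  cXZ := by simpa [mul_comm] using h.cXZ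
  cYZ := by simpa [mul_comm] using h.cXY

lemma gExp_perm_XY (X Y Z : Ω → ℝ) (f g h : ℝ → ℝ) :
    gExp μ X Y Z f g h = gExp μ Y X Z g f h := by
  unfold gExp; congr 1; ext η; ring

lemma gExp_perm_XZ (X Y Z : Ω → ℝ) (f g h : ℝ → ℝ) :
    gExp μ X Y Z f g h = gExp μ Z Y X h g f := by
  unfold gExp; congr 1; ext η; ring

lemma abs_le_of_covariance {U W : Ω → ℝ} (hU : AllLp μ U) (hW : AllLp μ W)
    (vU : ∫ η, U η * U η ∂μ = v) (vW : ∫ η, W η * W η ∂μ = v)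
    (c : ∫ η, U η * W η ∂μ = p) : |p| ≤ v := by
  have h1 := integral_nonneg (μ := μ) (f := fun η => (U η + W η) ^ 2) (fun η => sq_nonneg _)
  have h2 := integral_nonneg (μ := μ) (f := fun η => (U η - W η) ^ 2) (fun η => sq_nonneg _)
  have e1 : ∀ η, (U η + W η) ^ 2 = U η * U η + W η * W η + 2 * (U η * W η) := fun η => by ring
  have e2 : ∀ η, (U η - W η) ^ 2 = U η * U η + W η * W η + -2 * (U η * W η) := fun η => by ring
  simp_rw [e1] at h1
  simp_rw [e2] at h2
  have i1 := hU.mul hU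
  have i2 := hW.mul hW
  have i3 := hU.mul hW
  rw [integral_add (i1.add i2).integrable (i3.const_mul _).integrable,
    integral_add i1.integrable i2.integrable, integral_const_mul, vU, vW, c] at h1 h2
  rw [abs_le]; constructor <;> linarith

lemma GTriple.abs_q_le (h : GTriple μ X Y Z v p q r) : |q| ≤ v :=
  abs_le_of_covariance h.allLpX h.allLpZ h.vX h.vZ h.cXZ

end Triples

/-- Moments of centred Gaussians are increasing in the variance. -/
lemma integral_growth_le {Ω : Type u} [MeasurableSpace Ω] {μ : Measure Ω} {U : Ω → ℝ}
    (hU : HasGaussianLaw U μ) (m : ∫ η, U η ∂μ = 0) {v V : ℝ}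
    (hv : ∫ η, U η * U η ∂μ = v) (hV : v ≤ V) (k : ℕ) :
    ∫ η, (1 + |U η|) ^ k ∂μ ≤ ∫ x, (1 + |Real.sqrt V * x|) ^ k ∂(gaussianReal 0 1) := by
  have hv0 : 0 ≤ v := by rw [← hv]; exact integral_nonneg fun _ => mul_self_nonneg _
  rw [integral_comp_of_centred hU m hv (f := fun x => (1 + |x|) ^ k) (by fun_prop), gMean]
  have : gaussianReal 0 v.toNNReal = (gaussianReal 0 1).map (Real.sqrt v * ·) := by
    rw [gaussianReal_map_const_mul]
    congr 1
    · simp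
    · ext; simp [Real.sq_sqrt hv0, hv0]
  rw [this, integral_map (by fun_prop) (by fun_prop)]
  have hl : ∀ c : ℝ, Integrable (fun x : ℝ => (1 + |c * x|) ^ k) (gaussianReal 0 1) := fun c =>
    (((allLp_id_gaussianReal 0 1).const_mul c).growth k).integrable
  refine integral_mono (hl _) (hl _) fun x => ?_
  simp only [abs_mul, abs_of_nonneg (Real.sqrt_nonneg _)]
  gcongr

/-- Uniform bound on Gaussian expectations when the variance is bounded. -/
lemma exists_gExp_le (V : ℝ) {f g h : ℝ → ℝ} (hf : PolyC 0 f) (hg : PolyC 0 g) (hh : PolyC 0 h) :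
    ∃ A : ℝ, 0 ≤ A ∧ ∀ (Ω : Type u) [MeasurableSpace Ω] (μ : Measure Ω) (X Y Z : Ω → ℝ)
      (v p q r : ℝ), GTriple μ X Y Z v p q r → v ≤ V → |gExp μ X Y Z f g h| ≤ A := by
  obtain ⟨C1, m1, hC1, g1⟩ := hf.growth.nonneg
  obtain ⟨C2, m2, hC2, g2⟩ := hg.growth.nonneg
  obtain ⟨C3, m3, hC3, g3⟩ := hh.growth.nonneg
  set m := m1 + m2 + m3
  set M := ∫ x, (1 + |Real.sqrt V * x|) ^ (m * 3) ∂(gaussianReal 0 1) with hM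
  refine ⟨C1 * C2 * C3 * (M + M + M), ?_, ?_⟩
  · have : 0 ≤ M := integral_nonneg fun x => by positivity
    positivity
  intro Ω _ μ X Y Z v p q r hT hv
  have hprob := hT.law.isProbabilityMeasure
  have l1 := hT.allLpX.growth (m * 3)
  have l2 := hT.allLpY.growth (m * 3)
  have l3 := hT.allLpZ.growth (m * 3)
  have b1 := integral_growth_le hT.law.fst hT.mX hT.vX hv (m * 3)
  have b2 := integral_growth_le hT.law.snd.fst hT.mY hT.vY hv (m * 3)
  have b3 := integral_growth_le hT.law.snd.snd hT.mZ hT.vZ hv (m * 3)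
  have mono : ∀ (k : ℕ) (x : ℝ), k ≤ m → (1 + |x|) ^ k ≤ (1 + |x|) ^ m := fun k x hk =>
    pow_le_pow_right₀ (by linarith [abs_nonneg x]) hk
  calc |gExp μ X Y Z f g h| ≤ ∫ η, C1 * C2 * C3 * ((1 + |X η|) ^ (m * 3) + (1 + |Y η|) ^ (m * 3)
        + (1 + |Z η|) ^ (m * 3)) ∂μ := by
        rw [gExp, ← Real.norm_eq_abs]
        refine norm_integral_le_of_norm_le (((l1.add l2).add l3).const_mul _).integrable
          (ae_of_all _ fun η => ?_)
        rw [Real.norm_eq_abs, abs_mul, abs_mul, pow_mul, pow_mul, pow_mul]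
        have x1 := (g1 (X η)).trans (mul_le_mul_of_nonneg_left (mono m1 (X η) (by omega)) hC1)
        have x2 := (g2 (Y η)).trans (mul_le_mul_of_nonneg_left (mono m2 (Y η) (by omega)) hC2)
        have x3 := (g3 (Z η)).trans (mul_le_mul_of_nonneg_left (mono m3 (Z η) (by omega)) hC3)
        set a := (1 + |X η|) ^ m
        set b := (1 + |Y η|) ^ m
        set c := (1 + |Z η|) ^ m
        have ha : 0 ≤ a := by positivity
        have hb : 0 ≤ b := by positivity
        have hc : 0 ≤ c := by positivity
        have amgm : a * b * c ≤ a ^ 3 + b ^ 3 + c ^ 3 := by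
          nlinarith [mul_nonneg (add_nonneg (add_nonneg ha hb) hc) (add_nonneg (add_nonneg
            (sq_nonneg (a - b)) (sq_nonneg (b - c))) (sq_nonneg (a - c))),
            pow_nonneg ha 3, pow_nonneg hb 3, pow_nonneg hc 3]
        calc |f (X η)| * |g (Y η)| * |h (Z η)| ≤ (C1 * a) * (C2 * b) * (C3 * c) := by gcongr
          _ = C1 * C2 * C3 * (a * b * c) := by ring
          _ ≤ _ := by gcongr
    _ = C1 * C2 * C3 * (∫ η, (1 + |X η|) ^ (m * 3) ∂μ + ∫ η, (1 + |Y η|) ^ (m * 3) ∂μ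
        + ∫ η, (1 + |Z η|) ^ (m * 3) ∂μ) := by
        rw [integral_const_mul, integral_add (l1.add l2).integrable l3.integrable,
          integral_add l1.integrable l2.integrable]
    _ ≤ _ := by gcongr

/-- The mean value inequality along the interpolation of two Gaussian triples, after subtraction of
a candidate `K` for the leading term. The bound is uniform over all Gaussian triples with the
interpolated covariances, so that expansions can be proved by iteration. -/
lemma abs_gExp_sub_sub_le {Ω₀ Ω₁ : Type u} [MeasurableSpace Ω₀] [MeasurableSpace Ω₁]
    {μ₀ : Measure Ω₀} {μ₁ : Measure Ω₁}
    {X₀ Y₀ Z₀ : Ω₀ → ℝ} {X₁ Y₁ Z₁ : Ω₁ → ℝ} {v₀ p₀ q₀ r₀ v₁ p₁ q₁ r₁ : ℝ}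
    (h₀ : GTriple μ₀ X₀ Y₀ Z₀ v₀ p₀ q₀ r₀)
    (h₁ : GTriple μ₁ X₁ Y₁ Z₁ v₁ p₁ q₁ r₁) {f g h : ℝ → ℝ} (hf : PolyC 2 f) (hg : PolyC 2 g)
    (hh : PolyC 2 h) (K K' : ℝ → ℝ) (hK : ∀ s, HasDerivAt K (K' s) s) (B : ℝ)
    (hB : ∀ s, 0 ≤ s → s ≤ 1 → ∀ (Ω : Type u) [MeasurableSpace Ω] (μ : Measure Ω)
      (X Y Z : Ω → ℝ), GTriple μ X Y Z ((1 - s) * v₀ + s * v₁) ((1 - s) * p₀ + s * p₁)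
        ((1 - s) * q₀ + s * q₁) ((1 - s) * r₀ + s * r₁) →
      |(v₁ - v₀) / 2 * (gExp μ X Y Z (deriv (deriv f)) g h + gExp μ X Y Z f (deriv (deriv g)) h
          + gExp μ X Y Z f g (deriv (deriv h)))
        + ((p₁ - p₀) * gExp μ X Y Z (deriv f) (deriv g) h
          + (q₁ - q₀) * gExp μ X Y Z (deriv f) g (deriv h)
          + (r₁ - r₀) * gExp μ X Y Z f (deriv g) (deriv h)) - K' s| ≤ B) :
    |gExp μ₁ X₁ Y₁ Z₁ f g h - gExp μ₀ X₀ Y₀ Z₀ f g h - (K 1 - K 0)| ≤ 2 * B := by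
  have i0 := h₀.law.isProbabilityMeasure
  have i1 := h₁.law.isProbabilityMeasure
  -- The parameter is `s = sin² α`; the factor `2` in the bound leaves room for the length `π / 2`
  -- of the interval of angles.
  set G : ℝ → ℝ := fun α => gExp (μ₀.prod μ₁) (rot α X₀ X₁) (rot α Y₀ Y₁) (rot α Z₀ Z₁) f g h
    - K (Real.sin α ^ 2) with hG
  have hB0 : 0 ≤ B := (abs_nonneg _).trans (hB 1 zero_le_one le_rfl Ω₁ μ₁ X₁ Y₁ Z₁ (by
    simpa using h₁))
  have hder : ∀ α, ∃ G', HasDerivAt G G' α ∧ ‖G'‖ ≤ B := by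
    intro α
    have d1 := hasDerivAt_integral_rot h₀ h₁ hf hg hh α
    have d2 : HasDerivAt (fun α => K (Real.sin α ^ 2))
        (K' (Real.sin α ^ 2) * (2 * Real.sin α * Real.cos α)) α := by
      have := (hK (Real.sin α ^ 2)).comp α ((Real.hasDerivAt_sin α).pow 2)
      simpa using! this
    refine ⟨_, d1.sub d2, ?_⟩
    have hs1 : Real.sin α ^ 2 ≤ 1 := Real.sin_sq_le_one α
    have hcos : Real.cos α ^ 2 = 1 - Real.sin α ^ 2 := by
      linarith [Real.sin_sq_add_cos_sq α]
    have hT := h₀.rot h₁ α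
    rw [hcos] at hT
    have b := hB (Real.sin α ^ 2) (sq_nonneg _) hs1 _ _ _ _ _ hT
    have hsc : |2 * Real.sin α * Real.cos α| ≤ 1 := by
      rw [← Real.sin_two_mul]; exact Real.abs_sin_le_one _
    rw [Real.norm_eq_abs]
    refine le_trans (le_of_eq ?_) ((mul_le_mul hsc b (abs_nonneg _) zero_le_one).trans
      (one_mul B).le)
    rw [← abs_mul]
    congr 1
    simp only [gExp]
    ring
  choose G' hG' hGb using hder
  have mv := (convex_univ (𝕜 := ℝ) (E := ℝ)).norm_image_sub_le_of_norm_hasDerivWithin_le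
    (f := G) (f' := G') (C := B) (x := 0) (y := Real.pi / 2)
    (fun α _ => (hG' α).hasDerivWithinAt) (fun α _ => hGb α) (mem_univ _) (mem_univ _)
  have e1 : G (Real.pi / 2) = gExp μ₁ X₁ Y₁ Z₁ f g h - K 1 := by
    simp only [hG, gExp, rot, Real.cos_pi_div_two, Real.sin_pi_div_two, zero_mul, one_mul, zero_add,
      one_pow]
    rw [integral_fun_snd (fun η => f (X₁ η) * g (Y₁ η) * h (Z₁ η))]
    simp
  have e0 : G 0 = gExp μ₀ X₀ Y₀ Z₀ f g h - K 0 := by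
    simp only [hG, gExp, rot, Real.cos_zero, Real.sin_zero, zero_mul, one_mul, add_zero]
    rw [integral_fun_fst (fun η => f (X₀ η) * g (Y₀ η) * h (Z₀ η))]
    simp
  rw [e0, e1, Real.norm_eq_abs, Real.norm_eq_abs, sub_zero,
    abs_of_nonneg (by positivity : (0 : ℝ) ≤ Real.pi / 2)] at mv
  calc _ = |gExp μ₁ X₁ Y₁ Z₁ f g h - K 1 - (gExp μ₀ X₀ Y₀ Z₀ f g h - K 0)| := by congr 1; ring
    _ ≤ _ := mv
    _ ≤ 2 * B := by nlinarith [Real.pi_le_four]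

section Decoupling

variable {Ω : Type u} [MeasurableSpace Ω] {μ : Measure Ω} {X Y Z : Ω → ℝ} {v p q r : ℝ}

/-- Replacing `X` by an independent copy. -/
lemma GTriple.decouple (h : GTriple μ X Y Z v p q r) :
    GTriple (μ.prod μ) (fun η => X η.1) (fun η => Y η.2) (fun η => Z η.2) v 0 0 r := by
  have hprob := h.law.isProbabilityMeasure
  have iX := h.allLpX
  have iY := h.allLpY
  have iZ := h.allLpZ
  constructor
  · let Lc : ((ℝ × ℝ × ℝ) × (ℝ × ℝ × ℝ)) →L[ℝ] ℝ × ℝ × ℝ :=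
      { toFun := fun w => (w.1.1, w.2.2.1, w.2.2.2)
        map_add' := by intro x y; ext <;> simp
        map_smul' := by intro m x; ext <;> simp
        cont := by fun_prop }
    exact (hasGaussianLaw_prod h.law h.law).map_fun Lc
  · rw [integral_fun_fst X]; simp [h.mX]
  · rw [integral_fun_snd Y]; simp [h.mY]
  · rw [integral_fun_snd Z]; simp [h.mZ]
  · rw [integral_fun_fst (fun η => X η * X η)]; simp [h.vX]
  · rw [integral_fun_snd (fun η => Y η * Y η)]; simp [h.vY]
  · rw [integral_fun_snd (fun η => Z η * Z η)]; simp [h.vZ]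
  · rw [integral_prod_mul X Y]; simp [h.mX]
  · rw [integral_prod_mul X Z]; simp [h.mX]
  · rw [integral_fun_snd (fun η => Y η * Z η)]; simp [h.cYZ]

/-- Decoupling `X` from `(Y, Z)`, with a correction `K` to be chosen. -/
lemma GTriple.abs_decouple_le (hT : GTriple μ X Y Z v p q r) {f g h : ℝ → ℝ} (hf : PolyC 2 f)
    (hg : PolyC 2 g) (hh : PolyC 2 h) (K K' : ℝ → ℝ) (hK : ∀ s, HasDerivAt K (K' s) s) (B : ℝ)
    (hB : ∀ s, 0 ≤ s → s ≤ 1 → ∀ (Ω : Type u) [MeasurableSpace Ω] (μ : Measure Ω)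
      (X Y Z : Ω → ℝ), GTriple μ X Y Z v (s * p) (s * q) r →
      |p * gExp μ X Y Z (deriv f) (deriv g) h + q * gExp μ X Y Z (deriv f) g (deriv h) - K' s|
        ≤ B) :
    |gExp μ X Y Z f g h - gMean f v * gExp μ X Y Z (fun _ => 1) g h - (K 1 - K 0)| ≤ 2 * B := by
  have hprob := hT.law.isProbabilityMeasure
  have := abs_gExp_sub_sub_le hT.decouple hT hf hg hh K K' hK B (by
    intro s h0 h1 Ω _ μ' X' Y' Z' hT'
    have e : GTriple μ' X' Y' Z' v (s * p) (s * q) r := by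
      convert! hT' using 1 <;> ring
    simpa using hB s h0 h1 Ω μ' X' Y' Z' e)
  have e : gExp (μ.prod μ) (fun η => X η.1) (fun η => Y η.2) (fun η => Z η.2) f g h
      = gMean f v * gExp μ X Y Z (fun _ => 1) g h := by
    simp only [gExp, mul_assoc, one_mul]
    rw [integral_prod_mul (fun η => f (X η)) (fun η => g (Y η) * h (Z η)),
      integral_comp_of_centred hT.law.fst hT.mX hT.vX hf.continuous]
  rwa [e] at this

end Decoupling

/-- `E[f(X) g(Y) h(Z)] = D + O(R)`, uniformly over the centred Gaussian triples with variance at most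
`V`; the main term `D` depends on the variance and the covariances, the error `R` on the
covariances. -/
def GExpansion (V : ℝ) (f g h : ℝ → ℝ) (D : ℝ → ℝ → ℝ → ℝ → ℝ) (R : ℝ → ℝ → ℝ → ℝ) : Prop :=
  ∃ A : ℝ, 0 ≤ A ∧ ∀ (Ω : Type u) [MeasurableSpace Ω] (μ : Measure Ω) (X Y Z : Ω → ℝ)
    (v p q r : ℝ), GTriple μ X Y Z v p q r → v ≤ V →
      |gExp μ X Y Z f g h - D v p q r| ≤ A * R p q r

lemma PolyC.one_fun {n : ℕ} : PolyC n (fun _ => 1) :=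
  ⟨contDiff_const, fun l _ => by
    have : iteratedDeriv l (fun _ : ℝ => (1 : ℝ)) = fun _ => if l = 0 then 1 else 0 := by
      ext x; simp [iteratedDeriv_const]
    rw [this]; exact PolyGrowth.const _⟩

section GExpansion

variable {V : ℝ} {f g h : ℝ → ℝ}

/-- An odd function of `X` has expectation of the order of the covariances of `X`. -/
lemma gExpansion_oddX (hf : PolyC 2 f) (hg : PolyC 2 g) (hh : PolyC 2 h)
    (of : ∀ u, f (-u) = -f u) :
    GExpansion.{u} V f g h (fun _ _ _ _ => 0) (fun p q _ => |p| + |q|) := by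
  obtain ⟨A1, p1, H1⟩ := exists_gExp_le.{u} V (hf.deriv.mono zero_le_one)
    (hg.deriv.mono zero_le_one) (hh.mono (by simp))
  obtain ⟨A2, p2, H2⟩ := exists_gExp_le.{u} V (hf.deriv.mono zero_le_one) (hg.mono (by simp))
    (hh.deriv.mono zero_le_one)
  refine ⟨2 * (A1 + A2), by positivity, fun Ω _ μ X Y Z v p q r hT hv => ?_⟩
  have := hT.abs_decouple_le hf hg hh (fun _ => 0) (fun _ => 0) (fun s => hasDerivAt_const _ _)
    (|p| * A1 + |q| * A2) (by
      intro s _ _ Ω' _ μ' X' Y' Z' hT'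
      rw [sub_zero]
      refine (abs_add_le _ _).trans ?_
      rw [abs_mul, abs_mul]
      gcongr
      · exact H1 _ _ _ _ _ _ _ _ _ hT' hv
      · exact H2 _ _ _ _ _ _ _ _ _ hT' hv)
  rw [gMean_odd of] at this
  simp only [zero_mul, sub_zero] at this ⊢
  refine this.trans ?_
  nlinarith [abs_nonneg p, abs_nonneg q]

/-- An odd function of `Y` has expectation of the order of the covariances of `Y`. -/
lemma gExpansion_oddY (hf : PolyC 2 f) (hg : PolyC 2 g) (hh : PolyC 2 h)
    (og : ∀ u, g (-u) = -g u) :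
    GExpansion.{u} V f g h (fun _ _ _ _ => 0) (fun p _ r => |p| + |r|) := by
  obtain ⟨A, h0, hA⟩ := gExpansion_oddX.{u} (V := V) hg hf hh og
  refine ⟨A, h0, fun Ω _ μ X Y Z v p q r hT hv => ?_⟩
  rw [gExp_perm_XY]
  exact hA _ _ _ _ _ _ _ _ _ hT.perm_XY hv

/-- If `g'` is odd, the covariance of `g(Y)` and `h(Z)` is of second order. -/
lemma gExpansion_even_pair (hg : PolyC 3 g) (hh : PolyC 3 h)
    (og : ∀ u, deriv g (-u) = -deriv g u) :
    GExpansion.{u} V (fun _ => 1) g h (fun v _ _ _ => gMean g v * gMean h v)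
      (fun p _ r => |r| * (|p| + |r|)) := by
  obtain ⟨A1, p1, H1⟩ := gExpansion_oddY.{u} (V := V) (PolyC.one_fun (n := 2)) hg.deriv hh.deriv og
  refine ⟨2 * A1, by positivity, fun Ω _ μ X Y Z v p q r hT hv => ?_⟩
  rw [gExp_perm_XY]
  have := hT.perm_XY.abs_decouple_le (hg.mono (by simp)) PolyC.one_fun (hh.mono (by simp))
    (fun _ => 0) (fun _ => 0)
    (fun s => hasDerivAt_const _ _) (A1 * (|r| * (|p| + |r|))) (by
      intro s s0 s1 Ω' _ μ' X' Y' Z' hT'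
      have b := H1 _ _ _ _ _ _ _ _ _ hT'.perm_XY hv
      rw [gExp_perm_XY] at b
      have z : gExp μ' X' Y' Z' (deriv g) (deriv fun _ => 1) h = 0 := by
        simp [gExp]
      rw [z, mul_zero, zero_add, sub_zero, abs_mul]
      simp only [sub_zero, abs_mul, abs_of_nonneg s0] at b
      calc _ ≤ |r| * (A1 * (s * |p| + s * |r|)) := by gcongr
        _ ≤ |r| * (A1 * (1 * |p| + 1 * |r|)) := by gcongr
        _ = _ := by ring)
  have e : gExp μ Y X Z (fun _ => 1) (fun _ => 1) h = gMean h v := by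
    simp only [gExp, one_mul]
    exact integral_comp_of_centred hT.law.snd.snd hT.mZ hT.vZ hh.continuous
  rw [e] at this
  simp only [sub_zero] at this
  exact this.trans (by ring_nf; rfl)

/-- If `f'` and `g'` are odd, the product formula for `E[f(X) g(Y) h(Z)]` holds up to second order in
the covariances. -/
lemma gExpansion_even (hf : PolyC 3 f) (hg : PolyC 3 g) (hh : PolyC 3 h)
    (of : ∀ u, deriv f (-u) = -deriv f u) (og : ∀ u, deriv g (-u) = -deriv g u) :
    GExpansion.{u} V f g h (fun v _ _ _ => gMean f v * gMean g v * gMean h v)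
      (fun p q r => p ^ 2 + q ^ 2 + r ^ 2) := by
  obtain ⟨A1, p1, H1⟩ := gExpansion_oddX.{u} (V := V) hf.deriv hg.deriv (hh.mono (by simp)) of
  obtain ⟨A2, p2, H2⟩ := gExpansion_oddX.{u} (V := V) hf.deriv (hg.mono (by simp)) hh.deriv of
  obtain ⟨A3, p3, H3⟩ := gExpansion_even_pair.{u} (V := V) hg hh og
  obtain ⟨A4, p4, H4⟩ := exists_gExp_le.{u} V (hf.mono (by simp) : PolyC 0 f)
    (PolyC.one_fun (n := 0)) (PolyC.one_fun (n := 0))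
  refine ⟨4 * (A1 + A2) + 2 * (A4 * A3), by positivity, fun Ω _ μ X Y Z v p q r hT hv => ?_⟩
  have d := hT.abs_decouple_le (hf.mono (by simp)) (hg.mono (by simp)) (hh.mono (by simp))
    (fun _ => 0) (fun _ => 0)
    (fun s => hasDerivAt_const _ _) ((A1 + A2) * (2 * (p ^ 2 + q ^ 2))) (by
      intro s s0 s1 Ω' _ μ' X' Y' Z' hT'
      have b1 := H1 _ _ _ _ _ _ _ _ _ hT' hv
      have b2 := H2 _ _ _ _ _ _ _ _ _ hT' hv
      simp only [sub_zero, abs_mul, abs_of_nonneg s0] at b1 b2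
      rw [sub_zero]
      refine (abs_add_le _ _).trans ?_
      rw [abs_mul, abs_mul]
      calc _ ≤ |p| * (A1 * (1 * |p| + 1 * |q|)) + |q| * (A2 * (1 * |p| + 1 * |q|)) := by
            gcongr
            · exact b1.trans (by gcongr)
            · exact b2.trans (by gcongr)
        _ ≤ _ := by
            rw [← sq_abs p, ← sq_abs q]
            have hp := abs_nonneg p
            have hq := abs_nonneg q
            have e1 : |p| * (|p| + |q|) ≤ 2 * (|p| ^ 2 + |q| ^ 2) := by
              nlinarith [sq_nonneg (|p| - |q|)]
            have e2 : |q| * (|p| + |q|) ≤ 2 * (|p| ^ 2 + |q| ^ 2) := by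
              nlinarith [sq_nonneg (|p| - |q|)]
            nlinarith [mul_le_mul_of_nonneg_left e1 p1, mul_le_mul_of_nonneg_left e2 p2])
  have b3 := H3 _ _ _ _ _ _ _ _ _ hT hv
  have hprob := hT.law.isProbabilityMeasure
  have b4 : |gMean f v| ≤ A4 := by
    have := H4 _ _ _ _ _ _ _ _ _ hT hv
    simp only [gExp, mul_one] at this
    rwa [integral_comp_of_centred hT.law.fst hT.mX hT.vX hf.continuous] at this
  have e : gExp μ X Y Z f g h - gMean f v * gMean g v * gMean h v
      = (gExp μ X Y Z f g h - gMean f v * gExp μ X Y Z (fun _ => 1) g h - (0 - 0))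
        + gMean f v * (gExp μ X Y Z (fun _ => 1) g h - gMean g v * gMean h v) := by ring
  rw [e]
  refine (abs_add_le _ _).trans ?_
  rw [abs_mul]
  have e2 : |r| * (|p| + |r|) ≤ 2 * (p ^ 2 + q ^ 2 + r ^ 2) := by
    rw [← sq_abs p, ← sq_abs r]
    nlinarith [sq_nonneg (|p| - |r|), sq_nonneg q, abs_nonneg r, abs_nonneg p]
  calc _ ≤ 2 * ((A1 + A2) * (2 * (p ^ 2 + q ^ 2))) + A4 * (A3 * (|r| * (|p| + |r|))) := by gcongr
    _ ≤ 2 * ((A1 + A2) * (2 * (p ^ 2 + q ^ 2 + r ^ 2)))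
        + A4 * (A3 * (2 * (p ^ 2 + q ^ 2 + r ^ 2))) := by
        have : p ^ 2 + q ^ 2 ≤ p ^ 2 + q ^ 2 + r ^ 2 := by nlinarith [sq_nonneg r]
        gcongr
    _ = _ := by ring

/-- If `f` and `g` are odd, `E[f(X) g(Y) h(Z)]` is of first order in `E[XY]`, the covariances with `Z`
entering only through products. -/
lemma gExpansion_odd_odd (hf : PolyC 2 f) (hg : PolyC 3 g) (hh : PolyC 3 h) (hf' : PolyC 3 f)
    (of : ∀ u, f (-u) = -f u) (og : ∀ u, g (-u) = -g u) :
    GExpansion.{u} V f g h (fun _ _ _ _ => 0) (fun p q r => |p| + |q| * (|p| + |r|)) := by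
  obtain ⟨A1, p1, H1⟩ := exists_gExp_le.{u} V (hf.deriv.mono zero_le_one)
    (hg.deriv.mono (by simp)) (hh.mono (by simp))
  obtain ⟨A2, p2, H2⟩ := gExpansion_oddY.{u} (V := V) hf'.deriv (hg.mono (by simp)) hh.deriv og
  refine ⟨2 * (A1 + A2), by positivity, fun Ω _ μ X Y Z v p q r hT hv => ?_⟩
  have := hT.abs_decouple_le hf (hg.mono (by simp)) (hh.mono (by simp)) (fun _ => 0) (fun _ => 0)
    (fun s => hasDerivAt_const _ _)
    (|p| * A1 + |q| * (A2 * (|p| + |r|))) (by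
      intro s s0 s1 Ω' _ μ' X' Y' Z' hT'
      have b2 := H2 _ _ _ _ _ _ _ _ _ hT' hv
      simp only [sub_zero, abs_mul, abs_of_nonneg s0] at b2
      rw [sub_zero]
      refine (abs_add_le _ _).trans ?_
      rw [abs_mul, abs_mul]
      gcongr
      · exact H1 _ _ _ _ _ _ _ _ _ hT' hv
      · exact b2.trans (by
          gcongr
          nlinarith [abs_nonneg p]))
  rw [gMean_odd of] at this
  simp only [zero_mul, sub_zero] at this ⊢
  refine this.trans ?_
  have : 0 ≤ |q| * (|p| + |r|) := by positivity
  nlinarith [abs_nonneg p, mul_nonneg p1 this, mul_nonneg p2 (abs_nonneg p)]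

/-- `E[f(X) g(Y) g(Z)]` when `f'`, `g` are odd: the leading term is linear in `E[YZ]`. -/
lemma gExpansion_even_odd_odd (hf : PolyC 5 f) (hg : PolyC 5 g)
    (of : ∀ u, deriv f (-u) = -deriv f u) (og : ∀ u, g (-u) = -g u)
    (og' : ∀ u, deriv (deriv g) (-u) = -deriv (deriv g) u) :
    GExpansion.{u} V f g g
      (fun v _ _ r => gMean f v * gMean (deriv g) v * gMean (deriv g) v * r)
      (fun p q r => |q| * (|p| + |q| * (|p| + |r|)) + |r| * (p ^ 2 + q ^ 2 + r ^ 2)) := by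
  obtain ⟨A1, p1, H1⟩ := gExpansion_odd_odd.{u} (V := V) (hf.deriv.mono (by simp))
    (hg.mono (by simp)) (hg.deriv.mono (by simp)) (hf.deriv.mono (by simp)) of og
  obtain ⟨A2, p2, H2⟩ := gExpansion_even.{u} (V := V) (hf.mono (by simp))
    (hg.deriv.mono (by simp)) (hg.deriv.mono (by simp)) of og'
  refine ⟨2 * (A1 + A2), by positivity, fun Ω _ μ X Y Z v p q r hT hv => ?_⟩
  set M := gMean f v * gMean (deriv g) v * gMean (deriv g) v with hM
  set R := |q| * (|p| + |q| * (|p| + |r|)) + |r| * (p ^ 2 + q ^ 2 + r ^ 2) with hR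
  rw [gExp_perm_XZ]
  have := hT.perm_XZ.abs_decouple_le (hg.mono (by simp)) (hg.mono (by simp)) (hf.mono (by simp))
    (fun s => M * r * s) (fun _ => M * r)
    (fun s => by simpa using (hasDerivAt_id s).const_mul (M * r))
    ((A1 + A2) * R) (by
      intro s s0 s1 Ω' _ μ' X' Y' Z' hT'
      have b1 := H1 _ _ _ _ _ _ _ _ _ hT'.perm_XZ hv
      have b2 := H2 _ _ _ _ _ _ _ _ _ hT'.perm_XZ hv
      rw [gExp_perm_XZ] at b1 b2
      simp only [sub_zero, abs_mul, abs_of_nonneg s0] at b1 b2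
      rw [← hM] at b2
      have e : r * gExp μ' X' Y' Z' (deriv g) (deriv g) f
            + q * gExp μ' X' Y' Z' (deriv g) g (deriv f) - M * r
          = q * gExp μ' X' Y' Z' (deriv g) g (deriv f)
            + r * (gExp μ' X' Y' Z' (deriv g) (deriv g) f - M) := by ring
      rw [e]
      refine (abs_add_le _ _).trans ?_
      rw [abs_mul, abs_mul]
      have c1 : s * |q| ≤ |q| := mul_le_of_le_one_left (abs_nonneg _) s1
      have c2 : s * |r| ≤ |r| := mul_le_of_le_one_left (abs_nonneg _) s1
      have c3 : (s * q) ^ 2 ≤ q ^ 2 := by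
        rw [mul_pow]; exact mul_le_of_le_one_left (sq_nonneg _) (pow_le_one₀ s0 s1)
      have c4 : (s * r) ^ 2 ≤ r ^ 2 := by
        rw [mul_pow]; exact mul_le_of_le_one_left (sq_nonneg _) (pow_le_one₀ s0 s1)
      calc _ ≤ |q| * (A1 * (|p| + |q| * (|p| + |r|))) + |r| * (A2 * (p ^ 2 + q ^ 2 + r ^ 2)) := by
            gcongr
            · exact b1.trans (by gcongr)
            · exact b2.trans (by gcongr)
        _ ≤ (A1 + A2) * R := by
            have x1 : 0 ≤ |q| * (|p| + |q| * (|p| + |r|)) := by positivity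
            have x2 : 0 ≤ |r| * (p ^ 2 + q ^ 2 + r ^ 2) := by positivity
            rw [hR]
            nlinarith [mul_nonneg p1 x2, mul_nonneg p2 x1])
  rw [gMean_odd og] at this
  simp only [zero_mul, mul_zero, sub_zero, mul_one] at this ⊢
  exact this.trans (le_of_eq (by ring))

/-- Change of `E[g(X) g(Y) h(Z)]`, `g` odd and `h' = g`, when only the covariance of `X` and `Z`
is modified. The increment `q₁ - q₀` is a factor of the error as well as of the main term; in the
application it is the increment of the covariance under a reflection, which is what makes the error
terms integrable. -/
lemma exists_abs_gExp_sub_le_of_cov (V : ℝ) {g h : ℝ → ℝ} (hg : PolyC 6 g)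
    (og : ∀ u, g (-u) = -g u) (og1 : ∀ u, deriv (deriv g) (-u) = -deriv (deriv g) u)
    (hh : PolyC 7 h) (e : deriv h = g) :
    ∃ A : ℝ, 0 ≤ A ∧ ∀ (Ω : Type u) [MeasurableSpace Ω] (μ : Measure Ω) (X₀ Y₀ Z₀ X₁ Y₁ Z₁ : Ω → ℝ)
      (v p q₀ q₁ r : ℝ), GTriple μ X₀ Y₀ Z₀ v p q₀ r → GTriple μ X₁ Y₁ Z₁ v p q₁ r → v ≤ V →
      |gExp μ X₁ Y₁ Z₁ g g h - gExp μ X₀ Y₀ Z₀ g g h - gMean (deriv g) v ^ 3 * r * (q₁ - q₀)|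
        ≤ A * (|q₁ - q₀| * (|p| * (|q₀| + |q₁|) + |r| * (p ^ 2 + q₀ ^ 2 + q₁ ^ 2 + r ^ 2))) := by
  obtain ⟨A, hA0, H⟩ := gExpansion_even_odd_odd.{u} (V := V) hg.deriv (hg.mono (by simp)) og1 og og1
  refine ⟨2 * (A * (2 * (1 + |V|))), by positivity, ?_⟩
  intro Ω _ μ X₀ Y₀ Z₀ X₁ Y₁ Z₁ v p q₀ q₁ r h₀ h₁ hv
  set M := gMean (deriv g) v ^ 3 with hM
  have hV : v ≤ |V| := hv.trans (le_abs_self V)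
  have := abs_gExp_sub_sub_le h₀ h₁ (hg.mono (by simp)) (hg.mono (by simp)) (hh.mono (by simp))
    (fun s => (q₁ - q₀) * M * r * s) (fun _ => (q₁ - q₀) * M * r)
    (fun s => by simpa using (hasDerivAt_id s).const_mul ((q₁ - q₀) * M * r))
    (A * (2 * (1 + |V|)) *
      (|q₁ - q₀| * (|p| * (|q₀| + |q₁|) + |r| * (p ^ 2 + q₀ ^ 2 + q₁ ^ 2 + r ^ 2)))) (by
      intro s s0 s1 Ω' _ μ' X' Y' Z' hT'
      have hT : GTriple μ' X' Y' Z' v p ((1 - s) * q₀ + s * q₁) r := by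
        convert! hT' using 1 <;> ring
      set q := (1 - s) * q₀ + s * q₁ with hq
      have b := H _ _ _ _ _ _ _ _ _ hT hv
      have hqv : |q| ≤ |V| := hT.abs_q_le.trans hV
      have e1 : (v - v) / 2 * (gExp μ' X' Y' Z' (deriv (deriv g)) g h
          + gExp μ' X' Y' Z' g (deriv (deriv g)) h + gExp μ' X' Y' Z' g g (deriv (deriv h)))
        + ((p - p) * gExp μ' X' Y' Z' (deriv g) (deriv g) h
          + (q₁ - q₀) * gExp μ' X' Y' Z' (deriv g) g (deriv h)
          + (r - r) * gExp μ' X' Y' Z' g (deriv g) (deriv h)) - (q₁ - q₀) * M * r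
        = (q₁ - q₀) * (gExp μ' X' Y' Z' (deriv g) g g - M * r) := by
        rw [e]; ring
      rw [e1, abs_mul]
      have e2 : gMean (deriv g) v * gMean (deriv g) v * gMean (deriv g) v * r = M * r := by
        rw [hM]; ring
      simp only [e2] at b
      have hq1 : |q| ≤ |q₀| + |q₁| := abs_trig_combination_le
        (by rw [abs_of_nonneg (by linarith)]; linarith) (by rw [abs_of_nonneg s0]; exact s1)
      have hq2 : q ^ 2 ≤ q₀ ^ 2 + q₁ ^ 2 := by
        rw [hq]
        nlinarith [mul_nonneg s0 (sub_nonneg.2 s1), sq_nonneg (q₀ - q₁), sq_nonneg q₀,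
          sq_nonneg q₁, mul_nonneg (mul_nonneg s0 (sub_nonneg.2 s1)) (sq_nonneg (q₀ - q₁)),
          mul_nonneg s0 (sq_nonneg q₀), mul_nonneg (sub_nonneg.2 s1) (sq_nonneg q₁)]
      have hVn := abs_nonneg V
      have hqn := abs_nonneg q
      have hpn := abs_nonneg p
      have hrn := abs_nonneg r
      calc _ ≤ |q₁ - q₀| * (A * (|q| * (|p| + |q| * (|p| + |r|)) + |r| * (p ^ 2 + q ^ 2 + r ^ 2))) := by
            gcongr
        _ = |q₁ - q₀| * (A * (|p| * |q| * (1 + |q|) + |r| * (p ^ 2 + 2 * q ^ 2 + r ^ 2))) := by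
            rw [← sq_abs q]; ring
        _ ≤ |q₁ - q₀| * (A * (|p| * (|q₀| + |q₁|) * (1 + |V|)
              + |r| * (p ^ 2 + 2 * (q₀ ^ 2 + q₁ ^ 2) + r ^ 2))) := by
            gcongr
        _ ≤ |q₁ - q₀| * (A * (2 * (1 + |V|) * (|p| * (|q₀| + |q₁|)
              + |r| * (p ^ 2 + q₀ ^ 2 + q₁ ^ 2 + r ^ 2)))) := by
            gcongr
            have x1 : 0 ≤ |p| * (|q₀| + |q₁|) := by positivity
            have x2 : 0 ≤ |r| * (p ^ 2 + q₀ ^ 2 + q₁ ^ 2 + r ^ 2) := by positivity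
            have x3 : 0 ≤ |r| * (p ^ 2 + r ^ 2) := by positivity
            nlinarith [mul_nonneg hVn x1, mul_nonneg hVn x2]
        _ = _ := by ring)
  refine le_trans (le_of_eq ?_) (this.trans (le_of_eq ?_))
  · congr 1; ring
  · ring

/-- The covariance of `f(Y)` and `f(Z)` is `E[f'']² r² / 2` up to fourth order when `f` is even: the odd
orders vanish. The error is at most `2 A r⁴` once `X` is taken equal to `Z`. -/
lemma gExpansion_covariance (hf : PolyC 5 f) (of : ∀ u, deriv f (-u) = -deriv f u)
    (of' : ∀ u, deriv (deriv (deriv f)) (-u) = -deriv (deriv (deriv f)) u) :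
    GExpansion.{u} V (fun _ => 1) f f
      (fun v _ _ r => gMean f v * gMean f v + gMean (deriv (deriv f)) v ^ 2 / 2 * r ^ 2)
      (fun p _ r => |r| ^ 3 * (|p| + |r|)) := by
  obtain ⟨A1, p1, H1⟩ := gExpansion_even_pair.{u} (V := V) (hf.deriv.deriv : PolyC 3 _)
    (hf.deriv.deriv) of'
  refine ⟨4 * A1, by positivity, fun Ω _ μ X Y Z v p q r hT hv => ?_⟩
  set m := gMean (deriv (deriv f)) v with hm
  rw [gExp_perm_XY]
  have z1 : ∀ (Ω' : Type u) [MeasurableSpace Ω'] (μ' : Measure Ω') (X' Y' Z' : Ω' → ℝ)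
      (k l : ℝ → ℝ), gExp μ' X' Y' Z' k (deriv fun _ => 1) l = 0 := by
    intros; simp [gExp]
  -- first the odd functions `f'`, then `f` itself
  have step : ∀ (Ω' : Type u) [MeasurableSpace Ω'] (μ' : Measure Ω') (X' Y' Z' : Ω' → ℝ)
      (p' q' r' : ℝ), GTriple μ' X' Y' Z' v p' q' r' →
      |gExp μ' X' Y' Z' (deriv f) (fun _ => 1) (deriv f) - m ^ 2 * q'|
        ≤ 2 * (A1 * (q' ^ 2 * (|p'| + |q'|))) := by
    intro Ω' _ μ' X' Y' Z' p' q' r' hT'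
    have := hT'.abs_decouple_le (hf.deriv.mono (by simp)) PolyC.one_fun (hf.deriv.mono (by simp))
      (fun s => m ^ 2 * q' * s) (fun _ => m ^ 2 * q')
      (fun s => by simpa using (hasDerivAt_id s).const_mul (m ^ 2 * q'))
      (A1 * (q' ^ 2 * (|p'| + |q'|))) (by
        intro s s0 s1 Ω'' _ μ'' X'' Y'' Z'' hT''
        have b := H1 _ _ _ _ _ _ _ _ _ hT''.perm_XY hv
        rw [gExp_perm_XY] at b
        simp only [abs_mul, abs_of_nonneg s0, ← hm] at b
        rw [z1, mul_zero, zero_add]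
        have e : q' * gExp μ'' X'' Y'' Z'' (deriv (deriv f)) (fun _ => 1) (deriv (deriv f))
            - m ^ 2 * q' = q' * (gExp μ'' X'' Y'' Z'' (deriv (deriv f)) (fun _ => 1)
              (deriv (deriv f)) - m * m) := by ring
        rw [e, abs_mul]
        have c1 : s * |q'| ≤ |q'| := mul_le_of_le_one_left (abs_nonneg _) s1
        have c2 : s * |p'| ≤ |p'| := mul_le_of_le_one_left (abs_nonneg _) s1
        calc _ ≤ |q'| * (A1 * (|q'| * (|p'| + |q'|))) := by
              gcongr
              exact b.trans (by gcongr)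
          _ = A1 * (|q'| ^ 2 * (|p'| + |q'|)) := by ring
          _ = _ := by rw [sq_abs])
    rw [gMean_odd of] at this
    simpa using this
  have := hT.perm_XY.abs_decouple_le (hf.mono (by simp)) PolyC.one_fun (hf.mono (by simp))
    (fun s => m ^ 2 * r ^ 2 / 2 * s ^ 2) (fun s => m ^ 2 * r ^ 2 * s)
    (fun s => by
      have := ((hasDerivAt_id s).pow 2).const_mul (m ^ 2 * r ^ 2 / 2)
      convert! this using 1
      simp; ring)
    (2 * A1 * (|r| ^ 3 * (|p| + |r|))) (by
      intro s s0 s1 Ω' _ μ' X' Y' Z' hT'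
      have b := step _ _ _ _ _ _ _ _ hT'
      rw [z1, mul_zero, zero_add]
      have e : r * gExp μ' X' Y' Z' (deriv f) (fun _ => 1) (deriv f) - m ^ 2 * r ^ 2 * s
          = r * (gExp μ' X' Y' Z' (deriv f) (fun _ => 1) (deriv f) - m ^ 2 * (s * r)) := by ring
      rw [e, abs_mul]
      simp only [abs_mul, abs_of_nonneg s0, mul_pow] at b
      have c1 : s * |r| ≤ |r| := mul_le_of_le_one_left (abs_nonneg _) s1
      have c2 : s * |p| ≤ |p| := mul_le_of_le_one_left (abs_nonneg _) s1
      have c3 : s ^ 2 * r ^ 2 ≤ |r| ^ 2 := by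
        rw [sq_abs]; exact mul_le_of_le_one_left (sq_nonneg _) (pow_le_one₀ s0 s1)
      calc _ ≤ |r| * (2 * (A1 * (|r| ^ 2 * (|p| + |r|)))) := by
            gcongr
            exact b.trans (by gcongr)
        _ = _ := by ring)
  have e : gExp μ Y X Z (fun _ => 1) (fun _ => 1) f = gMean f v := by
    simp only [gExp, one_mul]
    exact integral_comp_of_centred hT.law.snd.snd hT.mZ hT.vZ hf.continuous
  rw [e] at this
  refine le_trans (le_of_eq ?_) (this.trans (le_of_eq ?_))
  · congr 1; ring
  · ring

/-- Gaussian expectations are Lipschitz functions of the covariances. -/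
lemma exists_abs_gExp_sub_le (V : ℝ) (hf : PolyC 2 f) (hg : PolyC 2 g) (hh : PolyC 2 h) :
    ∃ A : ℝ, 0 ≤ A ∧ ∀ (Ω : Type u) [MeasurableSpace Ω] (μ : Measure Ω) (X₀ Y₀ Z₀ X₁ Y₁ Z₁ : Ω → ℝ)
      (v p₀ q₀ r₀ p₁ q₁ r₁ : ℝ), GTriple μ X₀ Y₀ Z₀ v p₀ q₀ r₀ → GTriple μ X₁ Y₁ Z₁ v p₁ q₁ r₁ →
      v ≤ V → |gExp μ X₁ Y₁ Z₁ f g h - gExp μ X₀ Y₀ Z₀ f g h|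
        ≤ A * (|p₁ - p₀| + |q₁ - q₀| + |r₁ - r₀|) := by
  obtain ⟨A1, p1, H1⟩ := exists_gExp_le.{u} V (hf.deriv.mono zero_le_one)
    (hg.deriv.mono zero_le_one) (hh.mono (by simp))
  obtain ⟨A2, p2, H2⟩ := exists_gExp_le.{u} V (hf.deriv.mono zero_le_one) (hg.mono (by simp))
    (hh.deriv.mono zero_le_one)
  obtain ⟨A3, p3, H3⟩ := exists_gExp_le.{u} V (hf.mono (by simp)) (hg.deriv.mono zero_le_one)
    (hh.deriv.mono zero_le_one)
  refine ⟨2 * (A1 + A2 + A3), by positivity, ?_⟩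
  intro Ω _ μ X₀ Y₀ Z₀ X₁ Y₁ Z₁ v p₀ q₀ r₀ p₁ q₁ r₁ h₀ h₁ hv
  have := abs_gExp_sub_sub_le h₀ h₁ hf hg hh (fun _ => 0) (fun _ => 0)
    (fun s => hasDerivAt_const _ _)
    (|p₁ - p₀| * A1 + |q₁ - q₀| * A2 + |r₁ - r₀| * A3) (by
      intro s s0 s1 Ω' _ μ' X' Y' Z' hT'
      have hv' : (1 - s) * v + s * v ≤ V := by linarith
      rw [sub_self, zero_div, zero_mul, zero_add, sub_zero]
      refine (abs_add_le _ _).trans (add_le_add ((abs_add_le _ _).trans (add_le_add ?_ ?_)) ?_)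
      · rw [abs_mul]; gcongr; exact H1 _ _ _ _ _ _ _ _ _ hT' hv'
      · rw [abs_mul]; gcongr; exact H2 _ _ _ _ _ _ _ _ _ hT' hv'
      · rw [abs_mul]; gcongr; exact H3 _ _ _ _ _ _ _ _ _ hT' hv')
  simp only [sub_zero] at this
  refine this.trans ?_
  have a1 := abs_nonneg (p₁ - p₀)
  have a2 := abs_nonneg (q₁ - q₀)
  have a3 := abs_nonneg (r₁ - r₀)
  nlinarith [mul_nonneg p1 a2, mul_nonneg p1 a3, mul_nonneg p2 a1, mul_nonneg p2 a3,
    mul_nonneg p3 a1, mul_nonneg p3 a2]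

/-- Gaussian means are Lipschitz functions of the variance. -/
lemma exists_abs_gMean_sub_le (V : ℝ) (hf : PolyC 2 f) :
    ∃ A : ℝ, 0 ≤ A ∧ ∀ v₀ v₁ : ℝ, 0 ≤ v₀ → 0 ≤ v₁ → v₀ ≤ V → v₁ ≤ V →
      |gMean f v₁ - gMean f v₀| ≤ A * |v₁ - v₀| := by
  obtain ⟨A1, p1, H1⟩ := exists_gExp_le.{0} V (hf.deriv.deriv : PolyC 0 _)
    (PolyC.one_fun (n := 0)) (PolyC.one_fun (n := 0))
  refine ⟨A1, p1, fun v₀ v₁ h0 h1 h0V h1V => ?_⟩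
  -- The means are expectations along the totally correlated triple `(x, x, x)`.
  have tr : ∀ v : ℝ, 0 ≤ v → GTriple (gaussianReal 0 v.toNNReal) (fun x => x) (fun x => x)
      (fun x => x) v v v v := by
    intro v hv
    have m : ∫ x, x ∂(gaussianReal 0 v.toNNReal) = 0 := integral_id_gaussianReal
    have c : ∫ x, x * x ∂(gaussianReal 0 v.toNNReal) = v := by
      have := variance_of_integral_eq_zero (μ := gaussianReal 0 v.toNNReal) (X := fun x => x)
        (by fun_prop) m
      rw [variance_fun_id_gaussianReal, Real.coe_toNNReal _ hv] at this
      refine Eq.trans ?_ this.symm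
      congr 1; ext x; ring
    refine ⟨?_, m, m, m, c, c, c, c, c, c⟩
    let Lc : ℝ →L[ℝ] ℝ × ℝ × ℝ :=
      { toFun := fun w => (w, w, w)
        map_add' := by intro x y; rfl
        map_smul' := by intro m x; rfl
        cont := by fun_prop }
    exact (IsGaussian.hasGaussianLaw_id (μ := gaussianReal 0 v.toNNReal)).map_fun Lc
  have hz : (deriv fun _ : ℝ => (1 : ℝ)) = fun _ => 0 := by ext; simp
  have hz' : (deriv fun _ : ℝ => (0 : ℝ)) = fun _ => 0 := by ext; simp
  have := abs_gExp_sub_sub_le (tr v₀ h0) (tr v₁ h1) hf PolyC.one_fun PolyC.one_fun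
    (fun _ => 0) (fun _ => 0) (fun s => hasDerivAt_const _ _) (|v₁ - v₀| / 2 * A1) (by
      intro s s0 s1 Ω' _ μ' X' Y' Z' hT'
      have b := H1 _ _ _ _ _ _ _ _ _ hT' (by nlinarith)
      have z : ∀ k l : ℝ → ℝ, gExp μ' X' Y' Z' k l (fun _ => 0) = 0 := by
        intros; simp [gExp]
      have z' : ∀ k l : ℝ → ℝ, gExp μ' X' Y' Z' k (fun _ => 0) l = 0 := by
        intros; simp [gExp]
      simp only [hz, hz', z, z', add_zero, mul_zero, sub_zero]
      rw [abs_mul, abs_div, abs_two]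
      gcongr)
  simp only [gExp, mul_one, sub_zero] at this
  change |gMean f v₁ - gMean f v₀| ≤ _ at this
  linarith

end GExpansion

/-! ### Integrals of negative powers of a distance on a three-dimensional space -/

open scoped ENNReal NNReal in
/-- The weight `1 / d`, with value `⊤` where the distance `d` vanishes. -/
noncomputable def iw (d : ℝ) : ℝ≥0∞ := (ENNReal.ofReal d)⁻¹

open scoped ENNReal NNReal

lemma iw_anti {a b : ℝ} (h : a ≤ b) : iw b ≤ iw a :=
  ENNReal.inv_le_inv.2 (ENNReal.ofReal_le_ofReal h)

lemma iw_ne_top {a : ℝ} (h : 0 < a) : iw a ≠ ⊤ := by simp [iw, h]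

lemma iw_rpow_of_pos {a : ℝ} (h : 0 < a) (α : ℝ) : iw a ^ α = ENNReal.ofReal (a⁻¹ ^ α) := by
  rw [iw, ← ENNReal.ofReal_inv_of_pos h, ENNReal.ofReal_rpow_of_pos (inv_pos.2 h)]

lemma iw_rpow_add (a : ℝ) {α β : ℝ} (hα : 0 ≤ α) (hβ : 0 ≤ β) :
    iw a ^ (α + β) = iw a ^ α * iw a ^ β := ENNReal.rpow_add_of_nonneg _ _ hα hβ

/-- The measure of the sublevel sets `{d ≤ r}` is at most `A r³`. -/
def BallGrowth {X : Type*} [MeasurableSpace X] (ν : Measure X) (d : X → ℝ) (A : ℝ≥0∞) : Prop :=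
  ∀ r : ℝ, 0 < r → ν {x | d x ≤ r} ≤ A * ENNReal.ofReal r ^ 3

lemma BallGrowth.mono {X : Type*} [MeasurableSpace X] {ν : Measure X} {d d' : X → ℝ} {A : ℝ≥0∞}
    (h : BallGrowth ν d A) (hd : ∀ x, d x ≤ d' x) : BallGrowth ν d' A := fun r hr =>
  (measure_mono fun _ hx => (hd _).trans hx).trans (h r hr)

section Weights

variable {X : Type*} [MeasurableSpace X] {ν : Measure X} {d : X → ℝ} {A : ℝ≥0∞}

lemma BallGrowth.ae_pos (h : BallGrowth ν d A) (hA : A ≠ ⊤) :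
    ∀ᵐ x ∂ν, 0 < d x := by
  have h0 : ν {x | d x ≤ 0} = 0 := by
    refine le_antisymm ?_ bot_le
    have lim : Tendsto (fun r : ℝ => A * ENNReal.ofReal r ^ 3) (𝓝[>] 0) (𝓝 0) := by
      have : Tendsto (fun r : ℝ => A * ENNReal.ofReal r ^ 3) (𝓝[>] 0)
          (𝓝 (A * ENNReal.ofReal 0 ^ 3)) := by
        refine ENNReal.Tendsto.const_mul ?_ (Or.inr hA)
        exact ((ENNReal.continuous_pow 3).comp ENNReal.continuous_ofReal).continuousAt.tendsto.mono_left
          nhdsWithin_le_nhds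
      simpa using this
    refine ge_of_tendsto lim ?_
    filter_upwards [self_mem_nhdsWithin] with r hr
    exact (measure_mono fun x (hx : d x ≤ 0) => hx.trans (le_of_lt hr)).trans (h r hr)
  rw [ae_iff]
  simpa using h0

/-- Both integrals below are computed from the measures of the level sets of `d⁻¹`; that `d`
vanishes only on a null set makes `⊤ = iw 0` agree with the convention `0⁻¹ = 0`. -/
lemma lintegral_layercake (h : BallGrowth ν d A) (hA : A ≠ ⊤) (hd : ∀ x, 0 ≤ d x)
    (hm : Measurable d) (s : Set X) {α : ℝ} (hα : 0 < α) :
    ∫⁻ x in s, iw (d x) ^ α ∂ν = ENNReal.ofReal α *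
      ∫⁻ t in Ioi 0, (ν.restrict s) {x | t ≤ (d x)⁻¹} * ENNReal.ofReal (t ^ (α - 1)) := by
  rw [← lintegral_rpow_eq_lintegral_meas_le_mul (ν.restrict s)
    (ae_of_all _ fun x => inv_nonneg.2 (hd x)) hm.inv.aemeasurable hα]
  refine lintegral_congr_ae (ae_restrict_of_ae ?_)
  filter_upwards [h.ae_pos hA] with x hx
  exact iw_rpow_of_pos hx α

lemma lintegral_rpow_Ioc {r α : ℝ} (hr : 0 < r) (hα : 0 < α) :
    ∫⁻ t in Ioc 0 r, ENNReal.ofReal (t ^ (α - 1)) = ENNReal.ofReal (r ^ α / α) := by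
  rw [← ofReal_integral_eq_lintegral_ofReal, ← intervalIntegral.integral_of_le hr.le,
    integral_rpow (Or.inl (by linarith))]
  · simp [Real.zero_rpow hα.ne']
  · exact (intervalIntegral.intervalIntegrable_rpow' (by linarith)).1
  · filter_upwards [ae_restrict_mem measurableSet_Ioc] with t ht
    exact Real.rpow_nonneg ht.1.le _

lemma lintegral_rpow_Ioi {r α : ℝ} (hr : 0 < r) (hα : α < 3) :
    ∫⁻ t in Ioi r, ENNReal.ofReal (t ^ (α - 4)) = ENNReal.ofReal (r ^ (α - 3) / (3 - α)) := by
  rw [← ofReal_integral_eq_lintegral_ofReal, integral_Ioi_rpow_of_lt (by linarith) hr]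
  · congr 1
    have : α - 4 + 1 = α - 3 := by ring
    rw [this, ← neg_sub, neg_div_neg_eq, neg_sub, ← neg_div_neg_eq]
  · exact integrableOn_Ioi_rpow_of_lt (by linarith) hr
  · filter_upwards [ae_restrict_mem measurableSet_Ioi] with t ht
    exact Real.rpow_nonneg (hr.le.trans (le_of_lt ht)) _

lemma BallGrowth.le_inv (h : BallGrowth ν d A) (hd : ∀ x, 0 ≤ d x) {t : ℝ} (ht : 0 < t) :
    ν {x | t ≤ (d x)⁻¹} ≤ A * ENNReal.ofReal t⁻¹ ^ 3 := by
  refine (measure_mono fun x (hx : t ≤ (d x)⁻¹) => ?_).trans (h t⁻¹ (inv_pos.2 ht))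
  rcases (hd x).eq_or_lt with h0 | h0
  · rw [← h0, inv_zero] at hx; linarith
  · exact (le_inv_comm₀ ht h0).1 hx

/-- Integral of `d ^ (-α)` over `{d ≤ r}` for `α < 3`. -/
lemma BallGrowth.lintegral_ball (h : BallGrowth ν d A) (hA : A ≠ ⊤) (hd : ∀ x, 0 ≤ d x)
    (hm : Measurable d) {α : ℝ} (hα : 0 < α) (hα3 : α < 3) {r : ℝ} (hr : 0 < r) :
    ∫⁻ x in {x | d x ≤ r}, iw (d x) ^ α ∂ν
      ≤ A * ENNReal.ofReal (3 / (3 - α)) * ENNReal.ofReal (r ^ (3 - α)) := by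
  rw [lintegral_layercake h hA hd hm _ hα]
  have hr' : 0 < r⁻¹ := inv_pos.2 hr
  rw [← Ioc_union_Ioi_eq_Ioi hr'.le, lintegral_union measurableSet_Ioi (Ioc_disjoint_Ioi le_rfl)]
  have h1 : ∫⁻ t in Ioc 0 r⁻¹, (ν.restrict {x | d x ≤ r}) {x | t ≤ (d x)⁻¹}
      * ENNReal.ofReal (t ^ (α - 1)) ≤ A * ENNReal.ofReal r ^ 3 * ENNReal.ofReal (r⁻¹ ^ α / α) := by
    rw [← lintegral_rpow_Ioc hr' hα, ← lintegral_const_mul' _ _ (by finiteness)]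
    refine lintegral_mono fun t => ?_
    gcongr
    refine (measure_mono (subset_univ _)).trans ?_
    rw [Measure.restrict_apply_univ]
    exact h r hr
  have h2 : ∫⁻ t in Ioi r⁻¹, (ν.restrict {x | d x ≤ r}) {x | t ≤ (d x)⁻¹}
      * ENNReal.ofReal (t ^ (α - 1)) ≤ A * ENNReal.ofReal (r⁻¹ ^ (α - 3) / (3 - α)) := by
    rw [← lintegral_rpow_Ioi hr' hα3, ← lintegral_const_mul' _ _ hA]
    refine setLIntegral_mono' measurableSet_Ioi fun t ht => ?_
    have ht0 : 0 < t := hr'.trans ht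
    have e : ENNReal.ofReal (t ^ (α - 4)) = ENNReal.ofReal t⁻¹ ^ 3 * ENNReal.ofReal (t ^ (α - 1)) := by
      rw [← ENNReal.ofReal_pow (by positivity), ← ENNReal.ofReal_mul (by positivity)]
      congr 1
      rw [inv_pow, ← Real.rpow_natCast, ← Real.rpow_neg ht0.le, ← Real.rpow_add ht0]
      congr 1; push_cast; ring
    rw [e, ← mul_assoc]
    gcongr
    exact (Measure.restrict_apply_le _ _).trans (h.le_inv hd ht0)
  refine (mul_le_mul_right (add_le_add h1 h2) _).trans (le_of_eq ?_)
  rw [mul_assoc A, ← mul_add, mul_left_comm, mul_assoc A]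
  congr 1
  have h3 : 0 < 3 - α := by linarith
  rw [← ENNReal.ofReal_pow hr.le, ← ENNReal.ofReal_mul (by positivity),
    ← ENNReal.ofReal_add (by positivity) (by positivity), ← ENNReal.ofReal_mul hα.le,
    ← ENNReal.ofReal_mul (by positivity)]
  congr 1
  have e1 : r⁻¹ ^ (α - 3) = r ^ (3 - α) := by
    rw [Real.inv_rpow hr.le, ← Real.rpow_neg hr.le, neg_sub]
  have e2 : r ^ 3 * r⁻¹ ^ α = r ^ (3 - α) := by
    rw [Real.inv_rpow hr.le, ← Real.rpow_neg hr.le, ← Real.rpow_natCast, ← Real.rpow_add hr]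
    congr 1
  rw [e1, ← mul_div_assoc, e2]
  field_simp
  ring

/-- Integral of `d ^ (-α)` over `{r < d}` for `α > 3`. -/
lemma BallGrowth.lintegral_compl_ball (h : BallGrowth ν d A) (hA : A ≠ ⊤) (hd : ∀ x, 0 ≤ d x)
    (hm : Measurable d) {α : ℝ} (hα3 : 3 < α) {r : ℝ} (hr : 0 < r) :
    ∫⁻ x in {x | r < d x}, iw (d x) ^ α ∂ν
      ≤ A * ENNReal.ofReal (α / (α - 3)) * ENNReal.ofReal (r ^ (3 - α)) := by
  have hα : 0 < α := by linarith
  rw [lintegral_layercake h hA hd hm _ hα]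
  have hr' : 0 < r⁻¹ := inv_pos.2 hr
  rw [← Ioc_union_Ioi_eq_Ioi hr'.le, lintegral_union measurableSet_Ioi (Ioc_disjoint_Ioi le_rfl)]
  have h1 : ∫⁻ t in Ioc 0 r⁻¹, (ν.restrict {x | r < d x}) {x | t ≤ (d x)⁻¹}
      * ENNReal.ofReal (t ^ (α - 1)) ≤ A * ENNReal.ofReal (r⁻¹ ^ (α - 3) / (α - 3)) := by
    rw [← lintegral_rpow_Ioc hr' (by linarith : 0 < α - 3), ← lintegral_const_mul' _ _ hA]
    refine setLIntegral_mono' measurableSet_Ioc fun t ht => ?_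
    have ht0 : 0 < t := ht.1
    have e : ENNReal.ofReal (t ^ (α - 3 - 1))
        = ENNReal.ofReal t⁻¹ ^ 3 * ENNReal.ofReal (t ^ (α - 1)) := by
      rw [← ENNReal.ofReal_pow (by positivity), ← ENNReal.ofReal_mul (by positivity)]
      congr 1
      rw [inv_pow, ← Real.rpow_natCast, ← Real.rpow_neg ht0.le, ← Real.rpow_add ht0]
      congr 1; push_cast; ring
    rw [e, ← mul_assoc]
    gcongr
    exact (Measure.restrict_apply_le _ _).trans (h.le_inv hd ht0)
  have h2 : ∫⁻ t in Ioi r⁻¹, (ν.restrict {x | r < d x}) {x | t ≤ (d x)⁻¹}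
      * ENNReal.ofReal (t ^ (α - 1)) = 0 := by
    rw [← lintegral_zero (α := ℝ) (μ := volume.restrict (Ioi r⁻¹))]
    refine setLIntegral_congr_fun measurableSet_Ioi fun t ht => ?_
    have : {x | t ≤ (d x)⁻¹} ∩ {x | r < d x} = ∅ := by
      ext x
      simp only [mem_inter_iff, mem_ofPred_eq, mem_empty_iff_false, iff_false, not_and, not_lt]
      intro hx
      by_contra! hlt
      have : (d x)⁻¹ < r⁻¹ := (inv_lt_inv₀ (hr.trans hlt) hr).2 hlt
      exact absurd (hx.trans_lt this) (not_lt.2 (le_of_lt ht))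
    have ms : MeasurableSet {x | t ≤ (d x)⁻¹} := measurableSet_le measurable_const hm.inv
    rw [Measure.restrict_apply ms, this]
    simp
  rw [h2, add_zero]
  refine (mul_le_mul_right h1 _).trans (le_of_eq ?_)
  rw [mul_left_comm, mul_assoc A]
  congr 1
  have h3 : 0 < α - 3 := by linarith
  rw [← ENNReal.ofReal_mul hα.le, ← ENNReal.ofReal_mul (by positivity)]
  congr 1
  have e1 : r⁻¹ ^ (α - 3) = r ^ (3 - α) := by
    rw [Real.inv_rpow hr.le, ← Real.rpow_neg hr.le, neg_sub]
  rw [e1]; ring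

end Weights

section Riesz

variable {X : Type*} [MeasurableSpace X]

lemma lintegral_split (ν : Measure X) (f : X → ℝ≥0∞) (d : X → ℝ) (hm : Measurable d) (r : ℝ) :
    ∫⁻ x, f x ∂ν = ∫⁻ x in {x | d x ≤ r}, f x ∂ν + ∫⁻ x in {x | r < d x}, f x ∂ν := by
  have h := lintegral_add_compl (μ := ν) f (measurableSet_le hm (measurable_const (a := r)))
  have e : {x | d x ≤ r}ᶜ = {x | r < d x} := by ext; simp
  rw [← h, e]

lemma iw_mul_le_add (a b : ℝ) {α β : ℝ} (hα : 0 ≤ α) (hβ : 0 ≤ β) :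
    iw a ^ α * iw b ^ β ≤ iw a ^ (α + β) + iw b ^ (α + β) := by
  rcases le_total (iw a) (iw b) with h | h
  · refine le_trans ?_ le_add_self
    rw [iw_rpow_add b hα hβ]; gcongr
  · refine le_trans ?_ le_self_add
    rw [iw_rpow_add a hα hβ]; gcongr

lemma iw_rpow_eq_ofReal {a : ℝ} (h : 0 < a) (α : ℝ) : iw a ^ α = ENNReal.ofReal (a ^ (-α)) := by
  rw [iw_rpow_of_pos h, Real.inv_rpow h.le, Real.rpow_neg h.le]

lemma iw_half_rpow {a : ℝ} (h : 0 < a) (γ : ℝ) :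
    ENNReal.ofReal ((a / 2) ^ (-γ)) = ENNReal.ofReal (2 ^ γ) * iw a ^ γ := by
  rw [iw_rpow_eq_ofReal h, ← ENNReal.ofReal_mul (by positivity)]
  congr 1
  rw [Real.rpow_neg (by positivity), Real.div_rpow h.le (by norm_num), Real.rpow_neg h.le]
  field_simp

/-- The composition of two Riesz potentials of orders `3 - α` and `3 - β` on a space of dimension
three, when `α, β < 3 < α + β`. -/
lemma exists_riesz {α β : ℝ} (hα : 0 < α) (hα3 : α < 3) (hβ : 0 < β) (hβ3 : β < 3)
    (hαβ : 3 < α + β) {A : ℝ≥0∞} (hA : A ≠ ⊤) :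
    ∃ C : ℝ≥0∞, C ≠ ⊤ ∧ ∀ (ν : Measure X) (d₁ d₂ : X → ℝ) (D : ℝ), BallGrowth ν d₁ A →
      BallGrowth ν d₂ A → Measurable d₁ → Measurable d₂ → (∀ x, 0 ≤ d₁ x) → (∀ x, 0 ≤ d₂ x) →
      (∀ x, D ≤ d₁ x + d₂ x) → 0 ≤ D →
      ∫⁻ x, iw (d₁ x) ^ α * iw (d₂ x) ^ β ∂ν ≤ C * iw D ^ (α + β - 3) := by
  set c : ℝ → ℝ≥0∞ := fun γ => A * ENNReal.ofReal (3 / (3 - γ)) with hc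
  set c' : ℝ≥0∞ := A * ENNReal.ofReal ((α + β) / (α + β - 3)) with hc'
  refine ⟨(c α + c β + c' + c') * ENNReal.ofReal (2 ^ (α + β - 3)) + 1, ?_, ?_⟩
  · simp only [hc, hc']; finiteness
  intro ν d₁ d₂ D h₁ h₂ m₁ m₂ p₁ p₂ hD D0
  have hγ : 0 < α + β - 3 := by linarith
  rcases D0.eq_or_lt with rfl | D0
  · have : iw 0 ^ (α + β - 3) = ⊤ := by simp [iw, hγ]
    rw [this, ENNReal.mul_top]
    · exact le_top
    · simp
  have hD2 : 0 < D / 2 := by linarith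
  refine le_trans ?_ (mul_le_mul_left (le_self_add) _)
  rw [mul_assoc, ← iw_half_rpow D0]
  -- Where one of the points is within `D / 2`, the other is at distance at least `D / 2`; where
  -- both are far away, the product is at most the sum of the powers `α + β`.
  have key : ∀ {α β : ℝ} (d₁ d₂ : X → ℝ), BallGrowth ν d₁ A → Measurable d₁ → (∀ x, 0 ≤ d₁ x) →
      (∀ x, D ≤ d₁ x + d₂ x) → 0 < α → α < 3 → 0 < β →
      ∫⁻ x in {x | d₁ x ≤ D / 2}, iw (d₁ x) ^ α * iw (d₂ x) ^ β ∂ν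
        ≤ c α * ENNReal.ofReal ((D / 2) ^ (-(α + β - 3))) := by
    intro α β d₁ d₂ h₁ m₁ p₁ hD hα hα3 hβ
    calc _ ≤ ∫⁻ x in {x | d₁ x ≤ D / 2}, iw (d₁ x) ^ α * iw (D / 2) ^ β ∂ν := by
          refine setLIntegral_mono' (measurableSet_le m₁ measurable_const) fun x hx => ?_
          gcongr
          exact iw_anti (by linarith [hD x, show d₁ x ≤ D / 2 from hx])
      _ = (∫⁻ x in {x | d₁ x ≤ D / 2}, iw (d₁ x) ^ α ∂ν) * iw (D / 2) ^ β := by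
          rw [lintegral_mul_const' _ _ (ENNReal.rpow_ne_top_of_nonneg hβ.le (iw_ne_top hD2))]
      _ ≤ (c α * ENNReal.ofReal ((D / 2) ^ (3 - α))) * iw (D / 2) ^ β := by
          gcongr
          exact h₁.lintegral_ball hA p₁ m₁ hα hα3 hD2
      _ = _ := by
          rw [iw_rpow_eq_ofReal hD2, mul_assoc, ← ENNReal.ofReal_mul (by positivity),
            ← Real.rpow_add hD2]
          ring_nf
  have far : ∀ (d : X → ℝ), BallGrowth ν d A → Measurable d → (∀ x, 0 ≤ d x) →
      ∫⁻ x in {x | D / 2 < d x}, iw (d x) ^ (α + β) ∂ν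
        ≤ c' * ENNReal.ofReal ((D / 2) ^ (-(α + β - 3))) := fun d h m p =>
    (h.lintegral_compl_ball hA p m hαβ hD2).trans (le_of_eq (by rw [neg_sub]))
  rw [lintegral_split ν _ d₁ m₁ (D / 2), lintegral_split (ν.restrict {x | D / 2 < d₁ x}) _ d₂ m₂ (D / 2)]
  have s1 := key d₁ d₂ h₁ m₁ p₁ hD hα hα3 hβ
  have s2 := key d₂ d₁ h₂ m₂ p₂ (fun x => (hD x).trans (add_comm _ _).le) hβ hβ3 hα
  have s3 : ∫⁻ x in {x | D / 2 < d₂ x}, iw (d₁ x) ^ α * iw (d₂ x) ^ β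
      ∂(ν.restrict {x | D / 2 < d₁ x})
      ≤ (c' + c') * ENNReal.ofReal ((D / 2) ^ (-(α + β - 3))) := by
    calc _ ≤ ∫⁻ x in {x | D / 2 < d₂ x}, iw (d₁ x) ^ (α + β) + iw (d₂ x) ^ (α + β)
          ∂(ν.restrict {x | D / 2 < d₁ x}) := lintegral_mono fun x => iw_mul_le_add _ _ hα.le hβ.le
      _ = ∫⁻ x in {x | D / 2 < d₂ x}, iw (d₁ x) ^ (α + β) ∂(ν.restrict {x | D / 2 < d₁ x})
          + ∫⁻ x in {x | D / 2 < d₂ x}, iw (d₂ x) ^ (α + β) ∂(ν.restrict {x | D / 2 < d₁ x}) := by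
          refine lintegral_add_left ?_ _
          unfold iw
          fun_prop
      _ ≤ _ := by
          rw [add_mul]
          refine add_le_add ((setLIntegral_le_lintegral _ _).trans (far d₁ h₁ m₁ p₁)) ?_
          exact (lintegral_mono' (Measure.restrict_mono le_rfl Measure.restrict_le_self)
            le_rfl).trans (far d₂ h₂ m₂ p₂)
  have s2' : ∫⁻ x in {x | d₂ x ≤ D / 2}, iw (d₁ x) ^ α * iw (d₂ x) ^ β
      ∂(ν.restrict {x | D / 2 < d₁ x})
      ≤ c β * ENNReal.ofReal ((D / 2) ^ (-(α + β - 3))) := by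
    refine (lintegral_mono' (Measure.restrict_mono le_rfl Measure.restrict_le_self)
      (le_of_eq (by ext x; rw [mul_comm]))).trans (s2.trans (le_of_eq (by rw [add_comm β α])))
  calc _ ≤ _ := add_le_add s1 (add_le_add s2' s3)
    _ = _ := by ring

/-- Integral of `d ^ (-α)` over a finite measure space whose small balls are controlled. -/
lemma BallGrowth.lintegral_le {ν : Measure X} {d : X → ℝ} {A : ℝ≥0∞} (h : BallGrowth ν d A)
    (hA : A ≠ ⊤) (hd : ∀ x, 0 ≤ d x) (hm : Measurable d) {α : ℝ} (hα : 0 < α) (hα3 : α < 3)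
    {r : ℝ} (hr : 0 < r) :
    ∫⁻ x, iw (d x) ^ α ∂ν ≤
      A * ENNReal.ofReal (3 / (3 - α)) * ENNReal.ofReal (r ^ (3 - α)) + iw r ^ α * ν univ := by
  rw [lintegral_split ν _ d hm r]
  refine add_le_add (h.lintegral_ball hA hd hm hα hα3 hr) ?_
  calc _ ≤ ∫⁻ x in {x | r < d x}, iw r ^ α ∂ν := by
        refine setLIntegral_mono' (measurableSet_lt measurable_const hm) fun x hx => ?_
        gcongr
        exact iw_anti (le_of_lt hx)
    _ ≤ _ := by
        rw [lintegral_const, Measure.restrict_apply_univ]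
        gcongr
        exact subset_univ _

/-- Integral of `d ^ (-α) (d + ε) ^ (-β)` when `α < 3 < α + β`. -/
lemma BallGrowth.lintegral_reg_le {ν : Measure X} {d : X → ℝ} {A : ℝ≥0∞} (h : BallGrowth ν d A)
    (hA : A ≠ ⊤) (hd : ∀ x, 0 ≤ d x) (hm : Measurable d) {α β : ℝ} (hα : 0 < α) (hα3 : α < 3)
    (hβ : 0 < β) (hαβ : 3 < α + β) {ε : ℝ} (hε : 0 < ε) :
    ∫⁻ x, iw (d x) ^ α * iw (d x + ε) ^ β ∂ν ≤
      A * (ENNReal.ofReal (3 / (3 - α)) + ENNReal.ofReal ((α + β) / (α + β - 3)))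
        * iw ε ^ (α + β - 3) := by
  rw [lintegral_split ν _ d hm ε, mul_add, add_mul]
  refine add_le_add ?_ ?_
  · calc _ ≤ ∫⁻ x in {x | d x ≤ ε}, iw (d x) ^ α * iw ε ^ β ∂ν := by
          refine lintegral_mono fun x => ?_
          gcongr
          exact iw_anti (by linarith [hd x])
      _ = (∫⁻ x in {x | d x ≤ ε}, iw (d x) ^ α ∂ν) * iw ε ^ β := by
          rw [lintegral_mul_const' _ _ (ENNReal.rpow_ne_top_of_nonneg hβ.le (iw_ne_top hε))]
      _ ≤ _ := mul_le_mul_left (h.lintegral_ball hA hd hm hα hα3 hε) _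
      _ = _ := by
          rw [iw_rpow_eq_ofReal hε, iw_rpow_eq_ofReal hε, mul_assoc,
            ← ENNReal.ofReal_mul (by positivity), ← Real.rpow_add hε]
          ring_nf
  · calc _ ≤ ∫⁻ x in {x | ε < d x}, iw (d x) ^ (α + β) ∂ν := by
          refine lintegral_mono fun x => ?_
          rw [iw_rpow_add _ hα.le hβ.le]
          gcongr
          exact iw_anti (by linarith [hd x])
      _ ≤ _ := h.lintegral_compl_ball hA hd hm hαβ hε
      _ = _ := by rw [iw_rpow_eq_ofReal hε, neg_sub]

end Riesz

/-! ### The parabolic distance -/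

/-- The parabolic size `√|t| + |x|` of a point of the plane. -/
noncomputable def pn (z : ℝ × ℝ) : ℝ := Real.sqrt |z.1| + |z.2|

/-- The parabolic size of a point of `ℝ × (ℝ / ℤ)`, truncated at large times. -/
noncomputable def pd (z : ℝ × ℝ) : ℝ := min (Real.sqrt |z.1|) 1 + ‖(z.2 : UnitAddCircle)‖

/-- The parabolic dilation by `ε`. -/
def dil (ε : ℝ) (z : ℝ × ℝ) : ℝ × ℝ := (ε ^ 2 * z.1, ε * z.2)

/-- The reflection in space. -/
def xrefl (z : ℝ × ℝ) : ℝ × ℝ := (z.1, -z.2)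

/-- The square `[-R, R]²`. -/
def box (R : ℝ) : Set (ℝ × ℝ) := Icc (-R) R ×ˢ Icc (-R) R

lemma pn_nonneg (z : ℝ × ℝ) : 0 ≤ pn z := by unfold pn; positivity

lemma pd_nonneg (z : ℝ × ℝ) : 0 ≤ pd z := by unfold pd; positivity

lemma continuous_pn : Continuous pn := by unfold pn; fun_prop

lemma continuous_pd : Continuous pd := by
  unfold pd
  have : Continuous fun z : ℝ × ℝ => (z.2 : UnitAddCircle) :=
    (AddCircle.continuous_mk' 1).comp continuous_snd
  fun_prop

lemma circle_norm_le (x : ℝ) : ‖(x : UnitAddCircle)‖ ≤ |x| := by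
  rw [UnitAddCircle.norm_eq]
  simpa using round_le x 0

lemma circle_norm_eq {x : ℝ} (h : |x| ≤ 1 / 2) : ‖(x : UnitAddCircle)‖ = |x| := by
  have := AddCircle.norm_coe_eq_abs_iff (x := x) (1 : ℝ) one_ne_zero
  exact this.2 (by simpa using h)

lemma circle_norm_le_half (x : ℝ) : ‖(x : UnitAddCircle)‖ ≤ 1 / 2 := by
  rw [UnitAddCircle.norm_eq]; exact abs_sub_round x

lemma pd_le_pn (z : ℝ × ℝ) : pd z ≤ pn z :=
  add_le_add (min_le_left _ _) (circle_norm_le _)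

lemma pd_le (z : ℝ × ℝ) : pd z ≤ 3 / 2 := by
  have := circle_norm_le_half z.2
  have := min_le_right (Real.sqrt |z.1|) 1
  unfold pd; linarith

lemma sqrt_abs_add_le (a b : ℝ) : Real.sqrt |a + b| ≤ Real.sqrt |a| + Real.sqrt |b| := by
  have h1 := Real.sq_sqrt (abs_nonneg a)
  have h2 := Real.sq_sqrt (abs_nonneg b)
  have h3 := mul_nonneg (Real.sqrt_nonneg |a|) (Real.sqrt_nonneg |b|)
  have h4 := abs_add_le a b
  exact Real.sqrt_le_iff.2 ⟨by positivity, by nlinarith⟩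

lemma pn_add_le (z w : ℝ × ℝ) : pn (z + w) ≤ pn z + pn w := by
  have h1 := sqrt_abs_add_le z.1 w.1
  have h2 := abs_add_le z.2 w.2
  simp only [pn, Prod.fst_add, Prod.snd_add]; linarith

lemma pd_add_le (z w : ℝ × ℝ) : pd (z + w) ≤ pd z + pd w := by
  have h1 := sqrt_abs_add_le z.1 w.1
  have h2 : ‖((z.2 + w.2 : ℝ) : UnitAddCircle)‖ ≤ _ := norm_add_le (z.2 : UnitAddCircle) w.2
  have h3 : min (Real.sqrt |z.1 + w.1|) 1 ≤ min (Real.sqrt |z.1|) 1 + min (Real.sqrt |w.1|) 1 := by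
    have := Real.sqrt_nonneg |z.1|
    have := Real.sqrt_nonneg |w.1|
    rcases min_cases (Real.sqrt |z.1|) 1 with h | h <;>
    rcases min_cases (Real.sqrt |w.1|) 1 with h' | h' <;>
    rcases min_cases (Real.sqrt |z.1 + w.1|) 1 with h'' | h'' <;> linarith
  simp only [pd, Prod.fst_add, Prod.snd_add]; linarith

lemma pn_neg (z : ℝ × ℝ) : pn (-z) = pn z := by simp [pn]

lemma pd_neg (z : ℝ × ℝ) : pd (-z) = pd z := by simp [pd]

lemma pd_refl (z : ℝ × ℝ) : pd (xrefl z) = pd z := by simp [pd, xrefl]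

lemma pd_sub_comm (z w : ℝ × ℝ) : pd (z - w) = pd (w - z) := by rw [← pd_neg, neg_sub]

lemma pd_add_int (t x : ℝ) (n : ℤ) : pd (t, x + n) = pd (t, x) := by simp [pd]

lemma pn_dil {ε : ℝ} (hε : 0 ≤ ε) (z : ℝ × ℝ) : pn (dil ε z) = ε * pn z := by
  simp only [pn, dil, abs_mul, abs_of_nonneg hε, abs_of_nonneg (pow_nonneg hε 2)]
  rw [Real.sqrt_mul (by positivity), Real.sqrt_sq hε]; ring

lemma pn_eq_pd {z : ℝ × ℝ} (h1 : |z.1| ≤ 1) (h2 : |z.2| ≤ 1 / 2) : pd z = pn z := by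
  have : Real.sqrt |z.1| ≤ 1 := Real.sqrt_le_one.2 h1
  rw [pd, pn, min_eq_left this, circle_norm_eq h2]

lemma measurableSet_box (R : ℝ) : MeasurableSet (box R) := measurableSet_Icc.prod measurableSet_Icc

lemma volume_box (R : ℝ) : volume (box R) = ENNReal.ofReal (2 * R) * ENNReal.ofReal (2 * R) := by
  rw [box, Measure.volume_eq_prod, Measure.prod_prod, Real.volume_Icc, sub_neg_eq_add, ← two_mul]

/-- The balls of the parabolic distance on `ℝ × (ℝ / ℤ)`, seen through a dilation: inside `box R` the
preimage of a ball of radius `r` is covered by a bounded number of translates of a parabolic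
rectangle of sides `(r / ε)²` and `r / ε`. -/
lemma ballGrowth_pd {R : ℝ} (hR : 0 ≤ R) {ε : ℝ} (hε : 0 < ε) (hε1 : ε ≤ 1) (v : ℝ × ℝ) :
    BallGrowth (volume.restrict (box R)) (fun w => pd (v - dil ε w))
      (ENNReal.ofReal (4 * (2 * R + 2) + 4 * R ^ 2) * iw ε ^ (3 : ℝ)) := by
  intro r hr
  have e3 : ENNReal.ofReal (4 * (2 * R + 2) + 4 * R ^ 2) * iw ε ^ (3 : ℝ) * ENNReal.ofReal r ^ 3
      = ENNReal.ofReal ((4 * (2 * R + 2) + 4 * R ^ 2) * (r / ε) ^ 3) := by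
    rw [iw_rpow_of_pos hε, ← ENNReal.ofReal_pow hr.le, ← ENNReal.ofReal_mul (by positivity),
      ← ENNReal.ofReal_mul (by positivity)]
    congr 1
    norm_cast
    rw [div_pow, inv_pow]; ring
  rw [e3]
  rcases lt_or_ge r 1 with h1 | h1
  · set N := Finset.Icc ⌈v.2 - R - 1 / 2⌉ ⌊v.2 + R + 1 / 2⌋ with hN
    have hsub : {w | pd (v - dil ε w) ≤ r} ∩ box R ⊆
        Icc ((v.1 - r ^ 2) / ε ^ 2) ((v.1 + r ^ 2) / ε ^ 2) ×ˢ
          ⋃ n ∈ N, Icc ((v.2 - n - r) / ε) ((v.2 - n + r) / ε) := by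
      rintro w ⟨hw, hw1, hw2⟩
      have hw : min (Real.sqrt |v.1 - ε ^ 2 * w.1|) 1 + ‖((v.2 - ε * w.2 : ℝ) : UnitAddCircle)‖ ≤ r :=
        hw
      have a1 : Real.sqrt |v.1 - ε ^ 2 * w.1| ≤ r := by
        have := norm_nonneg ((v.2 - ε * w.2 : ℝ) : UnitAddCircle)
        rcases min_cases (Real.sqrt |v.1 - ε ^ 2 * w.1|) 1 with h | h <;> linarith
      have a2 : ‖((v.2 - ε * w.2 : ℝ) : UnitAddCircle)‖ ≤ r := by
        have : 0 ≤ min (Real.sqrt |v.1 - ε ^ 2 * w.1|) 1 := by positivity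
        linarith
      rw [Real.sqrt_le_left hr.le, abs_le] at a1
      rw [UnitAddCircle.norm_eq, abs_le] at a2
      have a3 := abs_le.1 (abs_sub_round (v.2 - ε * w.2))
      have b1 : |ε * w.2| ≤ R := by
        rw [abs_mul, abs_of_pos hε]
        calc ε * |w.2| ≤ 1 * R := by
              gcongr
              exact abs_le.2 hw2
          _ = R := one_mul R
      rw [abs_le] at b1
      have hε2 : 0 < ε ^ 2 := by positivity
      refine ⟨⟨by rw [div_le_iff₀ hε2]; linarith, by rw [le_div_iff₀ hε2]; linarith⟩, ?_⟩
      refine mem_iUnion₂.2 ⟨round (v.2 - ε * w.2), ?_, ?_⟩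
      · rw [hN, Finset.mem_Icc, Int.ceil_le, Int.le_floor]
        constructor <;> linarith
      · exact ⟨by rw [div_le_iff₀ hε]; linarith, by rw [le_div_iff₀ hε]; linarith⟩
    have hcard : (N.card : ℝ) ≤ 2 * R + 2 := by
      rw [hN, Int.card_Icc]
      have f1 := Int.floor_le (v.2 + R + 1 / 2)
      have f2 := Int.le_ceil (v.2 - R - 1 / 2)
      rcases le_total 0 (⌊v.2 + R + 1 / 2⌋ + 1 - ⌈v.2 - R - 1 / 2⌉) with h | h
      · have : ((⌊v.2 + R + 1 / 2⌋ + 1 - ⌈v.2 - R - 1 / 2⌉).toNat : ℝ)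
            = ((⌊v.2 + R + 1 / 2⌋ + 1 - ⌈v.2 - R - 1 / 2⌉ : ℤ) : ℝ) := by
          rw [← Int.cast_natCast, Int.toNat_of_nonneg h]
        rw [this]; push_cast; linarith
      · rw [Int.toNat_of_nonpos h]; push_cast; linarith
    have hmeas : MeasurableSet {w | pd (v - dil ε w) ≤ r} := by
      refine measurableSet_le ?_ measurable_const
      unfold dil
      exact (continuous_pd.comp (by fun_prop)).measurable
    rw [Measure.restrict_apply hmeas]
    refine (measure_mono hsub).trans ?_
    rw [Measure.volume_eq_prod, Measure.prod_prod, Real.volume_Icc]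
    calc _ ≤ ENNReal.ofReal ((v.1 + r ^ 2) / ε ^ 2 - (v.1 - r ^ 2) / ε ^ 2)
          * ∑ n ∈ N, volume (Icc ((v.2 - n - r) / ε) ((v.2 - n + r) / ε)) := by
          gcongr
          exact measure_biUnion_finset_le _ _
      _ = ENNReal.ofReal (2 * r ^ 2 / ε ^ 2) * ∑ n ∈ N, ENNReal.ofReal (2 * r / ε) := by
          congr 1
          · congr 1; ring
          · refine Finset.sum_congr rfl fun n _ => ?_
            rw [Real.volume_Icc]; congr 1; ring
      _ = ENNReal.ofReal (2 * r ^ 2 / ε ^ 2 * (N.card * (2 * r / ε))) := by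
          rw [Finset.sum_const, nsmul_eq_mul, ← ENNReal.ofReal_natCast,
            ← ENNReal.ofReal_mul (by positivity), ← ENNReal.ofReal_mul (by positivity)]
      _ ≤ _ := by
          apply ENNReal.ofReal_le_ofReal
          have : 2 * r ^ 2 / ε ^ 2 * (N.card * (2 * r / ε)) = 4 * N.card * (r / ε) ^ 3 := by
            field_simp; ring
          rw [this]
          gcongr
          nlinarith
  · refine (measure_mono (subset_univ _)).trans ?_
    rw [Measure.restrict_apply_univ, volume_box, ← ENNReal.ofReal_mul (by positivity)]
    apply ENNReal.ofReal_le_ofReal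
    have : 1 ≤ (r / ε) ^ 3 := one_le_pow₀ ((one_le_div hε).2 (hε1.trans h1))
    have h0 : 0 ≤ 4 * (2 * R + 2) + 4 * R ^ 2 := by positivity
    nlinarith

lemma dil_one (z : ℝ × ℝ) : dil 1 z = z := by simp [dil]

/-- The constant in the growth of the balls of the parabolic distance inside `box R`. -/
noncomputable def boxConst (R : ℝ) : ℝ≥0∞ := ENNReal.ofReal (4 * (2 * R + 2) + 4 * R ^ 2)

lemma boxConst_ne_top (R : ℝ) : boxConst R ≠ ⊤ := ENNReal.ofReal_ne_top

lemma ballGrowth_sub {R : ℝ} (hR : 0 ≤ R) (v : ℝ × ℝ) :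
    BallGrowth (volume.restrict (box R)) (fun w => pd (v - w)) (boxConst R) := by
  have h := ballGrowth_pd hR one_pos le_rfl v
  simpa [dil_one, iw, boxConst] using h

lemma ballGrowth_add {R : ℝ} (hR : 0 ≤ R) (v : ℝ × ℝ) :
    BallGrowth (volume.restrict (box R)) (fun w => pd (w + v)) (boxConst R) :=
  (ballGrowth_sub hR (-v)).mono fun w => by rw [← pd_neg]; simp [add_comm]

lemma ballGrowth_id {R : ℝ} (hR : 0 ≤ R) :
    BallGrowth (volume.restrict (box R)) pd (boxConst R) := by
  simpa using ballGrowth_add hR 0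

/-! ### The heat kernel on the line -/

/-- The first space derivative of the heat kernel on the line. -/
noncomputable def lineD (z : ℝ × ℝ) : ℝ := -(z.2 / (2 * z.1)) * heatKernelLine z

/-- The second space derivative of the heat kernel on the line. -/
noncomputable def lineDD (z : ℝ × ℝ) : ℝ :=
  (z.2 ^ 2 / (4 * z.1 ^ 2) - 1 / (2 * z.1)) * heatKernelLine z

/-- The third space derivative of the heat kernel on the line. -/
noncomputable def lineDDD (z : ℝ × ℝ) : ℝ :=
  (3 * z.2 / (4 * z.1 ^ 2) - z.2 ^ 3 / (8 * z.1 ^ 3)) * heatKernelLine z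

lemma heatKernelLine_of_pos {t : ℝ} (ht : 0 < t) (x : ℝ) :
    heatKernelLine (t, x) = (Real.sqrt (4 * Real.pi * t))⁻¹ * Real.exp (-x ^ 2 / (4 * t)) := by
  simp [heatKernelLine, ht]

lemma heatKernelLine_of_nonpos {z : ℝ × ℝ} (hz : z.1 ≤ 0) : heatKernelLine z = 0 := by
  simp [heatKernelLine, not_lt.2 hz]

lemma heatKernelLine_nonneg (z : ℝ × ℝ) : 0 ≤ heatKernelLine z := by
  unfold heatKernelLine; split_ifs <;> positivity

lemma heatKernelLine_neg (t x : ℝ) : heatKernelLine (t, -x) = heatKernelLine (t, x) := by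
  simp [heatKernelLine]

lemma lineD_of_nonpos {z : ℝ × ℝ} (hz : z.1 ≤ 0) : lineD z = 0 := by
  simp [lineD, heatKernelLine_of_nonpos hz]

lemma lineD_neg (t x : ℝ) : lineD (t, -x) = -lineD (t, x) := by
  simp [lineD, heatKernelLine_neg, neg_div]

lemma measurable_heatKernelLine : Measurable heatKernelLine := by
  unfold heatKernelLine
  refine Measurable.ite (measurableSet_lt measurable_const measurable_fst) ?_ measurable_const
  fun_prop

lemma measurable_lineD : Measurable lineD := by
  have := measurable_heatKernelLine
  unfold lineD; fun_prop

lemma hasDerivAt_heatKernelLine (t x : ℝ) :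
    HasDerivAt (fun x => heatKernelLine (t, x)) (lineD (t, x)) x := by
  rcases le_or_gt t 0 with ht | ht
  · have : (fun x => heatKernelLine (t, x)) = fun _ => 0 := by
      ext x; exact heatKernelLine_of_nonpos ht
    rw [this, lineD_of_nonpos ht]
    exact hasDerivAt_const _ _
  · have : (fun x => heatKernelLine (t, x))
        = fun x => (Real.sqrt (4 * Real.pi * t))⁻¹ * Real.exp (-x ^ 2 / (4 * t)) := by
      ext x; exact heatKernelLine_of_pos ht x
    rw [this, lineD, heatKernelLine_of_pos ht]
    have h := ((((hasDerivAt_id x).pow 2).neg.div_const (4 * t)).exp).const_mul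
      (Real.sqrt (4 * Real.pi * t))⁻¹
    refine h.congr_deriv ?_
    change (Real.sqrt (4 * Real.pi * t))⁻¹ * (Real.exp (-x ^ 2 / (4 * t))
      * (-(2 * x ^ 1 * 1) / (4 * t))) = _
    field_simp
    ring

lemma hasDerivAt_lineD {t : ℝ} (ht : 0 < t) (x : ℝ) :
    HasDerivAt (fun x => lineD (t, x)) (lineDD (t, x)) x := by
  have h := (((hasDerivAt_id x).div_const (2 * t)).neg).mul (hasDerivAt_heatKernelLine t x)
  refine h.congr_deriv ?_
  change -(1 / (2 * t)) * heatKernelLine (t, x) + -(x / (2 * t)) * lineD (t, x) = _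
  simp only [lineD, lineDD]
  field_simp
  ring

lemma hasDerivAt_heatKernelLine_time {t : ℝ} (ht : 0 < t) (x : ℝ) :
    HasDerivAt (fun t => heatKernelLine (t, x)) (lineDD (t, x)) t := by
  have hs : HasDerivAt (fun t => Real.sqrt (4 * Real.pi * t))
      (4 * Real.pi * 1 / (2 * Real.sqrt (4 * Real.pi * t))) t :=
    ((hasDerivAt_id t).const_mul (4 * Real.pi)).sqrt (by simp; positivity)
  have hsq : Real.sqrt (4 * Real.pi * t) ^ 2 = 4 * Real.pi * t := Real.sq_sqrt (by positivity)
  have hs0 : Real.sqrt (4 * Real.pi * t) ≠ 0 := by positivity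
  have he : HasDerivAt (fun t => Real.exp (-x ^ 2 / (4 * t)))
      (Real.exp (-x ^ 2 / (4 * t)) * (x ^ 2 / (4 * t ^ 2))) t := by
    have h1 : HasDerivAt (fun t : ℝ => -x ^ 2 / (4 * t)) (x ^ 2 / (4 * t ^ 2)) t := by
      have := (hasDerivAt_const t (-x ^ 2)).div ((hasDerivAt_id t).const_mul 4)
        (by simp; exact ht.ne')
      refine this.congr_deriv ?_
      simp; field_simp
    exact h1.exp
  have h := (hs.inv hs0).mul he
  have heq : (fun t => heatKernelLine (t, x)) =ᶠ[𝓝 t]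
      fun t => (Real.sqrt (4 * Real.pi * t))⁻¹ * Real.exp (-x ^ 2 / (4 * t)) := by
    filter_upwards [lt_mem_nhds ht] with s hs
    exact heatKernelLine_of_pos hs x
  refine (h.congr_of_eventuallyEq heq).congr_deriv ?_
  simp only [lineDD, heatKernelLine_of_pos ht, Pi.inv_apply]
  set S := Real.sqrt (4 * Real.pi * t)
  have : 4 * Real.pi = S ^ 2 / t := by rw [hsq]; field_simp
  rw [this]
  field_simp
  ring

lemma hasDerivAt_lineD_time {t : ℝ} (ht : 0 < t) (x : ℝ) :
    HasDerivAt (fun t => lineD (t, x)) (lineDDD (t, x)) t := by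
  have h1 : HasDerivAt (fun t : ℝ => -(x / (2 * t))) (x / (2 * t ^ 2)) t := by
    have := ((hasDerivAt_const t x).div ((hasDerivAt_id t).const_mul 2)
      (by simp; exact ht.ne')).neg
    refine this.congr_deriv ?_
    simp; field_simp
  refine (h1.mul (hasDerivAt_heatKernelLine_time ht x)).congr_deriv ?_
  simp only [lineDD, lineDDD]
  field_simp
  ring

lemma spaceDeriv_heatKernelLine : spaceDeriv heatKernelLine = lineD := by
  ext z
  exact (hasDerivAt_heatKernelLine z.1 z.2).deriv

lemma exists_poly_mul_exp_le (n : ℕ) :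
    ∃ A : ℝ, 0 < A ∧ ∀ y : ℝ, 0 ≤ y → (1 + y) ^ n * Real.exp (-y ^ 2 / 4) ≤ A := by
  refine ⟨n.factorial * Real.exp 2, by positivity, fun y hy => ?_⟩
  have h1 := Real.pow_div_factorial_le_exp (1 + y) (by positivity) n
  rw [div_le_iff₀ (by positivity)] at h1
  calc (1 + y) ^ n * Real.exp (-y ^ 2 / 4)
      ≤ (Real.exp (1 + y) * n.factorial) * Real.exp (-y ^ 2 / 4) := by gcongr
    _ = n.factorial * Real.exp (1 + y - y ^ 2 / 4) := by
        rw [mul_right_comm, ← Real.exp_add, mul_comm]; ring_nf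
    _ ≤ _ := by
        gcongr
        nlinarith [sq_nonneg (y / 2 - 1)]

/-- The Gaussian decay of the heat kernel, written as a bound by powers of the parabolic size. -/
lemma exists_heatKernelLine_le (n : ℕ) : ∃ A : ℝ, 0 < A ∧ ∀ t x : ℝ, 0 < t →
    heatKernelLine (t, x) * (1 + |x| / Real.sqrt t) ^ n ≤ A / Real.sqrt t := by
  obtain ⟨A, hA, h⟩ := exists_poly_mul_exp_le n
  refine ⟨A, hA, fun t x ht => ?_⟩
  have hs : 0 < Real.sqrt t := Real.sqrt_pos.2 ht
  have h2 := h (|x| / Real.sqrt t) (by positivity)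
  rw [heatKernelLine_of_pos ht, div_eq_mul_inv]
  have e : -(|x| / Real.sqrt t) ^ 2 / 4 = -x ^ 2 / (4 * t) := by
    rw [div_pow, sq_abs, Real.sq_sqrt ht.le]; field_simp
  rw [e] at h2
  have h3 : (Real.sqrt (4 * Real.pi * t))⁻¹ ≤ (Real.sqrt t)⁻¹ := by
    gcongr
    nlinarith [Real.pi_gt_three]
  calc _ = (Real.sqrt (4 * Real.pi * t))⁻¹
        * ((1 + |x| / Real.sqrt t) ^ n * Real.exp (-x ^ 2 / (4 * t))) := by
        ring_nf
    _ ≤ (Real.sqrt t)⁻¹ * A := by gcongr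
    _ = _ := mul_comm _ _

/-- A polynomial of degree `m` in `x / √t`, times the heat kernel and `t ^ (-k / 2)`, is bounded by a
power of the parabolic size. -/
lemma exists_kernel_bound (c : ℝ) (hc : 0 ≤ c) (m k l : ℕ) : ∃ A : ℝ, 0 < A ∧
    ∀ (t x P : ℝ), 0 < t → |P| * Real.sqrt t ^ k ≤ c * (1 + |x| / Real.sqrt t) ^ m →
      |P * heatKernelLine (t, x)| * (Real.sqrt t + |x|) ^ l
        * (Real.sqrt t ^ k * Real.sqrt t) ≤ A * Real.sqrt t ^ l := by
  obtain ⟨A, hA, h⟩ := exists_heatKernelLine_le (m + l)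
  refine ⟨(c + 1) * A, by positivity, fun t x P ht hP => ?_⟩
  have hs : 0 < Real.sqrt t := Real.sqrt_pos.2 ht
  have h2 := h t x ht
  rw [le_div_iff₀ hs] at h2
  set σ := Real.sqrt t
  have e : σ + |x| = σ * (1 + |x| / σ) := by field_simp
  rw [abs_mul, abs_of_nonneg (heatKernelLine_nonneg _), e]
  have hh := heatKernelLine_nonneg (t, x)
  calc |P| * heatKernelLine (t, x) * (σ * (1 + |x| / σ)) ^ l * (σ ^ k * σ)
      = (|P| * σ ^ k) * (heatKernelLine (t, x) * (1 + |x| / σ) ^ l * σ) * σ ^ l := by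
        rw [mul_pow]; ring
    _ ≤ (c * (1 + |x| / σ) ^ m) * (heatKernelLine (t, x) * (1 + |x| / σ) ^ l * σ) * σ ^ l := by
        gcongr
    _ = c * (heatKernelLine (t, x) * (1 + |x| / σ) ^ (m + l) * σ) * σ ^ l := by
        rw [pow_add]; ring
    _ ≤ (c + 1) * A * σ ^ l := by
        gcongr
        linarith

lemma exists_kernel_le (c : ℝ) (hc : 0 ≤ c) (m k : ℕ) : ∃ A : ℝ, 0 < A ∧
    ∀ (t x P : ℝ), 0 < t → |P| * Real.sqrt t ^ k ≤ c * (1 + |x| / Real.sqrt t) ^ m →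
      |P * heatKernelLine (t, x)| ≤ A / (Real.sqrt t + |x|) ^ (k + 1) := by
  obtain ⟨A, hA, h⟩ := exists_kernel_bound c hc m k (k + 1)
  refine ⟨A, hA, fun t x P ht hP => ?_⟩
  have hs : 0 < Real.sqrt t := Real.sqrt_pos.2 ht
  have h2 := h t x P ht hP
  rw [← pow_succ] at h2
  rw [le_div_iff₀ (by positivity)]
  exact le_of_mul_le_mul_right h2 (by positivity)

lemma exists_heatKernelLine_le_one : ∃ A : ℝ, 0 < A ∧ ∀ t x : ℝ, 0 < t →
    heatKernelLine (t, x) ≤ A / (Real.sqrt t + |x|) := by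
  obtain ⟨A, hA, h⟩ := exists_kernel_le 1 zero_le_one 0 0
  refine ⟨A, hA, fun t x ht => ?_⟩
  have := h t x 1 ht (by simp)
  simpa [abs_of_nonneg (heatKernelLine_nonneg _)] using this

lemma exists_heatKernelLine_le_three : ∃ A : ℝ, 0 < A ∧ ∀ t x : ℝ, 0 < t →
    heatKernelLine (t, x) ≤ A * t / (Real.sqrt t + |x|) ^ 3 := by
  obtain ⟨A, hA, h⟩ := exists_kernel_bound 1 zero_le_one 0 0 3
  refine ⟨A, hA, fun t x ht => ?_⟩
  have hs : 0 < Real.sqrt t := Real.sqrt_pos.2 ht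
  have h2 := h t x 1 ht (by simp)
  rw [one_mul, abs_of_nonneg (heatKernelLine_nonneg _), pow_zero, one_mul] at h2
  rw [le_div_iff₀ (by positivity)]
  have e : A * Real.sqrt t ^ 3 = A * t * Real.sqrt t := by
    rw [pow_succ, Real.sq_sqrt ht.le]; ring
  rw [e] at h2
  exact le_of_mul_le_mul_right h2 hs

lemma exists_lineD_le : ∃ A : ℝ, 0 < A ∧ ∀ t x : ℝ, 0 < t →
    |lineD (t, x)| ≤ A / (Real.sqrt t + |x|) ^ 2 := by
  obtain ⟨A, hA, h⟩ := exists_kernel_le 1 zero_le_one 1 1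
  refine ⟨A, hA, fun t x ht => ?_⟩
  refine h t x _ ht ?_
  have hs : 0 < Real.sqrt t := Real.sqrt_pos.2 ht
  have e : t = Real.sqrt t ^ 2 := (Real.sq_sqrt ht.le).symm
  simp only [abs_neg, abs_div, abs_mul, abs_two, abs_of_pos ht]
  have : |x| / (2 * t) * Real.sqrt t ^ 1 = |x| / Real.sqrt t / 2 := by
    nth_rw 1 [e]; field_simp
  rw [this]
  have : 0 ≤ |x| / Real.sqrt t := by positivity
  linarith

lemma exists_lineDD_le : ∃ A : ℝ, 0 < A ∧ ∀ t x : ℝ, 0 < t →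
    |lineDD (t, x)| ≤ A / (Real.sqrt t + |x|) ^ 3 := by
  obtain ⟨A, hA, h⟩ := exists_kernel_le 1 zero_le_one 2 2
  refine ⟨A, hA, fun t x ht => ?_⟩
  refine h t x _ ht ?_
  have hs : 0 < Real.sqrt t := Real.sqrt_pos.2 ht
  have e : Real.sqrt t ^ 2 = t := Real.sq_sqrt ht.le
  set y := |x| / Real.sqrt t with hy
  have hy0 : 0 ≤ y := by positivity
  have hx : x ^ 2 = y ^ 2 * t := by rw [hy, div_pow, sq_abs, e]; field_simp
  have : |x ^ 2 / (4 * t ^ 2) - 1 / (2 * t)| ≤ (y ^ 2 / 4 + 1 / 2) / t := by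
    rw [hx, abs_le]
    have e1 : y ^ 2 * t / (4 * t ^ 2) - 1 / (2 * t) = (y ^ 2 / 4 - 1 / 2) / t := by field_simp
    rw [e1, ← neg_div]
    constructor <;> gcongr <;> nlinarith [sq_nonneg y]
  simp only [e]
  calc _ ≤ (y ^ 2 / 4 + 1 / 2) / t * t := by gcongr
    _ = y ^ 2 / 4 + 1 / 2 := by field_simp
    _ ≤ _ := by nlinarith [sq_nonneg y]

lemma exists_lineDDD_le : ∃ A : ℝ, 0 < A ∧ ∀ t x : ℝ, 0 < t →
    |lineDDD (t, x)| ≤ A / (Real.sqrt t + |x|) ^ 4 := by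
  obtain ⟨A, hA, h⟩ := exists_kernel_le 1 zero_le_one 3 3
  refine ⟨A, hA, fun t x ht => ?_⟩
  refine h t x _ ht ?_
  have hs : 0 < Real.sqrt t := Real.sqrt_pos.2 ht
  have e : Real.sqrt t ^ 2 = t := Real.sq_sqrt ht.le
  set σ := Real.sqrt t with hσ
  set y := |x| / σ with hy
  have hy0 : 0 ≤ y := by positivity
  have hx : |x| = y * σ := by rw [hy]; field_simp
  have h1 : |3 * x / (4 * t ^ 2) - x ^ 3 / (8 * t ^ 3)| ≤ 3 * |x| / (4 * t ^ 2) + |x| ^ 3 / (8 * t ^ 3) := by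
    refine (abs_sub _ _).trans (le_of_eq ?_)
    simp only [abs_div, abs_mul, abs_pow, abs_of_pos ht]
    norm_num
  simp only
  calc _ ≤ (3 * |x| / (4 * t ^ 2) + |x| ^ 3 / (8 * t ^ 3)) * σ ^ 3 := by gcongr
    _ = 3 / 4 * y + y ^ 3 / 8 := by rw [hx, ← e]; field_simp
    _ ≤ _ := by nlinarith [sq_nonneg y, pow_nonneg hy0 3]

lemma dil_heatKernelLine {ε : ℝ} (hε : 0 < ε) (z : ℝ × ℝ) :
    ε * heatKernelLine (dil ε z) = heatKernelLine z := by
  rcases le_or_gt z.1 0 with h | h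
  · rw [heatKernelLine_of_nonpos h, heatKernelLine_of_nonpos, mul_zero]
    exact mul_nonpos_of_nonneg_of_nonpos (by positivity) h
  · have h2 : 0 < ε ^ 2 * z.1 := by positivity
    rw [dil, heatKernelLine_of_pos h2]
    rw [show z = (z.1, z.2) from rfl, heatKernelLine_of_pos h]
    have : Real.sqrt (4 * Real.pi * (ε ^ 2 * z.1)) = ε * Real.sqrt (4 * Real.pi * z.1) := by
      rw [show 4 * Real.pi * (ε ^ 2 * z.1) = ε ^ 2 * (4 * Real.pi * z.1) by ring,
        Real.sqrt_mul (by positivity), Real.sqrt_sq hε.le]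
    rw [this]
    have : -(ε * z.2) ^ 2 / (4 * (ε ^ 2 * z.1)) = -z.2 ^ 2 / (4 * z.1) := by field_simp
    simp only [this]
    field_simp

/-- The variation of `∂_x P` under a shift that is small compared to the parabolic size. -/
lemma exists_lineD_sub_le : ∃ A : ℝ, 0 < A ∧ ∀ s s' x x' : ℝ, 0 < s → 0 < s' →
    2 * (Real.sqrt |s - s'| + |x - x'|) ≤ Real.sqrt s + |x| →
    |lineD (s, x) - lineD (s', x')|
      ≤ A * (Real.sqrt |s - s'| + |x - x'|) / (Real.sqrt s + |x|) ^ 3 := by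
  obtain ⟨A₂, hA₂, h₂⟩ := exists_lineDD_le
  obtain ⟨A₃, hA₃, h₃⟩ := exists_lineDDD_le
  refine ⟨8 * A₂ + 8 * A₃, by positivity, fun s s' x x' hs hs' hh => ?_⟩
  set d := Real.sqrt s + |x| with hd
  have hd0 : 0 < d := by have := Real.sqrt_pos.2 hs; positivity
  set h := Real.sqrt |s - s'| + |x - x'| with hh'
  have h0 : 0 ≤ h := by positivity
  have b1 : |lineD (s, x) - lineD (s, x')| ≤ (A₂ / (d / 2) ^ 3) * |x - x'| := by
    have := (convex_uIcc x' x).norm_image_sub_le_of_norm_hasDerivWithin_le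
      (f := fun x => lineD (s, x)) (f' := fun x => lineDD (s, x)) (C := A₂ / (d / 2) ^ 3)
      (fun y _ => (hasDerivAt_lineD hs y).hasDerivWithinAt) (fun y hy => ?_)
      left_mem_uIcc right_mem_uIcc
    · simpa using this
    · refine (h₂ s y hs).trans ?_
      gcongr
      have h1 : |y - x| ≤ |x' - x| := abs_sub_left_of_mem_uIcc (uIcc_comm x' x ▸ hy)
      have h2 : |x| ≤ |y| + |y - x| := by
        rw [abs_sub_comm y x]
        have := abs_add_le y (x - y); simpa using this
      rw [abs_sub_comm x' x] at h1
      have := Real.sqrt_nonneg |s - s'|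
      linarith
  have b2 : |lineD (s, x') - lineD (s', x')| ≤ (A₃ / (d / 2) ^ 4) * |s - s'| := by
    have := (convex_uIcc s' s).norm_image_sub_le_of_norm_hasDerivWithin_le
      (f := fun s => lineD (s, x')) (f' := fun s => lineDDD (s, x')) (C := A₃ / (d / 2) ^ 4)
      (fun y hy => (hasDerivAt_lineD_time ?_ x').hasDerivWithinAt) (fun y hy => ?_)
      left_mem_uIcc right_mem_uIcc
    · simpa using this
    · exact (lt_min hs' hs).trans_le hy.1
    · have hy0 : 0 < y := (lt_min hs' hs).trans_le hy.1
      refine (h₃ y x' hy0).trans ?_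
      gcongr
      have h1 : |y - s| ≤ |s' - s| := abs_sub_left_of_mem_uIcc (uIcc_comm s' s ▸ hy)
      have h2 : |x| ≤ |x'| + |x - x'| := by
        have := abs_add_le x' (x - x'); simpa using this
      have h3 : Real.sqrt s ≤ Real.sqrt y + Real.sqrt |s - s'| := by
        have := sqrt_abs_add_le y (s - y)
        rw [add_sub_cancel, abs_of_pos hs, abs_of_pos hy0] at this
        refine this.trans (add_le_add_right (Real.sqrt_le_sqrt ?_) _)
        rwa [abs_sub_comm s y, abs_sub_comm s s']
      linarith
  have e1 : |s - s'| ≤ h * (d / 2) := by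
    have h1 : |s - s'| = Real.sqrt |s - s'| ^ 2 := (Real.sq_sqrt (abs_nonneg _)).symm
    have h2 : Real.sqrt |s - s'| ≤ h := by have := abs_nonneg (x - x'); linarith
    rw [h1, sq]
    gcongr
    linarith
  have e2 : |x - x'| ≤ h := by have := Real.sqrt_nonneg |s - s'|; linarith
  calc _ ≤ |lineD (s, x) - lineD (s, x')| + |lineD (s, x') - lineD (s', x')| := abs_sub_le _ _ _
    _ ≤ (A₂ / (d / 2) ^ 3) * h + (A₃ / (d / 2) ^ 4) * (h * (d / 2)) := by
        refine add_le_add (b1.trans ?_) (b2.trans ?_) <;> gcongr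
    _ ≤ _ := by
        apply le_of_eq
        field_simp
        ring

lemma heatKernelLine_eq_gaussianPDFReal {t : ℝ} (ht : 0 < t) (x m : ℝ) :
    heatKernelLine (t, x - m) = gaussianPDFReal m (2 * t).toNNReal x := by
  rw [heatKernelLine_of_pos ht, gaussianPDFReal, Real.coe_toNNReal _ (by positivity)]
  congr 2
  · congr 1; ring
  · congr 1; field_simp; ring

/-- The product of two heat kernels, as a function of the intermediate point, is a multiple of a
Gaussian density. -/
lemma heatKernelLine_mul {a b : ℝ} (ha : 0 < a) (hb : 0 < b) (x y : ℝ) :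
    heatKernelLine (a, x - y) * heatKernelLine (b, y) =
      heatKernelLine (a + b, x) * heatKernelLine (a * b / (a + b), y - x * b / (a + b)) := by
  rw [heatKernelLine_of_pos ha, heatKernelLine_of_pos hb, heatKernelLine_of_pos (by positivity),
    heatKernelLine_of_pos (by positivity)]
  conv_lhs => rw [mul_mul_mul_comm, ← Real.exp_add, ← mul_inv, ← Real.sqrt_mul (by positivity)]
  conv_rhs => rw [mul_mul_mul_comm, ← Real.exp_add, ← mul_inv, ← Real.sqrt_mul (by positivity)]
  congr 2
  · congr 1; field_simp
  · field_simp; ring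

/-- The semigroup property, differentiated twice in space. -/
lemma integral_lineD_mul_lineD {a b : ℝ} (ha : 0 < a) (hb : 0 < b) (x : ℝ) :
    ∫ y, lineD (a, x - y) * lineD (b, y) = lineDD (a + b, x) := by
  set m := x * b / (a + b) with hm
  set c := a * b / (a + b) with hc
  have hc0 : 0 < c := by positivity
  have hv : (2 * c).toNNReal ≠ 0 := by simpa using hc0
  have e : ∀ y, lineD (a, x - y) * lineD (b, y) = heatKernelLine (a + b, x) / (4 * a * b) *
      (gaussianPDFReal m (2 * c).toNNReal y • ((x - y) * y)) := by
    intro y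
    have h1 := heatKernelLine_mul ha hb x y
    rw [← hm, ← hc, heatKernelLine_eq_gaussianPDFReal hc0] at h1
    calc _ = (x - y) * y / (4 * a * b) * (heatKernelLine (a, x - y) * heatKernelLine (b, y)) := by
          simp only [lineD]; field_simp; ring
      _ = _ := by rw [h1, smul_eq_mul]; ring
  simp_rw [e]
  rw [integral_const_mul, ← integral_gaussianReal_eq_integral_smul hv]
  have hid : MemLp (id : ℝ → ℝ) 2 (gaussianReal m (2 * c).toNNReal) :=
    memLp_id_gaussianReal 2
  have i2 : Integrable (fun y : ℝ => y ^ 2) (gaussianReal m (2 * c).toNNReal) := hid.integrable_sq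
  have i1 : Integrable (fun y : ℝ => y) (gaussianReal m (2 * c).toNNReal) :=
    hid.integrable one_le_two
  have hvar := variance_id_gaussianReal (μ := m) (v := (2 * c).toNNReal)
  rw [variance_eq_sub hid, Real.coe_toNNReal _ (by positivity)] at hvar
  have hmean := integral_id_gaussianReal (μ := m) (v := (2 * c).toNNReal)
  have e2 : ∫ y, (x - y) * y ∂gaussianReal m (2 * c).toNNReal = x * m - (2 * c + m ^ 2) := by
    have : ∀ y : ℝ, (x - y) * y = x * y - y ^ 2 := fun y => by ring
    simp_rw [this]
    rw [integral_sub (i1.const_mul x) i2, integral_const_mul, hmean]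
    have : ∫ y, y ^ 2 ∂gaussianReal m (2 * c).toNNReal = 2 * c + m ^ 2 := by
      simp only [Pi.pow_apply, id] at hvar hmean
      rw [hmean] at hvar
      linarith
    rw [this]
  rw [e2, lineDD, hm, hc]
  field_simp
  ring

/-- A Gaussian bound with a larger variance absorbs the linear factor of `∂_x P`. -/
lemma exists_abs_lineD_le_gaussian : ∃ A : ℝ, 0 < A ∧ ∀ t x : ℝ, 0 < t →
    |lineD (t, x)| ≤ A / t * Real.exp (-(1 / (8 * t)) * x ^ 2) := by
  refine ⟨1, one_pos, fun t x ht => ?_⟩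
  have hs : 0 < Real.sqrt t := Real.sqrt_pos.2 ht
  have e : Real.sqrt t ^ 2 = t := Real.sq_sqrt ht.le
  rw [lineD, heatKernelLine_of_pos ht]
  simp only [abs_mul, abs_neg, abs_div, abs_two, abs_of_pos ht, Real.abs_exp, abs_inv,
    abs_of_nonneg (Real.sqrt_nonneg _)]
  have h1 : (Real.sqrt (4 * Real.pi * t))⁻¹ ≤ (Real.sqrt t)⁻¹ := by
    gcongr
    nlinarith [Real.pi_gt_three]
  have h2 : Real.exp (-x ^ 2 / (4 * t)) = Real.exp (-(1 / (8 * t)) * x ^ 2)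
      * Real.exp (-(1 / (8 * t)) * x ^ 2) := by
    rw [← Real.exp_add]; congr 1; field_simp; ring
  set y := |x| / Real.sqrt t with hy
  have hy0 : 0 ≤ y := by positivity
  have h3 : y * Real.exp (-(1 / (8 * t)) * x ^ 2) ≤ 2 := by
    have : -(1 / (8 * t)) * x ^ 2 = -(y ^ 2 / 8) := by
      rw [hy, div_pow, sq_abs, e]; field_simp
    rw [this, Real.exp_neg, ← div_eq_mul_inv, div_le_iff₀ (Real.exp_pos _)]
    have := Real.add_one_le_exp (y ^ 2 / 8)
    nlinarith [sq_nonneg (y - 2)]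
  calc |x| / (2 * t) * ((Real.sqrt (4 * Real.pi * t))⁻¹ * Real.exp (-x ^ 2 / (4 * t)))
      ≤ |x| / (2 * t) * ((Real.sqrt t)⁻¹ * Real.exp (-x ^ 2 / (4 * t))) := by gcongr
    _ = (y * Real.exp (-(1 / (8 * t)) * x ^ 2)) / (2 * t) * Real.exp (-(1 / (8 * t)) * x ^ 2) := by
        rw [h2, hy]; field_simp
    _ ≤ 2 / (2 * t) * Real.exp (-(1 / (8 * t)) * x ^ 2) := by gcongr
    _ = _ := by field_simp

lemma integrable_lineD {t : ℝ} : Integrable (fun x => lineD (t, x)) := by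
  rcases le_or_gt t 0 with ht | ht
  · simp [lineD_of_nonpos (z := (t, _)) ht]
  obtain ⟨A, -, h⟩ := exists_abs_lineD_le_gaussian
  refine ((integrable_exp_neg_mul_sq (b := 1 / (8 * t)) (by positivity)).const_mul (A / t)).mono'
    (measurable_lineD.comp (by fun_prop)).aestronglyMeasurable (ae_of_all _ fun x => h t x ht)

lemma exists_integral_abs_lineD_le : ∃ A : ℝ, 0 < A ∧ ∀ t : ℝ, 0 < t →
    ∫ x, |lineD (t, x)| ≤ A / Real.sqrt t := by
  obtain ⟨A, hA, h⟩ := exists_abs_lineD_le_gaussian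
  refine ⟨A * Real.sqrt (Real.pi * 8), by positivity, fun t ht => ?_⟩
  have hi := integrable_exp_neg_mul_sq (b := 1 / (8 * t)) (by positivity)
  calc _ ≤ ∫ x, A / t * Real.exp (-(1 / (8 * t)) * x ^ 2) :=
        integral_mono integrable_lineD.abs (hi.const_mul _) fun x => h t x ht
    _ = A / t * Real.sqrt (Real.pi / (1 / (8 * t))) := by
        rw [integral_const_mul, integral_gaussian]
    _ = _ := by
        rw [show Real.pi / (1 / (8 * t)) = (Real.pi * 8) * t by field_simp,
          Real.sqrt_mul (by positivity)]
        have : t = Real.sqrt t ^ 2 := (Real.sq_sqrt ht.le).symm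
        have hs : 0 < Real.sqrt t := Real.sqrt_pos.2 ht
        nth_rw 1 [this]
        field_simp

/-! ### The heat kernel on the circle -/

/-- The periodisation of the space derivative of the heat kernel on the line. -/
noncomputable def circD (z : ℝ × ℝ) : ℝ := ∑' n : ℤ, lineD (z.1, z.2 + n)

lemma summable_shifted_sq : Summable (fun n : ℕ => 1 / ((n : ℝ) + 1) ^ 2) := by
  have := (summable_nat_add_iff (f := fun n : ℕ => 1 / (n : ℝ) ^ 2) 1).2
    (Real.summable_one_div_nat_pow.2 one_lt_two)
  simpa using this

lemma exp_neg_sq_le {m τ : ℝ} (hm : 1 ≤ m) (hτ : 0 < τ) :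
    m * Real.exp (-Real.pi * m ^ 2 * τ) ≤ 1 / m ^ 2 / τ ^ 2 := by
  have h3 := Real.pi_gt_three
  have hm0 : 0 < m := by linarith
  have h1 := Real.quadratic_le_exp_of_nonneg (x := Real.pi * m ^ 2 * τ) (by positivity)
  have h2 : m ^ 3 * τ ^ 2 ≤ Real.exp (Real.pi * m ^ 2 * τ) := by
    refine le_trans ?_ h1
    have : m ^ 3 * τ ^ 2 ≤ (Real.pi * m ^ 2 * τ) ^ 2 / 2 := by
      have e : (Real.pi * m ^ 2 * τ) ^ 2 / 2 = m ^ 3 * τ ^ 2 * (Real.pi ^ 2 / 2 * m) := by ring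
      rw [e]
      refine le_mul_of_one_le_right (by positivity) ?_
      nlinarith
    have : 0 ≤ Real.pi * m ^ 2 * τ := by positivity
    linarith
  rw [show -Real.pi * m ^ 2 * τ = -(Real.pi * m ^ 2 * τ) by ring, Real.exp_neg,
    ← div_eq_mul_inv, div_le_iff₀ (Real.exp_pos _)]
  calc m = 1 / m ^ 2 / τ ^ 2 * (m ^ 3 * τ ^ 2) := by field_simp
    _ ≤ _ := by gcongr

open HurwitzZeta in
/-- By Poisson summation the heat kernel of the circle is a theta function, whose Fourier series
gives the decay at large times. -/
lemma heatKernelCircle_eq_cosKernel {t : ℝ} (ht : 0 < t) (x : ℝ) :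
    heatKernelCircle (t, x) = cosKernel (x : UnitAddCircle) (4 * Real.pi * t) := by
  have hτ : 0 < 4 * Real.pi * t := by positivity
  have h := (hasSum_int_evenKernel x (one_div_pos.2 hτ)).mul_left (Real.sqrt (4 * Real.pi * t))⁻¹
  rw [evenKernel_functional_equation, one_div_one_div] at h
  have e : (Real.sqrt (4 * Real.pi * t))⁻¹ * (1 / (1 / (4 * Real.pi * t)) ^ (1 / 2 : ℝ)
      * cosKernel (x : UnitAddCircle) (4 * Real.pi * t))
      = cosKernel (x : UnitAddCircle) (4 * Real.pi * t) := by
    rw [← Real.sqrt_eq_rpow, Real.sqrt_div zero_le_one, Real.sqrt_one, one_div_one_div,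
      inv_mul_cancel_left₀ (Real.sqrt_pos.2 hτ).ne']
  rw [e] at h
  rw [← h.tsum_eq, heatKernelCircle]
  refine tsum_congr fun n => ?_
  rw [heatKernelLine_of_pos ht]
  congr 2
  simp only
  field_simp
  ring

open HurwitzZeta in
lemma hasSum_lineD_sinKernel {t : ℝ} (ht : 0 < t) (x : ℝ) :
    HasSum (fun n : ℤ => lineD (t, x + n))
      (-2 * Real.pi * sinKernel (x : UnitAddCircle) (4 * Real.pi * t)) := by
  have hτ : 0 < 4 * Real.pi * t := by positivity
  have h := (hasSum_int_oddKernel x (one_div_pos.2 hτ)).mul_left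
    (-(1 / (2 * t)) * (Real.sqrt (4 * Real.pi * t))⁻¹)
  rw [oddKernel_functional_equation, one_div_one_div] at h
  have e : -(1 / (2 * t)) * (Real.sqrt (4 * Real.pi * t))⁻¹ * (1 / (1 / (4 * Real.pi * t)) ^ (3 / 2 : ℝ)
      * sinKernel (x : UnitAddCircle) (4 * Real.pi * t))
      = -2 * Real.pi * sinKernel (x : UnitAddCircle) (4 * Real.pi * t) := by
    rw [show (3 / 2 : ℝ) = 1 + 1 / 2 by norm_num, Real.rpow_add (one_div_pos.2 hτ), Real.rpow_one,
      ← Real.sqrt_eq_rpow, Real.sqrt_div zero_le_one, Real.sqrt_one]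
    have := (Real.sqrt_pos.2 hτ).ne'
    field_simp
    ring
  rw [e] at h
  refine h.congr_fun fun n => ?_
  rw [lineD, heatKernelLine_of_pos ht]
  have e2 : -Real.pi * (n + x) ^ 2 * (1 / (4 * Real.pi * t)) = -(x + n) ^ 2 / (4 * t) := by
    field_simp; ring
  rw [e2]
  simp only
  field_simp
  ring

lemma hasSum_circD (t x : ℝ) : HasSum (fun n : ℤ => lineD (t, x + n)) (circD (t, x)) := by
  rcases le_or_gt t 0 with ht | ht
  · have : (fun n : ℤ => lineD (t, x + n)) = fun _ => 0 := by
      ext n; exact lineD_of_nonpos ht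
    rw [circD, this]; simp
  · exact (hasSum_lineD_sinKernel ht x).summable.hasSum

lemma circD_of_nonpos {z : ℝ × ℝ} (hz : z.1 ≤ 0) : circD z = 0 := by
  have : ∀ n : ℤ, lineD (z.1, z.2 + n) = 0 := fun n => lineD_of_nonpos hz
  simp [circD, this]

open HurwitzZeta in
lemma hasSum_nat_circD {t : ℝ} (ht : 0 < t) (x : ℝ) :
    HasSum (fun n : ℕ => -2 * Real.pi * (2 * (n + 1) * Real.sin (2 * Real.pi * x * (n + 1))
      * Real.exp (-Real.pi * (n + 1) ^ 2 * (4 * Real.pi * t)))) (circD (t, x)) := by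
  have hτ : 0 < 4 * Real.pi * t := by positivity
  rw [(hasSum_circD t x).unique (hasSum_lineD_sinKernel ht x)]
  refine HasSum.mul_left _ ?_
  have := (hasSum_nat_add_iff' 1).2 (hasSum_nat_sinKernel x hτ)
  simpa using this

open HurwitzZeta in
lemma hasSum_nat_heatKernelCircle {t : ℝ} (ht : 0 < t) (x : ℝ) :
    HasSum (fun n : ℕ => 2 * Real.cos (2 * Real.pi * x * (n + 1))
      * Real.exp (-Real.pi * (n + 1) ^ 2 * (4 * Real.pi * t))) (heatKernelCircle (t, x) - 1) := by
  rw [heatKernelCircle_eq_cosKernel ht]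
  exact hasSum_nat_cosKernel₀ x (by positivity)

lemma circD_term_le {t : ℝ} (ht : 0 < t) (x : ℝ) (n : ℕ) :
    |-2 * Real.pi * (2 * (n + 1) * Real.sin (2 * Real.pi * x * (n + 1))
      * Real.exp (-Real.pi * (n + 1) ^ 2 * (4 * Real.pi * t)))|
      ≤ 1 / ((n : ℝ) + 1) ^ 2 * (4 * Real.pi / (4 * Real.pi * t) ^ 2) := by
  have h := exp_neg_sq_le (m := n + 1) (τ := 4 * Real.pi * t) (by simp) (by positivity)
  have hs := Real.abs_sin_le_one (2 * Real.pi * x * (n + 1))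
  have hn : (0 : ℝ) < n + 1 := by positivity
  simp only [abs_mul, abs_neg, abs_two, abs_of_pos Real.pi_pos, abs_of_pos hn, Real.abs_exp]
  calc _ ≤ 2 * Real.pi * (2 * (n + 1) * 1
        * Real.exp (-Real.pi * (n + 1) ^ 2 * (4 * Real.pi * t))) := by gcongr
    _ = 4 * Real.pi * ((n + 1) * Real.exp (-Real.pi * (n + 1) ^ 2 * (4 * Real.pi * t))) := by ring
    _ ≤ 4 * Real.pi * (1 / ((n : ℝ) + 1) ^ 2 / (4 * Real.pi * t) ^ 2) := by gcongr
    _ = _ := by ring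

/-- The derivative is computed on the Fourier series, where the differentiated series converges
uniformly in space. -/
lemma hasDerivAt_heatKernelCircle (t x : ℝ) :
    HasDerivAt (fun x => heatKernelCircle (t, x)) (circD (t, x)) x := by
  rcases le_or_gt t 0 with ht | ht
  · have : (fun x => heatKernelCircle (t, x)) = fun _ => 0 := by
      ext x; simp [heatKernelCircle, heatKernelLine_of_nonpos (z := (t, _)) ht]
    rw [this, circD_of_nonpos ht]
    exact hasDerivAt_const _ _
  have h := hasDerivAt_tsum (𝕜 := ℝ) (F := ℝ) (y₀ := 0) (g := fun (n : ℕ) (x : ℝ) =>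
      2 * Real.cos (2 * Real.pi * x * (n + 1))
        * Real.exp (-Real.pi * (n + 1) ^ 2 * (4 * Real.pi * t)))
    (g' := fun (n : ℕ) (x : ℝ) => -2 * Real.pi * (2 * (n + 1) * Real.sin (2 * Real.pi * x * (n + 1))
      * Real.exp (-Real.pi * (n + 1) ^ 2 * (4 * Real.pi * t))))
    (summable_shifted_sq.mul_right (4 * Real.pi / (4 * Real.pi * t) ^ 2)) (fun n x => ?_)
    (fun n x => circD_term_le ht x n) (hasSum_nat_heatKernelCircle ht 0).summable x
  · rw [(hasSum_nat_circD ht x).tsum_eq] at h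
    refine (h.add_const 1).congr_of_eventuallyEq (Eventually.of_forall fun y => ?_)
    dsimp only
    rw [(hasSum_nat_heatKernelCircle ht y).tsum_eq]; ring
  · have h1 : HasDerivAt (fun x : ℝ => 2 * Real.pi * x * (n + 1)) (2 * Real.pi * (n + 1)) x := by
      have := ((hasDerivAt_id x).const_mul (2 * Real.pi)).mul_const ((n : ℝ) + 1)
      simpa using this
    have := ((h1.cos).const_mul 2).mul_const
      (Real.exp (-Real.pi * (n + 1) ^ 2 * (4 * Real.pi * t)))
    refine this.congr_deriv ?_
    ring

lemma spaceDeriv_heatKernelCircle : spaceDeriv heatKernelCircle = circD := by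
  ext z
  exact (hasDerivAt_heatKernelCircle z.1 z.2).deriv

lemma exists_circD_le_large : ∃ A : ℝ, 0 < A ∧ ∀ t x : ℝ, 0 < t → |circD (t, x)| ≤ A / t ^ 2 := by
  refine ⟨(∑' n : ℕ, 1 / ((n : ℝ) + 1) ^ 2) * (4 * Real.pi / (4 * Real.pi) ^ 2) + 1, ?_,
    fun t x ht => ?_⟩
  · have : 0 ≤ ∑' n : ℕ, 1 / ((n : ℝ) + 1) ^ 2 := tsum_nonneg fun n => by positivity
    positivity
  rw [← (hasSum_nat_circD ht x).tsum_eq]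
  have := tsum_of_norm_bounded (summable_shifted_sq.mul_right (4 * Real.pi / (4 * Real.pi * t) ^ 2)).hasSum
    (f := fun n : ℕ => -2 * Real.pi * (2 * (n + 1) * Real.sin (2 * Real.pi * x * (n + 1))
      * Real.exp (-Real.pi * (n + 1) ^ 2 * (4 * Real.pi * t)))) (fun n => circD_term_le ht x n)
  refine this.trans ?_
  rw [tsum_mul_right, le_div_iff₀ (by positivity)]
  have e : (4 * Real.pi / (4 * Real.pi * t) ^ 2) * t ^ 2 = 4 * Real.pi / (4 * Real.pi) ^ 2 := by
    field_simp
  rw [mul_assoc, e]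
  linarith

lemma exists_heatKernelCircle_sub_one_le :
    ∃ A : ℝ, 0 < A ∧ ∀ t x : ℝ, 0 < t → |heatKernelCircle (t, x) - 1| ≤ A / t ^ 2 := by
  refine ⟨(∑' n : ℕ, 1 / ((n : ℝ) + 1) ^ 2) * (2 / (4 * Real.pi) ^ 2) + 1, ?_,
    fun t x ht => ?_⟩
  · have : 0 ≤ ∑' n : ℕ, 1 / ((n : ℝ) + 1) ^ 2 := tsum_nonneg fun n => by positivity
    positivity
  rw [← (hasSum_nat_heatKernelCircle ht x).tsum_eq]
  have := tsum_of_norm_bounded (summable_shifted_sq.mul_right (2 / (4 * Real.pi * t) ^ 2)).hasSum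
    (f := fun n : ℕ => 2 * Real.cos (2 * Real.pi * x * (n + 1))
      * Real.exp (-Real.pi * (n + 1) ^ 2 * (4 * Real.pi * t))) (fun n => ?_)
  · refine this.trans ?_
    rw [tsum_mul_right, le_div_iff₀ (by positivity)]
    have e : (2 / (4 * Real.pi * t) ^ 2) * t ^ 2 = 2 / (4 * Real.pi) ^ 2 := by
      field_simp
    rw [mul_assoc, e]
    linarith
  · have h := exp_neg_sq_le (m := n + 1) (τ := 4 * Real.pi * t) (by simp) (by positivity)
    have hs := Real.abs_cos_le_one (2 * Real.pi * x * (n + 1))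
    have hn : (1 : ℝ) ≤ n + 1 := by simp
    rw [Real.norm_eq_abs]
    simp only [abs_mul, abs_two, Real.abs_exp]
    calc _ ≤ 2 * 1 * ((n + 1) * Real.exp (-Real.pi * (n + 1) ^ 2 * (4 * Real.pi * t))) := by
          gcongr
          exact le_mul_of_one_le_left (Real.exp_pos _).le hn
      _ ≤ 2 * 1 * (1 / ((n : ℝ) + 1) ^ 2 / (4 * Real.pi * t) ^ 2) := by gcongr
      _ = _ := by ring

/-- The terms of a periodisation other than the closest one sum up to a bounded quantity. -/
lemma exists_periodisation (k : ℕ) (hk : 2 ≤ k) : ∃ C : ℝ, 0 < C ∧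
    ∀ (σ A : ℝ) (f : ℝ → ℝ) (x : ℝ), 0 ≤ σ → 0 ≤ A →
      (∀ n : ℤ, |f (x + n)| ≤ A / (σ + |x + n|) ^ k) →
      Summable (fun n : ℤ => |f (x + n)|) ∧
        |∑' n : ℤ, f (x + n) - f (x - round x)| ≤ A * C := by
  have hsum : Summable (fun n : ℤ => 2 ^ k * (1 / (n : ℝ) ^ 2)) :=
    (Real.summable_one_div_int_pow.2 one_lt_two).mul_left _
  refine ⟨∑' n : ℤ, 2 ^ k * (1 / (n : ℝ) ^ 2) + 1, ?_, fun σ A f x hσ hA hf => ?_⟩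
  · have : 0 ≤ ∑' n : ℤ, (2 ^ k * (1 / (n : ℝ) ^ 2) : ℝ) := tsum_nonneg fun n => by positivity
    positivity
  set m := round x with hm
  set θ := x - m with hθ
  have hθ2 : |θ| ≤ 1 / 2 := abs_sub_round x
  have hb : ∀ n : ℤ, n ≠ 0 → |f (θ + n)| ≤ A * (2 ^ k * (1 / (n : ℝ) ^ 2)) := by
    intro n hn
    have hn1 : (1 : ℝ) ≤ |(n : ℝ)| := by exact_mod_cast Int.one_le_abs hn
    have h1 := hf (n - m)
    have e : x + ((n - m : ℤ) : ℝ) = θ + n := by rw [hθ]; push_cast; ring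
    rw [e] at h1
    have h2 : |(n : ℝ)| / 2 ≤ σ + |θ + n| := by
      have : |(n : ℝ)| ≤ |θ + n| + |θ| := by
        have := abs_sub (θ + n) θ; simpa using this
      linarith
    refine h1.trans ?_
    calc A / (σ + |θ + n|) ^ k ≤ A / (|(n : ℝ)| / 2) ^ k := by gcongr
      _ = A * (2 ^ k * (1 / |(n : ℝ)| ^ k)) := by rw [div_pow]; field_simp
      _ ≤ A * (2 ^ k * (1 / |(n : ℝ)| ^ 2)) := by gcongr
      _ = _ := by rw [sq_abs]
  have hs0 : Summable (fun n : ℤ => |if n = 0 then 0 else f (θ + n)|) := by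
    refine Summable.of_nonneg_of_le (fun _ => abs_nonneg _) (fun n => ?_) (hsum.mul_left A)
    split_ifs with h
    · simp only [abs_zero]; positivity
    · exact hb n h
  have hs : Summable (fun n : ℤ => |f (θ + n)|) := by
    refine (hs0.add (summable_of_hasFiniteSupport (f := fun n : ℤ => if n = 0 then |f θ| else 0)
      ((Set.finite_singleton (0 : ℤ)).subset fun n hn => ?_))).congr fun n => ?_
    · by_contra h; simp at h; simp [h] at hn
    · by_cases h : n = 0 <;> simp [h]
  have hshift : ∀ g : ℝ → ℝ, (fun n : ℤ => g (θ + n)) ∘ (Equiv.addRight m) = fun n : ℤ => g (x + n) := by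
    intro g; ext n
    simp only [Function.comp, Equiv.coe_addRight, hθ]
    congr 1; push_cast; ring
  refine ⟨?_, ?_⟩
  · have := (Equiv.summable_iff (Equiv.addRight m)).2 hs
    rwa [hshift (fun y => |f y|)] at this
  · have hts : ∑' n : ℤ, f (x + n) = ∑' n : ℤ, f (θ + n) := by
      rw [← hshift f]
      exact (Equiv.addRight m).tsum_eq (fun n : ℤ => f (θ + n))
    rw [hts, hs.of_abs.tsum_eq_add_tsum_ite 0]
    simp only [Int.cast_zero, add_zero, add_sub_cancel_left]
    have := tsum_of_norm_bounded (f := fun n : ℤ => if n = 0 then 0 else f (θ + n))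
      (hsum.mul_left A).hasSum (fun n => by
        rw [Real.norm_eq_abs]
        split_ifs with h
        · simp only [abs_zero]; positivity
        · exact hb n h)
    refine this.trans ?_
    rw [tsum_mul_left]
    gcongr
    linarith

lemma measurable_circD : Measurable circD := by
  have h : ∀ n : ℤ, Measurable fun z : ℝ × ℝ => lineD (z.1, z.2 + n) := fun n =>
    measurable_lineD.comp (by fun_prop)
  exact Measurable.tsum h

lemma measurable_heatKernelCircle : Measurable heatKernelCircle := by
  have h : ∀ n : ℤ, Measurable fun z : ℝ × ℝ => heatKernelLine (z.1, z.2 + n) := fun n =>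
    measurable_heatKernelLine.comp (by fun_prop)
  exact Measurable.tsum h

lemma circD_add_int (t x : ℝ) (n : ℤ) : circD (t, x + n) = circD (t, x) := by
  unfold circD
  rw [← (Equiv.addRight n).tsum_eq (fun m : ℤ => lineD (t, x + m))]
  refine tsum_congr fun m => ?_
  simp only [Equiv.coe_addRight]
  push_cast; ring_nf

lemma heatKernelCircle_add_int (t x : ℝ) (n : ℤ) :
    heatKernelCircle (t, x + n) = heatKernelCircle (t, x) := by
  unfold heatKernelCircle
  rw [← (Equiv.addRight n).tsum_eq (fun m : ℤ => heatKernelLine (t, x + m))]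
  refine tsum_congr fun m => ?_
  simp only [Equiv.coe_addRight]
  push_cast; ring_nf

lemma heatKernelCircle_neg (t x : ℝ) : heatKernelCircle (t, -x) = heatKernelCircle (t, x) := by
  unfold heatKernelCircle
  rw [← (Equiv.neg ℤ).tsum_eq (fun m : ℤ => heatKernelLine (t, -x + m))]
  refine tsum_congr fun m => ?_
  simp only [Equiv.neg_apply]
  rw [← heatKernelLine_neg]
  push_cast; ring_nf

lemma circle_norm_eq_round (x : ℝ) : |x - round x| = ‖(x : UnitAddCircle)‖ :=
  (UnitAddCircle.norm_eq).symm

lemma circle_norm_le_abs_add_int (x : ℝ) (n : ℤ) : ‖(x : UnitAddCircle)‖ ≤ |x + n| := by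
  have := circle_norm_le (x + n)
  simpa using this

lemma pd_le_sqrt_add (t x : ℝ) (ht : 0 ≤ t) : pd (t, x) ≤ Real.sqrt t + ‖(x : UnitAddCircle)‖ := by
  unfold pd
  simp only [abs_of_nonneg ht]
  gcongr
  exact min_le_left _ _

lemma pd_pos {t : ℝ} (ht : t ≠ 0) (x : ℝ) : 0 < pd (t, x) := by
  have : 0 < Real.sqrt |t| := Real.sqrt_pos.2 (abs_pos.2 ht)
  unfold pd
  have := norm_nonneg (x : UnitAddCircle)
  positivity

lemma le_div_pd_pow {t x A C : ℝ} (ht : 0 < t) (hA : 0 ≤ A) (hC : 0 ≤ C) (k : ℕ) {X : ℝ}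
    (h : X ≤ A / (Real.sqrt t + ‖(x : UnitAddCircle)‖) ^ k + C) :
    X ≤ (A + C * (3 / 2) ^ k) / pd (t, x) ^ k := by
  have h1 := pd_pos ht.ne' x
  have h2 := pd_le_sqrt_add t x ht.le
  have h3 := pd_le (t, x)
  rw [add_div]
  refine h.trans (add_le_add (by gcongr) ?_)
  rw [le_div_iff₀ (by positivity)]
  gcongr

lemma exists_circD_sub_lineD_le : ∃ A : ℝ, 0 < A ∧ ∀ t x : ℝ, 0 < t →
    |circD (t, x) - lineD (t, x - round x)| ≤ A := by
  obtain ⟨A, hA, h⟩ := exists_lineD_le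
  obtain ⟨C, hC, hp⟩ := exists_periodisation 2 le_rfl
  exact ⟨A * C, by positivity, fun t x ht =>
    (hp (Real.sqrt t) A (fun x => lineD (t, x)) x (by positivity) hA.le fun n => h t _ ht).2⟩

lemma exists_circD_le_line : ∃ A C : ℝ, 0 < A ∧ 0 < C ∧ ∀ t x : ℝ, 0 < t →
    |circD (t, x)| ≤ A / (Real.sqrt t + ‖(x : UnitAddCircle)‖) ^ 2 + C := by
  obtain ⟨A, hA, h⟩ := exists_lineD_le
  obtain ⟨C, hC, hp⟩ := exists_circD_sub_lineD_le
  refine ⟨A, C, hA, hC, fun t x ht => ?_⟩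
  have h1 := h t (x - round x) ht
  rw [circle_norm_eq_round] at h1
  have h2 := hp t x ht
  have h3 := abs_sub_abs_le_abs_sub (circD (t, x)) (lineD (t, x - round x))
  linarith

lemma exists_circD_le_pd : ∃ A : ℝ, 0 < A ∧ ∀ t x : ℝ, 0 < t →
    |circD (t, x)| ≤ A / pd (t, x) ^ 2 := by
  obtain ⟨A, C, hA, hC, h⟩ := exists_circD_le_line
  exact ⟨A + C * (3 / 2) ^ 2, by positivity, fun t x ht =>
    le_div_pd_pow ht hA.le hC.le 2 (h t x ht)⟩

lemma exists_circD_le_inv : ∃ A : ℝ, 0 < A ∧ ∀ t x : ℝ, 0 < t → |circD (t, x)| ≤ A / t := by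
  obtain ⟨A, C, hA, hC, h⟩ := exists_circD_le_line
  obtain ⟨A', hA', h'⟩ := exists_circD_le_large
  refine ⟨A + C + A', by positivity, fun t x ht => ?_⟩
  have hs : 0 < Real.sqrt t := Real.sqrt_pos.2 ht
  rw [le_div_iff₀ ht]
  rcases le_total t 1 with h1 | h1
  · have h2 : |circD (t, x)| ≤ A / Real.sqrt t ^ 2 + C := (h t x ht).trans (by
      have := norm_nonneg (x : UnitAddCircle)
      gcongr; linarith)
    rw [Real.sq_sqrt ht.le] at h2
    calc |circD (t, x)| * t ≤ (A / t + C) * t := by gcongr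
      _ = A + C * t := by field_simp
      _ ≤ _ := by nlinarith
  · calc |circD (t, x)| * t ≤ A' / t ^ 2 * t := by gcongr; exact h' t x ht
      _ = A' / t := by field_simp
      _ ≤ A' / 1 := by gcongr
      _ ≤ _ := by rw [div_one]; linarith

lemma exists_heatKernelCircle_sub_line_le : ∃ A : ℝ, 0 < A ∧ ∀ t x : ℝ, 0 < t → t ≤ 1 →
    |heatKernelCircle (t, x) - heatKernelLine (t, x - round x)| ≤ A := by
  obtain ⟨A, hA, h⟩ := exists_heatKernelLine_le_three
  obtain ⟨C, hC, hp⟩ := exists_periodisation 3 (by norm_num)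
  refine ⟨A * C, by positivity, fun t x ht ht1 => ?_⟩
  refine (hp (Real.sqrt t) A (fun x => heatKernelLine (t, x)) x (by positivity) hA.le fun n => ?_).2
  rw [abs_of_nonneg (heatKernelLine_nonneg _)]
  refine (h t _ ht).trans ?_
  gcongr
  nlinarith

lemma summable_heatKernelLine {t : ℝ} (ht : 0 < t) (x : ℝ) :
    Summable (fun n : ℤ => heatKernelLine (t, x + n)) := by
  obtain ⟨A, hA, h⟩ := exists_heatKernelLine_le_three
  obtain ⟨C, hC, hp⟩ := exists_periodisation 3 (by norm_num)
  exact (hp (Real.sqrt t) (A * t) (fun x => heatKernelLine (t, x)) x (by positivity)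
    (by positivity) fun n => by
      rw [abs_of_nonneg (heatKernelLine_nonneg _)]; exact h t _ ht).1.of_abs

lemma exists_heatKernelCircle_le_pd : ∃ A : ℝ, 0 < A ∧ ∀ t x : ℝ, 0 < t →
    |heatKernelCircle (t, x) - 1| ≤ A / pd (t, x) := by
  obtain ⟨A, hA, h⟩ := exists_heatKernelLine_le_one
  obtain ⟨C, hC, hp⟩ := exists_heatKernelCircle_sub_line_le
  obtain ⟨A', hA', h'⟩ := exists_heatKernelCircle_sub_one_le
  refine ⟨A + (C + 1 + A') * (3 / 2) ^ 1, by positivity, fun t x ht => ?_⟩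
  rw [← pow_one (pd (t, x))]
  refine le_div_pd_pow ht hA.le (by positivity) 1 ?_
  rw [pow_one]
  have hn := norm_nonneg (x : UnitAddCircle)
  have hs : 0 < Real.sqrt t := Real.sqrt_pos.2 ht
  rcases le_total t 1 with h1 | h1
  · have h2 := h t (x - round x) ht
    rw [circle_norm_eq_round] at h2
    have h3 := hp t x ht h1
    rw [abs_le] at h3 ⊢
    have h4 := heatKernelLine_nonneg (t, x - round x)
    have : 0 ≤ A / (Real.sqrt t + ‖(x : UnitAddCircle)‖) := by positivity
    constructor <;> linarith
  · have h2 : |heatKernelCircle (t, x) - 1| ≤ A' / 1 := (h' t x ht).trans (by gcongr; nlinarith)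
    have : 0 ≤ A / (Real.sqrt t + ‖(x : UnitAddCircle)‖) := by positivity
    rw [div_one] at h2
    linarith

/-- The regularity of `∂_x P` on the line passes to the nearest periodic image; the other images are
smooth. -/
lemma exists_circD_shift_le : ∃ A : ℝ, 0 < A ∧ ∀ s s' x x' : ℝ, 0 < s → 0 < s' →
    2 * (Real.sqrt |s - s'| + |x - x'|) ≤ pd (s, x) →
    |circD (s, x) - circD (s', x')|
      ≤ A * (Real.sqrt |s - s'| + |x - x'|) / pd (s, x) ^ 3 := by
  obtain ⟨A, hA, h⟩ := exists_lineD_sub_le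
  obtain ⟨C, hC, hp⟩ := exists_periodisation 3 (by norm_num)
  refine ⟨A + A * C * (3 / 2) ^ 3, by positivity, fun s s' x x' hs hs' hh => ?_⟩
  set δ := Real.sqrt |s - s'| + |x - x'| with hδ
  have hδ0 : 0 ≤ δ := by positivity
  have key : ∀ n : ℤ, |lineD (s, x + n) - lineD (s', x + n + (x' - x))|
      ≤ A * δ / (Real.sqrt s + |x + n|) ^ 3 := fun n => by
    have e : |x + n - (x + n + (x' - x))| = |x - x'| := by congr 1; ring
    have := h s s' (x + n) (x + n + (x' - x)) hs hs' (by
      rw [e]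
      refine hh.trans ((pd_le_sqrt_add s x hs.le).trans ?_)
      gcongr
      exact circle_norm_le_abs_add_int x n)
    rwa [e] at this
  have h1 := (hp (Real.sqrt s) (A * δ) (fun y => lineD (s, y) - lineD (s', y + (x' - x))) x
    (by positivity) (by positivity) key).2
  have h2 : ∑' n : ℤ, (lineD (s, x + n) - lineD (s', x + n + (x' - x)))
      = circD (s, x) - circD (s', x') := by
    have := (hasSum_circD s x).sub (hasSum_circD s' x')
    rw [← this.tsum_eq]
    refine tsum_congr fun n => ?_
    congr 3; ring
  rw [h2] at h1
  have h3 := key (-round x)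
  push_cast at h3
  rw [← sub_eq_add_neg, circle_norm_eq_round] at h3
  have h4 : |circD (s, x) - circD (s', x')|
      ≤ A * δ / (Real.sqrt s + ‖(x : UnitAddCircle)‖) ^ 3 + A * δ * C := by
    have := abs_sub_abs_le_abs_sub (circD (s, x) - circD (s', x'))
      (lineD (s, x - round x) - lineD (s', x - round x + (x' - x)))
    linarith
  refine (le_div_pd_pow hs (by positivity) (by positivity) 3 h4).trans (le_of_eq ?_)
  ring

/-- Unfolding the integral of a periodisation over a period. -/
lemma lintegral_Ico_periodisation_le {f : ℝ → ℝ} (hf : Integrable f) (g : ℝ → ℝ)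
    (hg : ∀ x, g x = ∑' n : ℤ, f (x + n)) :
    IntegrableOn g (Ico 0 1) ∧ ∫ x in Ico (0 : ℝ) 1, |g x| ≤ ∫ x, |f x| ∧
      ∫ x in Ico (0 : ℝ) 1, g x = ∫ x, f x := by
  have hfn : ∀ n : ℤ, IntegrableOn (fun x => f (x + n)) (Ico 0 1) := fun n =>
    (hf.comp_add_right (n : ℝ)).integrableOn
  have e : ∀ φ : ℝ → ℝ, ∫ x in Ico (0 : ℝ) 1, φ x = ∫ x in (0 : ℝ)..1, φ x := fun φ => by
    rw [intervalIntegral.integral_of_le zero_le_one, integral_Ico_eq_integral_Ioo,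
      integral_Ioc_eq_integral_Ioo]
  have hs := hf.abs.hasSum_intervalIntegral_comp_add_int
  have h1 := hasSum_integral_of_summable_integral_norm hfn (by
    simp_rw [e, Real.norm_eq_abs]; exact hs.summable)
  have hg' : g = fun x => ∑' n : ℤ, f (x + n) := funext hg
  have hmain : ∫ x in Ico (0 : ℝ) 1, g x = ∫ x, f x := by
    rw [hg']
    refine h1.unique ?_
    simp_rw [e]
    exact hf.hasSum_intervalIntegral_comp_add_int
  have hL : ∑' n : ℤ, ∫⁻ x in Ico (0 : ℝ) 1, ‖f (x + n)‖ₑ = ∫⁻ x, ‖f x‖ₑ := by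
    have : ∀ n : ℤ, ∫⁻ x in Ico (0 : ℝ) 1, ‖f (x + n)‖ₑ
        = ENNReal.ofReal (∫ x in (0 : ℝ)..1, |f (x + n)|) := fun n => by
      rw [← e, ofReal_integral_eq_lintegral_ofReal (hfn n).abs (ae_of_all _ fun _ => abs_nonneg _)]
      simp_rw [← Real.norm_eq_abs, ofReal_norm]
    simp_rw [this]
    rw [← ENNReal.ofReal_tsum_of_nonneg (fun n => intervalIntegral.integral_nonneg zero_le_one
      fun _ _ => abs_nonneg _) hs.summable, hs.tsum_eq,
      ofReal_integral_eq_lintegral_ofReal hf.abs (ae_of_all _ fun _ => abs_nonneg _)]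
    simp_rw [← Real.norm_eq_abs, ofReal_norm]
  have hm : AEStronglyMeasurable g (volume.restrict (Ico 0 1)) := by
    rw [hg']
    exact (AEMeasurable.tsum fun n => (hfn n).aestronglyMeasurable.aemeasurable).aestronglyMeasurable
  have hle : ∫⁻ x in Ico (0 : ℝ) 1, ‖g x‖ₑ ≤ ∫⁻ x, ‖f x‖ₑ := by
    rw [← hL, ← lintegral_tsum fun n => (hfn n).aestronglyMeasurable.enorm]
    refine lintegral_mono fun x => ?_
    rw [hg]
    exact enorm_tsum_le_tsum_enorm
  have hfin : HasFiniteIntegral g (volume.restrict (Ico 0 1)) := hle.trans_lt hf.2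
  refine ⟨⟨hm, hfin⟩, ?_, hmain⟩
  simp_rw [← Real.norm_eq_abs]
  rw [integral_norm_eq_lintegral_enorm hm, integral_norm_eq_lintegral_enorm hf.1]
  exact ENNReal.toReal_mono hf.2.ne hle

lemma lineDD_neg (t x : ℝ) : lineDD (t, -x) = lineDD (t, x) := by
  simp [lineDD, heatKernelLine_neg]

lemma measurable_lineDD : Measurable lineDD := by
  have := measurable_heatKernelLine
  unfold lineDD; fun_prop

lemma integral_lineD_mul_lineD_shift {s s' : ℝ} (hs : 0 < s) (hs' : 0 < s') (a b : ℝ) :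
    ∫ y, lineD (s, a - y) * lineD (s', b - y) = -lineDD (s + s', b - a) := by
  rw [← integral_add_right_eq_self _ b]
  have : ∀ y, lineD (s, a - (y + b)) * lineD (s', b - (y + b))
      = -(lineD (s, (a - b) - y) * lineD (s', y)) := fun y => by
    rw [show b - (y + b) = -y by ring, lineD_neg, show a - (y + b) = a - b - y by ring]; ring
  simp_rw [this]
  rw [integral_neg, integral_lineD_mul_lineD hs hs', ← lineDD_neg, neg_sub]

lemma exists_tsum_abs_lineD_le {t : ℝ} (ht : 0 < t) : ∃ B : ℝ, ∀ x : ℝ,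
    Summable (fun n : ℤ => |lineD (t, x + n)|) ∧ ∑' n : ℤ, |lineD (t, x + n)| ≤ B := by
  obtain ⟨A, hA, h⟩ := exists_lineD_le
  obtain ⟨C, hC, hp⟩ := exists_periodisation 2 le_rfl
  refine ⟨A / t + A * C, fun x => ?_⟩
  have h1 := hp (Real.sqrt t) A (fun x => |lineD (t, x)|) x (by positivity) hA.le
    fun n => by rw [abs_abs]; exact h t _ ht
  refine ⟨by simpa only [abs_abs] using h1.1, ?_⟩
  have h2 : |lineD (t, x - round x)| ≤ A / t := by
    refine (h t _ ht).trans ?_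
    gcongr
    nth_rw 1 [← Real.sq_sqrt ht.le]
    gcongr
    have := abs_nonneg (x - round x)
    linarith
  have h3 := (abs_le.1 h1.2).2
  linarith

/-- The correlation of two space derivatives of the heat kernel of the circle at different times,
obtained by unfolding one of the two to the line. -/
lemma integral_circD_mul_circD {s s' : ℝ} (hs : 0 < s) (hs' : 0 < s') (a b : ℝ) :
    ∫ y in Ico (0 : ℝ) 1, circD (s, a - y) * circD (s', b - y)
      = ∑' m : ℤ, -lineDD (s + s', b - a + m) := by
  obtain ⟨B, hB⟩ := exists_tsum_abs_lineD_le hs'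
  have hcB : ∀ x, |circD (s', x)| ≤ B := fun x =>
    (norm_tsum_le_tsum_norm (f := fun n : ℤ => lineD (s', x + n)) (hB x).1).trans (hB x).2
  have hi : Integrable (fun y => lineD (s, a - y)) := integrable_lineD.comp_sub_left a
  have hmc : Measurable fun y : ℝ => circD (s', b - y) := measurable_circD.comp (by fun_prop)
  have hf : Integrable (fun y => lineD (s, a - y) * circD (s', b - y)) :=
    hi.mul_bdd (c := B) hmc.aestronglyMeasurable (ae_of_all _ fun y => hcB _)
  have hper := (lintegral_Ico_periodisation_le hf (fun y => circD (s, a - y) * circD (s', b - y))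
    fun y => ?_).2.2
  · rw [hper]
    have hsum := hasSum_integral_of_dominated_convergence (μ := volume)
      (F := fun (m : ℤ) (y : ℝ) => lineD (s, a - y) * lineD (s', b + m - y))
      (f := fun y => lineD (s, a - y) * circD (s', b - y))
      (fun (m : ℤ) (y : ℝ) => |lineD (s, a - y)| * |lineD (s', b - y + m)|)
      (fun m => ?_) (fun m => ae_of_all _ fun y => ?_) (ae_of_all _ fun y => ?_) ?_
      (ae_of_all _ fun y => ?_)
    · rw [← hsum.tsum_eq]
      refine tsum_congr fun m => ?_
      rw [integral_lineD_mul_lineD_shift hs hs', show b + m - a = b - a + (m : ℝ) by ring]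
    · exact ((measurable_lineD.comp (by fun_prop)).mul
        (measurable_lineD.comp (by fun_prop))).aestronglyMeasurable
    · rw [Real.norm_eq_abs, abs_mul, show b + m - y = b - y + (m : ℝ) by ring]
    · exact (hB _).1.mul_left _
    · simp_rw [tsum_mul_left]
      refine hi.abs.mul_bdd (c := B) ?_ (ae_of_all _ fun y => ?_)
      · have : Measurable fun y : ℝ => ∑' m : ℤ, |lineD (s', b - y + m)| := by
          refine Measurable.tsum fun m => ?_
          exact (continuous_abs.measurable.comp (measurable_lineD.comp (by fun_prop)))
        exact this.aestronglyMeasurable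
      · rw [Real.norm_eq_abs, abs_of_nonneg (tsum_nonneg fun _ => abs_nonneg _)]
        exact (hB _).2
    · refine ((hasSum_circD s' (b - y)).mul_left _).congr_fun fun m => ?_
      rw [show b + m - y = b - y + (m : ℝ) by ring]
  · have h1 : HasSum (fun n : ℤ => lineD (s, a - (y + n))) (circD (s, a - y)) := by
      rw [← (Equiv.neg ℤ).hasSum_iff]
      refine (hasSum_circD s (a - y)).congr_fun fun n => ?_
      simp only [Function.comp, Equiv.neg_apply]
      push_cast; congr 2; ring
    rw [← (h1.mul_right (circD (s', b - y))).tsum_eq]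
    refine tsum_congr fun n => ?_
    congr 1
    have := circD_add_int s' (b - (y + n)) n
    rw [← this]; congr 2; ring

/-- The heat equation `∂_t P = ∂_x² P` turns the time integral into boundary terms. -/
lemma integral_lineDD_time {h T : ℝ} (hh : 0 < h) (hT : 0 ≤ T) (x : ℝ) :
    ∫ s in (0 : ℝ)..T, -lineDD (s + (s + h), x)
      = (1 / 2) * (heatKernelLine (h, x) - heatKernelLine (2 * T + h, x)) := by
  obtain ⟨A, hA, hb⟩ := exists_lineDD_le
  have hpos : ∀ s ∈ uIcc 0 T, 0 < s + (s + h) := fun s hs => by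
    rw [uIcc_of_le hT] at hs; linarith [hs.1]
  have hd : ∀ s ∈ uIcc 0 T, HasDerivAt (fun s => -(1 / 2) * heatKernelLine (s + (s + h), x))
      (-lineDD (s + (s + h), x)) s := fun s hs => by
    have h1 := (hasDerivAt_heatKernelLine_time (hpos s hs) x)
    have h2 : HasDerivAt (fun s : ℝ => s + (s + h)) (1 + 1) s :=
      (hasDerivAt_id s).add ((hasDerivAt_id s).add_const h)
    have h3 := (h1.comp s h2).const_mul (-(1 / 2))
    refine h3.congr_deriv ?_
    ring
  have hi : IntervalIntegrable (fun s => -lineDD (s + (s + h), x)) volume 0 T := by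
    rw [intervalIntegrable_iff, uIoc_of_le hT]
    refine Measure.integrableOn_of_bounded (M := A / Real.sqrt h ^ 3) (by simp)
      (measurable_lineDD.comp (by fun_prop)).neg.aestronglyMeasurable ?_
    filter_upwards [ae_restrict_mem measurableSet_Ioc] with s hs
    rw [norm_neg, Real.norm_eq_abs]
    refine (hb _ x (by linarith [hs.1])).trans ?_
    have := Real.sqrt_pos.2 hh
    gcongr
    have h1 : Real.sqrt h ≤ Real.sqrt (s + (s + h)) := Real.sqrt_le_sqrt (by linarith [hs.1])
    have := abs_nonneg x
    linarith
  rw [intervalIntegral.integral_eq_sub_of_hasDerivAt hd hi]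
  rw [show T + (T + h) = 2 * T + h by ring]
  simp; ring

lemma integral_circD_mul_circD_time {h T : ℝ} (hh : 0 < h) (hT : 0 ≤ T) (a b : ℝ) :
    ∫ s in (0 : ℝ)..T, ∫ y in Ico (0 : ℝ) 1, circD (s, a - y) * circD (s + h, b - y)
      = (1 / 2) * (heatKernelCircle (h, b - a) - heatKernelCircle (2 * T + h, b - a)) := by
  obtain ⟨A, hA, hb⟩ := exists_lineDD_le
  obtain ⟨C, hC, hp⟩ := exists_periodisation 3 (by norm_num)
  have hsh := Real.sqrt_pos.2 hh
  have hsB : Summable fun m : ℤ => A / (Real.sqrt h + |b - a + m|) ^ 3 := by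
    have := (hp (Real.sqrt h) A (fun x => A / (Real.sqrt h + |x|) ^ 3) (b - a) (by positivity) hA.le
      fun n => by rw [abs_of_nonneg (by positivity)]).1
    refine this.congr fun n => ?_
    rw [abs_of_nonneg (by positivity)]
  have hbd : ∀ s x : ℝ, 0 < s → |-lineDD (s + (s + h), x)| ≤ A / (Real.sqrt h + |x|) ^ 3 := by
    intro s x hs
    rw [abs_neg]
    refine (hb _ x (by linarith)).trans ?_
    gcongr
    linarith
  have h1 := intervalIntegral.hasSum_integral_of_dominated_convergence (a := 0) (b := T)
    (μ := volume) (F := fun (m : ℤ) (s : ℝ) => -lineDD (s + (s + h), b - a + m))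
    (f := fun s => ∑' m : ℤ, -lineDD (s + (s + h), b - a + m))
    (fun m _ => A / (Real.sqrt h + |b - a + m|) ^ 3)
    (fun m => (measurable_lineDD.comp (by fun_prop)).neg.aestronglyMeasurable)
    (fun m => ae_of_all _ fun s hs => hbd s _ ((uIoc_of_le hT ▸ hs).1))
    (ae_of_all _ fun s _ => hsB) intervalIntegrable_const
    (ae_of_all _ fun s hs => (Summable.of_norm_bounded hsB
      fun m => hbd s _ ((uIoc_of_le hT ▸ hs).1)).hasSum)
  have h2 : ∫ s in (0 : ℝ)..T, ∫ y in Ico (0 : ℝ) 1, circD (s, a - y) * circD (s + h, b - y)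
      = ∫ s in (0 : ℝ)..T, ∑' m : ℤ, -lineDD (s + (s + h), b - a + m) := by
    refine intervalIntegral.integral_congr_ae (ae_of_all _ fun s hs => ?_)
    have hs0 : 0 < s := (uIoc_of_le hT ▸ hs).1
    exact integral_circD_mul_circD hs0 (by linarith) a b
  rw [h2]
  refine h1.unique ?_
  simp_rw [integral_lineDD_time hh hT]
  exact (((summable_heatKernelLine hh _).hasSum).sub
    ((summable_heatKernelLine (by linarith : 0 < 2 * T + h) _).hasSum)).mul_left (1 / 2)

/-! ### Correlations of the kernel of the noise -/

/-- `G` is a kernel of the type of the space derivative of the heat kernel, on a space with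
reference measure `S`, and `Q` is the space-time correlation function of `G`. -/
structure IsNoiseKernel (S : Measure ℝ) (G Q : ℝ × ℝ → ℝ) : Prop where
  meas : Measurable G
  zero : ∀ z, z.1 ≤ 0 → G z = 0
  sup : ∃ A : ℝ, 0 < A ∧ ∀ t x : ℝ, 0 < t → |G (t, x)| ≤ A / t
  integrable : ∀ t x, Integrable (fun y => G (t, x - y)) S
  l1 : ∃ A : ℝ, 0 < A ∧ ∀ t x : ℝ, 0 < t → ∫ y, |G (t, x - y)| ∂S ≤ A / Real.sqrt t
  corr : ∀ h a b : ℝ, 0 < h → Tendsto (fun T : ℝ => ∫ s in (0 : ℝ)..T,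
    ∫ y, G (s, a - y) * G (s + h, b - y) ∂S) atTop (𝓝 (Q (h, b - a)))
  corr_neg : ∀ z, Q (-z) = Q z

/-- The correlation function of the kernel on the line. -/
noncomputable def lineQ (z : ℝ × ℝ) : ℝ := (1 / 2) * heatKernelLine (|z.1|, z.2)

/-- The correlation function of the kernel on the circle. The constant mode `1` of the heat kernel is
annihilated by the space derivative and does not contribute. -/
noncomputable def circQ (z : ℝ × ℝ) : ℝ := (1 / 2) * (heatKernelCircle (|z.1|, z.2) - 1)

lemma tendsto_heatKernelLine_atTop (x : ℝ) :
    Tendsto (fun t => heatKernelLine (t, x)) atTop (𝓝 0) := by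
  obtain ⟨A, hA, h⟩ := exists_heatKernelLine_le_one
  refine tendsto_of_tendsto_of_tendsto_of_le_of_le' tendsto_const_nhds
    (h := fun t => A / Real.sqrt t) ?_ (Eventually.of_forall fun t => heatKernelLine_nonneg _) ?_
  · exact Tendsto.div_atTop tendsto_const_nhds Real.tendsto_sqrt_atTop
  · filter_upwards [eventually_gt_atTop 0] with t ht
    refine (h t x ht).trans ?_
    have := Real.sqrt_pos.2 ht
    gcongr
    have := abs_nonneg x
    linarith

lemma tendsto_heatKernelCircle_atTop (x : ℝ) :
    Tendsto (fun t => heatKernelCircle (t, x)) atTop (𝓝 1) := by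
  obtain ⟨A, hA, h⟩ := exists_heatKernelCircle_sub_one_le
  rw [tendsto_iff_norm_sub_tendsto_zero]
  refine tendsto_of_tendsto_of_tendsto_of_le_of_le' tendsto_const_nhds
    (h := fun t => A / t ^ 2) ?_ (Eventually.of_forall fun t => norm_nonneg _) ?_
  · exact Tendsto.div_atTop tendsto_const_nhds (tendsto_pow_atTop two_ne_zero)
  · filter_upwards [eventually_gt_atTop 0] with t ht
    exact h t x ht

lemma tendsto_two_mul_add_atTop (h : ℝ) : Tendsto (fun T : ℝ => 2 * T + h) atTop atTop :=
  tendsto_atTop_add_const_right _ _ (tendsto_id.const_mul_atTop two_pos)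

lemma isNoiseKernel_line : IsNoiseKernel volume lineD lineQ where
  meas := measurable_lineD
  zero := fun z => lineD_of_nonpos
  sup := by
    obtain ⟨A, hA, h⟩ := exists_lineD_le
    refine ⟨A, hA, fun t x ht => (h t x ht).trans ?_⟩
    gcongr
    nth_rw 1 [← Real.sq_sqrt ht.le]
    gcongr
    have := abs_nonneg x
    linarith
  integrable := fun t x => integrable_lineD.comp_sub_left x
  l1 := by
    obtain ⟨A, hA, h⟩ := exists_integral_abs_lineD_le
    refine ⟨A, hA, fun t x ht => ?_⟩
    rw [integral_sub_left_eq_self (fun y => |lineD (t, y)|)]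
    exact h t ht
  corr := fun h a b hh => by
    have e : ∀ᶠ T : ℝ in atTop, (1 / 2) * (heatKernelLine (h, b - a)
        - heatKernelLine (2 * T + h, b - a)) = ∫ s in (0 : ℝ)..T,
          ∫ y, lineD (s, a - y) * lineD (s + h, b - y) := by
      filter_upwards [eventually_ge_atTop 0] with T hT
      rw [← integral_lineDD_time hh hT]
      refine intervalIntegral.integral_congr_ae (ae_of_all _ fun s hs => ?_)
      have hs0 : 0 < s := (uIoc_of_le hT ▸ hs).1
      exact (integral_lineD_mul_lineD_shift hs0 (by linarith) a b).symm
    refine Tendsto.congr' e ?_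
    have := ((tendsto_heatKernelLine_atTop (b - a)).comp
      (tendsto_two_mul_add_atTop h)).const_sub (heatKernelLine (h, b - a))
    simpa only [lineQ, abs_of_pos hh, sub_zero, Function.comp_def] using this.const_mul (1 / 2)
  corr_neg := fun z => by simp [lineQ, heatKernelLine_neg]

lemma lineD_periodisation (t x y : ℝ) : circD (t, x - y) = ∑' n : ℤ, lineD (t, x - (y + n)) := by
  unfold circD
  rw [← (Equiv.neg ℤ).tsum_eq]
  refine tsum_congr fun n => ?_
  simp only [Equiv.neg_apply]
  push_cast; congr 2; ring

lemma isNoiseKernel_circle : IsNoiseKernel (volume.restrict (Ico 0 1)) circD circQ where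
  meas := measurable_circD
  zero := fun z => circD_of_nonpos
  sup := exists_circD_le_inv
  integrable := fun t x => (lintegral_Ico_periodisation_le (integrable_lineD.comp_sub_left x) _
    (fun y => lineD_periodisation t x y)).1
  l1 := by
    obtain ⟨A, hA, h⟩ := exists_integral_abs_lineD_le
    refine ⟨A, hA, fun t x ht => ?_⟩
    refine (lintegral_Ico_periodisation_le (integrable_lineD.comp_sub_left x) _
      (fun y => lineD_periodisation t x y)).2.1.trans ?_
    rw [integral_sub_left_eq_self (fun y => |lineD (t, y)|)]
    exact h t ht
  corr := fun h a b hh => by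
    have e : ∀ᶠ T : ℝ in atTop, (1 / 2) * (heatKernelCircle (h, b - a)
        - heatKernelCircle (2 * T + h, b - a)) = ∫ s in (0 : ℝ)..T,
          ∫ y in Ico (0 : ℝ) 1, circD (s, a - y) * circD (s + h, b - y) := by
      filter_upwards [eventually_ge_atTop 0] with T hT
      rw [integral_circD_mul_circD_time hh hT]
    refine Tendsto.congr' e ?_
    have := ((tendsto_heatKernelCircle_atTop (b - a)).comp
      (tendsto_two_mul_add_atTop h)).const_sub (heatKernelCircle (h, b - a))
    simpa only [circQ, abs_of_pos hh, Function.comp_def] using this.const_mul (1 / 2)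
  corr_neg := fun z => by simp [circQ, heatKernelCircle_neg]

/-- A function of time dominating `s ^ (-1/2) (s + h)⁻¹` on the positive half-line. -/
lemma exists_time_majorant {h : ℝ} (hh : 0 < h) : ∃ D : ℝ → ℝ, Integrable D ∧
    (∀ s, 0 ≤ D s) ∧ (∀ s, 0 < s → 1 / (Real.sqrt s * (s + h)) ≤ D s) ∧
    ∫ s, D s = 4 / Real.sqrt h := by
  have e1 : ∀ s : ℝ, 0 < s → s ^ (-(1 / 2) : ℝ) = 1 / Real.sqrt s := fun s hs => by
    rw [Real.rpow_neg hs.le, ← Real.sqrt_eq_rpow, ← one_div]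
  have i1 : IntegrableOn (fun s : ℝ => s ^ (-(1 / 2) : ℝ) * h⁻¹) (Ioc 0 h) :=
    ((intervalIntegral.intervalIntegrable_rpow' (by norm_num)).1).mul_const _
  have i2 : IntegrableOn (fun s : ℝ => s ^ (-(3 / 2) : ℝ)) (Ioi h) :=
    integrableOn_Ioi_rpow_of_lt (by norm_num) hh
  refine ⟨fun s => (Ioc 0 h).indicator (fun s : ℝ => s ^ (-(1 / 2) : ℝ) * h⁻¹) s
    + (Ioi h).indicator (fun s : ℝ => s ^ (-(3 / 2) : ℝ)) s, ?_, fun s => ?_, fun s hs => ?_, ?_⟩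
  · exact (i1.integrable_indicator measurableSet_Ioc).add
      (i2.integrable_indicator measurableSet_Ioi)
  · refine add_nonneg (indicator_nonneg (fun s hs => ?_) _) (indicator_nonneg (fun s hs => ?_) _)
    · have := Real.rpow_nonneg hs.1.le (-(1 / 2)); positivity
    · exact Real.rpow_nonneg (hh.le.trans (le_of_lt hs)) _
  · have hq := Real.sqrt_pos.2 hs
    dsimp only
    rcases le_or_gt s h with h1 | h1
    · rw [indicator_of_mem (show s ∈ Ioc 0 h from ⟨hs, h1⟩),
        indicator_of_notMem (show s ∉ Ioi h from not_lt.2 h1), add_zero, e1 s hs, ← one_div,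
        ← one_div_mul_one_div]
      gcongr
      linarith
    · rw [indicator_of_notMem (show s ∉ Ioc 0 h from fun h' => not_le.2 h1 h'.2),
        indicator_of_mem (show s ∈ Ioi h from h1), zero_add]
      rw [show (-(3 / 2) : ℝ) = -(1 / 2) + (-1) by norm_num, Real.rpow_add hs, e1 s hs,
        Real.rpow_neg_one, ← one_div, ← one_div_mul_one_div, one_div s, ← one_div]
      gcongr
      linarith
  · rw [integral_add (i1.integrable_indicator measurableSet_Ioc)
      (i2.integrable_indicator measurableSet_Ioi), integral_indicator measurableSet_Ioc,
      integral_indicator measurableSet_Ioi, integral_Ioi_rpow_of_lt (by norm_num) hh,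
      integral_mul_const, ← intervalIntegral.integral_of_le hh.le,
      integral_rpow (Or.inl (by norm_num))]
    have hq := Real.sqrt_pos.2 hh
    have e2 : h ^ (1 / 2 : ℝ) = Real.sqrt h := (Real.sqrt_eq_rpow h).symm
    have e3 : h = Real.sqrt h * Real.sqrt h := (Real.mul_self_sqrt hh.le).symm
    norm_num
    rw [e2, Real.rpow_neg hh.le, e2]
    nth_rw 2 [e3]
    field_simp
    norm_num

section NoiseKernel

variable {S : Measure ℝ} {G Q : ℝ × ℝ → ℝ}

lemma IsNoiseKernel.exists_space_bound (hG : IsNoiseKernel S G Q) : ∃ A : ℝ, 0 < A ∧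
    ∀ s h a b : ℝ, 0 < h →
      Integrable (fun y => G (s, a - y) * G (s + h, b - y)) S ∧
      (0 < s → ∫ y, |G (s, a - y) * G (s + h, b - y)| ∂S ≤ A * (1 / (Real.sqrt s * (s + h)))) := by
  obtain ⟨A₁, hA₁, h₁⟩ := hG.sup
  obtain ⟨A₂, hA₂, h₂⟩ := hG.l1
  refine ⟨A₁ * A₂, by positivity, fun s h a b hh => ?_⟩
  have hm : ∀ t c, Measurable fun y => G (t, c - y) := fun t c => hG.meas.comp (by fun_prop)
  rcases le_or_gt s 0 with hs | hs
  · have : (fun y => G (s, a - y) * G (s + h, b - y)) = fun _ => 0 := by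
      ext y; rw [hG.zero (s, a - y) hs, zero_mul]
    rw [this]
    exact ⟨integrable_zero _ _ _, fun h => absurd h (not_lt.2 hs)⟩
  have hi : Integrable (fun y => G (s, a - y) * G (s + h, b - y)) S :=
    (hG.integrable s a).mul_bdd (c := A₁ / (s + h)) (hm _ _).aestronglyMeasurable
      (ae_of_all _ fun y => h₁ _ _ (by linarith))
  refine ⟨hi, fun _ => ?_⟩
  calc ∫ y, |G (s, a - y) * G (s + h, b - y)| ∂S
      ≤ ∫ y, |G (s, a - y)| * (A₁ / (s + h)) ∂S := by
        refine integral_mono hi.abs ((hG.integrable s a).abs.mul_const _) fun y => ?_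
        rw [abs_mul]
        gcongr
        exact h₁ _ _ (by linarith)
    _ ≤ A₂ / Real.sqrt s * (A₁ / (s + h)) := by
        rw [integral_mul_const]
        gcongr
        exact h₂ s a hs
    _ = _ := by field_simp

/-- The space-time correlation of a noise kernel at two points with different time coordinates. -/
lemma IsNoiseKernel.exists_correlation [SFinite S] (hG : IsNoiseKernel S G Q) : ∃ A : ℝ, 0 < A ∧
    ∀ a b : ℝ × ℝ, a.1 ≠ b.1 →
      Integrable (fun w : ℝ × ℝ => G (a - w) * G (b - w)) (volume.prod S) ∧
      ∫ w, |G (a - w) * G (b - w)| ∂(volume.prod S) ≤ A / Real.sqrt |a.1 - b.1| ∧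
      ∫ w, G (a - w) * G (b - w) ∂(volume.prod S) = Q (a - b) := by
  obtain ⟨A, hA, hsp⟩ := hG.exists_space_bound
  refine ⟨A * 4, by positivity, ?_⟩
  have main : ∀ a b : ℝ × ℝ, a.1 < b.1 →
      Integrable (fun w : ℝ × ℝ => G (a - w) * G (b - w)) (volume.prod S) ∧
      ∫ w, |G (a - w) * G (b - w)| ∂(volume.prod S) ≤ A * 4 / Real.sqrt |a.1 - b.1| ∧
      ∫ w, G (a - w) * G (b - w) ∂(volume.prod S) = Q (a - b) := by
    intro a b hab
    set h := b.1 - a.1 with hh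
    have h0 : 0 < h := by linarith
    obtain ⟨D, hD, hD0, hDb, hDi⟩ := exists_time_majorant h0
    have hm : Measurable fun w : ℝ × ℝ => G (a - w) * G (b - w) :=
      (hG.meas.comp (by fun_prop)).mul (hG.meas.comp (by fun_prop))
    have hform : ∀ t y : ℝ, G (a - (t, y)) * G (b - (t, y))
        = G (a.1 - t, a.2 - y) * G (a.1 - t + h, b.2 - y) := by
      intro t y
      have : b - (t, y) = (a.1 - t + h, b.2 - y) := by
        ext
        · simp [hh]
        · simp
      rw [this]; rfl
    have hnorm : ∀ s, ∫ y, |G (s, a.2 - y) * G (s + h, b.2 - y)| ∂S ≤ A * D s := by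
      intro s
      rcases le_or_gt s 0 with hs | hs
      · have : (fun y => |G (s, a.2 - y) * G (s + h, b.2 - y)|) = fun _ => 0 := by
          ext y; rw [hG.zero (s, a.2 - y) hs, zero_mul, abs_zero]
        rw [this, integral_zero]
        exact mul_nonneg hA.le (hD0 s)
      · exact ((hsp s h _ _ h0).2 hs).trans (by gcongr; exact hDb s hs)
    have hint : Integrable (fun w : ℝ × ℝ => G (a - w) * G (b - w)) (volume.prod S) := by
      rw [integrable_prod_iff hm.aestronglyMeasurable]
      refine ⟨ae_of_all _ fun t => ?_, ?_⟩
      · simp_rw [hform]; exact (hsp _ h _ _ h0).1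
      · refine ((hD.comp_sub_left a.1).const_mul A).mono'
          (hm.norm.stronglyMeasurable.integral_prod_right).aestronglyMeasurable
          (ae_of_all _ fun t => ?_)
        simp_rw [hform, Real.norm_eq_abs]
        rw [abs_of_nonneg (integral_nonneg fun _ => abs_nonneg _)]
        exact hnorm _
    refine ⟨hint, ?_, ?_⟩
    · rw [integral_prod _ hint.abs]
      simp_rw [hform]
      rw [integral_sub_left_eq_self
        (fun s => ∫ y, |G (s, a.2 - y) * G (s + h, b.2 - y)| ∂S) volume a.1]
      calc _ ≤ ∫ s, A * D s := by
            refine integral_mono_of_nonneg (ae_of_all _ fun s =>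
              integral_nonneg fun _ => abs_nonneg _) (hD.const_mul A) (ae_of_all _ hnorm)
        _ = A * 4 / Real.sqrt |a.1 - b.1| := by
            rw [integral_const_mul, hDi, abs_sub_comm, abs_of_pos h0]; ring
    · have hint2 := hint.integral_prod_left
      rw [integral_prod _ hint]
      simp_rw [hform] at hint2 ⊢
      set I : ℝ → ℝ := fun s => ∫ y, G (s, a.2 - y) * G (s + h, b.2 - y) ∂S with hI
      have hI2 : Integrable I := by
        have := hint2.comp_sub_left a.1
        simpa using this
      rw [integral_sub_left_eq_self I volume a.1]
      have hI0 : ∀ s, s ∉ Ioi (0 : ℝ) → I s = 0 := fun s hs => by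
        have : (fun y => G (s, a.2 - y) * G (s + h, b.2 - y)) = fun _ => 0 := by
          ext y; rw [hG.zero (s, a.2 - y) (not_lt.1 hs), zero_mul]
        rw [hI]; simp only [this, integral_zero]
      rw [← setIntegral_eq_integral_of_forall_compl_eq_zero hI0]
      have l1 := intervalIntegral_tendsto_integral_Ioi 0 hI2.integrableOn tendsto_id
      have l2 := hG.corr h a.2 b.2 h0
      have e := tendsto_nhds_unique l1 l2
      rw [e, ← hG.corr_neg]
      congr 1
      ext <;> simp [hh]
  intro a b hab
  rcases lt_or_gt_of_ne hab with h | h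
  · exact main a b h
  · have := main b a h
    simp_rw [mul_comm (G (b - _))] at this
    rw [abs_sub_comm, ← neg_sub b a, hG.corr_neg]
    exact this

end NoiseKernel

lemma intervalIntegrable_inv_sqrt_abs (L : ℝ) (hL : 0 ≤ L) :
    IntervalIntegrable (fun t : ℝ => 1 / Real.sqrt |t|) volume (-L) L := by
  have h : IntervalIntegrable (fun t : ℝ => 1 / Real.sqrt |t|) volume 0 L := by
    have h1 : IntervalIntegrable (fun t : ℝ => t ^ (-(1 / 2) : ℝ)) volume 0 L :=
      intervalIntegral.intervalIntegrable_rpow' (by norm_num)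
    refine h1.congr fun t ht => ?_
    rw [uIoc_of_le hL] at ht
    rw [Real.rpow_neg ht.1.le, ← Real.sqrt_eq_rpow, ← one_div, abs_of_pos ht.1]
  have h2 := (IntervalIntegrable.iff_comp_neg).1 h
  simp only [abs_neg, neg_zero] at h2
  exact h2.symm.trans h

lemma integrableOn_box_inv_sqrt (R c : ℝ) :
    IntegrableOn (fun z : ℝ × ℝ => 1 / Real.sqrt |c - z.1|) (box R) := by
  have h := (intervalIntegrable_inv_sqrt_abs (|c| + |R|) (by positivity)).comp_sub_left c
  have h1 : IntegrableOn (fun t : ℝ => 1 / Real.sqrt |c - t|) (Icc (-R) R) := by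
    have h2 := (intervalIntegrable_iff' (by simp)).1 h
    refine h2.mono_set fun t ht => ?_
    rw [mem_uIcc]
    right
    have := le_abs_self c
    have := neg_abs_le c
    have := le_abs_self R
    have := neg_abs_le R
    constructor <;> linarith [ht.1, ht.2]
  have h2 : IntegrableOn (fun _ : ℝ => (1 : ℝ)) (Icc (-R) R) := by simp
  have := Integrable.mul_prod h1 h2
  rw [IntegrableOn, box, Measure.volume_eq_prod, ← Measure.prod_restrict]
  simpa using this

lemma ae_fst_ne (c : ℝ) : ∀ᵐ z : ℝ × ℝ, z.1 ≠ c :=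
  (Measure.quasiMeasurePreserving_fst (μ := (volume : Measure ℝ)) (ν := (volume : Measure ℝ))).ae
    (Measure.ae_ne volume c)

/-- The autocorrelation of a mollifier. -/
noncomputable def autocorr (r : ℝ × ℝ → ℝ) (κ : ℝ × ℝ) : ℝ := ∫ v, r (κ + v) * r v

lemma exists_box_of_hasCompactSupport {r : ℝ × ℝ → ℝ} (hc : HasCompactSupport r) :
    ∃ R : ℝ, 0 < R ∧ ∀ z, z ∉ box R → r z = 0 := by
  obtain ⟨R, hR⟩ := hc.isCompact.isBounded.subset_closedBall 0
  refine ⟨|R| + 1, by positivity, fun z hz => ?_⟩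
  by_contra h
  refine hz ?_
  have h1 := hR (subset_tsupport _ h)
  rw [mem_closedBall_zero_iff, Prod.norm_def, max_le_iff] at h1
  have := le_abs_self R
  exact ⟨abs_le.1 (h1.1.trans (by linarith)), abs_le.1 (h1.2.trans (by linarith))⟩

lemma box_add {R R' : ℝ} {z w : ℝ × ℝ} (hz : z ∈ box R) (hw : w ∈ box R') :
    z + w ∈ box (R + R') := by
  obtain ⟨⟨a, b⟩, c, d⟩ := hz
  obtain ⟨⟨a', b'⟩, c', d'⟩ := hw
  refine ⟨⟨?_, ?_⟩, ?_, ?_⟩ <;> simp only [Prod.fst_add, Prod.snd_add] <;> linarith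

lemma box_neg {R : ℝ} {z : ℝ × ℝ} (hz : z ∈ box R) : -z ∈ box R := by
  obtain ⟨⟨a, b⟩, c, d⟩ := hz
  refine ⟨⟨?_, ?_⟩, ?_, ?_⟩ <;> simp only [Prod.fst_neg, Prod.snd_neg] <;> linarith

lemma box_sub {R R' : ℝ} {z w : ℝ × ℝ} (hz : z ∈ box R) (hw : w ∈ box R') :
    z - w ∈ box (R + R') := by
  rw [sub_eq_add_neg]; exact box_add hz (box_neg hw)

section NoiseKernel

variable {S : Measure ℝ} {G Q : ℝ × ℝ → ℝ} {r : ℝ × ℝ → ℝ}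

lemma IsNoiseKernel.stronglyMeasurable_conv (hG : IsNoiseKernel S G Q) (hr : Continuous r) :
    StronglyMeasurable (spaceTimeConv G r) := by
  have : StronglyMeasurable fun p : (ℝ × ℝ) × (ℝ × ℝ) => G (p.1 - p.2) * r p.2 :=
    ((hG.meas.comp (by fun_prop)).mul (hr.measurable.comp measurable_snd)).stronglyMeasurable
  exact this.integral_prod_right

/-- The correlations of the noise kernel mollified by `r`. -/
lemma IsNoiseKernel.correlation_conv [SFinite S] (hG : IsNoiseKernel S G Q) (hr : Continuous r)
    (hc : HasCompactSupport r) (z₁ z₂ : ℝ × ℝ) :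
    Integrable (fun w => spaceTimeConv G r (z₁ - w) * spaceTimeConv G r (z₂ - w))
      (volume.prod S) ∧
    ∫ w, spaceTimeConv G r (z₁ - w) * spaceTimeConv G r (z₂ - w) ∂(volume.prod S)
      = ∫ κ, autocorr r κ * Q (z₁ - z₂ - κ) := by
  obtain ⟨A, hA, hcorr⟩ := hG.exists_correlation
  obtain ⟨R, hR, hsupp⟩ := exists_box_of_hasCompactSupport hc
  obtain ⟨M, hM⟩ := hr.bounded_above_of_compact_support hc
  have hM0 : 0 ≤ M := (norm_nonneg _).trans (hM 0)
  set c := z₁.1 - z₂.1 with hc'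
  set Θ : (ℝ × ℝ) × ((ℝ × ℝ) × (ℝ × ℝ)) → ℝ := fun q =>
    (r (q.2.1 + q.2.2) * r q.2.2) * (G (z₁ - q.2.1 - q.2.2 - q.1) * G (z₂ - q.2.2 - q.1)) with hΘ
  have hdiff : ∀ κ v : ℝ × ℝ, (z₁ - κ - v) - (z₂ - v) = z₁ - z₂ - κ := fun κ v => by abel
  have hne : ∀ κ v : ℝ × ℝ, κ.1 ≠ c → (z₁ - κ - v).1 ≠ (z₂ - v).1 := fun κ v h h' => by
    apply h
    simp only [Prod.fst_sub] at h'
    rw [hc']; linarith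
  have hae : ∀ᵐ p : (ℝ × ℝ) × (ℝ × ℝ), p.1.1 ≠ c :=
    (Measure.quasiMeasurePreserving_fst (μ := (volume : Measure (ℝ × ℝ)))
      (ν := (volume : Measure (ℝ × ℝ)))).ae (ae_fst_ne c)
  have hmΘ : Measurable Θ := by
    have := hG.meas
    have := hr.measurable
    rw [hΘ]; fun_prop
  have hΘint : Integrable Θ ((volume.prod S).prod volume) := by
    rw [integrable_prod_iff' hmΘ.aestronglyMeasurable]
    refine ⟨?_, ?_⟩
    · filter_upwards [hae] with p hp
      exact ((hcorr _ _ (hne p.1 p.2 hp)).1).const_mul (r (p.1 + p.2) * r p.2)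
    · have hdom : Integrable (fun p : (ℝ × ℝ) × (ℝ × ℝ) =>
          (box (R + R)).indicator (fun z : ℝ × ℝ => 1 / Real.sqrt |c - z.1|) p.1
            * (box R).indicator (fun _ => M * M * A) p.2) := by
        refine Integrable.mul_prod ((integrableOn_box_inv_sqrt _ c).integrable_indicator
          (measurableSet_box _)) (IntegrableOn.integrable_indicator ?_ (measurableSet_box _))
        refine integrableOn_const ?_
        rw [volume_box]; finiteness
      refine hdom.mono' ?_ ?_
      · have h1 : StronglyMeasurable fun q : ((ℝ × ℝ) × (ℝ × ℝ)) × (ℝ × ℝ) => ‖Θ (q.2, q.1)‖ :=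
          (hmΘ.norm.comp (by fun_prop)).stronglyMeasurable
        exact h1.integral_prod_right.aestronglyMeasurable
      · filter_upwards [hae] with p hp
        rw [Real.norm_eq_abs, abs_of_nonneg (integral_nonneg fun _ => norm_nonneg _)]
        simp only [hΘ, norm_mul (r _ * r _), Real.norm_eq_abs]
        rw [integral_const_mul]
        by_cases h2 : p.2 ∈ box R
        · by_cases h12 : p.1 + p.2 ∈ box R
          · have h1 : p.1 ∈ box (R + R) := by simpa using box_sub h12 h2
            rw [indicator_of_mem h1, indicator_of_mem h2]
            have h3 := (hcorr _ _ (hne p.1 p.2 hp)).2.1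
            have e : (z₁ - p.1 - p.2).1 - (z₂ - p.2).1 = c - p.1.1 := by
              simp only [Prod.fst_sub, hc']; ring
            rw [e] at h3
            calc _ ≤ M * M * (A / Real.sqrt |c - p.1.1|) := by
                  rw [abs_mul]
                  gcongr
                  · exact hM _
                  · exact hM _
              _ = _ := by ring
          · rw [hsupp _ h12, zero_mul, abs_zero, zero_mul]
            exact mul_nonneg (indicator_nonneg (fun _ _ => by positivity) _)
              (indicator_nonneg (fun _ _ => by positivity) _)
        · rw [hsupp _ h2, mul_zero, abs_zero, zero_mul]
          exact mul_nonneg (indicator_nonneg (fun _ _ => by positivity) _)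
            (indicator_nonneg (fun _ _ => by positivity) _)
  have hprod : ∀ᵐ w ∂(volume.prod S), ∫ p, Θ (w, p)
      = spaceTimeConv G r (z₁ - w) * spaceTimeConv G r (z₂ - w) := by
    filter_upwards [hΘint.prod_right_ae] with w hw
    rw [Measure.volume_eq_prod] at hw ⊢
    rw [integral_prod_symm _ hw]
    have e1 : ∀ v : ℝ × ℝ, ∫ κ, Θ (w, (κ, v))
        = spaceTimeConv G r (z₁ - w) * (G (z₂ - w - v) * r v) := by
      intro v
      have e2 : ∀ κ, Θ (w, (κ, v)) = (fun κ => G (z₁ - w - κ) * r κ) (κ + v)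
          * (G (z₂ - w - v) * r v) := by
        intro κ
        simp only [hΘ]
        rw [show z₁ - κ - v - w = z₁ - w - (κ + v) by abel,
          show z₂ - v - w = z₂ - w - v by abel]
        ring
      simp_rw [e2]
      rw [integral_mul_const, integral_add_right_eq_self (fun κ => G (z₁ - w - κ) * r κ) v]
      rfl
    simp_rw [e1]
    rw [integral_const_mul]
    rfl
  refine ⟨hΘint.integral_prod_left.congr hprod, ?_⟩
  rw [← integral_congr_ae hprod, integral_integral_swap (f := fun w p => Θ (w, p)) hΘint]
  have e3 : ∀ᵐ p : (ℝ × ℝ) × (ℝ × ℝ), ∫ w, Θ (w, p) ∂(volume.prod S)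
      = r (p.1 + p.2) * r p.2 * Q (z₁ - z₂ - p.1) := by
    filter_upwards [hae] with p hp
    simp only [hΘ]
    rw [integral_const_mul, (hcorr _ _ (hne p.1 p.2 hp)).2.2, hdiff]
  have hint4 := hΘint.integral_prod_right.congr e3
  rw [integral_congr_ae e3, Measure.volume_eq_prod, integral_prod _ hint4]
  refine integral_congr_ae (ae_of_all _ fun κ => ?_)
  exact integral_mul_const (Q (z₁ - z₂ - κ)) fun v => r (κ + v) * r v

lemma IsNoiseKernel.memLp_conv [SFinite S] (hG : IsNoiseKernel S G Q) (hr : Continuous r)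
    (hc : HasCompactSupport r) (z : ℝ × ℝ) :
    MemLp (fun w => spaceTimeConv G r (z - w)) 2 (volume.prod S) := by
  rw [memLp_two_iff_integrable_sq]
  · exact (hG.correlation_conv hr hc z z).1.congr (ae_of_all _ fun w => (sq _).symm)
  · exact ((hG.stronglyMeasurable_conv hr).comp_measurable (by fun_prop)).aestronglyMeasurable

end NoiseKernel

lemma circleVolume_eq : circleVolume = volume.prod (volume.restrict (Ico 0 1)) := by
  rw [circleVolume, Measure.volume_eq_prod, ← Measure.prod_restrict, Measure.restrict_univ]

/-! ### The autocorrelation of the mollifier -/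

lemma map_dil_volume {ε : ℝ} (hε : 0 < ε) :
    Measure.map (dil ε) volume = ENNReal.ofReal (ε ^ 3)⁻¹ • (volume : Measure (ℝ × ℝ)) := by
  have h : ∀ a : ℝ, 0 < a → Measure.map (fun x : ℝ => a * x) volume
      = ENNReal.ofReal a⁻¹ • (volume : Measure ℝ) := fun a ha => by
    rw [Real.map_volume_mul_left ha.ne', abs_of_pos (inv_pos.2 ha)]
  have e : dil ε = Prod.map (fun t => ε ^ 2 * t) (fun x => ε * x) := rfl
  have := Measure.map_prod_map (volume : Measure ℝ) (volume : Measure ℝ)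
    (f := fun t : ℝ => ε ^ 2 * t) (g := fun x : ℝ => ε * x) (by fun_prop) (by fun_prop)
  rw [e, Measure.volume_eq_prod, ← this, h _ (by positivity), h _ hε, Measure.prod_smul_left,
    Measure.prod_smul_right, smul_smul, ← ENNReal.ofReal_mul (by positivity)]
  congr 2
  field_simp

lemma measurableEmbedding_dil {ε : ℝ} (hε : 0 < ε) : MeasurableEmbedding (dil ε) :=
  ((Homeomorph.mulLeft₀ (ε ^ 2) (by positivity)).prodCongr
    (Homeomorph.mulLeft₀ ε hε.ne')).measurableEmbedding

lemma integral_dil {ε : ℝ} (hε : 0 < ε) (f : ℝ × ℝ → ℝ) :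
    ∫ v, f (dil ε v) = (ε ^ 3)⁻¹ * ∫ v, f v := by
  rw [← (measurableEmbedding_dil hε).integral_map, map_dil_volume hε, integral_smul_measure,
    ENNReal.toReal_ofReal (by positivity), smul_eq_mul]

lemma measurePreserving_xrefl : MeasurePreserving xrefl :=
  (MeasurePreserving.id (volume : Measure ℝ)).prod (Measure.measurePreserving_neg volume)

lemma measurableEmbedding_xrefl : MeasurableEmbedding xrefl :=
  ((Homeomorph.refl ℝ).prodCongr (Homeomorph.neg ℝ)).measurableEmbedding

lemma integral_xrefl (f : ℝ × ℝ → ℝ) : ∫ v, f (xrefl v) = ∫ v, f v :=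
  measurePreserving_xrefl.integral_comp measurableEmbedding_xrefl f

lemma xrefl_add (z w : ℝ × ℝ) : xrefl (z + w) = xrefl z + xrefl w := by
  ext <;> simp [xrefl, add_comm]

lemma xrefl_xrefl (z : ℝ × ℝ) : xrefl (xrefl z) = z := by simp [xrefl]

lemma isCompact_box (R : ℝ) : IsCompact (box R) := isCompact_Icc.prod isCompact_Icc

section Autocorr

variable {r : ℝ × ℝ → ℝ}

lemma autocorr_eq_zero {R : ℝ} (h : ∀ z, z ∉ box R → r z = 0) {κ : ℝ × ℝ} (hκ : κ ∉ box (R + R)) :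
    autocorr r κ = 0 := by
  refine integral_eq_zero_of_ae (ae_of_all _ fun v => ?_)
  by_cases h2 : v ∈ box R
  · have : κ + v ∉ box R := fun h12 => hκ (by simpa using box_sub h12 h2)
    simp [h _ this]
  · simp [h _ h2]

lemma continuous_autocorr (hr : Continuous r) (hc : HasCompactSupport r) :
    Continuous (autocorr r) := by
  obtain ⟨R, -, hR⟩ := exists_box_of_hasCompactSupport hc
  have e : autocorr r = fun κ => ∫ v in box R, r (κ + v) * r v := by
    ext κ
    refine (setIntegral_eq_integral_of_forall_compl_eq_zero fun v hv => ?_).symm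
    rw [hR v hv, mul_zero]
  rw [e]
  exact continuous_parametric_integral_of_continuous (f := fun κ v => r (κ + v) * r v)
    (by fun_prop) (isCompact_box R)

lemma hasCompactSupport_autocorr (hc : HasCompactSupport r) : HasCompactSupport (autocorr r) := by
  obtain ⟨R, -, hR⟩ := exists_box_of_hasCompactSupport hc
  exact HasCompactSupport.intro (isCompact_box (R + R)) fun κ hκ => autocorr_eq_zero hR hκ

lemma autocorr_neg (κ : ℝ × ℝ) : autocorr r (-κ) = autocorr r κ := by
  unfold autocorr
  rw [← integral_add_right_eq_self _ κ]
  refine integral_congr_ae (ae_of_all _ fun v => ?_)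
  dsimp only
  rw [mul_comm]
  congr 2 <;> abel

lemma autocorr_xrefl (hs : ∀ z, r (xrefl z) = r z) (κ : ℝ × ℝ) :
    autocorr r (xrefl κ) = autocorr r κ := by
  unfold autocorr
  rw [← integral_xrefl]
  refine integral_congr_ae (ae_of_all _ fun v => ?_)
  dsimp only
  rw [← xrefl_add, hs, hs]

lemma integral_autocorr (hr : Continuous r) (hc : HasCompactSupport r) :
    ∫ κ, autocorr r κ = (∫ v, r v) ^ 2 := by
  obtain ⟨R, -, hR⟩ := exists_box_of_hasCompactSupport hc
  have hcs : HasCompactSupport fun p : (ℝ × ℝ) × (ℝ × ℝ) => r (p.1 + p.2) * r p.2 := by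
    refine HasCompactSupport.intro ((isCompact_box (R + R)).prod (isCompact_box R)) fun p hp => ?_
    by_cases h2 : p.2 ∈ box R
    · have : p.1 + p.2 ∉ box R := fun h12 => hp ⟨by simpa using box_sub h12 h2, h2⟩
      simp [hR _ this]
    · simp [hR _ h2]
  have hi : Integrable fun p : (ℝ × ℝ) × (ℝ × ℝ) => r (p.1 + p.2) * r p.2 :=
    Continuous.integrable_of_hasCompactSupport (by fun_prop) hcs
  unfold autocorr
  rw [Measure.volume_eq_prod] at hi
  rw [integral_integral_swap (f := fun κ v => r (κ + v) * r v) hi]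
  simp_rw [integral_mul_const]
  have : ∀ v : ℝ × ℝ, ∫ κ, r (κ + v) = ∫ κ, r κ := fun v => integral_add_right_eq_self _ v
  simp_rw [this]
  rw [integral_const_mul, sq]

lemma rescale_dil {ε : ℝ} (hε : 0 < ε) (z : ℝ × ℝ) : rescale ε r (dil ε z) = (ε ^ 3)⁻¹ * r z := by
  unfold rescale dil
  congr 2
  ext <;> simp <;> field_simp

lemma dil_add (ε : ℝ) (z w : ℝ × ℝ) : dil ε (z + w) = dil ε z + dil ε w := by
  ext <;> simp [dil] <;> ring

lemma autocorr_rescale_dil {ε : ℝ} (hε : 0 < ε) (κ : ℝ × ℝ) :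
    autocorr (rescale ε r) (dil ε κ) = (ε ^ 3)⁻¹ * autocorr r κ := by
  have h := integral_dil hε fun v => rescale ε r (dil ε κ + v) * rescale ε r v
  simp_rw [← dil_add, rescale_dil hε] at h
  have e : ∀ v, (ε ^ 3)⁻¹ * r (κ + v) * ((ε ^ 3)⁻¹ * r v)
      = ((ε ^ 3)⁻¹ * (ε ^ 3)⁻¹) * (r (κ + v) * r v) := fun v => by ring
  simp_rw [e] at h
  rw [integral_const_mul, mul_assoc] at h
  exact (mul_left_cancel₀ (by positivity) h).symm

lemma integral_autocorr_rescale {ε : ℝ} (hε : 0 < ε) (f : ℝ × ℝ → ℝ) :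
    ∫ κ, autocorr (rescale ε r) κ * f κ = ∫ v, autocorr r v * f (dil ε v) := by
  have h := integral_dil hε fun κ => autocorr (rescale ε r) κ * f κ
  simp_rw [autocorr_rescale_dil hε, mul_assoc] at h
  rw [integral_const_mul] at h
  exact (mul_left_cancel₀ (by positivity) h).symm

lemma continuous_rescale (hr : Continuous r) (ε : ℝ) : Continuous (rescale ε r) := by
  unfold rescale; fun_prop

lemma hasCompactSupport_rescale (hc : HasCompactSupport r) {ε : ℝ} (hε : 0 < ε) :
    HasCompactSupport (rescale ε r) := by
  have e : rescale ε r = (fun z => (ε ^ 3)⁻¹ * r z) ∘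
      ((Homeomorph.mulRight₀ (ε ^ 2)⁻¹ (by positivity)).prodCongr
        (Homeomorph.mulRight₀ ε⁻¹ (by positivity))) := by
    ext z
    change (ε ^ 3)⁻¹ * r (z.1 / ε ^ 2, z.2 / ε) = (ε ^ 3)⁻¹ * r (z.1 * (ε ^ 2)⁻¹, z.2 * ε⁻¹)
    rw [div_eq_mul_inv, div_eq_mul_inv]
  rw [e]
  exact (hc.mul_left).comp_homeomorph _

end Autocorr

/-! ### Averages of the weights at scale `ε` -/

lemma enorm_le_iw {y d A : ℝ} (n : ℕ) (hn : n ≠ 0) (hd : 0 ≤ d) (hA : 0 < A)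
    (h : |y| * d ^ n ≤ A) : ‖y‖ₑ ≤ ENNReal.ofReal A * iw d ^ (n : ℝ) := by
  rcases hd.eq_or_lt with rfl | hd
  · have : iw 0 ^ (n : ℝ) = ⊤ := by
      simp [iw, hn]
    rw [this, ENNReal.mul_top (by simpa using hA)]
    exact le_top
  · rw [iw_rpow_of_pos hd, ← ENNReal.ofReal_mul hA.le, Real.enorm_eq_ofReal_abs]
    apply ENNReal.ofReal_le_ofReal
    rw [Real.rpow_natCast, inv_pow, ← div_eq_mul_inv, le_div_iff₀ (by positivity)]
    exact h

lemma iw_le_mul {c a b : ℝ} (hc : 0 < c) (h : b ≤ c * a) : iw a ≤ ENNReal.ofReal c * iw b := by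
  have h1 : ENNReal.ofReal b ≤ ENNReal.ofReal c * ENNReal.ofReal a := by
    rw [← ENNReal.ofReal_mul hc.le]; exact ENNReal.ofReal_le_ofReal h
  have h2 : iw (c * a) = (ENNReal.ofReal c)⁻¹ * iw a := by
    unfold iw
    rw [ENNReal.ofReal_mul hc.le, ENNReal.mul_inv] <;> simp [hc]
  have h3 : iw (c * a) ≤ iw b := iw_anti h
  rw [h2] at h3
  calc iw a = ENNReal.ofReal c * ((ENNReal.ofReal c)⁻¹ * iw a) := by
        rw [← mul_assoc, ENNReal.mul_inv_cancel (by simpa using hc) (by simp), one_mul]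
    _ ≤ _ := by gcongr

lemma iw_rpow_le_mul {c a b : ℝ} (hc : 0 < c) (h : b ≤ c * a) {γ : ℝ} (hγ : 0 ≤ γ) :
    iw a ^ γ ≤ ENNReal.ofReal c ^ γ * iw b ^ γ := by
  rw [← ENNReal.mul_rpow_of_nonneg _ _ hγ]
  gcongr
  exact iw_le_mul hc h

/-- A bound of the parabolic size on `box R`. -/
noncomputable def boxRad (R : ℝ) : ℝ := Real.sqrt R + R + 1

lemma pn_le_boxRad {R : ℝ} {z : ℝ × ℝ} (hz : z ∈ box R) : pn z ≤ boxRad R := by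
  have h1 : |z.1| ≤ R := abs_le.2 hz.1
  have h2 : |z.2| ≤ R := abs_le.2 hz.2
  have := Real.sqrt_le_sqrt h1
  unfold pn boxRad; linarith

lemma continuous_dil (ε : ℝ) : Continuous (dil ε) := by unfold dil; fun_prop

/-- Averaging a negative power of the distance against a bounded function at the scale `ε`
regularises it at that scale. -/
lemma exists_lintegral_average_le {η : ℝ × ℝ → ℝ} {R M : ℝ} (hR : 0 ≤ R)
    (hM : ∀ z, |η z| ≤ M) (hη : ∀ z, z ∉ box R → η z = 0) {γ : ℝ} (hγ : 0 < γ) (hγ3 : γ < 3) :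
    ∃ C : ℝ≥0∞, C ≠ ⊤ ∧ ∀ ε : ℝ, 0 < ε → ε ≤ 1 → ∀ z : ℝ × ℝ,
      ∫⁻ v, ‖η v‖ₑ * iw (pd (z - dil ε v)) ^ γ ≤ C * iw (pd z + ε) ^ γ := by
  set c := boxRad R with hc
  have hc1 : 1 ≤ c := by rw [hc, boxRad]; linarith [Real.sqrt_nonneg R]
  have hvol : volume (box R) ≠ ⊤ := by rw [volume_box]; finiteness
  set C₁ : ℝ≥0∞ := ENNReal.ofReal 4 ^ γ * volume (box R) with hC₁
  set C₂ : ℝ≥0∞ := (boxConst R * ENNReal.ofReal (3 / (3 - γ)) + volume (box R))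
    * ENNReal.ofReal (2 * c + 1) ^ γ with hC₂
  refine ⟨ENNReal.ofReal M * (C₁ + C₂), ?_, fun ε hε hε1 z => ?_⟩
  · have : boxConst R ≠ ⊤ := boxConst_ne_top R
    finiteness
  have hpd := pd_nonneg z
  have step : ∫⁻ v, ‖η v‖ₑ * iw (pd (z - dil ε v)) ^ γ
      ≤ ENNReal.ofReal M * ∫⁻ v in box R, iw (pd (z - dil ε v)) ^ γ := by
    rw [← lintegral_const_mul' _ _ ENNReal.ofReal_ne_top, ← lintegral_indicator (measurableSet_box R)]
    refine lintegral_mono fun v => ?_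
    by_cases hv : v ∈ box R
    · rw [indicator_of_mem hv, Real.enorm_eq_ofReal_abs]
      gcongr
      exact hM v
    · rw [hη v hv]; simp
  refine step.trans ?_
  rw [mul_assoc]
  gcongr
  rcases le_or_gt (2 * c * ε) (pd z) with h | h
  · refine le_trans ?_ (mul_le_mul_left le_self_add _)
    calc _ ≤ ∫⁻ v in box R, ENNReal.ofReal 4 ^ γ * iw (pd z + ε) ^ γ := by
          refine setLIntegral_mono' (measurableSet_box R) fun v hv => ?_
          refine iw_rpow_le_mul (by norm_num) ?_ hγ.le
          have h1 := pd_add_le (z - dil ε v) (dil ε v)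
          rw [sub_add_cancel] at h1
          have h2 : pd (dil ε v) ≤ ε * c := by
            refine (pd_le_pn _).trans ?_
            rw [pn_dil hε.le]
            gcongr
            exact pn_le_boxRad hv
          nlinarith
      _ = _ := by
          rw [lintegral_const, Measure.restrict_apply_univ, hC₁]; ring
  · refine le_trans ?_ (mul_le_mul_left le_add_self _)
    have hb := ballGrowth_pd hR hε hε1 z
    have hm : Measurable fun v => pd (z - dil ε v) :=
      (continuous_pd.comp (continuous_const.sub (continuous_dil ε))).measurable
    have hne : ENNReal.ofReal (4 * (2 * R + 2) + 4 * R ^ 2) * iw ε ^ (3 : ℝ) ≠ ⊤ :=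
      ENNReal.mul_ne_top ENNReal.ofReal_ne_top
        (ENNReal.rpow_ne_top_of_nonneg (by norm_num) (iw_ne_top hε))
    have := hb.lintegral_le hne (fun _ => pd_nonneg _) hm hγ hγ3 hε
    refine this.trans ?_
    rw [Measure.restrict_apply_univ]
    have e1 : iw ε ^ (3 : ℝ) * ENNReal.ofReal (ε ^ (3 - γ)) = iw ε ^ γ := by
      rw [iw_rpow_eq_ofReal hε, iw_rpow_eq_ofReal hε, ← ENNReal.ofReal_mul (by positivity),
        ← Real.rpow_add hε]
      congr 2; ring
    have e2 : iw ε ^ γ ≤ ENNReal.ofReal (2 * c + 1) ^ γ * iw (pd z + ε) ^ γ :=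
      iw_rpow_le_mul (by linarith) (by nlinarith) hγ.le
    calc _ = boxConst R * ENNReal.ofReal (3 / (3 - γ)) * (iw ε ^ (3 : ℝ) * ENNReal.ofReal (ε ^ (3 - γ)))
          + iw ε ^ γ * volume (box R) := by unfold boxConst; ring
      _ = (boxConst R * ENNReal.ofReal (3 / (3 - γ)) + volume (box R)) * iw ε ^ γ := by
          rw [e1]; ring
      _ ≤ (boxConst R * ENNReal.ofReal (3 / (3 - γ)) + volume (box R))
          * (ENNReal.ofReal (2 * c + 1) ^ γ * iw (pd z + ε) ^ γ) := by gcongr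
      _ = _ := by rw [hC₂]; ring

/-! ### The covariance of the rescaled field -/

/-- The space derivative of the heat kernel of the circle, extended symmetrically in time. -/
noncomputable def symmD (z : ℝ × ℝ) : ℝ := circD (|z.1|, z.2)

/-- The covariance function of the field `√ε Ψ_ε`. -/
noncomputable def covFun (ρ : ℝ × ℝ → ℝ) (ε : ℝ) (z : ℝ × ℝ) : ℝ :=
  ε * ∫ v, autocorr ρ v * circQ (z - dil ε v)

/-- The space derivative of `covFun`, divided by `ε / 2`; it is an approximation at scale `ε` of the
derivative of the heat kernel. -/
noncomputable def covDer (ρ : ℝ × ℝ → ℝ) (ε : ℝ) (z : ℝ × ℝ) : ℝ :=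
  ∫ v, autocorr ρ v * symmD (z - dil ε v)

lemma measurable_symmD : Measurable symmD := by
  have : Measurable fun z : ℝ × ℝ => (|z.1|, z.2) := by
    exact (continuous_abs.measurable.comp measurable_fst).prodMk measurable_snd
  exact measurable_circD.comp this

lemma measurable_circQ : Measurable circQ := by
  have h : Measurable fun z : ℝ × ℝ => (|z.1|, z.2) := by
    exact (continuous_abs.measurable.comp measurable_fst).prodMk measurable_snd
  have := measurable_heatKernelCircle.comp h
  exact (this.sub_const 1).const_mul _

lemma exists_symmD_le : ∃ a : ℝ≥0∞, a ≠ ⊤ ∧ ∀ z, ‖symmD z‖ₑ ≤ a * iw (pd z) ^ (2 : ℝ) := by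
  obtain ⟨A, hA, h⟩ := exists_circD_le_pd
  refine ⟨ENNReal.ofReal A, by simp, fun z => ?_⟩
  refine enorm_le_iw 2 two_ne_zero (pd_nonneg z) hA ?_
  rcases eq_or_ne z.1 0 with h0 | h0
  · rw [symmD, h0, abs_zero, circD_of_nonpos le_rfl]; simpa using hA.le
  · have h1 := h |z.1| z.2 (abs_pos.2 h0)
    have e : pd (|z.1|, z.2) = pd z := by simp [pd]
    have hp : 0 < pd z := pd_pos h0 z.2
    rw [e, le_div_iff₀ (by positivity)] at h1
    exact h1

lemma exists_circQ_le : ∃ a : ℝ≥0∞, a ≠ ⊤ ∧ ∀ z, ‖circQ z‖ₑ ≤ a * iw (pd z) ^ (1 : ℝ) := by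
  obtain ⟨A, hA, h⟩ := exists_heatKernelCircle_le_pd
  refine ⟨ENNReal.ofReal (A + 1), by simp, fun z => ?_⟩
  have := enorm_le_iw (y := circQ z) (d := pd z) (A := A + 1) 1 one_ne_zero (pd_nonneg z)
    (by positivity) ?_
  · simpa using this
  rcases eq_or_ne z.1 0 with h0 | h0
  · have e : circQ z = -(1 / 2) := by
      have : heatKernelCircle (0, z.2) = 0 := by
        simp [heatKernelCircle, heatKernelLine_of_nonpos (z := (0, _)) le_rfl]
      rw [circQ, h0, abs_zero, this]; norm_num
    rw [e, abs_neg, abs_of_pos (by norm_num)]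
    have := pd_le z
    linarith
  · have h1 := h |z.1| z.2 (abs_pos.2 h0)
    have e : pd (|z.1|, z.2) = pd z := by simp [pd]
    have hp : 0 < pd z := pd_pos h0 z.2
    rw [e, le_div_iff₀ hp] at h1
    rw [circQ, abs_mul, abs_of_pos (by norm_num : (0 : ℝ) < 1 / 2), pow_one]
    nlinarith [mul_nonneg (abs_nonneg (heatKernelCircle (|z.1|, z.2) - 1)) hp.le]

lemma hasDerivAt_circQ (t x : ℝ) :
    HasDerivAt (fun x => circQ (t, x)) (1 / 2 * symmD (t, x)) x :=
  ((hasDerivAt_heatKernelCircle |t| x).sub_const 1).const_mul (1 / 2)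

lemma circQ_xrefl (z : ℝ × ℝ) : circQ (xrefl z) = circQ z := by
  simp [circQ, xrefl, heatKernelCircle_neg]

lemma lintegral_box_iw_lt_top {R γ : ℝ} (hR : 0 ≤ R) (hγ : 0 < γ) (hγ3 : γ < 3) :
    ∫⁻ z in box R, iw (pd z) ^ γ < ⊤ := by
  refine ((ballGrowth_id hR).lintegral_le (boxConst_ne_top R) pd_nonneg continuous_pd.measurable hγ
    hγ3 one_pos).trans_lt ?_
  rw [Measure.restrict_apply_univ, volume_box]
  have h1 := boxConst_ne_top R
  have h2 : iw 1 ^ γ ≠ ⊤ := ENNReal.rpow_ne_top_of_nonneg hγ.le (iw_ne_top one_pos)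
  exact lt_top_iff_ne_top.2 (by finiteness)

lemma exists_mem_box (z : ℝ × ℝ) : ∃ R : ℝ, 0 ≤ R ∧ box R ∈ 𝓝 z := by
  refine ⟨|z.1| + |z.2| + 1, by positivity, ?_⟩
  have h1 := abs_lt.1 (show |z.1| < |z.1| + |z.2| + 1 by linarith [abs_nonneg z.2])
  have h2 := abs_lt.1 (show |z.2| < |z.1| + |z.2| + 1 by linarith [abs_nonneg z.1])
  exact prod_mem_nhds (Icc_mem_nhds h1.1 h1.2) (Icc_mem_nhds h2.1 h2.2)

lemma locallyIntegrable_of_le_iw {f : ℝ × ℝ → ℝ} (hf : Measurable f) {a : ℝ≥0∞} (ha : a ≠ ⊤)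
    {γ : ℝ} (hγ : 0 < γ) (hγ3 : γ < 3) (h : ∀ z, ‖f z‖ₑ ≤ a * iw (pd z) ^ γ) :
    LocallyIntegrable f := by
  intro z
  obtain ⟨R, hR, hz⟩ := exists_mem_box z
  refine ⟨box R, hz, hf.aestronglyMeasurable, ?_⟩
  refine (lintegral_mono fun z => h z).trans_lt ?_
  rw [lintegral_const_mul' _ _ ha]
  exact ENNReal.mul_lt_top ha.lt_top (lintegral_box_iw_lt_top hR hγ hγ3)

lemma locallyIntegrable_circQ : LocallyIntegrable circQ := by
  obtain ⟨a, ha, h⟩ := exists_circQ_le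
  exact locallyIntegrable_of_le_iw measurable_circQ ha one_pos (by norm_num) h

lemma locallyIntegrable_symmD : LocallyIntegrable symmD := by
  obtain ⟨a, ha, h⟩ := exists_symmD_le
  exact locallyIntegrable_of_le_iw measurable_symmD ha two_pos (by norm_num) h

section Cov

variable {ρ : ℝ × ℝ → ℝ}

lemma covFun_eq_conv {ε : ℝ} (hε : 0 < ε) (z : ℝ × ℝ) :
    covFun ρ ε z = ε * ∫ κ, autocorr (rescale ε ρ) κ * circQ (z - κ) := by
  rw [covFun, integral_autocorr_rescale hε fun κ => circQ (z - κ)]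

lemma covDer_eq_conv {ε : ℝ} (hε : 0 < ε) (z : ℝ × ℝ) :
    covDer ρ ε z = ∫ κ, autocorr (rescale ε ρ) κ * symmD (z - κ) := by
  rw [covDer, integral_autocorr_rescale hε fun κ => symmD (z - κ)]

lemma continuous_conv_autocorr (hr : Continuous ρ) (hc : HasCompactSupport ρ) {f : ℝ × ℝ → ℝ}
    (hf : LocallyIntegrable f) : Continuous fun z => ∫ κ, autocorr ρ κ * f (z - κ) :=
  HasCompactSupport.continuous_convolution_left (ContinuousLinearMap.mul ℝ ℝ)
    (hasCompactSupport_autocorr hc) (continuous_autocorr hr hc) hf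

lemma continuous_covFun (hr : Continuous ρ) (hc : HasCompactSupport ρ) {ε : ℝ} (hε : 0 < ε) :
    Continuous (covFun ρ ε) := by
  rw [funext (covFun_eq_conv hε)]
  exact continuous_const.mul (continuous_conv_autocorr (continuous_rescale hr ε)
    (hasCompactSupport_rescale hc hε) locallyIntegrable_circQ)

lemma continuous_covDer (hr : Continuous ρ) (hc : HasCompactSupport ρ) {ε : ℝ} (hε : 0 < ε) :
    Continuous (covDer ρ ε) := by
  rw [funext (covDer_eq_conv hε)]
  exact continuous_conv_autocorr (continuous_rescale hr ε)
    (hasCompactSupport_rescale hc hε) locallyIntegrable_symmD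

lemma covFun_neg (ε : ℝ) (z : ℝ × ℝ) : covFun ρ ε (-z) = covFun ρ ε z := by
  unfold covFun
  rw [← integral_neg_eq_self]
  congr 1
  refine integral_congr_ae (ae_of_all _ fun v => ?_)
  dsimp only
  rw [autocorr_neg, ← isNoiseKernel_circle.corr_neg]
  congr 2
  ext <;> simp [dil] <;> ring

lemma covFun_xrefl (hs : ∀ z, ρ (xrefl z) = ρ z) (ε : ℝ) (z : ℝ × ℝ) :
    covFun ρ ε (xrefl z) = covFun ρ ε z := by
  unfold covFun
  rw [← integral_xrefl]
  congr 1
  refine integral_congr_ae (ae_of_all _ fun v => ?_)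
  dsimp only
  rw [autocorr_xrefl hs, ← circQ_xrefl]
  congr 2
  ext <;> simp [dil, xrefl]; ring

lemma circQ_add_int (t x : ℝ) (n : ℤ) : circQ (t, x + n) = circQ (t, x) := by
  simp [circQ, heatKernelCircle_add_int]

lemma covFun_add_int (ε t x : ℝ) (n : ℤ) : covFun ρ ε (t, x + n) = covFun ρ ε (t, x) := by
  unfold covFun
  congr 1
  refine integral_congr_ae (ae_of_all _ fun v => ?_)
  dsimp only
  congr 1
  change circQ (t - (dil ε v).1, x + n - (dil ε v).2) = circQ (t - (dil ε v).1, x - (dil ε v).2)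
  rw [← circQ_add_int _ (x - (dil ε v).2) n]; congr 2; ring

lemma exists_autocorr_bounds (hr : Continuous ρ) (hc : HasCompactSupport ρ) :
    ∃ R M : ℝ, 0 < R ∧ 0 < M ∧ (∀ z, |autocorr ρ z| ≤ M) ∧ ∀ z, z ∉ box R → autocorr ρ z = 0 := by
  obtain ⟨R, hR, h⟩ := exists_box_of_hasCompactSupport (hasCompactSupport_autocorr hc)
  obtain ⟨M, hM⟩ := (continuous_autocorr hr hc).bounded_above_of_compact_support
    (hasCompactSupport_autocorr hc)
  refine ⟨R, |M| + 1, hR, by positivity, fun z => ?_, h⟩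
  have := hM z
  rw [Real.norm_eq_abs] at this
  linarith [le_abs_self M]

lemma exists_covFun_le (hr : Continuous ρ) (hc : HasCompactSupport ρ) :
    ∃ a : ℝ≥0∞, a ≠ ⊤ ∧ ∀ ε : ℝ, 0 < ε → ε ≤ 1 → ∀ z,
      ‖covFun ρ ε z‖ₑ ≤ a * ENNReal.ofReal ε * iw (pd z + ε) ^ (1 : ℝ) := by
  obtain ⟨R, M, hR, -, hM, hη⟩ := exists_autocorr_bounds hr hc
  obtain ⟨C, hC, h⟩ := exists_lintegral_average_le hR.le hM hη one_pos (by norm_num)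
  obtain ⟨a, ha, hQ⟩ := exists_circQ_le
  refine ⟨a * C, by finiteness, fun ε hε hε1 z => ?_⟩
  rw [covFun, enorm_mul, Real.enorm_eq_ofReal hε.le]
  calc _ ≤ ENNReal.ofReal ε * ∫⁻ v, ‖autocorr ρ v * circQ (z - dil ε v)‖ₑ := by
        gcongr; exact enorm_integral_le_lintegral_enorm _
    _ ≤ ENNReal.ofReal ε * ∫⁻ v, a * (‖autocorr ρ v‖ₑ * iw (pd (z - dil ε v)) ^ (1 : ℝ)) := by
        gcongr with v
        rw [enorm_mul, mul_left_comm]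
        gcongr
        exact hQ _
    _ ≤ ENNReal.ofReal ε * (a * (C * iw (pd z + ε) ^ (1 : ℝ))) := by
        rw [lintegral_const_mul' _ _ ha]
        gcongr
        exact h ε hε hε1 z
    _ = _ := by ring

lemma exists_lintegral_symmD_average_le (hr : Continuous ρ) (hc : HasCompactSupport ρ) :
    ∃ a : ℝ≥0∞, a ≠ ⊤ ∧ ∀ ε : ℝ, 0 < ε → ε ≤ 1 → ∀ z,
      ∫⁻ v, ‖autocorr ρ v * symmD (z - dil ε v)‖ₑ ≤ a * iw (pd z + ε) ^ (2 : ℝ) := by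
  obtain ⟨R, M, hR, -, hM, hη⟩ := exists_autocorr_bounds hr hc
  obtain ⟨C, hC, h⟩ := exists_lintegral_average_le hR.le hM hη two_pos (by norm_num)
  obtain ⟨a, ha, hQ⟩ := exists_symmD_le
  refine ⟨a * C, by finiteness, fun ε hε hε1 z => ?_⟩
  calc _ ≤ ∫⁻ v, a * (‖autocorr ρ v‖ₑ * iw (pd (z - dil ε v)) ^ (2 : ℝ)) := by
        gcongr with v
        rw [enorm_mul, mul_left_comm]
        gcongr
        exact hQ _
    _ ≤ a * (C * iw (pd z + ε) ^ (2 : ℝ)) := by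
        rw [lintegral_const_mul' _ _ ha]
        gcongr
        exact h ε hε hε1 z
    _ = _ := by ring

lemma exists_covDer_le (hr : Continuous ρ) (hc : HasCompactSupport ρ) :
    ∃ a : ℝ≥0∞, a ≠ ⊤ ∧ ∀ ε : ℝ, 0 < ε → ε ≤ 1 → ∀ z,
      ‖covDer ρ ε z‖ₑ ≤ a * iw (pd z + ε) ^ (2 : ℝ) := by
  obtain ⟨a, ha, h⟩ := exists_lintegral_symmD_average_le hr hc
  exact ⟨a, ha, fun ε hε hε1 z => (enorm_integral_le_lintegral_enorm _).trans (h ε hε hε1 z)⟩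

lemma ae_sub_dil_fst_ne {ε : ℝ} (hε : 0 < ε) (t : ℝ) : ∀ᵐ v : ℝ × ℝ, t - ε ^ 2 * v.1 ≠ 0 := by
  filter_upwards [ae_fst_ne (t / ε ^ 2)] with v hv h
  apply hv
  field_simp
  linarith

lemma integrable_autocorr_mul_circQ (hr : Continuous ρ) (hc : HasCompactSupport ρ) {ε : ℝ}
    (hε : 0 < ε) (hε1 : ε ≤ 1) (z : ℝ × ℝ) :
    Integrable fun v => autocorr ρ v * circQ (z - dil ε v) := by
  obtain ⟨R, M, hR, -, hM, hη⟩ := exists_autocorr_bounds hr hc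
  obtain ⟨C, hC, h⟩ := exists_lintegral_average_le hR.le hM hη one_pos (by norm_num)
  obtain ⟨a, ha, hQ⟩ := exists_circQ_le
  refine ⟨((continuous_autocorr hr hc).measurable.mul (measurable_circQ.comp
    ((continuous_const.sub (continuous_dil ε)).measurable))).aestronglyMeasurable, ?_⟩
  calc _ ≤ ∫⁻ v, a * (‖autocorr ρ v‖ₑ * iw (pd (z - dil ε v)) ^ (1 : ℝ)) := by
        refine lintegral_mono fun v => ?_
        rw [enorm_mul, mul_left_comm]
        gcongr
        exact hQ _
    _ ≤ a * (C * iw (pd z + ε) ^ (1 : ℝ)) := by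
        rw [lintegral_const_mul' _ _ ha]
        gcongr
        exact h ε hε hε1 z
    _ < ⊤ := by
        have := iw_ne_top (a := pd z + ε) (by linarith [pd_nonneg z])
        have : iw (pd z + ε) ^ (1 : ℝ) ≠ ⊤ := ENNReal.rpow_ne_top_of_nonneg zero_le_one this
        exact lt_top_iff_ne_top.2 (by finiteness)

/-- The covariance of the circle kernel is singular at the origin, so that its increments are
written as integrals before averaging, and Fubini's theorem is used. -/
lemma covFun_sub_eq_integral (hr : Continuous ρ) (hc : HasCompactSupport ρ) {ε : ℝ} (hε : 0 < ε)
    (hε1 : ε ≤ 1) (t x y : ℝ) :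
    covFun ρ ε (t, y) - covFun ρ ε (t, x) = ∫ s in x..y, ε / 2 * covDer ρ ε (t, s) := by
  have hmD : Measurable fun p : ℝ × (ℝ × ℝ) => autocorr ρ p.2 * symmD ((t, p.1) - dil ε p.2) := by
    refine ((continuous_autocorr hr hc).measurable.comp measurable_snd).mul
      (measurable_symmD.comp ?_)
    have := continuous_dil ε
    exact Continuous.measurable (by fun_prop)
  obtain ⟨a, ha, h⟩ := exists_lintegral_symmD_average_le hr hc
  have hint : ∀ x y : ℝ, x ≤ y → Integrable (fun p : ℝ × (ℝ × ℝ) =>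
      autocorr ρ p.2 * symmD ((t, p.1) - dil ε p.2)) ((volume.restrict (Ioc x y)).prod volume) := by
    intro x y hxy
    refine ⟨hmD.aestronglyMeasurable, ?_⟩
    rw [HasFiniteIntegral, lintegral_prod _ hmD.enorm.aemeasurable]
    calc _ ≤ ∫⁻ _ in Ioc x y, a * iw ε ^ (2 : ℝ) := by
          refine lintegral_mono fun s => (h ε hε hε1 (t, s)).trans ?_
          gcongr
          exact iw_anti (by linarith [pd_nonneg (t, s)])
      _ < ⊤ := by
          rw [lintegral_const, Measure.restrict_apply_univ, Real.volume_Ioc]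
          have := ENNReal.rpow_ne_top_of_nonneg zero_le_two (iw_ne_top hε)
          exact lt_top_iff_ne_top.2 (by finiteness)
  have main : ∀ x y : ℝ, x ≤ y →
      covFun ρ ε (t, y) - covFun ρ ε (t, x) = ∫ s in x..y, ε / 2 * covDer ρ ε (t, s) := by
    intro x y hxy
    have hi := hint x y hxy
    rw [intervalIntegral.integral_of_le hxy, integral_const_mul]
    unfold covDer
    rw [integral_integral_swap (f := fun s v => autocorr ρ v * symmD ((t, s) - dil ε v)) hi]
    rw [covFun, covFun, ← mul_sub, ← integral_sub (integrable_autocorr_mul_circQ hr hc hε hε1 _)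
      (integrable_autocorr_mul_circQ hr hc hε hε1 _), ← integral_const_mul, ← integral_const_mul]
    refine integral_congr_ae ?_
    filter_upwards [hi.prod_left_ae, ae_sub_dil_fst_ne hε t] with v hv hne
    rw [integral_const_mul, ← intervalIntegral.integral_of_le hxy]
    by_cases h0 : autocorr ρ v = 0
    · simp [h0]
    have hd : ∀ s ∈ uIcc x y, HasDerivAt (fun s => circQ ((t, s) - dil ε v))
        (1 / 2 * symmD ((t, s) - dil ε v)) s := fun s _ => by
      have := (hasDerivAt_circQ (t - (dil ε v).1) (s - (dil ε v).2)).comp s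
        ((hasDerivAt_id s).sub_const (dil ε v).2)
      exact this.congr_deriv (mul_one _)
    have hii : IntervalIntegrable (fun s => 1 / 2 * symmD ((t, s) - dil ε v)) volume x y := by
      rw [intervalIntegrable_iff, uIoc_of_le hxy]
      have := (hv.const_mul (autocorr ρ v)⁻¹).const_mul (1 / 2)
      refine this.congr (ae_of_all _ fun s => ?_)
      dsimp only
      rw [inv_mul_cancel_left₀ h0]
    have := intervalIntegral.integral_eq_sub_of_hasDerivAt hd hii
    rw [intervalIntegral.integral_const_mul] at this
    have e : ∫ s in x..y, symmD ((t, s) - dil ε v)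
        = 2 * (circQ ((t, y) - dil ε v) - circQ ((t, x) - dil ε v)) := by linarith
    rw [e]; ring
  rcases le_total x y with hxy | hxy
  · exact main x y hxy
  · rw [intervalIntegral.integral_symm, ← main y x hxy]; ring

lemma hasDerivAt_covFun (hr : Continuous ρ) (hc : HasCompactSupport ρ) {ε : ℝ} (hε : 0 < ε)
    (hε1 : ε ≤ 1) (t x : ℝ) :
    HasDerivAt (fun x => covFun ρ ε (t, x)) (ε / 2 * covDer ρ ε (t, x)) x := by
  have hcont : Continuous fun s => ε / 2 * covDer ρ ε (t, s) :=
    continuous_const.mul ((continuous_covDer hr hc hε).comp (by fun_prop))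
  have h1 := (hcont.integral_hasStrictDerivAt 0 x).hasDerivAt.add_const (covFun ρ ε (t, 0))
  refine h1.congr_of_eventuallyEq (Eventually.of_forall fun y => ?_)
  dsimp only
  rw [← covFun_sub_eq_integral hr hc hε hε1 t 0 y]; ring

end Cov

section Cov

variable {ρ : ℝ × ℝ → ℝ}

/-- At distances larger than `ε`, `covDer` is close to the derivative of the heat kernel. -/
lemma exists_symmD_sub_covDer_le (hr : Continuous ρ) (hc : HasCompactSupport ρ)
    (h1 : ∫ z, ρ z = 1) :
    ∃ a : ℝ≥0∞, a ≠ ⊤ ∧ ∀ ε : ℝ, 0 < ε → ε ≤ 1 → ∀ z : ℝ × ℝ, 0 < z.1 →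
      ‖symmD z - covDer ρ ε z‖ₑ
        ≤ a * ENNReal.ofReal ε * (iw (pd z) ^ (2 : ℝ) * iw (pd z + ε) ^ (1 : ℝ)) := by
  obtain ⟨R, M, hR, hM0, hM, hη⟩ := exists_autocorr_bounds hr hc
  obtain ⟨A, hA, hsh⟩ := exists_circD_shift_le
  obtain ⟨a₁, ha₁, hs⟩ := exists_symmD_le
  obtain ⟨a₂, ha₂, hd⟩ := exists_covDer_le hr hc
  obtain ⟨a₃, ha₃, hav⟩ := exists_lintegral_symmD_average_le hr hc
  set c := boxRad R with hcdef
  have hc1 : 1 ≤ c := by rw [hcdef, boxRad]; linarith [Real.sqrt_nonneg R]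
  have hvol : volume (box R) ≠ ⊤ := by rw [volume_box]; finiteness
  set b₁ : ℝ≥0∞ := ENNReal.ofReal M * (ENNReal.ofReal (A * c) * ENNReal.ofReal 2)
    * volume (box R) with hb₁
  set b₂ : ℝ≥0∞ := (a₁ + a₂) * ENNReal.ofReal (2 * c + 1) with hb₂
  refine ⟨b₁ + b₂, by finiteness, fun ε hε hε1 z hz => ?_⟩
  have hp : 0 < pd z := pd_pos hz.ne' z.2
  rcases le_total (2 * (c * ε)) (pd z) with hcase | hcase
  · have hmv : Measurable fun v : ℝ × ℝ => symmD (z - dil ε v) :=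
      measurable_symmD.comp ((continuous_const.sub (continuous_dil ε)).measurable)
    have hi2 : Integrable fun v => autocorr ρ v * symmD (z - dil ε v) := by
      refine ⟨((continuous_autocorr hr hc).measurable.mul hmv).aestronglyMeasurable, ?_⟩
      refine (hav ε hε hε1 z).trans_lt ?_
      have := ENNReal.rpow_ne_top_of_nonneg zero_le_two
        (iw_ne_top (a := pd z + ε) (by linarith))
      exact lt_top_iff_ne_top.2 (by finiteness)
    have hi1 : Integrable fun v => autocorr ρ v * symmD z :=
      ((continuous_autocorr hr hc).integrable_of_hasCompactSupport
        (hasCompactSupport_autocorr hc)).mul_const _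
    have e1 : symmD z - covDer ρ ε z
        = ∫ v, autocorr ρ v * (symmD z - symmD (z - dil ε v)) := by
      simp_rw [mul_sub]
      rw [integral_sub hi1 hi2, integral_mul_const, integral_autocorr hr hc, h1, covDer]
      ring
    have hpt : ∀ᵐ v : ℝ × ℝ, v ∈ box R →
        ‖symmD z - symmD (z - dil ε v)‖ₑ
          ≤ ENNReal.ofReal (A * c) * ENNReal.ofReal 2 * (ENNReal.ofReal ε
            * (iw (pd z) ^ (2 : ℝ) * iw (pd z + ε) ^ (1 : ℝ))) := by
      filter_upwards [ae_sub_dil_fst_ne hε z.1] with v hv hvR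
      have hpn : pn (dil ε v) ≤ ε * c := by
        rw [pn_dil hε.le]; gcongr; exact pn_le_boxRad hvR
      have ht : |z.1 - (|z.1 - ε ^ 2 * v.1|)| ≤ |ε ^ 2 * v.1| := by
        have := abs_abs_sub_abs_le_abs_sub z.1 (z.1 - ε ^ 2 * v.1)
        rw [abs_of_pos hz, sub_sub_cancel] at this
        exact this
      have hsum : √(|z.1 - (|z.1 - ε ^ 2 * v.1|)|) + |z.2 - (z.2 - ε * v.2)| ≤ ε * c := by
        refine le_trans ?_ hpn
        rw [sub_sub_cancel]
        unfold pn dil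
        gcongr
      have h2 := hsh z.1 (|z.1 - ε ^ 2 * v.1|) z.2 (z.2 - ε * v.2) hz (abs_pos.2 hv)
        (by rw [Prod.mk.eta]; nlinarith)
      have e : |symmD z - symmD (z - dil ε v)| ≤ A * (ε * c) / pd z ^ 3 := by
        unfold symmD
        rw [abs_of_pos hz]
        refine h2.trans ?_
        rw [Prod.mk.eta]
        gcongr
      rw [le_div_iff₀ (by positivity)] at e
      have h3 := enorm_le_iw 3 (by norm_num) hp.le (by positivity) e
      have h4 : iw (pd z) ^ ((3 : ℕ) : ℝ) = iw (pd z) ^ (2 : ℝ) * iw (pd z) ^ (1 : ℝ) := by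
        rw [← iw_rpow_add _ (by norm_num) (by norm_num)]; norm_num
      have h5 : iw (pd z) ^ (1 : ℝ) ≤ ENNReal.ofReal 2 ^ (1 : ℝ) * iw (pd z + ε) ^ (1 : ℝ) :=
        iw_rpow_le_mul two_pos (by nlinarith) zero_le_one
      rw [ENNReal.rpow_one (ENNReal.ofReal 2)] at h5
      rw [h4] at h3
      refine h3.trans ?_
      rw [show A * (ε * c) = A * c * ε by ring, ENNReal.ofReal_mul (by positivity)]
      calc _ ≤ ENNReal.ofReal (A * c) * ENNReal.ofReal ε * (iw (pd z) ^ (2 : ℝ)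
            * (ENNReal.ofReal 2 * iw (pd z + ε) ^ (1 : ℝ))) := by gcongr
        _ = _ := by ring
    calc ‖symmD z - covDer ρ ε z‖ₑ
        ≤ ∫⁻ v, ‖autocorr ρ v * (symmD z - symmD (z - dil ε v))‖ₑ := by
          rw [e1]; exact enorm_integral_le_lintegral_enorm _
      _ = ∫⁻ v in box R, ‖autocorr ρ v * (symmD z - symmD (z - dil ε v))‖ₑ := by
          refine (setLIntegral_eq_of_support_subset ?_).symm
          intro v hv
          by_contra h
          simp [hη v h] at hv
      _ ≤ ∫⁻ _ in box R, ENNReal.ofReal M * (ENNReal.ofReal (A * c) * ENNReal.ofReal 2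
            * (ENNReal.ofReal ε * (iw (pd z) ^ (2 : ℝ) * iw (pd z + ε) ^ (1 : ℝ)))) := by
          refine setLIntegral_mono_ae measurable_const.aemeasurable ?_
          filter_upwards [hpt] with v hv hvR
          rw [enorm_mul]
          gcongr
          · rw [Real.enorm_eq_ofReal_abs]; exact ENNReal.ofReal_le_ofReal (hM v)
          · exact hv hvR
      _ = b₁ * ENNReal.ofReal ε * (iw (pd z) ^ (2 : ℝ) * iw (pd z + ε) ^ (1 : ℝ)) := by
          rw [lintegral_const, Measure.restrict_apply_univ, hb₁]; ring
      _ ≤ _ := by gcongr; exact le_self_add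
  · have h5 : (1 : ℝ≥0∞) ≤ ENNReal.ofReal ((2 * c + 1) * ε) * iw (pd z + ε) := by
      have := iw_le_mul (c := (2 * c + 1) * ε) (a := 1) (b := pd z + ε) (by positivity)
        (by nlinarith)
      simpa [iw] using this
    rw [ENNReal.ofReal_mul (by positivity)] at h5
    calc ‖symmD z - covDer ρ ε z‖ₑ ≤ ‖symmD z‖ₑ + ‖covDer ρ ε z‖ₑ := enorm_sub_le
      _ ≤ a₁ * iw (pd z) ^ (2 : ℝ) + a₂ * iw (pd z) ^ (2 : ℝ) := by
          refine add_le_add (hs z) ((hd ε hε hε1 z).trans ?_)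
          gcongr
          exact iw_anti (by linarith)
      _ = (a₁ + a₂) * iw (pd z) ^ (2 : ℝ) * 1 := by ring
      _ ≤ (a₁ + a₂) * iw (pd z) ^ (2 : ℝ) * (ENNReal.ofReal (2 * c + 1) * ENNReal.ofReal ε
            * iw (pd z + ε)) := by gcongr
      _ = b₂ * ENNReal.ofReal ε * (iw (pd z) ^ (2 : ℝ) * iw (pd z + ε) ^ (1 : ℝ)) := by
          rw [ENNReal.rpow_one, hb₂]; ring
      _ ≤ _ := by gcongr; exact le_add_self

lemma exists_lineQ_le : ∃ a : ℝ≥0∞, a ≠ ⊤ ∧ ∀ z, ‖lineQ z‖ₑ ≤ a * iw (pd z) ^ (1 : ℝ) := by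
  obtain ⟨A, hA, h⟩ := exists_heatKernelLine_le_one
  refine ⟨ENNReal.ofReal A, by simp, fun z => ?_⟩
  have := enorm_le_iw (y := lineQ z) (d := pd z) (A := A) 1 one_ne_zero (pd_nonneg z) hA ?_
  · simpa using this
  rcases eq_or_ne z.1 0 with h0 | h0
  · rw [lineQ, h0, abs_zero, heatKernelLine_of_nonpos (z := (0, _)) le_rfl]
    simpa using hA.le
  · have h1 := h |z.1| z.2 (abs_pos.2 h0)
    have hp : 0 < pd z := pd_pos h0 z.2
    have e : pd z ≤ √|z.1| + |z.2| := pd_le_pn z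
    rw [le_div_iff₀ (by linarith)] at h1
    have h2 := heatKernelLine_nonneg (|z.1|, z.2)
    rw [lineQ, abs_of_nonneg (by positivity), pow_one]
    nlinarith

lemma measurable_lineQ : Measurable lineQ := by
  have h : Measurable fun z : ℝ × ℝ => (|z.1|, z.2) := by
    exact (continuous_abs.measurable.comp measurable_fst).prodMk measurable_snd
  exact (measurable_heatKernelLine.comp h).const_mul _

lemma integrable_autocorr_mul_lineQ (hr : Continuous ρ) (hc : HasCompactSupport ρ) :
    Integrable fun v => autocorr ρ v * lineQ (0 - v) := by
  obtain ⟨a, ha, h⟩ := exists_lineQ_le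
  have hl : LocallyIntegrable fun v => lineQ (0 - v) := by
    refine locallyIntegrable_of_le_iw (γ := 1)
      (measurable_lineQ.comp (measurable_const.sub measurable_id)) ha one_pos
      (by norm_num) fun z => (h _).trans ?_
    rw [zero_sub, pd_neg]
  exact hl.integrable_smul_left_of_hasCompactSupport (continuous_autocorr hr hc)
    (hasCompactSupport_autocorr hc)

/-- The variance of the rescaled field on the circle converges to the variance of the field on the
line, at rate `ε`: the two heat kernels differ by a bounded function, and the kernel of the line is
invariant under the parabolic scaling. -/
lemma exists_covFun_zero_sub_le (hr : Continuous ρ) (hc : HasCompactSupport ρ) :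
    ∃ A : ℝ, 0 ≤ A ∧ ∀ ε : ℝ, 0 < ε → ε ≤ 1 →
      |covFun ρ ε 0 - ∫ v, autocorr ρ v * lineQ (0 - v)| ≤ A * ε := by
  obtain ⟨R, M, hR, hM0, hM, hη⟩ := exists_autocorr_bounds hr hc
  obtain ⟨A, hA, hP⟩ := exists_heatKernelCircle_sub_line_le
  obtain ⟨a, ha, hC⟩ := exists_covFun_le hr hc
  set s := ∫ v, autocorr ρ v * lineQ (0 - v) with hs
  set V := (volume (box R)).toReal with hV
  refine ⟨M * (A + 1) * V + (a.toReal + |s|) * (2 * (R + 1)), by positivity, fun ε hε hε1 => ?_⟩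
  rcases le_total (2 * (R + 1) * ε) 1 with hcase | hcase
  · have hpt : ∀ᵐ v : ℝ × ℝ, ‖ε * (autocorr ρ v * circQ (0 - dil ε v))
        - autocorr ρ v * lineQ (0 - v)‖ ≤ (box R).indicator (fun _ => M * (A + 1) * ε) v := by
      filter_upwards [ae_fst_ne 0] with v hv
      by_cases hvR : v ∈ box R
      · rw [indicator_of_mem hvR]
        have hv1 : |v.1| ≤ R := abs_le.2 hvR.1
        have hv2 : |v.2| ≤ R := abs_le.2 hvR.2
        have hx : |(-(ε * v.2))| < 1 / 2 := by
          rw [abs_neg, abs_mul, abs_of_pos hε]; nlinarith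
        have hround : round (-(ε * v.2)) = 0 := by
          rw [round_eq_zero_iff]
          exact ⟨by linarith [(abs_lt.1 hx).1], (abs_lt.1 hx).2⟩
        have ht : |-(ε ^ 2 * v.1)| = ε ^ 2 * |v.1| := by
          rw [abs_neg, abs_mul, abs_of_pos (by positivity : 0 < ε ^ 2)]
        have ht1 : ε ^ 2 * |v.1| ≤ 1 := by nlinarith [abs_nonneg v.1]
        have h0 := hP (ε ^ 2 * |v.1|) (-(ε * v.2))
          (mul_pos (by positivity) (abs_pos.2 hv)) ht1
        rw [hround, Int.cast_zero, sub_zero] at h0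
        have h1 : lineQ (0 - v) = ε * ((1 / 2) * heatKernelLine (ε ^ 2 * |v.1|, -(ε * v.2))) := by
          have := dil_heatKernelLine hε (|v.1|, -v.2)
          rw [lineQ, mul_left_comm, Prod.fst_sub, Prod.snd_sub, Prod.fst_zero, Prod.snd_zero,
            zero_sub, zero_sub, abs_neg, ← this]
          simp only [dil, mul_neg]
        have h2 : circQ (0 - dil ε v)
            = (1 / 2) * (heatKernelCircle (ε ^ 2 * |v.1|, -(ε * v.2)) - 1) := by
          unfold circQ
          simp only [dil, zero_sub, Prod.fst_neg, Prod.snd_neg, ht]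
        rw [h1, h2, Real.norm_eq_abs]
        set P := heatKernelCircle (ε ^ 2 * |v.1|, -(ε * v.2))
        set L := heatKernelLine (ε ^ 2 * |v.1|, -(ε * v.2))
        have e : ε * (autocorr ρ v * (1 / 2 * (P - 1))) - autocorr ρ v * (ε * (1 / 2 * L))
            = autocorr ρ v * ((1 / 2) * ((P - L) - 1)) * ε := by ring
        rw [e, abs_mul, abs_mul, abs_of_pos hε]
        gcongr
        · exact hM v
        · rw [abs_mul, abs_of_pos (by norm_num : (0 : ℝ) < 1 / 2)]
          have := abs_sub (P - L) 1
          rw [abs_one] at this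
          linarith
      · rw [indicator_of_notMem hvR, hη v hvR]; simp
    have hi1 := (integrable_autocorr_mul_circQ hr hc hε hε1 0).const_mul ε
    have e : covFun ρ ε 0 - s = ∫ v, (ε * (autocorr ρ v * circQ (0 - dil ε v))
        - autocorr ρ v * lineQ (0 - v)) := by
      rw [integral_sub hi1 (integrable_autocorr_mul_lineQ hr hc), integral_const_mul, covFun]
    have hvol : volume (box R) ≠ ⊤ := by rw [volume_box]; finiteness
    have hind : Integrable ((box R).indicator (fun _ => M * (A + 1) * ε)) :=
      (integrable_indicator_iff (measurableSet_box R)).2 (integrableOn_const hvol)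
    have h3 := norm_integral_le_of_norm_le hind hpt
    rw [← e, integral_indicator (measurableSet_box R), setIntegral_const, Real.norm_eq_abs,
      smul_eq_mul, measureReal_def, ← hV] at h3
    refine h3.trans ?_
    have : 0 ≤ (a.toReal + |s|) * (2 * (R + 1)) * ε := by positivity
    linarith
  · have h1 : |covFun ρ ε 0| ≤ a.toReal := by
      have := hC ε hε hε1 0
      have e0 : pd (0 : ℝ × ℝ) = 0 := by simp [pd]
      rw [e0, zero_add, iw, ENNReal.rpow_one, mul_assoc,
        ENNReal.mul_inv_cancel (by simpa using hε) (by simp), mul_one] at this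
      rw [← Real.norm_eq_abs, ← toReal_enorm]
      exact ENNReal.toReal_mono ha this
    have h2 := abs_sub (covFun ρ ε 0) s
    have h3 : 0 ≤ M * (A + 1) * V * ε := by positivity
    have h4 : 0 ≤ a.toReal + |s| := by positivity
    nlinarith

end Cov

section Fields

variable {Ω : Type u} [MeasurableSpace Ω] {μ : Measure Ω} {ρ : ℝ × ℝ → ℝ}
  {ξ : (ℝ × ℝ → ℝ) → Ω → ℝ}

lemma IsWhiteNoise.hasGaussianLaw_triple {E : Type*} [MeasurableSpace E] {ν : Measure E}
    {ξ : (E → ℝ) → Ω → ℝ} (hξ : IsWhiteNoise ν μ ξ) {g₁ g₂ g₃ : E → ℝ} (h₁ : MemLp g₁ 2 ν)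
    (h₂ : MemLp g₂ 2 ν) (h₃ : MemLp g₃ 2 ν) (c : ℝ) :
    HasGaussianLaw (fun η => (c * ξ g₁ η, c * ξ g₂ η, c * ξ g₃ η)) μ := by
  classical
  have h := hξ.gaussian.hasGaussianLaw {⟨g₁, h₁⟩, ⟨g₂, h₂⟩, ⟨g₃, h₃⟩}
  let I : Finset {g : E → ℝ // MemLp g 2 ν} := {⟨g₁, h₁⟩, ⟨g₂, h₂⟩, ⟨g₃, h₃⟩}
  let L : (I → ℝ) →L[ℝ] ℝ × ℝ × ℝ :=
    (c • ContinuousLinearMap.proj (⟨⟨g₁, h₁⟩, by simp [I]⟩ : I)).prod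
      ((c • ContinuousLinearMap.proj (⟨⟨g₂, h₂⟩, by simp [I]⟩ : I)).prod
        (c • ContinuousLinearMap.proj (⟨⟨g₃, h₃⟩, by simp [I]⟩ : I)))
  exact h.map L

lemma memLp_fieldCircle (hr : Continuous ρ) (hc : HasCompactSupport ρ) {ε : ℝ} (hε : 0 < ε)
    (z : ℝ × ℝ) :
    MemLp (fun w => spaceTimeConv (spaceDeriv heatKernelCircle) (rescale ε ρ) (z - w)) 2
      circleVolume := by
  rw [circleVolume_eq, spaceDeriv_heatKernelCircle]
  exact isNoiseKernel_circle.memLp_conv (continuous_rescale hr ε) (hasCompactSupport_rescale hc hε) z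

/-- The covariance of the field is stationary and given by `covFun`. -/
lemma integral_scaledField_mul (hξ : IsWhiteNoise circleVolume μ ξ) (hr : Continuous ρ)
    (hc : HasCompactSupport ρ) {ε : ℝ} (hε : 0 < ε) (x y : ℝ × ℝ) :
    ∫ η, scaledField ρ ξ ε x η * scaledField ρ ξ ε y η ∂μ = covFun ρ ε (x - y) := by
  have h := hξ.covariance _ _ (memLp_fieldCircle hr hc hε x) (memLp_fieldCircle hr hc hε y)
  have e : ∀ η, scaledField ρ ξ ε x η * scaledField ρ ξ ε y η
      = ε * (fieldCircle ρ ξ ε x η * fieldCircle ρ ξ ε y η) := fun η => by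
    rw [scaledField, scaledField]
    calc _ = √ε * √ε * (fieldCircle ρ ξ ε x η * fieldCircle ρ ξ ε y η) := by ring
      _ = _ := by rw [Real.mul_self_sqrt hε.le]
  simp_rw [e]
  rw [integral_const_mul]
  unfold fieldCircle
  rw [h, circleVolume_eq, spaceDeriv_heatKernelCircle, (isNoiseKernel_circle.correlation_conv
    (continuous_rescale hr ε) (hasCompactSupport_rescale hc hε) x y).2, covFun_eq_conv hε]

/-- By the isometry property of white noise the covariances are correlations of the mollified
kernel. -/
lemma gTriple_scaledField (hξ : IsWhiteNoise circleVolume μ ξ) (hr : Continuous ρ)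
    (hc : HasCompactSupport ρ) {ε : ℝ} (hε : 0 < ε) (x y z : ℝ × ℝ) :
    GTriple μ (scaledField ρ ξ ε x) (scaledField ρ ξ ε y) (scaledField ρ ξ ε z)
      (covFun ρ ε 0) (covFun ρ ε (x - y)) (covFun ρ ε (x - z)) (covFun ρ ε (y - z)) := by
  have hm : ∀ z, ∫ η, scaledField ρ ξ ε z η ∂μ = 0 := fun z => by
    unfold scaledField
    rw [integral_const_mul]
    unfold fieldCircle
    rw [hξ.mean_zero _ (memLp_fieldCircle hr hc hε z), mul_zero]
  have hv := integral_scaledField_mul hξ hr hc hε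
  exact ⟨hξ.hasGaussianLaw_triple (memLp_fieldCircle hr hc hε x) (memLp_fieldCircle hr hc hε y)
    (memLp_fieldCircle hr hc hε z) √ε, hm x, hm y, hm z, by rw [hv, sub_self], by rw [hv, sub_self],
    by rw [hv, sub_self], hv x y, hv x z, hv y z⟩

lemma couplingConst_eq_gMean {F : ℝ → ℝ} (hF : Continuous (iteratedDeriv 2 F))
    (hξ : IsWhiteNoise volume μ ξ) (hr : Continuous ρ) (hc : HasCompactSupport ρ) :
    couplingConst μ F ρ ξ
      = (1 / 2) * gMean (iteratedDeriv 2 F) (∫ v, autocorr ρ v * lineQ (0 - v)) := by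
  have hm : MemLp (fun w => spaceTimeConv (spaceDeriv heatKernelLine) ρ (0 - w)) 2 volume := by
    rw [spaceDeriv_heatKernelLine]
    exact isNoiseKernel_line.memLp_conv hr hc 0
  have hg : HasGaussianLaw (fieldLine ρ ξ 0) μ := hξ.gaussian.hasGaussianLaw_eval ⟨_, hm⟩
  have hv : ∫ η, fieldLine ρ ξ 0 η * fieldLine ρ ξ 0 η ∂μ
      = ∫ v, autocorr ρ v * lineQ (0 - v) := by
    unfold fieldLine
    rw [hξ.covariance _ _ hm hm, spaceDeriv_heatKernelLine, Measure.volume_eq_prod,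
      (isNoiseKernel_line.correlation_conv hr hc 0 0).2, sub_self]
    rfl
  rw [couplingConst, integral_comp_of_centred hg (hξ.mean_zero _ hm) hv hF]

end Fields

/-! ### The truncated kernel -/

/-- The properties of the space derivative of a truncated heat kernel which matter here: it is odd,
supported in `box R`, has the singularity of the derivative of the heat kernel at the origin, and
coincides with the latter up to a bounded function on `(0, ∞) × [-1/2, 1/2]`. -/
structure IsTruncatedDeriv (k : ℝ × ℝ → ℝ) (R A : ℝ) : Prop where
  meas : Measurable k
  odd : ∀ z, k (xrefl z) = -k z
  supp : ∀ z, z ∉ box R → k z = 0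
  bound : ∀ z, |k z| * pn z ^ 2 ≤ A
  past : ∀ z, z.1 ≤ 0 → |k z| ≤ A
  away : ∀ z, 1 / 2 ≤ |z.2| → |k z| ≤ A
  near : ∀ z, 0 < z.1 → |z.2| ≤ 1 / 2 → |k z - symmD z| ≤ A

lemma symmD_of_pos {z : ℝ × ℝ} (hz : 0 < z.1) : symmD z = circD z := by
  rw [symmD, abs_of_pos hz]

/-- A common description of the heat kernels of the circle and of the line near the origin. -/
lemma exists_spaceDeriv_near_bounds {P : ℝ × ℝ → ℝ}
    (hP : P = heatKernelCircle ∨ P = heatKernelLine) :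
    ∃ A : ℝ, 0 < A ∧ (∀ z, z.1 ≤ 0 → spaceDeriv P z = 0) ∧
      ∀ z, 0 < z.1 → |z.2| ≤ 1 / 2 → |spaceDeriv P z - symmD z| ≤ A := by
  rcases hP with rfl | rfl
  · refine ⟨1, one_pos, fun z hz => ?_, fun z hz _ => ?_⟩
    · rw [spaceDeriv_heatKernelCircle, circD_of_nonpos hz]
    · rw [spaceDeriv_heatKernelCircle, symmD_of_pos hz, sub_self, abs_zero]; exact zero_le_one
  · obtain ⟨A, hA, h⟩ := exists_circD_sub_lineD_le
    obtain ⟨A₁, hA₁, h₁⟩ := exists_lineD_le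
    refine ⟨A + A₁ * 32, by positivity, fun z hz => ?_, fun z hz hx => ?_⟩
    · rw [spaceDeriv_heatKernelLine, lineD_of_nonpos hz]
    · rw [spaceDeriv_heatKernelLine, symmD_of_pos hz, abs_sub_comm]
      have h2 := h z.1 z.2 hz
      rcases hx.lt_or_eq with hx | hx
      · have hr : round z.2 = 0 := by
          rw [round_eq_zero_iff]
          exact ⟨by linarith [(abs_lt.1 hx).1], (abs_lt.1 hx).2⟩
        rw [hr, Int.cast_zero, sub_zero] at h2
        exact h2.trans (by linarith [mul_pos hA₁ (by norm_num : (0 : ℝ) < 32)])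
      · -- at distance `1/2` from the integers the kernel of the line is bounded
        have hb : ∀ y : ℝ, |y| = 1 / 2 → |lineD (z.1, y)| ≤ A₁ * 16 := fun y hy => by
          refine (h₁ z.1 y hz).trans ?_
          rw [hy, div_le_iff₀ (by positivity)]
          have : (1 / 2 : ℝ) ^ 2 ≤ (√z.1 + 1 / 2) ^ 2 := by
            gcongr; linarith [Real.sqrt_nonneg z.1]
          nlinarith
        have hr : |z.2 - round z.2| = 1 / 2 := by
          rw [circle_norm_eq_round, circle_norm_eq hx.le, hx]
        have h4 := hb _ hr
        have h5 := hb z.2 hx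
        calc |circD z - lineD z|
            ≤ |circD z - lineD (z.1, z.2 - round z.2)| + |lineD (z.1, z.2 - round z.2)|
              + |lineD z| := by
              have := abs_sub_le (circD z) (lineD (z.1, z.2 - round z.2)) (lineD z)
              have := abs_sub (lineD (z.1, z.2 - round z.2)) (lineD z)
              linarith
          _ ≤ A + A₁ * 16 + A₁ * 16 := add_le_add (add_le_add h2 h4) h5
          _ = _ := by ring

lemma spaceDeriv_xrefl {K : ℝ × ℝ → ℝ} (hs : ∀ t x, K (t, -x) = K (t, x)) (z : ℝ × ℝ) :
    spaceDeriv K (xrefl z) = -spaceDeriv K z := by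
  have h : (fun x => K (z.1, x)) = fun x => K (z.1, -x) := funext fun x => (hs _ _).symm
  unfold spaceDeriv
  change deriv (fun x => K (z.1, x)) (-z.2) = _
  conv_rhs => rw [h]
  rw [deriv_comp_neg (fun x => K (z.1, x)), neg_neg]

lemma continuousOn_spaceDeriv {K : ℝ × ℝ → ℝ} (hK : ContDiffOn ℝ ∞ K {0}ᶜ) :
    ContinuousOn (spaceDeriv K) {0}ᶜ := by
  have h1 : ContinuousOn (fun z => fderiv ℝ K z (0, 1)) {0}ᶜ :=
    (hK.continuousOn_fderiv_of_isOpen isOpen_compl_singleton (by simp)).clm_apply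
      continuousOn_const
  refine h1.congr fun z hz => ?_
  have hd : HasFDerivAt K (fderiv ℝ K z) z :=
    ((hK.contDiffAt (isOpen_compl_singleton.mem_nhds hz)).differentiableAt (by simp)).hasFDerivAt
  have h2 : HasDerivAt (fun x : ℝ => (z.1, x)) ((0 : ℝ), (1 : ℝ)) z.2 :=
    (hasDerivAt_const z.2 z.1).prodMk (hasDerivAt_id z.2)
  exact (hd.comp_hasDerivAt z.2 h2).deriv

lemma spaceDeriv_eq_zero_of_notMem_tsupport {K : ℝ × ℝ → ℝ} {z : ℝ × ℝ} (hz : z ∉ tsupport K) :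
    spaceDeriv K z = 0 := by
  have h : ∀ᶠ y in 𝓝 z, K y = 0 := by
    filter_upwards [(isClosed_tsupport K).isOpen_compl.mem_nhds hz] with y hy
    exact image_eq_zero_of_notMem_tsupport hy
  have h2 : ∀ᶠ x in 𝓝 z.2, K (z.1, x) = 0 :=
    ((continuous_const.prodMk continuous_id).tendsto' z.2 z rfl).eventually h
  unfold spaceDeriv
  rw [EventuallyEq.deriv_eq (f := fun _ => (0 : ℝ)) h2, deriv_const]

/-- Near the origin the truncated kernel is the heat kernel; elsewhere its derivative is bounded on
the compact support, and so is the derivative of the heat kernel. -/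
lemma IsTruncation.exists_isTruncatedDeriv {P K : ℝ × ℝ → ℝ} (hK : IsTruncation P K)
    (hP : P = heatKernelCircle ∨ P = heatKernelLine) :
    ∃ R A : ℝ, 0 < R ∧ 0 < A ∧ IsTruncatedDeriv (spaceDeriv K) R A := by
  obtain ⟨A₁, hA₁, hpast, hnear⟩ := exists_spaceDeriv_near_bounds hP
  obtain ⟨A₂, hA₂, hcirc⟩ := exists_circD_le_pd
  obtain ⟨r₀, hr₀, hball⟩ := Metric.eventually_nhds_iff.1 (eventually_nhdsWithin_iff.1
    hK.eq_near_origin)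
  set r := min r₀ (1 / 2) with hr
  have hrpos : 0 < r := lt_min hr₀ (by norm_num)
  have hr2 : r ≤ 1 / 2 := min_le_right _ _
  have hcont := continuousOn_spaceDeriv hK.contDiffOn
  have hodd := spaceDeriv_xrefl hK.symm
  have h0 : spaceDeriv K 0 = 0 := by
    have := hodd 0
    have e : xrefl (0 : ℝ × ℝ) = 0 := by ext <;> simp [xrefl]
    rw [e] at this; linarith
  -- near the origin the kernel is the derivative of the heat kernel
  have hin : ∀ z : ℝ × ℝ, ‖z‖ < r → z ≠ 0 → spaceDeriv K z = spaceDeriv P z := by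
    intro z hz hz0
    have ho : ∀ᶠ y in 𝓝 z, K y = P y := by
      have h1 : ∀ᶠ y in 𝓝 z, ‖y‖ < r := continuous_norm.continuousAt.eventually_lt_const hz
      have h2 : ∀ᶠ y in 𝓝 z, y ≠ 0 := isOpen_ne.mem_nhds hz0
      filter_upwards [h1, h2] with y hy hy0
      exact hball (by rw [dist_zero_right]; exact hy.trans_le (min_le_left _ _)) hy0
    have h2 : ∀ᶠ x in 𝓝 z.2, K (z.1, x) = P (z.1, x) :=
      ((continuous_const.prodMk continuous_id).tendsto' z.2 z rfl).eventually ho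
    exact EventuallyEq.deriv_eq h2
  -- away from the origin it is bounded
  obtain ⟨A₃, hA₃⟩ : ∃ A₃ : ℝ, ∀ z : ℝ × ℝ, r ≤ ‖z‖ → |spaceDeriv K z| ≤ A₃ := by
    have hcpt : IsCompact (tsupport K ∩ {z | r ≤ ‖z‖}) :=
      hK.compactSupport.inter_right (isClosed_le continuous_const continuous_norm)
    obtain ⟨B, hB⟩ := hcpt.exists_bound_of_continuousOn (hcont.mono fun z hz => by
      intro h
      rw [mem_singleton_iff.1 h] at hz
      have : r ≤ ‖(0 : ℝ × ℝ)‖ := hz.2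
      rw [norm_zero] at this; linarith)
    refine ⟨max B 0, fun z hz => ?_⟩
    by_cases h : z ∈ tsupport K
    · exact (hB z ⟨h, hz⟩).trans (le_max_left _ _)
    · rw [spaceDeriv_eq_zero_of_notMem_tsupport h, abs_zero]; exact le_max_right _ _
  have hA₃0 : 0 ≤ A₃ := (abs_nonneg _).trans (hA₃ (r, 0) (by simp [Prod.norm_def, le_abs_self]))
  obtain ⟨R, hR, hbox⟩ := exists_box_of_hasCompactSupport hK.compactSupport
  have hsupp : ∀ z, z ∉ box R → spaceDeriv K z = 0 := by
    intro z hz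
    by_contra hne
    have hsub : tsupport K ⊆ box R := closure_minimal (fun y hy => by
      by_contra h; exact hy (hbox y h)) (isCompact_box R).isClosed
    exact hne (spaceDeriv_eq_zero_of_notMem_tsupport fun h => hz (hsub h))
  have hsym : ∀ z : ℝ × ℝ, 0 < z.1 → |symmD z| * pd z ^ 2 ≤ A₂ := fun z hz => by
    rw [symmD_of_pos hz]
    have := hcirc z.1 z.2 hz
    rwa [le_div_iff₀ (by have := pd_pos hz.ne' z.2; positivity)] at this
  have hsym2 : ∀ z : ℝ × ℝ, 0 < z.1 → |z.2| ≤ 1 / 2 → r ≤ ‖z‖ → |symmD z| ≤ A₂ / r ^ 2 := by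
    intro z hz hx hn
    rw [le_div_iff₀ (by positivity)]
    refine le_trans ?_ (hsym z hz)
    gcongr
    rw [Prod.norm_def, le_max_iff, Real.norm_eq_abs, Real.norm_eq_abs] at hn
    unfold pd
    rcases hn with hn | hn
    · have h1 : r ≤ √|z.1| := by
        refine Real.le_sqrt_of_sq_le ?_
        nlinarith
      have : r ≤ min √|z.1| 1 := le_min h1 (by linarith)
      linarith [norm_nonneg (z.2 : UnitAddCircle)]
    · rw [circle_norm_eq hx]
      have : 0 ≤ min √|z.1| 1 := le_min (Real.sqrt_nonneg _) zero_le_one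
      linarith
  set c := boxRad R
  have hc : 0 ≤ c := by simp only [c, boxRad]; positivity
  refine ⟨R, (3 * A₁ + A₂) + (A₃ * c ^ 2) + (A₃ + A₂ / r ^ 2), hR, by positivity, ?_⟩
  have p1 : 0 ≤ A₃ * c ^ 2 := by positivity
  have p2 : 0 ≤ A₂ / r ^ 2 := by positivity
  refine ⟨measurable_of_continuousOn_compl_singleton 0 hcont, hodd, hsupp, fun z => ?_,
    fun z hz => ?_, fun z hz => ?_, fun z hz hx => ?_⟩
  · rcases eq_or_ne z 0 with rfl | hz0
    · rw [h0, abs_zero, zero_mul]; positivity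
    rcases lt_or_ge ‖z‖ r with hn | hn
    · rw [hin z hn hz0]
      rcases le_or_gt z.1 0 with ht | ht
      · rw [hpast z ht, abs_zero, zero_mul]; positivity
      · have hx : |z.2| ≤ 1 / 2 := (norm_snd_le z).trans (hn.le.trans hr2)
        have ht1 : |z.1| ≤ 1 / 2 := (norm_fst_le z).trans (hn.le.trans hr2)
        have e1 := hnear z ht hx
        have e2 := hsym z ht
        rw [pn_eq_pd (by linarith) hx] at e2
        have e3 : |spaceDeriv P z| ≤ A₁ + |symmD z| := by
          have := abs_sub_abs_le_abs_sub (spaceDeriv P z) (symmD z); linarith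
        have e4 : pn z ^ 2 ≤ 3 := by
          have h1 : √|z.1| ≤ 1 := by
            rw [Real.sqrt_le_left zero_le_one]; linarith
          have h2 : pn z ≤ 3 / 2 := by unfold pn; linarith
          nlinarith [pn_nonneg z]
        nlinarith [mul_le_mul_of_nonneg_right e3 (sq_nonneg (pn z)),
          mul_le_mul_of_nonneg_left e4 hA₁.le]
    · by_cases hb : z ∈ box R
      · have e1 : pn z ^ 2 ≤ c ^ 2 := by
          gcongr
          · exact pn_nonneg z
          · exact pn_le_boxRad hb
        have := mul_le_mul (hA₃ z hn) e1 (by positivity) hA₃0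
        linarith
      · rw [hsupp z hb, abs_zero, zero_mul]; positivity
  · rcases eq_or_ne z 0 with rfl | hz0
    · rw [h0, abs_zero]; positivity
    rcases lt_or_ge ‖z‖ r with hn | hn
    · rw [hin z hn hz0, hpast z hz, abs_zero]; positivity
    · linarith [hA₃ z hn]
  · have : r ≤ ‖z‖ := hr2.trans (hz.trans (norm_snd_le z))
    linarith [hA₃ z this]
  · rcases lt_or_ge ‖z‖ r with hn | hn
    · rw [hin z hn (by rintro rfl; simp at hz)]
      linarith [hnear z hz hx]
    · have := abs_sub (spaceDeriv K z) (symmD z)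
      linarith [hA₃ z hn, hsym2 z hz hx hn]

/-- The properties of the truncated kernel `k`, of the covariance function `C` of the field at scale
`ε`, and of the derivative `(ε / 2) D` of `C`, on which the cancellation rests. The constant `a`
does not depend on `ε`. -/
structure CovKernel (k C D : ℝ × ℝ → ℝ) (R ε : ℝ) (a : ℝ≥0∞) : Prop where
  R_pos : 0 < R
  ε_pos : 0 < ε
  ε_le : ε ≤ 1
  a_ne : a ≠ ⊤
  k_meas : Measurable k
  k_odd : ∀ z, k (xrefl z) = -k z
  k_supp : ∀ z, z ∉ box R → k z = 0
  k_le : ∀ z, ‖k z‖ₑ ≤ a * iw (pn z) ^ (2 : ℝ)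
  k_past : ∀ z, z.1 ≤ 0 → ‖k z‖ₑ ≤ a
  k_away : ∀ z, 1 / 2 ≤ |z.2| → ‖k z‖ₑ ≤ a
  C_cont : Continuous C
  D_cont : Continuous D
  C_deriv : ∀ t x, HasDerivAt (fun x => C (t, x)) (ε / 2 * D (t, x)) x
  C_neg : ∀ z, C (-z) = C z
  C_refl : ∀ z, C (xrefl z) = C z
  C_per : ∀ (t x : ℝ) (n : ℤ), C (t, x + n) = C (t, x)
  C_le : ∀ z, ‖C z‖ₑ ≤ a * ENNReal.ofReal ε * iw (pd z + ε) ^ (1 : ℝ)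
  D_le : ∀ z, ‖D z‖ₑ ≤ a * iw (pd z + ε) ^ (2 : ℝ)
  kD_le : ∀ z, 0 < z.1 → |z.2| ≤ 1 / 2 →
    ‖k z - D z‖ₑ ≤ a * (1 + ENNReal.ofReal ε * (iw (pd z) ^ (2 : ℝ) * iw (pd z + ε) ^ (1 : ℝ)))

/-- At positive times `k` differs from the derivative of the heat kernel by a bounded amount, and
the latter from `covDer` by an amount that is small away from the scale `ε`. -/
lemma exists_covKernel {ρ k : ℝ × ℝ → ℝ} {R A : ℝ} (hR : 0 < R) (hA : 0 < A)
    (hk : IsTruncatedDeriv k R A) (hr : Continuous ρ) (hc : HasCompactSupport ρ)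
    (hs : ∀ z, ρ (xrefl z) = ρ z) (h1 : ∫ z, ρ z = 1) :
    ∃ a : ℝ≥0∞, ∀ ε : ℝ, 0 < ε → ε ≤ 1 →
      CovKernel k (covFun ρ ε) (covDer ρ ε) R ε a := by
  obtain ⟨a₁, ha₁, h₁⟩ := exists_covFun_le hr hc
  obtain ⟨a₂, ha₂, h₂⟩ := exists_covDer_le hr hc
  obtain ⟨a₃, ha₃, h₃⟩ := exists_symmD_sub_covDer_le hr hc h1
  have hle : ∀ y : ℝ, |y| ≤ A → ‖y‖ₑ ≤ ENNReal.ofReal A := fun y hy => by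
    rw [Real.enorm_eq_ofReal_abs]; exact ENNReal.ofReal_le_ofReal hy
  refine ⟨ENNReal.ofReal A + (a₁ + (a₂ + a₃)), fun ε hε hε1 => ?_⟩
  have l1 : a₁ ≤ ENNReal.ofReal A + (a₁ + (a₂ + a₃)) := le_self_add.trans le_add_self
  have l2 : a₂ ≤ ENNReal.ofReal A + (a₁ + (a₂ + a₃)) :=
    (le_self_add.trans le_add_self).trans le_add_self
  refine ⟨hR, hε, hε1, by finiteness, hk.meas, hk.odd, hk.supp, fun z => ?_,
    fun z hz => (hle _ (hk.past z hz)).trans le_self_add,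
    fun z hz => (hle _ (hk.away z hz)).trans le_self_add, continuous_covFun hr hc hε,
    continuous_covDer hr hc hε, hasDerivAt_covFun hr hc hε hε1, covFun_neg ε, covFun_xrefl hs ε,
    covFun_add_int ε, fun z => ?_, fun z => ?_, fun z hz hx => ?_⟩
  · refine (enorm_le_iw 2 two_ne_zero (pn_nonneg z) hA (hk.bound z)).trans ?_
    rw [Nat.cast_ofNat]
    gcongr
    exact le_self_add
  · exact (h₁ ε hε hε1 z).trans (by gcongr)
  · exact (h₂ ε hε hε1 z).trans (by gcongr)
  · calc ‖k z - covDer ρ ε z‖ₑ = ‖(k z - symmD z) + (symmD z - covDer ρ ε z)‖ₑ := by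
          rw [sub_add_sub_cancel]
      _ ≤ ENNReal.ofReal A + a₃ * ENNReal.ofReal ε
          * (iw (pd z) ^ (2 : ℝ) * iw (pd z + ε) ^ (1 : ℝ)) :=
          (enorm_add_le _ _).trans (add_le_add (hle _ (hk.near z hz hx)) (h₃ ε hε hε1 z hz))
      _ ≤ (ENNReal.ofReal A + (a₁ + (a₂ + a₃))) * 1 + (ENNReal.ofReal A + (a₁ + (a₂ + a₃)))
          * (ENNReal.ofReal ε * (iw (pd z) ^ (2 : ℝ) * iw (pd z + ε) ^ (1 : ℝ))) := by
          rw [mul_one, mul_assoc a₃]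
          gcongr
          · exact le_self_add
          · exact (le_add_self.trans le_add_self).trans le_add_self
      _ = _ := by ring

lemma measurable_iw_rpow {f : ℝ × ℝ → ℝ} (hf : Continuous f) (γ : ℝ) :
    Measurable fun z => iw (f z) ^ γ :=
  (ENNReal.measurable_ofReal.comp hf.measurable).inv.pow_const γ

/-- The convolution of two powers of the distance on a box. -/
lemma exists_riesz_pd {R α β : ℝ} (hR : 0 ≤ R) (hα : 0 < α) (hα3 : α < 3) (hβ : 0 < β)
    (hβ3 : β < 3) (h : 3 < α + β) : ∃ c : ℝ≥0∞, c ≠ ⊤ ∧ ∀ w : ℝ × ℝ,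
      ∫⁻ u in box R, iw (pd u) ^ α * iw (pd (u + w)) ^ β ≤ c * iw (pd w) ^ (α + β - 3) := by
  obtain ⟨c, hc, hcw⟩ := exists_riesz (X := ℝ × ℝ) hα hα3 hβ hβ3 h (boxConst_ne_top R)
  refine ⟨c, hc, fun w => hcw _ pd (fun u => pd (u + w)) (pd w) (ballGrowth_id hR)
    (ballGrowth_add hR w) continuous_pd.measurable (by
      have := continuous_pd; exact Continuous.measurable (by fun_prop)) pd_nonneg
    (fun u => pd_nonneg _) (fun u => ?_) (pd_nonneg w)⟩
  have := pd_add_le (u + w) (-u)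
  rw [pd_neg, add_neg_cancel_comm] at this
  linarith

lemma exists_riesz_pn {R α β : ℝ} (hR : 0 ≤ R) (hα : 0 < α) (hα3 : α < 3) (hβ : 0 < β)
    (hβ3 : β < 3) (h : 3 < α + β) : ∃ c : ℝ≥0∞, c ≠ ⊤ ∧ ∀ w : ℝ × ℝ,
      ∫⁻ u in box R, iw (pn u) ^ α * iw (pn (u + w)) ^ β ≤ c * iw (pn w) ^ (α + β - 3) := by
  obtain ⟨c, hc, hcw⟩ := exists_riesz (X := ℝ × ℝ) hα hα3 hβ hβ3 h (boxConst_ne_top R)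
  refine ⟨c, hc, fun w => hcw _ pn (fun u => pn (u + w)) (pn w)
    ((ballGrowth_id hR).mono pd_le_pn)
    ((ballGrowth_add hR w).mono fun u => pd_le_pn _) continuous_pn.measurable (by
      have := continuous_pn; exact Continuous.measurable (by fun_prop)) pn_nonneg
    (fun u => pn_nonneg _) (fun u => ?_) (pn_nonneg w)⟩
  have := pn_add_le (u + w) (-u)
  rw [pn_neg, add_neg_cancel_comm] at this
  linarith

namespace CovKernel

variable {k C D : ℝ × ℝ → ℝ} {R ε : ℝ} {a : ℝ≥0∞}

lemma k_le_pd (h : CovKernel k C D R ε a) (z : ℝ × ℝ) : ‖k z‖ₑ ≤ a * iw (pd z) ^ (2 : ℝ) := by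
  refine (h.k_le z).trans ?_
  gcongr
  exact iw_anti (pd_le_pn z)

lemma k_ind_le (h : CovKernel k C D R ε a) (z : ℝ × ℝ) :
    ‖k z‖ₑ ≤ (box R).indicator (fun z => a * iw (pd z) ^ (2 : ℝ)) z := by
  by_cases hz : z ∈ box R
  · rw [indicator_of_mem hz]; exact h.k_le_pd z
  · rw [h.k_supp z hz]; simp

lemma C_le_pd (h : CovKernel k C D R ε a) (z : ℝ × ℝ) :
    ‖C z‖ₑ ≤ a * ENNReal.ofReal ε * iw (pd z) ^ (1 : ℝ) := by
  refine (h.C_le z).trans ?_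
  gcongr
  exact iw_anti (by linarith [h.ε_pos])

lemma lintegral_k_mul_eq (h : CovKernel k C D R ε a) (f : ℝ × ℝ → ℝ≥0∞) :
    ∫⁻ z, ‖k z‖ₑ * f z = ∫⁻ z in box R, ‖k z‖ₑ * f z := by
  refine (setLIntegral_eq_of_support_subset fun z hz => ?_).symm
  by_contra hb
  simp [h.k_supp z hb] at hz

lemma integrable_k (h : CovKernel k C D R ε a) : Integrable k := by
  refine ⟨h.k_meas.aestronglyMeasurable, ?_⟩
  have := h.lintegral_k_mul_eq fun _ => 1
  simp only [mul_one] at this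
  rw [HasFiniteIntegral, this]
  refine (lintegral_mono fun z => h.k_le_pd z).trans_lt ?_
  rw [lintegral_const_mul' _ _ h.a_ne]
  exact ENNReal.mul_lt_top h.a_ne.lt_top
    (lintegral_box_iw_lt_top h.R_pos.le two_pos (by norm_num))

/-- The oscillation of `C` along the space variable of the plane. -/
lemma C_sub_le_abs (h : CovKernel k C D R ε a) (t x y : ℝ) :
    ‖C (t, x) - C (t, y)‖ₑ ≤ 2 * a * ENNReal.ofReal ε * ENNReal.ofReal |x - y|
      * (iw (pd (t, x)) ^ (2 : ℝ) + iw (pd (t, y)) ^ (2 : ℝ)) := by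
  -- if one of the points is at distance `2|x - y|` from the origin, apply the mean value theorem
  have far : ∀ x y : ℝ, 0 < |x - y| → 2 * |x - y| ≤ pd (t, x) →
      ‖C (t, x) - C (t, y)‖ₑ ≤ 2 * a * ENNReal.ofReal ε * ENNReal.ofReal |x - y|
        * iw (pd (t, x)) ^ (2 : ℝ) := by
    intro x y h0 hxy
    set M : ℝ≥0∞ := a * (4 * iw (pd (t, x)) ^ (2 : ℝ)) with hM
    have hp : 0 < pd (t, x) := by linarith
    have hMt : M ≠ ⊤ := by
      have := ENNReal.rpow_ne_top_of_nonneg zero_le_two (iw_ne_top hp)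
      have := h.a_ne
      finiteness
    have hD : ∀ s ∈ uIcc x y, ‖ε / 2 * D (t, s)‖ ≤ ε / 2 * M.toReal := by
      intro s hs
      rw [norm_mul, Real.norm_of_nonneg (by linarith [h.ε_pos])]
      refine mul_le_mul_of_nonneg_left ?_ (by linarith [h.ε_pos])
      rw [← toReal_enorm]
      refine ENNReal.toReal_mono hMt ((h.D_le _).trans ?_)
      rw [hM]
      gcongr
      have h2 : pd (t, x) ≤ pd (t, s) + |x - y| := by
        have h3 := pd_add_le (t, s) (0, x - s)
        have h4 := circle_norm_le (x - s)
        have h5 : |x - s| ≤ |x - y| := by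
          rw [abs_sub_comm x s, abs_sub_comm x y]
          exact abs_sub_left_of_mem_uIcc hs
        have e : ((t, s) : ℝ × ℝ) + (0, x - s) = (t, x) := by ext <;> simp
        have e2 : pd (0, x - s) = ‖((x - s : ℝ) : UnitAddCircle)‖ := by simp [pd]
        rw [e, e2] at h3
        linarith
      have h3 := iw_rpow_le_mul (c := 2) (a := pd (t, s) + ε) (b := pd (t, x)) two_pos
        (by linarith [h.ε_pos, pd_nonneg (t, s)]) zero_le_two
      refine h3.trans (le_of_eq ?_)
      congr 1
      rw [ENNReal.rpow_two, ENNReal.ofReal_ofNat]; norm_num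
    have h1 := (convex_uIcc x y).norm_image_sub_le_of_norm_hasDerivWithin_le
      (fun s hs => (h.C_deriv t s).hasDerivWithinAt) hD (right_mem_uIcc) (left_mem_uIcc)
    rw [← ofReal_norm]
    refine (ENNReal.ofReal_le_ofReal h1).trans (le_of_eq ?_)
    have := h.ε_pos
    rw [ENNReal.ofReal_mul (by positivity), ENNReal.ofReal_mul (by positivity),
      ENNReal.ofReal_toReal hMt, hM, ENNReal.ofReal_div_of_pos two_pos, Real.norm_eq_abs]
    have e4 : (4 : ℝ≥0∞) = 2 * 2 := by norm_num
    rw [e4, ENNReal.ofReal_ofNat, div_eq_mul_inv]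
    have e2 : (2 : ℝ≥0∞)⁻¹ * 2 = 1 := ENNReal.inv_mul_cancel (by simp) (by simp)
    calc _ = (2⁻¹ * 2) * (2 * a * ENNReal.ofReal ε * ENNReal.ofReal |x - y|
        * iw (pd (t, x)) ^ (2 : ℝ)) := by ring
      _ = _ := by rw [e2, one_mul]
  rcases eq_or_ne x y with rfl | hne
  · simp
  have h0 : 0 < |x - y| := abs_pos.2 (sub_ne_zero.2 hne)
  rcases le_total (2 * |x - y|) (pd (t, x)) with h1 | h1
  · exact (far x y h0 h1).trans (by gcongr; exact le_self_add)
  rcases le_total (2 * |x - y|) (pd (t, y)) with h2 | h2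
  · rw [← enorm_neg, neg_sub, abs_sub_comm]
    rw [abs_sub_comm] at h0 h2
    exact (far y x h0 h2).trans (by gcongr; exact le_add_self)
  -- otherwise both values are small
  have near : ∀ z : ℝ × ℝ, pd z ≤ 2 * |x - y| →
      ‖C z‖ₑ ≤ 2 * a * ENNReal.ofReal ε * ENNReal.ofReal |x - y| * iw (pd z) ^ (2 : ℝ) := by
    intro z hz
    have h3 : (1 : ℝ≥0∞) ≤ ENNReal.ofReal (2 * |x - y|) * iw (pd z) := by
      have := iw_le_mul (c := 2 * |x - y|) (a := 1) (b := pd z) (by positivity) (by linarith)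
      simpa [iw] using this
    rw [ENNReal.ofReal_mul zero_le_two, ENNReal.ofReal_ofNat] at h3
    have e : iw (pd z) ^ (2 : ℝ) = iw (pd z) * iw (pd z) ^ (1 : ℝ) := by
      rw [ENNReal.rpow_one, ENNReal.rpow_two, sq]
    calc _ ≤ a * ENNReal.ofReal ε * iw (pd z) ^ (1 : ℝ) * 1 := by
          rw [mul_one]; exact h.C_le_pd z
      _ ≤ a * ENNReal.ofReal ε * iw (pd z) ^ (1 : ℝ)
          * (2 * ENNReal.ofReal |x - y| * iw (pd z)) := by gcongr
      _ = _ := by rw [e]; ring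
  rw [mul_add]
  exact enorm_sub_le.trans (add_le_add (near _ h1) (near _ h2))

/-- The oscillation of `C` in the space variable. The distance of the two points may be measured on
the circle, since `C` is periodic. -/
lemma C_sub_le (h : CovKernel k C D R ε a) (t x y : ℝ) :
    ‖C (t, x) - C (t, y)‖ₑ
      ≤ 2 * a * ENNReal.ofReal ε * ENNReal.ofReal ‖((x - y : ℝ) : UnitAddCircle)‖
        * (iw (pd (t, x)) ^ (2 : ℝ) + iw (pd (t, y)) ^ (2 : ℝ)) := by
  have := h.C_sub_le_abs t x (y + round (x - y))
  rwa [h.C_per, pd_add_int, ← sub_sub, circle_norm_eq_round] at this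

end CovKernel

/-- Since `k` is odd, the integral of the increment of `C` between a point and its reflection gains
a factor `ε` and has no singularity. -/
lemma exists_lintegral_k_mul_reflect_le {R : ℝ} (hR : 0 < R) {a : ℝ≥0∞} (ha : a ≠ ⊤) :
    ∃ c : ℝ≥0∞, c ≠ ⊤ ∧ ∀ (k C D : ℝ × ℝ → ℝ) (ε : ℝ), CovKernel k C D R ε a → ∀ w : ℝ × ℝ,
      ∫⁻ u, ‖k u‖ₑ * ‖C (u + w) - C (u + xrefl w)‖ₑ ≤ c * ENNReal.ofReal ε := by
  obtain ⟨c, hc, hr⟩ := exists_riesz_pd (α := 2) (β := 2) hR.le two_pos (by norm_num) two_pos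
    (by norm_num) (by norm_num)
  refine ⟨8 * a * a * c, by finiteness, fun k C D ε h w => ?_⟩
  set d := ENNReal.ofReal (pd w) with hd
  have hpt : ∀ u, ‖C (u + w) - C (u + xrefl w)‖ₑ ≤ 4 * a * ENNReal.ofReal ε * d
      * (iw (pd (u + w)) ^ (2 : ℝ) + iw (pd (u + xrefl w)) ^ (2 : ℝ)) := by
    intro u
    refine (h.C_sub_le (u.1 + w.1) (u.2 + w.2) (u.2 + -w.2)).trans ?_
    have h1 : ENNReal.ofReal ‖((u.2 + w.2 - (u.2 + -w.2) : ℝ) : UnitAddCircle)‖ ≤ 2 * d := by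
      have e : u.2 + w.2 - (u.2 + -w.2) = w.2 + w.2 := by ring
      have h2 : ‖((w.2 + w.2 : ℝ) : UnitAddCircle)‖ ≤ 2 * pd w := by
        rw [AddCircle.coe_add]
        have h3 := norm_add_le (w.2 : UnitAddCircle) (w.2 : UnitAddCircle)
        have h4 : ‖(w.2 : UnitAddCircle)‖ ≤ pd w := by
          have : 0 ≤ min √|w.1| 1 := le_min (Real.sqrt_nonneg _) zero_le_one
          unfold pd; linarith
        linarith
      rw [e, hd, ← ENNReal.ofReal_ofNat, ← ENNReal.ofReal_mul zero_le_two]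
      exact ENNReal.ofReal_le_ofReal h2
    calc _ ≤ 2 * a * ENNReal.ofReal ε * (2 * d)
          * (iw (pd (u + w)) ^ (2 : ℝ) + iw (pd (u + xrefl w)) ^ (2 : ℝ)) := by
          gcongr
          · rfl
          · rfl
      _ = _ := by ring
  have hm : ∀ w : ℝ × ℝ, Measurable fun u : ℝ × ℝ =>
      iw (pd u) ^ (2 : ℝ) * iw (pd (u + w)) ^ (2 : ℝ) := fun w =>
    (measurable_iw_rpow continuous_pd _).mul
      (measurable_iw_rpow (continuous_pd.comp (continuous_add_const w)) _)
  rw [h.lintegral_k_mul_eq]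
  calc _ ≤ ∫⁻ u in box R, (a * iw (pd u) ^ (2 : ℝ)) * (4 * a * ENNReal.ofReal ε * d
      * (iw (pd (u + w)) ^ (2 : ℝ) + iw (pd (u + xrefl w)) ^ (2 : ℝ))) :=
        lintegral_mono fun u => mul_le_mul' (h.k_le_pd u) (hpt u)
    _ = ∫⁻ u in box R, (4 * a * a * ENNReal.ofReal ε * d)
        * (iw (pd u) ^ (2 : ℝ) * iw (pd (u + w)) ^ (2 : ℝ)
          + iw (pd u) ^ (2 : ℝ) * iw (pd (u + xrefl w)) ^ (2 : ℝ)) := by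
        congr with u; ring
    _ ≤ (4 * a * a * ENNReal.ofReal ε * d) * (c * iw (pd w) ^ ((2 : ℝ) + 2 - 3)
          + c * iw (pd (xrefl w)) ^ ((2 : ℝ) + 2 - 3)) := by
        rw [lintegral_const_mul' _ _ (by finiteness), lintegral_add_left (hm w)]
        gcongr
        · exact hr w
        · exact hr _
    _ = 8 * a * a * c * ENNReal.ofReal ε * (d * iw (pd w)) := by
        rw [pd_refl]; norm_num; ring
    _ ≤ 8 * a * a * c * ENNReal.ofReal ε * 1 := by
        gcongr
        exact ENNReal.mul_inv_le_one _
    _ = _ := by ring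

/-- The correlation `w ↦ ∫ k(u) f(u + w) du`. -/
noncomputable def corrK (k f : ℝ × ℝ → ℝ) (w : ℝ × ℝ) : ℝ := ∫ u, k u * f (u + w)

lemma ofReal_mul_iw {ε : ℝ} (hε : 0 < ε) : ENNReal.ofReal ε * iw ε = 1 :=
  ENNReal.mul_inv_cancel (by simpa using hε) (by simp)

lemma iw_reg_le {ε : ℝ} (d : ℝ) (hd : 0 ≤ d) (hε : 0 < ε) {α β : ℝ} (hα : 0 ≤ α) (hβ : 0 ≤ β) :
    iw (d + ε) ^ (α + β) ≤ iw ε ^ α * iw d ^ β := by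
  rw [iw_rpow_add _ hα hβ]
  gcongr
  · exact iw_anti (by linarith)
  · exact iw_anti (by linarith)

lemma quarter_le_circle_norm {x : ℝ} (h1 : 1 / 2 ≤ |x|) (h2 : |x| ≤ 3 / 4) :
    1 / 4 ≤ ‖(x : UnitAddCircle)‖ := by
  have key : ∀ y : ℝ, 1 / 2 ≤ y → y ≤ 3 / 4 → 1 / 4 ≤ ‖(y : UnitAddCircle)‖ := fun y h1 h2 => by
    have e : (y : UnitAddCircle) = ((y - 1 : ℝ) : UnitAddCircle) := by
      rw [AddCircle.coe_sub, AddCircle.coe_period, sub_zero]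
    rw [e, circle_norm_eq (by rw [abs_le]; constructor <;> linarith), abs_of_nonpos (by linarith)]
    linarith
  rcases abs_choice x with h | h
  · rw [h] at h1 h2; exact key x h1 h2
  · rw [h] at h1 h2
    rw [← norm_neg, ← AddCircle.coe_neg]
    exact key _ h1 h2

lemma iw_inv_nat {n : ℕ} (hn : n ≠ 0) : iw (1 / n) = n := by
  have : (0 : ℝ) < n := by positivity
  rw [iw, one_div, ENNReal.ofReal_inv_of_pos this, inv_inv, ENNReal.ofReal_natCast]

lemma exists_lintegral_box_le {R γ : ℝ} (hR : 0 ≤ R) (hγ : 0 < γ) (hγ3 : γ < 3) :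
    ∃ c : ℝ≥0∞, c ≠ ⊤ ∧ ∀ w : ℝ × ℝ, ∫⁻ z in box R, iw (pd (z + w)) ^ γ ≤ c := by
  refine ⟨_, ?_, fun w => (ballGrowth_add hR w).lintegral_le (boxConst_ne_top R)
    (fun _ => pd_nonneg _) (continuous_pd.comp (continuous_add_const w)).measurable hγ hγ3 one_pos⟩
  rw [Measure.restrict_apply_univ, volume_box]
  have h1 := boxConst_ne_top R
  have h2 : iw 1 ^ γ ≠ ⊤ := ENNReal.rpow_ne_top_of_nonneg hγ.le (iw_ne_top one_pos)
  finiteness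

lemma exists_lintegral_box_reg_le {R α β : ℝ} (hR : 0 ≤ R) (hα : 0 < α) (hα3 : α < 3) (hβ : 0 < β)
    (h : 3 < α + β) : ∃ c : ℝ≥0∞, c ≠ ⊤ ∧ ∀ ε : ℝ, 0 < ε →
      ∫⁻ z in box R, iw (pd z) ^ α * iw (pd z + ε) ^ β ≤ c * iw ε ^ (α + β - 3) := by
  have h1 := boxConst_ne_top R
  exact ⟨boxConst R * (ENNReal.ofReal (3 / (3 - α)) + ENNReal.ofReal ((α + β) / (α + β - 3))),
    by finiteness, fun ε hε => (ballGrowth_id hR).lintegral_reg_le h1 pd_nonneg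
      continuous_pd.measurable hα hα3 hβ h hε⟩

namespace CovKernel

variable {k C D : ℝ × ℝ → ℝ} {R ε : ℝ} {a : ℝ≥0∞}

lemma C_bdd (h : CovKernel k C D R ε a) : ∃ M : ℝ, ∀ z, |C z| ≤ M := by
  refine ⟨(a * ENNReal.ofReal ε * iw ε ^ (1 : ℝ)).toReal, fun z => ?_⟩
  rw [← Real.norm_eq_abs, ← toReal_enorm]
  have h1 := h.a_ne
  have h2 := ENNReal.rpow_ne_top_of_nonneg zero_le_one (iw_ne_top h.ε_pos)
  refine ENNReal.toReal_mono (by finiteness) ((h.C_le z).trans ?_)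
  gcongr
  exact iw_anti (by linarith [pd_nonneg z])

lemma D_bdd (h : CovKernel k C D R ε a) : ∃ M : ℝ, ∀ z, |D z| ≤ M := by
  refine ⟨(a * iw ε ^ (2 : ℝ)).toReal, fun z => ?_⟩
  rw [← Real.norm_eq_abs, ← toReal_enorm]
  have h1 := h.a_ne
  have h2 := ENNReal.rpow_ne_top_of_nonneg zero_le_two (iw_ne_top h.ε_pos)
  refine ENNReal.toReal_mono (by finiteness) ((h.D_le z).trans ?_)
  gcongr
  exact iw_anti (by linarith [pd_nonneg z])

lemma continuous_corrK (h : CovKernel k C D R ε a) {f : ℝ × ℝ → ℝ} (hf : Continuous f)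
    (hb : ∃ M : ℝ, ∀ z, |f z| ≤ M) : Continuous (corrK k f) := by
  obtain ⟨M, hM⟩ := hb
  refine continuous_of_dominated (bound := fun u => |k u| * M) (fun w => ?_) (fun w => ?_)
    (h.integrable_k.abs.mul_const M) ?_
  · exact (h.k_meas.mul (hf.comp (continuous_add_const w)).measurable).aestronglyMeasurable
  · refine ae_of_all _ fun u => ?_
    rw [norm_mul, Real.norm_eq_abs, Real.norm_eq_abs]
    gcongr
    exact hM _
  · exact ae_of_all _ fun u => continuous_const.mul (hf.comp (by fun_prop))

lemma hasDerivAt_corrK (h : CovKernel k C D R ε a) (t x : ℝ) :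
    HasDerivAt (fun x => corrK k C (t, x)) (ε / 2 * corrK k D (t, x)) x := by
  obtain ⟨M, hM⟩ := h.D_bdd
  obtain ⟨M₁, hM₁⟩ := h.C_bdd
  have hm : ∀ {f : ℝ × ℝ → ℝ}, Continuous f → ∀ y : ℝ,
      AEStronglyMeasurable (fun u : ℝ × ℝ => k u * f (u + (t, y))) := fun hf y =>
    (h.k_meas.mul (hf.comp (continuous_add_const _)).measurable).aestronglyMeasurable
  have key := hasDerivAt_integral_of_dominated_loc_of_deriv_le (μ := (volume : Measure (ℝ × ℝ)))
    (F := fun y u => k u * C (u + (t, y))) (F' := fun y u => k u * (ε / 2 * D (u + (t, y))))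
    (x₀ := x) (s := univ) (bound := fun u => |k u| * (ε / 2 * M)) univ_mem
    (Eventually.of_forall fun y => hm h.C_cont y) ?_ ?_ ?_ (h.integrable_k.abs.mul_const _) ?_
  · have e : ∫ u, k u * (ε / 2 * D (u + (t, x))) = ε / 2 * corrK k D (t, x) := by
      rw [corrK, ← integral_const_mul]
      congr with u; ring
    rw [← e]
    exact key.2
  · refine (h.integrable_k.abs.mul_const M₁).mono' (hm h.C_cont x) (ae_of_all _ fun u => ?_)
    rw [norm_mul, Real.norm_eq_abs, Real.norm_eq_abs]
    gcongr
    exact hM₁ _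
  · exact hm (continuous_const.mul h.D_cont) x
  · refine ae_of_all _ fun u y _ => ?_
    have := h.ε_pos
    rw [norm_mul, Real.norm_eq_abs, Real.norm_eq_abs, abs_mul, abs_of_pos (by positivity : 0 < ε / 2)]
    gcongr
    exact hM _
  · refine ae_of_all _ fun u y _ => ?_
    have h1 := (h.C_deriv (u.1 + t) (u.2 + y)).comp y ((hasDerivAt_id y).const_add u.2)
    have h2 := h1.const_mul (k u)
    rw [mul_one] at h2
    exact h2

lemma measurable_corrK_neg (h : CovKernel k C D R ε a) :
    Measurable fun w => ∫ u, k u * k (u - w) := by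
  have : Measurable fun p : (ℝ × ℝ) × (ℝ × ℝ) => k p.2 * k (p.2 - p.1) :=
    (h.k_meas.comp measurable_snd).mul (h.k_meas.comp (measurable_snd.sub measurable_fst))
  exact this.stronglyMeasurable.integral_prod_right.measurable

end CovKernel

/-- The correlation of `k` with itself has the singularity of the heat kernel. -/
lemma exists_lintegral_k_mul_k_le {R : ℝ} (hR : 0 < R) {a : ℝ≥0∞} (ha : a ≠ ⊤) :
    ∃ c : ℝ≥0∞, c ≠ ⊤ ∧ ∀ (k C D : ℝ × ℝ → ℝ) (ε : ℝ), CovKernel k C D R ε a → ∀ w : ℝ × ℝ,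
      ∫⁻ u, ‖k u * k (u - w)‖ₑ ≤ c * iw (pn w) ^ (1 : ℝ) := by
  obtain ⟨c, hc, hr⟩ := exists_riesz_pn (α := 2) (β := 2) hR.le two_pos (by norm_num) two_pos
    (by norm_num) (by norm_num)
  refine ⟨a * a * c, by finiteness, fun k C D ε h w => ?_⟩
  simp_rw [enorm_mul]
  rw [h.lintegral_k_mul_eq]
  calc _ ≤ ∫⁻ u in box R, a * a * (iw (pn u) ^ (2 : ℝ) * iw (pn (u + -w)) ^ (2 : ℝ)) := by
        refine lintegral_mono fun u => (mul_le_mul' (h.k_le u) (h.k_le (u - w))).trans_eq ?_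
        rw [sub_eq_add_neg]; ring
    _ ≤ a * a * (c * iw (pn (-w)) ^ ((2 : ℝ) + 2 - 3)) := by
        rw [lintegral_const_mul' _ _ (by finiteness)]
        gcongr
        exact hr _
    _ = _ := by rw [pn_neg]; norm_num; ring

/-- The correlation of `k` with `C` would be `ε` times a logarithm by power counting; as `k` is odd
and `C` even in space, it is the integral of an increment, and of order `ε`. -/
lemma exists_corrK_le {R : ℝ} (hR : 0 < R) {a : ℝ≥0∞} (ha : a ≠ ⊤) :
    ∃ c : ℝ≥0∞, c ≠ ⊤ ∧ ∀ (k C D : ℝ × ℝ → ℝ) (ε : ℝ), CovKernel k C D R ε a → ∀ w : ℝ × ℝ,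
      ‖corrK k C w‖ₑ ≤ c * ENNReal.ofReal ε := by
  obtain ⟨c, hc, hr⟩ := exists_lintegral_k_mul_reflect_le hR ha
  refine ⟨c, hc, fun k C D ε h w => ?_⟩
  obtain ⟨M, hM⟩ := h.C_bdd
  have hi : ∀ w, Integrable fun u => k u * C (u + w) := fun w => by
    refine (h.integrable_k.abs.mul_const M).mono' (h.k_meas.mul
      (h.C_cont.comp (continuous_add_const w)).measurable).aestronglyMeasurable
      (ae_of_all _ fun u => ?_)
    rw [norm_mul, Real.norm_eq_abs, Real.norm_eq_abs]
    gcongr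
    exact hM _
  have e1 : corrK k C w = -corrK k C (xrefl w) := by
    unfold corrK
    rw [← integral_xrefl, ← integral_neg]
    refine integral_congr_ae (ae_of_all _ fun u => ?_)
    dsimp only
    rw [h.k_odd, ← h.C_refl (xrefl u + w), xrefl_add, xrefl_xrefl]
    ring
  have e2 : 2 * corrK k C w = ∫ u, k u * (C (u + w) - C (u + xrefl w)) := by
    simp_rw [mul_sub]
    rw [integral_sub (hi _) (hi _)]
    change _ = corrK k C w - corrK k C (xrefl w)
    linarith
  have e3 : ‖corrK k C w‖ₑ ≤ ‖2 * corrK k C w‖ₑ := by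
    rw [enorm_mul]
    refine le_mul_of_one_le_left (by simp) ?_
    rw [Real.enorm_eq_ofReal zero_le_two]; norm_num
  refine e3.trans ?_
  rw [e2]
  refine (enorm_integral_le_lintegral_enorm _).trans ?_
  simp_rw [enorm_mul]
  exact hr k C D ε h w

/-- Replacing `k` by `D` in the correlation of `k` with itself costs a bounded error, up to a
singularity which is compensated by a power of `ε`. -/
lemma exists_lintegral_k_mul_sub_le {R : ℝ} (hR : 0 < R) {a : ℝ≥0∞} (ha : a ≠ ⊤) :
    ∃ c : ℝ≥0∞, c ≠ ⊤ ∧ ∀ (k C D : ℝ × ℝ → ℝ) (ε : ℝ), CovKernel k C D R ε a → ∀ w : ℝ × ℝ,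
      0 < w.1 → w.1 ≤ 2 * R → |w.2| ≤ 1 / 2 →
      ∫⁻ v, ‖k (v - w) * (k v - D v)‖ₑ ≤ c * (1 + ENNReal.ofReal ε
        * (iw ε ^ (1 / 2 : ℝ) * iw (pd w) ^ (3 / 2 : ℝ))) := by
  set R₁ := 3 * R + 1 with hR₁
  have hR₁0 : 0 ≤ R₁ := by positivity
  obtain ⟨c₁, hc₁, h₁⟩ := exists_riesz_pd (α := 5 / 2) (β := 2) hR₁0 (by norm_num) (by norm_num)
    two_pos (by norm_num) (by norm_num)
  obtain ⟨c₂, hc₂, h₂⟩ := exists_lintegral_box_le (γ := 2) hR₁0 two_pos (by norm_num)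
  have hvol : volume (box R₁) ≠ ⊤ := by rw [volume_box]; finiteness
  refine ⟨17 * (a * a) * (volume (box R₁) + c₂ + c₂ + c₁), by finiteness,
    fun k C D ε h w hw hwR hwx => ?_⟩
  set s := ENNReal.ofReal ε * iw ε ^ (1 / 2 : ℝ) with hs
  have hs_top : s ≠ ⊤ := by
    have := ENNReal.rpow_ne_top_of_nonneg (by norm_num : (0 : ℝ) ≤ 1 / 2) (iw_ne_top h.ε_pos)
    finiteness
  have hpt : ∀ v, ‖k (v - w) * (k v - D v)‖ₑ ≤ 17 * (a * a) * (1 + iw (pd (v + 0)) ^ (2 : ℝ)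
      + iw (pd (v + -w)) ^ (2 : ℝ)
      + s * (iw (pd v) ^ (5 / 2 : ℝ) * iw (pd (v + -w)) ^ (2 : ℝ))) := by
    intro v
    rw [enorm_mul, add_zero, ← sub_eq_add_neg]
    set W := iw (pd v) ^ (2 : ℝ) with hW
    set W' := iw (pd (v - w)) ^ (2 : ℝ) with hW'
    set Z := iw (pd v) ^ (5 / 2 : ℝ) with hZ
    have hDle : ‖D v‖ₑ ≤ a * W := (h.D_le v).trans (by
      rw [hW]; gcongr; exact iw_anti (by linarith [h.ε_pos]))
    have hG : 1 + W ≤ 1 + W + W' + s * (Z * W') :=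
      (le_self_add : 1 + W ≤ 1 + W + W').trans le_self_add
    have hG' : W' + s * (Z * W') ≤ 1 + W + W' + s * (Z * W') := by
      rw [add_assoc (1 + W)]; exact le_add_self
    rcases le_or_gt v.1 0 with hv1 | hv1
    · -- both kernels see the past
      have h3 : ‖k (v - w)‖ₑ ≤ a := h.k_past _ (by rw [Prod.fst_sub]; linarith)
      calc _ ≤ a * (a + a * W) := by
            gcongr; exact enorm_sub_le.trans (add_le_add (h.k_past v hv1) hDle)
        _ = 1 * (a * a) * (1 + W) := by ring
        _ ≤ _ := by
            refine mul_le_mul' ?_ hG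
            gcongr
            norm_num
    -- In the future and within half a period, `k - D` is bounded up to the mollification error.
    rcases le_or_gt |v.2| (1 / 2) with hv2 | hv2
    · calc _ ≤ (a * W') * (a * (1 + ENNReal.ofReal ε * (W * iw (pd v + ε) ^ (1 : ℝ)))) := by
            gcongr
            · exact h.k_le_pd _
            · exact h.kD_le v hv1 hv2
        _ ≤ (a * W') * (a * (1 + ENNReal.ofReal ε
              * (W * (iw ε ^ (1 / 2 : ℝ) * iw (pd v) ^ (1 / 2 : ℝ))))) := by
            gcongr
            have := iw_reg_le (pd v) (pd_nonneg v) h.ε_pos (α := 1 / 2) (β := 1 / 2)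
              (by norm_num) (by norm_num)
            norm_num at this ⊢
            exact this
        _ = 1 * (a * a) * (W' + s * (Z * W')) := by
            have e : Z = W * iw (pd v) ^ (1 / 2 : ℝ) := by
              rw [hZ, hW, ← iw_rpow_add _ (by norm_num) (by norm_num)]; norm_num
            rw [e, hs]; ring
        _ ≤ _ := by
            refine mul_le_mul' ?_ hG'
            gcongr
            norm_num
    -- Beyond half a period `k` is bounded, while `D`, which is periodic, may be singular; if it is,
    -- then `v` is far from `w`, and `k (v - w)` is bounded.
    · have hkv := h.k_away v hv2.le
      rcases le_or_gt (1 / 4) (pn (v - w)) with h4 | h4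
      · have h3 : ‖k (v - w)‖ₑ ≤ a * 16 := by
          refine (h.k_le _).trans ?_
          have := iw_anti h4
          have e := iw_inv_nat (n := 4) (by norm_num)
          rw [Nat.cast_ofNat] at e
          rw [e] at this
          gcongr
          calc _ ≤ (4 : ℝ≥0∞) ^ (2 : ℝ) := by gcongr; exact_mod_cast this
            _ = 16 := by rw [ENNReal.rpow_two]; norm_num
        calc _ ≤ a * 16 * (a + a * W) := by
              gcongr; exact enorm_sub_le.trans (add_le_add hkv hDle)
          _ = 16 * (a * a) * (1 + W) := by ring
          _ ≤ _ := by
              refine mul_le_mul' ?_ hG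
              gcongr
              norm_num
      · have h5 : |v.2| ≤ 3 / 4 := by
          have : |v.2 - w.2| ≤ pn (v - w) := by
            unfold pn; rw [Prod.snd_sub]; linarith [Real.sqrt_nonneg |(v - w).1|]
          have := abs_sub_abs_le_abs_sub v.2 w.2
          linarith
        have h6 := quarter_le_circle_norm hv2.le h5
        have h7 : 1 / 4 ≤ pd v + ε := by
          have : 0 ≤ min √|v.1| 1 := le_min (Real.sqrt_nonneg _) zero_le_one
          unfold pd; linarith [h.ε_pos]
        have h8 : ‖D v‖ₑ ≤ a * 16 := by
          refine (h.D_le _).trans ?_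
          have := iw_anti h7
          have e := iw_inv_nat (n := 4) (by norm_num)
          rw [Nat.cast_ofNat] at e
          rw [e] at this
          gcongr
          calc _ ≤ (4 : ℝ≥0∞) ^ (2 : ℝ) := by gcongr; exact_mod_cast this
            _ = 16 := by rw [ENNReal.rpow_two]; norm_num
        calc _ ≤ (a * W') * (a + a * 16) := by
              gcongr
              · exact h.k_le_pd _
              · exact enorm_sub_le.trans (add_le_add hkv h8)
          _ = 17 * (a * a) * W' := by ring
          _ ≤ _ := by
              refine mul_le_mul' le_rfl (le_trans ?_ hG')
              exact le_self_add
  have hsupp : ∫⁻ v, ‖k (v - w) * (k v - D v)‖ₑ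
      = ∫⁻ v in box R₁, ‖k (v - w) * (k v - D v)‖ₑ := by
    refine (setLIntegral_eq_of_support_subset fun v hv => ?_).symm
    by_contra hb
    have : v - w ∈ box R := by
      by_contra h0; simp [h.k_supp _ h0] at hv
    apply hb
    have h1 := this.1; have h2 := this.2
    rw [Prod.fst_sub] at h1; rw [Prod.snd_sub] at h2
    have h3 := abs_le.1 hwx
    exact ⟨⟨by linarith [h1.1], by linarith [h1.2]⟩, ⟨by linarith [h2.1, h3.1],
      by linarith [h2.2, h3.2]⟩⟩
  have m1 : ∀ w, Measurable fun v : ℝ × ℝ => iw (pd (v + w)) ^ (2 : ℝ) := fun w =>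
    measurable_iw_rpow (continuous_pd.comp (continuous_add_const w)) _
  have m2 : Measurable fun v : ℝ × ℝ => iw (pd v) ^ (5 / 2 : ℝ) := measurable_iw_rpow continuous_pd _
  have m3 : Measurable fun v : ℝ × ℝ => 1 + iw (pd (v + 0)) ^ (2 : ℝ) := (m1 0).const_add 1
  have m4 : Measurable fun v : ℝ × ℝ =>
      1 + iw (pd (v + 0)) ^ (2 : ℝ) + iw (pd (v + -w)) ^ (2 : ℝ) := m3.add (m1 _)
  rw [hsupp]
  calc _ ≤ ∫⁻ v in box R₁, 17 * (a * a) * (1 + iw (pd (v + 0)) ^ (2 : ℝ)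
      + iw (pd (v + -w)) ^ (2 : ℝ)
      + s * (iw (pd v) ^ (5 / 2 : ℝ) * iw (pd (v + -w)) ^ (2 : ℝ))) := lintegral_mono fun v => hpt v
    _ ≤ 17 * (a * a) * (volume (box R₁) + c₂ + c₂ + s * (c₁ * iw (pd (-w)) ^ ((5 / 2 : ℝ) + 2 - 3))) := by
        rw [lintegral_const_mul' _ _ (by finiteness),
          lintegral_add_left m4, lintegral_add_left m3, lintegral_add_left measurable_const,
          lintegral_const_mul' _ _ hs_top, lintegral_one, Measure.restrict_apply_univ]
        gcongr
        · exact h₂ 0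
        · exact h₂ _
        · exact h₁ _
    _ = 17 * (a * a) * ((volume (box R₁) + c₂ + c₂) * 1 + c₁ * (s * iw (pd w) ^ (3 / 2 : ℝ))) := by
        rw [pd_neg]; norm_num; ring
    _ ≤ 17 * (a * a) * ((volume (box R₁) + c₂ + c₂ + c₁) * 1
          + (volume (box R₁) + c₂ + c₂ + c₁) * (s * iw (pd w) ^ (3 / 2 : ℝ))) := by
        exact mul_le_mul' le_rfl (add_le_add (mul_le_mul' le_self_add le_rfl)
          (mul_le_mul' le_add_self le_rfl))
    _ = _ := by rw [hs]; ring

/-! ### The cancellation -/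

lemma measurable_iw_pd_add (w : ℝ × ℝ) (γ : ℝ) : Measurable fun z => iw (pd (z + w)) ^ γ :=
  measurable_iw_rpow (continuous_pd.comp (continuous_add_const w)) γ

/-- The region near the origin, in the future, where the truncated kernel is compared with the
derivative of the covariance. -/
def slab (R : ℝ) : Set (ℝ × ℝ) := Ioc 0 (2 * R) ×ˢ Icc (-(1 / 2)) (1 / 2)

lemma measurableSet_slab (R : ℝ) : MeasurableSet (slab R) := measurableSet_Ioc.prod measurableSet_Icc

lemma slab_subset_box {R : ℝ} (hR : 0 < R) : slab R ⊆ box (2 * R + 1) := fun z hz => by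
  obtain ⟨⟨h1, h2⟩, h3, h4⟩ := hz
  exact ⟨⟨by linarith, by linarith⟩, ⟨by linarith, by linarith⟩⟩

lemma integrableOn_slab {R : ℝ} {f : ℝ × ℝ → ℝ} (hf : Continuous f) : IntegrableOn f (slab R) :=
  (hf.continuousOn.integrableOn_compact (isCompact_Icc.prod isCompact_Icc)).mono_set
    (prod_mono Ioc_subset_Icc_self Subset.rfl)

lemma notMem_slab {R : ℝ} {z : ℝ × ℝ} (hz : z ∉ slab R) : z.1 ≤ 0 ∨ 2 * R < z.1 ∨ 1 / 2 ≤ |z.2| := by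
  by_contra! h
  have h3 := abs_lt.1 h.2.2
  exact hz ⟨⟨h.1, h.2.1⟩, ⟨h3.1.le, h3.2.le⟩⟩

/-- The autocorrelation of the truncated kernel. -/
noncomputable def corrKK (k : ℝ × ℝ → ℝ) (w : ℝ × ℝ) : ℝ := ∫ u, k u * k (u - w)

section Bounds

variable {R : ℝ} {a : ℝ≥0∞}

lemma exists_corrKK_le (hR : 0 < R) (ha : a ≠ ⊤) :
    ∃ c : ℝ≥0∞, c ≠ ⊤ ∧ ∀ (k C D : ℝ × ℝ → ℝ) (ε : ℝ), CovKernel k C D R ε a → ∀ w : ℝ × ℝ,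
      ‖corrKK k w‖ₑ ≤ (box (2 * R)).indicator (fun w => c * iw (pn w) ^ (1 : ℝ)) w := by
  obtain ⟨c, hc, h⟩ := exists_lintegral_k_mul_k_le hR ha
  refine ⟨c, hc, fun k C D ε hk w => ?_⟩
  by_cases hw : w ∈ box (2 * R)
  · rw [indicator_of_mem hw]
    exact (enorm_integral_le_lintegral_enorm _).trans (h k C D ε hk w)
  · have : ∀ u, k u * k (u - w) = 0 := fun u => by
      by_contra hne
      have h1 : u ∈ box R := by by_contra h0; simp [hk.k_supp u h0] at hne
      have h2 : u - w ∈ box R := by by_contra h0; simp [hk.k_supp _ h0] at hne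
      have h3 := box_sub h1 h2
      rw [sub_sub_cancel, ← two_mul] at h3
      exact hw h3
    simp [corrKK, this]

lemma lintegral_le_of_le_indicator {f g : ℝ × ℝ → ℝ≥0∞} {S T : Set (ℝ × ℝ)} (hS : MeasurableSet S)
    (hT : MeasurableSet T) (h : ∀ w ∈ S, f w ≤ T.indicator g w) :
    ∫⁻ w in S, f w ≤ ∫⁻ w in T, g w :=
  calc _ ≤ ∫⁻ w in S, T.indicator g w := setLIntegral_mono' hS h
    _ ≤ ∫⁻ w, T.indicator g w := setLIntegral_le_lintegral _ _
    _ = _ := lintegral_indicator hT _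

/-- A bound of order `ε`, cruder than the true order `ε² |log ε|`; it is used only with the
additional factor `a_ε - a`, which is of order `ε`. -/
lemma exists_lintegral_sq_mul_corrKK_le (hR : 0 < R) (ha : a ≠ ⊤) :
    ∃ c : ℝ≥0∞, c ≠ ⊤ ∧ ∀ (k C D : ℝ × ℝ → ℝ) (ε : ℝ), CovKernel k C D R ε a →
      ∫⁻ w, ‖C w ^ 2 * corrKK k w‖ₑ ≤ c * ENNReal.ofReal ε := by
  obtain ⟨c, hc, hB⟩ := exists_corrKK_le hR ha
  obtain ⟨c₂, hc₂, h₂⟩ := exists_lintegral_box_le (R := 2 * R) (γ := 2) (by positivity) two_pos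
    (by norm_num)
  refine ⟨a * a * c * c₂, by finiteness, fun k C D ε h => ?_⟩
  have he := ofReal_mul_iw h.ε_pos
  have het : iw ε ≠ ⊤ := iw_ne_top h.ε_pos
  set e := ENNReal.ofReal ε
  have hpt : ∀ w ∈ (univ : Set (ℝ × ℝ)), ‖C w ^ 2 * corrKK k w‖ₑ ≤ (box (2 * R)).indicator
      (fun w => a * a * c * e * iw (pd (w + 0)) ^ (2 : ℝ)) w := by
    intro w _
    have hb := hB k C D ε h w
    by_cases hw : w ∈ box (2 * R)
    · rw [indicator_of_mem hw] at hb ⊢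
      rw [enorm_mul, enorm_pow, add_zero]
      calc _ ≤ (a * e * iw (pd w + ε) ^ (1 : ℝ)) ^ 2 * (c * iw (pd w) ^ (1 : ℝ)) := by
            gcongr
            · exact h.C_le w
            · refine hb.trans ?_
              gcongr
              exact iw_anti (pd_le_pn w)
        _ ≤ (a * e * iw ε ^ (1 : ℝ)) * (a * e * iw (pd w) ^ (1 : ℝ)) * (c * iw (pd w) ^ (1 : ℝ)) := by
            rw [sq]
            gcongr
            · exact iw_anti (by linarith [pd_nonneg w])
            · exact iw_anti (by linarith [h.ε_pos])
        _ = a * a * c * e * (e * iw ε) * iw (pd w) ^ (2 : ℝ) := by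
            rw [ENNReal.rpow_one, ENNReal.rpow_one, ENNReal.rpow_two]; ring
        _ = _ := by rw [he, mul_one]
    · rw [indicator_of_notMem hw] at hb ⊢
      rw [enorm_mul, le_antisymm hb bot_le, mul_zero]
  rw [← setLIntegral_univ]
  refine (lintegral_le_of_le_indicator MeasurableSet.univ (measurableSet_box _) hpt).trans ?_
  have := h.a_ne
  rw [lintegral_const_mul' _ _ (by finiteness)]
  calc _ ≤ a * a * c * e * c₂ := by gcongr; exact h₂ 0
    _ = _ := by ring

/-- As for the first integral, a crude bound of order `ε` is sufficient. -/
lemma exists_lintegral_k_mul_corrK_le (hR : 0 < R) (ha : a ≠ ⊤) :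
    ∃ c : ℝ≥0∞, c ≠ ⊤ ∧ ∀ (k C D : ℝ × ℝ → ℝ) (ε : ℝ), CovKernel k C D R ε a →
      ∫⁻ w, ‖k w * (C w * corrK k C w)‖ₑ ≤ c * ENNReal.ofReal ε := by
  obtain ⟨c, hc, hA⟩ := exists_corrK_le hR ha
  obtain ⟨c₂, hc₂, h₂⟩ := exists_lintegral_box_le (R := R) (γ := 2) hR.le two_pos
    (by norm_num)
  refine ⟨a * a * c * c₂, by finiteness, fun k C D ε h => ?_⟩
  have he := ofReal_mul_iw h.ε_pos
  set e := ENNReal.ofReal ε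
  simp_rw [enorm_mul]
  rw [h.lintegral_k_mul_eq]
  calc _ ≤ ∫⁻ w in box R, (a * iw (pd w) ^ (2 : ℝ)) * ((a * e * iw ε ^ (1 : ℝ)) * (c * e)) := by
        refine lintegral_mono fun w => mul_le_mul' (h.k_le_pd w)
          (mul_le_mul' ((h.C_le w).trans ?_) (hA k C D ε h w))
        gcongr
        exact iw_anti (by linarith [pd_nonneg w])
    _ = ∫⁻ w in box R, a * a * c * e * iw (pd (w + 0)) ^ (2 : ℝ) := by
        congr with w
        rw [add_zero, ENNReal.rpow_one]
        calc _ = a * a * c * e * (e * iw ε) * iw (pd w) ^ (2 : ℝ) := by ring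
          _ = _ := by rw [he, mul_one]
    _ ≤ a * a * c * e * c₂ := by
        rw [lintegral_const_mul' _ _ (by finiteness)]; gcongr; exact h₂ 0
    _ = _ := by ring

/-- At positive times outside the slab the autocorrelation of `k` is bounded on its support. -/
lemma exists_lintegral_sq_mul_corrKK_diff_slab_le (hR : 0 < R) (ha : a ≠ ⊤) :
    ∃ c : ℝ≥0∞, c ≠ ⊤ ∧ ∀ (k C D : ℝ × ℝ → ℝ) (ε : ℝ), CovKernel k C D R ε a →
      ∫⁻ w in {w | 0 < w.1} \ slab R, ‖C w ^ 2 * corrKK k w‖ₑ ≤ c * ENNReal.ofReal ε ^ 2 := by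
  obtain ⟨c, hc, hB⟩ := exists_corrKK_le hR ha
  obtain ⟨c₂, hc₂, h₂⟩ := exists_lintegral_box_le (R := 2 * R) (γ := 2) (by positivity) two_pos
    (by norm_num)
  refine ⟨a * a * c * 2 * c₂, by finiteness, fun k C D ε h => ?_⟩
  set e := ENNReal.ofReal ε
  have hm : MeasurableSet ({w : ℝ × ℝ | 0 < w.1} \ slab R) :=
    (measurableSet_lt measurable_const measurable_fst).diff (measurableSet_slab R)
  have hpt : ∀ w ∈ {w : ℝ × ℝ | 0 < w.1} \ slab R, ‖C w ^ 2 * corrKK k w‖ₑ ≤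
      (box (2 * R)).indicator (fun w => a * a * c * 2 * e ^ 2 * iw (pd (w + 0)) ^ (2 : ℝ)) w := by
    intro w hwS
    have hb := hB k C D ε h w
    by_cases hw : w ∈ box (2 * R)
    · rw [indicator_of_mem hw] at hb ⊢
      have hx : 1 / 2 ≤ |w.2| := by
        rcases notMem_slab hwS.2 with h1 | h1 | h1
        · exact absurd hwS.1 (not_lt.2 h1)
        · exact absurd hw.1.2 (not_le.2 h1)
        · exact h1
      have h2 : iw (pn w) ≤ 2 := by
        have e2 := iw_inv_nat (n := 2) (by norm_num)
        rw [Nat.cast_ofNat] at e2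
        refine (iw_anti (a := 1 / 2) ?_).trans_eq e2
        unfold pn; linarith [Real.sqrt_nonneg |w.1|]
      rw [enorm_mul, enorm_pow, add_zero]
      calc _ ≤ (a * e * iw (pd w) ^ (1 : ℝ)) ^ 2 * (c * 2) := by
            gcongr
            · exact h.C_le_pd w
            · refine hb.trans ?_
              rw [ENNReal.rpow_one]
              gcongr
        _ = _ := by
            rw [ENNReal.rpow_one, ENNReal.rpow_two]; ring
    · rw [indicator_of_notMem hw] at hb ⊢
      rw [enorm_mul, le_antisymm hb bot_le, mul_zero]
  refine (lintegral_le_of_le_indicator hm (measurableSet_box _) hpt).trans ?_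
  rw [lintegral_const_mul' _ _ (by finiteness)]
  calc _ ≤ a * a * c * 2 * e ^ 2 * c₂ := by gcongr; exact h₂ 0
    _ = _ := by ring

/-- Outside the slab `k` is bounded. -/
lemma exists_lintegral_k_mul_corrK_compl_slab_le (hR : 0 < R) (ha : a ≠ ⊤) :
    ∃ c : ℝ≥0∞, c ≠ ⊤ ∧ ∀ (k C D : ℝ × ℝ → ℝ) (ε : ℝ), CovKernel k C D R ε a →
      ∫⁻ w in (slab R)ᶜ, ‖k w * (C w * corrK k C w)‖ₑ ≤ c * ENNReal.ofReal ε ^ 2 := by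
  obtain ⟨c, hc, hA⟩ := exists_corrK_le hR ha
  obtain ⟨c₂, hc₂, h₂⟩ := exists_lintegral_box_le (R := R) (γ := 1) hR.le one_pos
    (by norm_num)
  refine ⟨a * a * c * c₂, by finiteness, fun k C D ε h => ?_⟩
  set e := ENNReal.ofReal ε
  have hpt : ∀ w ∈ (slab R)ᶜ, ‖k w * (C w * corrK k C w)‖ₑ ≤
      (box R).indicator (fun w => a * a * c * e ^ 2 * iw (pd (w + 0)) ^ (1 : ℝ)) w := by
    intro w hwS
    by_cases hw : w ∈ box R
    · rw [indicator_of_mem hw]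
      have hk : ‖k w‖ₑ ≤ a := by
        rcases notMem_slab hwS with h1 | h1 | h1
        · exact h.k_past w h1
        · have := hw.1.2
          linarith
        · exact h.k_away w h1
      rw [enorm_mul, enorm_mul, add_zero]
      calc _ ≤ a * ((a * e * iw (pd w) ^ (1 : ℝ)) * (c * e)) := by
            gcongr
            · exact h.C_le_pd w
            · exact hA k C D ε h w
        _ = _ := by ring
    · rw [h.k_supp w hw]; simp
  refine (lintegral_le_of_le_indicator (measurableSet_slab R).compl (measurableSet_box _)
    hpt).trans ?_
  rw [lintegral_const_mul' _ _ (by finiteness)]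
  calc _ ≤ a * a * c * e ^ 2 * c₂ := by gcongr; exact h₂ 0
    _ = _ := by ring

/-- The first replacement of `k` by `D` on the slab. -/
lemma exists_lintegral_sub_mul_corrK_slab_le (hR : 0 < R) (ha : a ≠ ⊤) :
    ∃ c : ℝ≥0∞, c ≠ ⊤ ∧ ∀ (k C D : ℝ × ℝ → ℝ) (ε : ℝ), CovKernel k C D R ε a →
      ∫⁻ w in slab R, ‖(k w - D w) * (C w * corrK k C w)‖ₑ ≤ c * ENNReal.ofReal ε ^ 2 := by
  obtain ⟨c, hc, hA⟩ := exists_corrK_le hR ha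
  have hR1 : 0 ≤ 2 * R + 1 := by positivity
  obtain ⟨c₁, hc₁, h₁⟩ := exists_lintegral_box_le (γ := 1) hR1 one_pos (by norm_num)
  obtain ⟨c₂, hc₂, h₂⟩ := exists_lintegral_box_reg_le (α := 2) (β := 2) hR1 two_pos (by norm_num)
    two_pos (by norm_num)
  refine ⟨a * a * c * (c₁ + c₂), by finiteness, fun k C D ε h => ?_⟩
  have he := ofReal_mul_iw h.ε_pos
  have h₂' := h₂ ε h.ε_pos
  set e := ENNReal.ofReal ε
  calc _ ≤ ∫⁻ w in slab R, a * a * c * e ^ 2 * (iw (pd (w + 0)) ^ (1 : ℝ)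
        + e * (iw (pd w) ^ (2 : ℝ) * iw (pd w + ε) ^ (2 : ℝ))) := by
        refine setLIntegral_mono' (measurableSet_slab R) fun w hw => ?_
        have hk := h.kD_le w hw.1.1 (abs_le.2 hw.2)
        rw [enorm_mul, enorm_mul, add_zero]
        set W := iw (pd w) ^ (1 : ℝ)
        set W₂ := iw (pd w) ^ (2 : ℝ)
        have e2 : iw (pd w + ε) ^ (2 : ℝ) = iw (pd w + ε) ^ (1 : ℝ) * iw (pd w + ε) ^ (1 : ℝ) := by
          rw [← iw_rpow_add _ zero_le_one zero_le_one]; norm_num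
        have e3 : iw (pd w + ε) ^ (1 : ℝ) ≤ W := by
          simp only [W]; gcongr; exact iw_anti (by linarith [h.ε_pos])
        rw [e2]
        set V := iw (pd w + ε) ^ (1 : ℝ)
        calc _ ≤ a * (1 + e * (W₂ * V)) * (a * e * V * (c * e)) := by
              gcongr
              · exact h.C_le w
              · exact hA k C D ε h w
          _ = a * a * c * e ^ 2 * (V + e * (W₂ * (V * V))) := by ring
          _ ≤ _ := by gcongr
    _ ≤ ∫⁻ w in box (2 * R + 1), a * a * c * e ^ 2 * (iw (pd (w + 0)) ^ (1 : ℝ)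
        + e * (iw (pd w) ^ (2 : ℝ) * iw (pd w + ε) ^ (2 : ℝ))) :=
        lintegral_mono_set (slab_subset_box hR)
    _ ≤ a * a * c * e ^ 2 * (c₁ + e * (c₂ * iw ε ^ ((2 : ℝ) + 2 - 3))) := by
        rw [lintegral_const_mul' _ _ (by finiteness), lintegral_add_left
          (measurable_iw_pd_add 0 _),
          lintegral_const_mul' _ _ (by finiteness)]
        gcongr
        exact h₁ 0
    _ = a * a * c * e ^ 2 * (c₁ + c₂ * (e * iw ε)) := by
        have : (2 : ℝ) + 2 - 3 = 1 := by norm_num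
        rw [this, ENNReal.rpow_one]; ring
    _ = _ := by rw [he]; ring

/-- The replacement of `k` by `D` in the autocorrelation. The factor `(d + ε) ^ (-1)` of the
mollification error is split evenly, so that the remaining powers stay below the dimension. -/
lemma exists_lintegral_sq_mul_sub_slab_le (hR : 0 < R) (ha : a ≠ ⊤) :
    ∃ c : ℝ≥0∞, c ≠ ⊤ ∧ ∀ (k C D : ℝ × ℝ → ℝ) (ε : ℝ), CovKernel k C D R ε a →
      ∫⁻ w in slab R, ‖C w ^ 2 * (corrKK k w - corrK k D w)‖ₑ ≤ c * ENNReal.ofReal ε ^ 2 := by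
  obtain ⟨c, hc, hs⟩ := exists_lintegral_k_mul_sub_le hR ha
  obtain ⟨c₀, hc₀, h₀⟩ := exists_lintegral_k_mul_k_le hR ha
  have hR1 : 0 ≤ 2 * R + 1 := by positivity
  obtain ⟨c₁, hc₁, h₁⟩ := exists_lintegral_box_le (γ := 2) hR1 two_pos (by norm_num)
  obtain ⟨c₂, hc₂, h₂⟩ := exists_lintegral_box_reg_le (α := 3 / 2) (β := 2) hR1 (by norm_num)
    (by norm_num) two_pos (by norm_num)
  refine ⟨a * a * c * (c₁ + c₂), by finiteness, fun k C D ε h => ?_⟩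
  have he := ofReal_mul_iw h.ε_pos
  have h₂' := h₂ ε h.ε_pos
  have hit : iw ε ^ (1 / 2 : ℝ) ≠ ⊤ :=
    ENNReal.rpow_ne_top_of_nonneg (by norm_num) (iw_ne_top h.ε_pos)
  set e := ENNReal.ofReal ε
  have hBG : ∀ w ∈ slab R, ‖corrKK k w - corrK k D w‖ₑ
      ≤ c * (1 + e * (iw ε ^ (1 / 2 : ℝ) * iw (pd w) ^ (3 / 2 : ℝ))) := by
    intro w hw
    obtain ⟨M, hM⟩ := h.D_bdd
    have hkm : Measurable fun v => k (v - w) := h.k_meas.comp (measurable_id.sub_const w)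
    have i1 : Integrable fun v => k v * k (v - w) := by
      refine ⟨(h.k_meas.mul hkm).aestronglyMeasurable, (h₀ k C D ε h w).trans_lt ?_⟩
      have hp : 0 < pn w := (pd_pos hw.1.1.ne' w.2).trans_le (pd_le_pn w)
      have := ENNReal.rpow_ne_top_of_nonneg zero_le_one (iw_ne_top hp)
      exact lt_top_iff_ne_top.2 (by finiteness)
    have i2 : Integrable fun v => k (v - w) * D v := by
      refine ((h.integrable_k.comp_sub_right w).abs.mul_const M).mono'
        (hkm.mul h.D_cont.measurable).aestronglyMeasurable (ae_of_all _ fun v => ?_)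
      rw [norm_mul, Real.norm_eq_abs, Real.norm_eq_abs]
      gcongr
      exact hM v
    have e1 : corrK k D w = ∫ v, k (v - w) * D v := by
      rw [corrK, ← integral_sub_right_eq_self _ w]
      simp
    have e2 : corrKK k w - corrK k D w = ∫ v, k (v - w) * (k v - D v) := by
      rw [e1, corrKK, ← integral_sub i1 i2]
      congr with v; ring
    rw [e2]
    exact (enorm_integral_le_lintegral_enorm _).trans
      (hs k C D ε h w hw.1.1 hw.1.2 (abs_le.2 hw.2))
  calc _ ≤ ∫⁻ w in slab R, a * a * c * e ^ 2 * (iw (pd (w + 0)) ^ (2 : ℝ)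
        + e * iw ε ^ (1 / 2 : ℝ) * (iw (pd w) ^ (3 / 2 : ℝ) * iw (pd w + ε) ^ (2 : ℝ))) := by
        refine setLIntegral_mono' (measurableSet_slab R) fun w hw => ?_
        rw [enorm_mul, enorm_pow, add_zero]
        have e3 : iw (pd w + ε) ^ (2 : ℝ) ≤ iw (pd w) ^ (2 : ℝ) := by
          gcongr; exact iw_anti (by linarith [h.ε_pos])
        calc _ ≤ (a * e * iw (pd w + ε) ^ (1 : ℝ)) ^ 2
              * (c * (1 + e * (iw ε ^ (1 / 2 : ℝ) * iw (pd w) ^ (3 / 2 : ℝ)))) := by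
              gcongr
              · exact h.C_le w
              · exact hBG w hw
          _ = a * a * c * e ^ 2 * (iw (pd w + ε) ^ (2 : ℝ)
              + e * iw ε ^ (1 / 2 : ℝ) * (iw (pd w) ^ (3 / 2 : ℝ) * iw (pd w + ε) ^ (2 : ℝ))) := by
              rw [ENNReal.rpow_one, ENNReal.rpow_two]; ring
          _ ≤ _ := by gcongr
    _ ≤ ∫⁻ w in box (2 * R + 1), a * a * c * e ^ 2 * (iw (pd (w + 0)) ^ (2 : ℝ)
        + e * iw ε ^ (1 / 2 : ℝ) * (iw (pd w) ^ (3 / 2 : ℝ) * iw (pd w + ε) ^ (2 : ℝ))) :=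
        lintegral_mono_set (slab_subset_box hR)
    _ ≤ a * a * c * e ^ 2 * (c₁ + e * iw ε ^ (1 / 2 : ℝ)
          * (c₂ * iw ε ^ ((3 / 2 : ℝ) + 2 - 3))) := by
        rw [lintegral_const_mul' _ _ (by finiteness), lintegral_add_left
          (measurable_iw_pd_add 0 _),
          lintegral_const_mul' _ _ (by finiteness)]
        gcongr
        exact h₁ 0
    _ = a * a * c * e ^ 2 * (c₁ + c₂ * (e * (iw ε ^ (1 / 2 : ℝ) * iw ε ^ (1 / 2 : ℝ)))) := by
        have : (3 / 2 : ℝ) + 2 - 3 = 1 / 2 := by norm_num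
        rw [this]; ring
    _ = _ := by
        rw [← iw_rpow_add _ (by norm_num) (by norm_num)]
        norm_num
        rw [he]; ring

/-- The integration by parts in the space variable. The integrand is `(4 / ε) ∂_x (C² (k ⋆ C))`, because
`∂_x C = (ε / 2) D`; only boundary terms at `x = ± 1/2` remain, which are of order `ε³`. -/
lemma exists_integral_slab_le (hR : 0 < R) (ha : a ≠ ⊤) :
    ∃ c : ℝ≥0∞, c ≠ ⊤ ∧ ∀ (k C D : ℝ × ℝ → ℝ) (ε : ℝ), CovKernel k C D R ε a →
      ‖∫ w in slab R, (4 * (D w * (C w * corrK k C w)) + 2 * (C w ^ 2 * corrK k D w))‖ₑ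
        ≤ c * ENNReal.ofReal ε ^ 2 := by
  obtain ⟨c, hc, hA⟩ := exists_corrK_le hR ha
  refine ⟨32 * (a * a) * c * ENNReal.ofReal (2 * R), by finiteness, fun k C D ε h => ?_⟩
  have hε := h.ε_pos
  have cA : Continuous (corrK k C) := h.continuous_corrK h.C_cont h.C_bdd
  have cG : Continuous (corrK k D) := h.continuous_corrK h.D_cont h.D_bdd
  have cC := h.C_cont
  have cD := h.D_cont
  set f : ℝ × ℝ → ℝ := fun w => 4 * (D w * (C w * corrK k C w)) + 2 * (C w ^ 2 * corrK k D w)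
    with hf
  have cf : Continuous f := by fun_prop
  have e1 : ∫ w in slab R, f w
      = ∫ t in Ioc 0 (2 * R), ∫ x in Icc (-(1 / 2) : ℝ) (1 / 2), f (t, x) := by
    rw [slab, Measure.volume_eq_prod]
    refine setIntegral_prod f ?_
    rw [← Measure.volume_eq_prod]
    exact integrableOn_slab cf
  have e2 : ∀ t, ∫ x in Icc (-(1 / 2) : ℝ) (1 / 2), f (t, x) = 4 / ε *
      (C (t, 1 / 2) ^ 2 * corrK k C (t, 1 / 2)
        - C (t, -(1 / 2)) ^ 2 * corrK k C (t, -(1 / 2))) := by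
    intro t
    have hd : ∀ x ∈ uIcc (-(1 / 2) : ℝ) (1 / 2),
        HasDerivAt (fun x => 4 / ε * (C (t, x) ^ 2 * corrK k C (t, x))) (f (t, x)) x := by
      intro x _
      have h1 := (((h.C_deriv t x).pow 2).mul (h.hasDerivAt_corrK t x)).const_mul (4 / ε)
      refine h1.congr_deriv ?_
      simp only [hf, Pi.pow_apply]
      field_simp
      norm_num
      ring
    have h2 := intervalIntegral.integral_eq_sub_of_hasDerivAt hd
      ((cf.comp (by fun_prop : Continuous fun x : ℝ => (t, x))).intervalIntegrable _ _)
    rw [integral_Icc_eq_integral_Ioc, ← intervalIntegral.integral_of_le (by norm_num)]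
    rw [mul_sub]
    exact h2
  have hb : ∀ t y : ℝ, |y| = 1 / 2 →
      ‖C (t, y) ^ 2 * corrK k C (t, y)‖ₑ ≤ 4 * (a * a) * c * ENNReal.ofReal ε ^ 3 := by
    intro t y hy
    have h1 : iw (pd (t, y)) ≤ 2 := by
      have e2 := iw_inv_nat (n := 2) (by norm_num)
      rw [Nat.cast_ofNat] at e2
      refine (iw_anti (a := 1 / 2) ?_).trans_eq e2
      have h3 := circle_norm_eq hy.le
      have : 0 ≤ min √|t| 1 := le_min (Real.sqrt_nonneg _) zero_le_one
      unfold pd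
      dsimp only
      linarith
    rw [enorm_mul, enorm_pow]
    calc _ ≤ (a * ENNReal.ofReal ε * 2) ^ 2 * (c * ENNReal.ofReal ε) := by
          gcongr
          · refine (h.C_le_pd _).trans ?_
            rw [ENNReal.rpow_one]
            gcongr
          · exact hA k C D ε h _
      _ = _ := by ring
  rw [e1]
  calc _ ≤ ∫⁻ t in Ioc 0 (2 * R), ‖∫ x in Icc (-(1 / 2) : ℝ) (1 / 2), f (t, x)‖ₑ :=
        enorm_integral_le_lintegral_enorm _
    _ ≤ ∫⁻ _ in Ioc 0 (2 * R), 32 * (a * a) * c * ENNReal.ofReal ε ^ 2 := by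
        refine lintegral_mono fun t => ?_
        rw [e2 t, enorm_mul, Real.enorm_eq_ofReal (by positivity)]
        calc _ ≤ ENNReal.ofReal (4 / ε) * (4 * (a * a) * c * ENNReal.ofReal ε ^ 3
              + 4 * (a * a) * c * ENNReal.ofReal ε ^ 3) := by
              gcongr
              refine enorm_sub_le.trans (add_le_add (hb t _ ?_) (hb t _ ?_))
              · norm_num [abs_of_pos]
              · rw [abs_neg]; norm_num [abs_of_pos]
          _ = 8 * (a * a) * c * ENNReal.ofReal ε ^ 2
              * (ENNReal.ofReal (4 / ε) * ENNReal.ofReal ε) := by ring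
          _ = _ := by
              rw [← ENNReal.ofReal_mul (by positivity), div_mul_cancel₀ _ hε.ne',
                ENNReal.ofReal_ofNat]
              ring
    _ = _ := by
        rw [lintegral_const, Measure.restrict_apply_univ, Real.volume_Ioc, sub_zero]; ring

end Bounds

namespace CovKernel

variable {k C D : ℝ × ℝ → ℝ} {R ε : ℝ} {a : ℝ≥0∞}

lemma continuous_corrK_C (h : CovKernel k C D R ε a) : Continuous (corrK k C) :=
  h.continuous_corrK h.C_cont h.C_bdd

lemma integrable_sq_mul_corrKK (h : CovKernel k C D R ε a) :
    Integrable fun w => C w ^ 2 * corrKK k w := by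
  obtain ⟨c, hc, hB⟩ := exists_lintegral_sq_mul_corrKK_le h.R_pos h.a_ne
  refine ⟨((h.C_cont.pow 2).measurable.mul h.measurable_corrK_neg).aestronglyMeasurable, ?_⟩
  exact (hB k C D ε h).trans_lt (lt_top_iff_ne_top.2 (by finiteness))

lemma integrable_k_mul_corrK (h : CovKernel k C D R ε a) :
    Integrable fun w => k w * (C w * corrK k C w) := by
  obtain ⟨c, hc, hB⟩ := exists_lintegral_k_mul_corrK_le h.R_pos h.a_ne
  refine ⟨(h.k_meas.mul (h.C_cont.mul h.continuous_corrK_C).measurable).aestronglyMeasurable, ?_⟩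
  exact (hB k C D ε h).trans_lt (lt_top_iff_ne_top.2 (by finiteness))

lemma corrKK_neg (w : ℝ × ℝ) : corrKK k (-w) = corrKK k w := by
  unfold corrKK
  rw [← integral_sub_right_eq_self _ w]
  congr with u
  rw [sub_neg_eq_add, sub_add_cancel, mul_comm]

/-- By symmetry only positive times matter in the first integral. This is the source of the factor `2`
in front of `C² (k ⋆ D)` which makes the two integrands add up to a derivative. -/
lemma integral_sq_mul_corrKK (h : CovKernel k C D R ε a) :
    ∫ w, C w ^ 2 * corrKK k w = 2 * ∫ w in {w | 0 < w.1}, C w ^ 2 * corrKK k w := by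
  have hi := h.integrable_sq_mul_corrKK
  set H : ℝ × ℝ → ℝ := fun w => C w ^ 2 * corrKK k w with hH
  have hneg : ∀ w, H (-w) = H w := fun w => by simp only [hH]; rw [h.C_neg, corrKK_neg]
  have hm : MeasurableSet {w : ℝ × ℝ | 0 < w.1} := measurableSet_lt measurable_const measurable_fst
  have e : ∫ w in {w : ℝ × ℝ | 0 < w.1}ᶜ, H w = ∫ w in {w : ℝ × ℝ | 0 < w.1}, H w := by
    rw [← integral_indicator hm, ← integral_indicator hm.compl, ← integral_neg_eq_self]
    refine integral_congr_ae ?_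
    filter_upwards [ae_fst_ne 0] with w hw
    rcases lt_or_gt_of_ne hw with h0 | h0
    · rw [indicator_of_notMem, indicator_of_notMem]
      · exact not_lt.2 h0.le
      · simpa using h0
    · rw [indicator_of_mem, indicator_of_mem, hneg]
      · exact h0
      · simpa using h0.le
  rw [← integral_add_compl hm hi, e]; ring

end CovKernel

/-- The two leading contributions cancel up to an error of order `ε²`, although by power counting each
of them is only of order `ε² |log ε|`. -/
lemma exists_cancellation {R : ℝ} (hR : 0 < R) {a : ℝ≥0∞} (ha : a ≠ ⊤) :
    ∃ c : ℝ≥0∞, c ≠ ⊤ ∧ ∀ (k C D : ℝ × ℝ → ℝ) (ε : ℝ), CovKernel k C D R ε a →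
      ‖(∫ w, C w ^ 2 * corrKK k w) + 4 * ∫ w, k w * (C w * corrK k C w)‖ₑ
        ≤ c * ENNReal.ofReal ε ^ 2 := by
  obtain ⟨c₁, hc₁, h₁⟩ := exists_lintegral_sq_mul_corrKK_diff_slab_le hR ha
  obtain ⟨c₂, hc₂, h₂⟩ := exists_lintegral_k_mul_corrK_compl_slab_le hR ha
  obtain ⟨c₃, hc₃, h₃⟩ := exists_lintegral_sub_mul_corrK_slab_le hR ha
  obtain ⟨c₄, hc₄, h₄⟩ := exists_lintegral_sq_mul_sub_slab_le hR ha
  obtain ⟨c₅, hc₅, h₅⟩ := exists_integral_slab_le hR ha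
  refine ⟨2 * c₁ + 4 * c₂ + 4 * c₃ + 2 * c₄ + c₅, by finiteness, fun k C D ε h => ?_⟩
  have cA : Continuous (corrK k C) := h.continuous_corrK_C
  have cG : Continuous (corrK k D) := h.continuous_corrK h.D_cont h.D_bdd
  have cC := h.C_cont
  have cD := h.D_cont
  have hS := measurableSet_slab R
  have hP : MeasurableSet {w : ℝ × ℝ | 0 < w.1} := measurableSet_lt measurable_const measurable_fst
  have iH := h.integrable_sq_mul_corrKK
  have iJ := h.integrable_k_mul_corrK
  have i1 : IntegrableOn (fun w => D w * (C w * corrK k C w)) (slab R) :=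
    integrableOn_slab (by fun_prop)
  have i2 : IntegrableOn (fun w => C w ^ 2 * corrK k D w) (slab R) :=
    integrableOn_slab (by fun_prop)
  have eP : ∫ w in {w | 0 < w.1}, C w ^ 2 * corrKK k w
      = (∫ w in {w | 0 < w.1} \ slab R, C w ^ 2 * corrKK k w)
        + ∫ w in slab R, C w ^ 2 * corrKK k w := by
    rw [← setIntegral_union disjoint_sdiff_left hS iH.integrableOn iH.integrableOn,
      sdiff_union_of_subset fun w hw => hw.1.1]
  have eJ := integral_add_compl hS iJ
  have e3 : ∫ w in slab R, (k w - D w) * (C w * corrK k C w)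
      = (∫ w in slab R, k w * (C w * corrK k C w)) - ∫ w in slab R, D w * (C w * corrK k C w) := by
    rw [← integral_sub iJ.integrableOn i1]; congr with w; ring
  have e4 : ∫ w in slab R, C w ^ 2 * (corrKK k w - corrK k D w)
      = (∫ w in slab R, C w ^ 2 * corrKK k w) - ∫ w in slab R, C w ^ 2 * corrK k D w := by
    rw [← integral_sub iH.integrableOn i2]; congr with w; ring
  have e5 : ∫ w in slab R, (4 * (D w * (C w * corrK k C w)) + 2 * (C w ^ 2 * corrK k D w))
      = 4 * (∫ w in slab R, D w * (C w * corrK k C w))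
        + 2 * ∫ w in slab R, C w ^ 2 * corrK k D w := by
    rw [integral_add (i1.const_mul 4) (i2.const_mul 2), integral_const_mul, integral_const_mul]
  have key : (∫ w, C w ^ 2 * corrKK k w) + 4 * ∫ w, k w * (C w * corrK k C w)
      = 2 * (∫ w in {w | 0 < w.1} \ slab R, C w ^ 2 * corrKK k w)
        + 4 * (∫ w in (slab R)ᶜ, k w * (C w * corrK k C w))
        + 4 * (∫ w in slab R, (k w - D w) * (C w * corrK k C w))
        + 2 * (∫ w in slab R, C w ^ 2 * (corrKK k w - corrK k D w))
        + ∫ w in slab R, (4 * (D w * (C w * corrK k C w)) + 2 * (C w ^ 2 * corrK k D w)) := by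
    rw [h.integral_sq_mul_corrKK, eP, ← eJ, e3, e4, e5]; ring
  have n2 : ∀ x : ℝ, ‖2 * x‖ₑ = 2 * ‖x‖ₑ := fun x => by
    rw [enorm_mul, Real.enorm_eq_ofReal zero_le_two, ENNReal.ofReal_ofNat]
  have n4 : ∀ x : ℝ, ‖4 * x‖ₑ = 4 * ‖x‖ₑ := fun x => by
    rw [enorm_mul, Real.enorm_eq_ofReal zero_le_four, ENNReal.ofReal_ofNat]
  rw [key]
  calc _ ≤ 2 * (c₁ * ENNReal.ofReal ε ^ 2) + 4 * (c₂ * ENNReal.ofReal ε ^ 2)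
        + 4 * (c₃ * ENNReal.ofReal ε ^ 2) + 2 * (c₄ * ENNReal.ofReal ε ^ 2)
        + c₅ * ENNReal.ofReal ε ^ 2 := by
        refine (enorm_add_le _ _).trans (add_le_add ((enorm_add_le _ _).trans (add_le_add
          ((enorm_add_le _ _).trans (add_le_add ((enorm_add_le _ _).trans (add_le_add ?_ ?_)) ?_))
          ?_)) (h₅ k C D ε h))
        · rw [n2]; gcongr
          exact (enorm_integral_le_lintegral_enorm _).trans (h₁ k C D ε h)
        · rw [n4]; gcongr
          exact (enorm_integral_le_lintegral_enorm _).trans (h₂ k C D ε h)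
        · rw [n4]; gcongr
          exact (enorm_integral_le_lintegral_enorm _).trans (h₃ k C D ε h)
        · rw [n2]; gcongr
          exact (enorm_integral_le_lintegral_enorm _).trans (h₄ k C D ε h)
    _ = _ := by ring

/-! ### The error terms -/

/-- Power counting for `∫∫ |u|^(-α) |w|^(-β) |u + w|^(-δ) (|u + w| + ε)^(-γ)`: the integral is
dominated by the scale `ε`, of order `ε^(6 - α - β - δ - γ)`, when all the sub-integrals converge.
-/
lemma exists_lintegral_conv_le {R α β δ γ : ℝ} (hR : 0 ≤ R) (hα : 0 < α) (hα3 : α < 3) (hβ : 0 < β)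
    (hβ3 : β < 3) (hαβ : 3 < α + β) (hδ : 0 ≤ δ) (hγ : 0 < γ) (h6 : α + β + δ < 6)
    (h7 : 6 < α + β + δ + γ) :
    ∃ c : ℝ≥0∞, c ≠ ⊤ ∧ ∀ (ε : ℝ) (K₁ K₂ K₃ : ℝ≥0∞) (f g φ : ℝ × ℝ → ℝ≥0∞), 0 < ε →
      K₁ ≠ ⊤ → K₂ ≠ ⊤ → K₃ ≠ ⊤ →
      (∀ u, f u ≤ (box R).indicator (fun u => K₁ * iw (pd u) ^ α) u) →
      (∀ u, g u ≤ (box R).indicator (fun u => K₂ * iw (pd u) ^ β) u) →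
      (∀ u, φ u ≤ K₃ * (iw (pd u) ^ δ * iw (pd u + ε) ^ γ)) →
      ∫⁻ p : (ℝ × ℝ) × (ℝ × ℝ), f p.1 * (g p.2 * φ (p.1 + p.2))
        ≤ K₁ * K₂ * K₃ * c * iw ε ^ (α + β + δ + γ - 6) := by
  obtain ⟨c₁, hc₁, h₁⟩ := exists_riesz_pd hR hα hα3 hβ hβ3 hαβ
  obtain ⟨c₂, hc₂, h₂⟩ := exists_lintegral_box_reg_le (R := 2 * R) (α := α + β - 3 + δ) (β := γ)
    (by positivity) (by linarith) (by linarith) hγ (by linarith)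
  refine ⟨c₁ * c₂, by finiteness, fun ε K₁ K₂ K₃ f g φ hε hK₁ hK₂ hK₃ hf hg hφ => ?_⟩
  set F : ℝ → ℝ × ℝ → ℝ≥0∞ := fun s => (box R).indicator (fun u => iw (pd u) ^ s) with hF
  set Φ : ℝ × ℝ → ℝ≥0∞ := fun v => iw (pd v) ^ δ * iw (pd v + ε) ^ γ with hΦ
  have mF : ∀ s, Measurable (F s) := fun s =>
    (measurable_iw_rpow continuous_pd s).indicator (measurableSet_box R)
  have mΦ : Measurable Φ := (measurable_iw_rpow continuous_pd δ).mul
    (measurable_iw_rpow (continuous_pd.add continuous_const) γ)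
  have eF : ∀ (K : ℝ≥0∞) s u, (box R).indicator (fun u => K * iw (pd u) ^ s) u = K * F s u := by
    intro K s u
    by_cases hu : u ∈ box R <;> simp [hF, hu]
  set G : (ℝ × ℝ) × (ℝ × ℝ) → ℝ≥0∞ := fun p => F α p.1 * (F β (p.2 - p.1) * Φ p.2) with hG
  have mG : Measurable G := ((mF α).comp measurable_fst).mul
    (((mF β).comp (measurable_snd.sub measurable_fst)).mul (mΦ.comp measurable_snd))
  have hinner : ∀ v, ∫⁻ u, G (u, v) ≤ (box (2 * R)).indicator (fun v =>
      c₁ * (iw (pd v) ^ (α + β - 3 + δ) * iw (pd v + ε) ^ γ)) v := by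
    intro v
    by_cases hv : v ∈ box (2 * R)
    · rw [indicator_of_mem hv]
      have mm : Measurable fun u => iw (pd u) ^ α * iw (pd (u + -v)) ^ β :=
        (measurable_iw_rpow continuous_pd α).mul (measurable_iw_pd_add _ β)
      calc ∫⁻ u, G (u, v) ≤ ∫⁻ u, (box R).indicator
            (fun u => Φ v * (iw (pd u) ^ α * iw (pd (u + -v)) ^ β)) u := by
            refine lintegral_mono fun u => ?_
            by_cases hu : u ∈ box R
            · rw [indicator_of_mem hu]
              simp only [hG, hF, indicator_of_mem hu]
              rw [mul_comm (Φ v), mul_assoc]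
              gcongr
              refine (indicator_le_self _ _ _).trans ?_
              rw [← sub_eq_add_neg, pd_sub_comm]
            · simp [hG, hF, hu]
        _ ≤ Φ v * (c₁ * iw (pd (-v)) ^ (α + β - 3)) := by
            rw [lintegral_indicator (measurableSet_box R), lintegral_const_mul _ mm]
            gcongr
            exact h₁ _
        _ = _ := by
            rw [pd_neg, hΦ, iw_rpow_add _ (by linarith : 0 ≤ α + β - 3) hδ]; ring
    · rw [indicator_of_notMem hv]
      refine le_of_eq (lintegral_eq_zero_of_ae_eq_zero (ae_of_all _ fun u => ?_))
      by_cases hu : u ∈ box R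
      · have : v - u ∉ box R := fun h => hv (by
          have := box_add h hu
          rwa [sub_add_cancel, ← two_mul] at this)
        simp [hG, hF, this]
      · simp [hG, hF, hu]
  calc _ ≤ ∫⁻ p : (ℝ × ℝ) × (ℝ × ℝ), K₁ * K₂ * K₃ * G (p.1, p.1 + p.2) := by
        refine lintegral_mono fun p => ?_
        have l1 := hf p.1
        have l2 := hg p.2
        rw [eF] at l1 l2
        refine (mul_le_mul' l1 (mul_le_mul' l2 (hφ _))).trans_eq ?_
        simp only [hG, hΦ, add_sub_cancel_left]
        ring
    _ = K₁ * K₂ * K₃ * ∫⁻ p : (ℝ × ℝ) × (ℝ × ℝ), G (p.1, p.1 + p.2) :=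
        lintegral_const_mul' _ _ (by finiteness)
    _ = K₁ * K₂ * K₃ * ∫⁻ p, G p := by
        congr 1
        rw [Measure.volume_eq_prod]
        exact (measurePreserving_prod_add (volume : Measure (ℝ × ℝ)) volume).lintegral_comp mG
    _ = K₁ * K₂ * K₃ * ∫⁻ v, ∫⁻ u, G (u, v) := by
        rw [Measure.volume_eq_prod, lintegral_prod_symm _ mG.aemeasurable]
    _ ≤ K₁ * K₂ * K₃ * (c₁ * (c₂ * iw ε ^ (α + β - 3 + δ + γ - 3))) := by
        gcongr
        refine (lintegral_mono hinner).trans ?_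
        rw [lintegral_indicator (measurableSet_box _), lintegral_const_mul' _ _ hc₁]
        gcongr
        exact h₂ ε hε
    _ = _ := by
        rw [show α + β - 3 + δ + γ - 3 = α + β + δ + γ - 6 by ring]; ring

namespace CovKernel

variable {k C D : ℝ × ℝ → ℝ} {R ε : ℝ} {a : ℝ≥0∞}

lemma k_mul_C_ind_le (h : CovKernel k C D R ε a) (z : ℝ × ℝ) :
    ‖k z * C z‖ₑ ≤ (box R).indicator
      (fun z => (a * a * ENNReal.ofReal ε * iw ε ^ (1 / 2 : ℝ)) * iw (pd z) ^ (5 / 2 : ℝ)) z := by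
  by_cases hz : z ∈ box R
  · rw [indicator_of_mem hz, enorm_mul]
    have h1 := iw_reg_le (pd z) (pd_nonneg z) h.ε_pos (α := 1 / 2) (β := 1 / 2)
      (by norm_num) (by norm_num)
    rw [show (1 / 2 : ℝ) + 1 / 2 = 1 by norm_num] at h1
    calc _ ≤ a * iw (pd z) ^ (2 : ℝ) * (a * ENNReal.ofReal ε
          * (iw ε ^ (1 / 2 : ℝ) * iw (pd z) ^ (1 / 2 : ℝ))) := by
          gcongr
          · exact h.k_le_pd z
          · refine (h.C_le z).trans ?_
            gcongr
      _ = _ := by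
          rw [show (5 / 2 : ℝ) = 2 + 1 / 2 by norm_num, iw_rpow_add _ (by norm_num) (by norm_num)]
          ring
  · rw [h.k_supp z hz]; simp

lemma C_pow_le (h : CovKernel k C D R ε a) (n : ℕ) (z : ℝ × ℝ) :
    ‖C z ^ n‖ₑ ≤ (a * ENNReal.ofReal ε) ^ n
      * (iw (pd z) ^ (0 : ℝ) * iw (pd z + ε) ^ (n : ℝ)) := by
  rw [enorm_pow, ENNReal.rpow_zero, one_mul, ENNReal.rpow_natCast, ← mul_pow]
  gcongr
  have := h.C_le z
  rwa [ENNReal.rpow_one] at this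

end CovKernel

lemma iw_half_mul_half {ε : ℝ} (e : ℝ≥0∞) {s : ℝ} (hs : 0 ≤ s) (n : ℕ)
    (hn : s + 1 / 2 = n) (he : e * iw ε = 1) : e ^ n * (iw ε ^ (1 / 2 : ℝ) * iw ε ^ s) = 1 := by
  rw [← iw_rpow_add _ (by norm_num) hs, add_comm, hn, ENNReal.rpow_natCast, ← mul_pow, he, one_pow]

section Errors

variable {R : ℝ} {a : ℝ≥0∞}

lemma exists_lintegral_error_four_le (hR : 0 < R) (ha : a ≠ ⊤) :
    ∃ c : ℝ≥0∞, c ≠ ⊤ ∧ ∀ (k C D : ℝ × ℝ → ℝ) (ε : ℝ), CovKernel k C D R ε a →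
      ∫⁻ p : (ℝ × ℝ) × (ℝ × ℝ), ‖k p.1 * (k p.2 * C (p.1 - p.2) ^ 4)‖ₑ
        ≤ c * ENNReal.ofReal ε ^ 2 := by
  obtain ⟨c, hc, hr⟩ := exists_lintegral_conv_le (α := 2) (β := 2) (δ := 0) (γ := 4) hR.le
    (by norm_num) (by norm_num) (by norm_num) (by norm_num) (by norm_num) le_rfl (by norm_num)
    (by norm_num) (by norm_num)
  refine ⟨a ^ 6 * c, by finiteness, fun k C D ε h => ?_⟩
  have he := ofReal_mul_iw h.ε_pos
  set e := ENNReal.ofReal ε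
  have hmp : MeasurePreserving (Prod.map id Neg.neg : (ℝ × ℝ) × (ℝ × ℝ) → (ℝ × ℝ) × (ℝ × ℝ)) := by
    rw [Measure.volume_eq_prod]
    exact (MeasurePreserving.id _).prod (Measure.measurePreserving_neg _)
  have hm : Measurable fun p : (ℝ × ℝ) × (ℝ × ℝ) => ‖k p.1 * (k p.2 * C (p.1 - p.2) ^ 4)‖ₑ :=
    ((h.k_meas.comp measurable_fst).mul ((h.k_meas.comp measurable_snd).mul
      ((h.C_cont.measurable.comp (measurable_fst.sub measurable_snd)).pow_const 4))).enorm
  have e4 := h.C_pow_le 4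
  rw [← hmp.lintegral_comp hm]
  calc _ = ∫⁻ p : (ℝ × ℝ) × (ℝ × ℝ), ‖k p.1‖ₑ * (‖k (-p.2)‖ₑ * ‖C (p.1 + p.2) ^ 4‖ₑ) := by
        congr with p
        simp only [Prod.map_fst, Prod.map_snd, id_eq, sub_neg_eq_add, enorm_mul]
    _ ≤ a * a * (a * e) ^ 4 * c * iw ε ^ ((2 : ℝ) + 2 + 0 + 4 - 6) := by
        refine hr ε a a ((a * e) ^ 4) (fun u => ‖k u‖ₑ) (fun u => ‖k (-u)‖ₑ)
          (fun u => ‖C u ^ 4‖ₑ) h.ε_pos ha ha (by finiteness) h.k_ind_le (fun u => ?_) ?_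
        · by_cases hu : u ∈ box R
          · rw [indicator_of_mem hu, ← pd_neg]; exact h.k_le_pd _
          · rw [h.k_supp (-u) fun hn => hu (by simpa using box_neg hn)]; simp
        · intro u; exact_mod_cast e4 u
    _ = a ^ 6 * c * e ^ 2 * (e * iw ε) ^ 2 := by
        rw [show (2 : ℝ) + 2 + 0 + 4 - 6 = (2 : ℕ) by norm_num, ENNReal.rpow_natCast]; ring
    _ = _ := by rw [he]; ring

lemma exists_lintegral_error_two_le (hR : 0 < R) (ha : a ≠ ⊤) :
    ∃ c : ℝ≥0∞, c ≠ ⊤ ∧ ∀ (k C D : ℝ × ℝ → ℝ) (ε : ℝ), CovKernel k C D R ε a →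
      ∫⁻ p : (ℝ × ℝ) × (ℝ × ℝ), ‖(k p.1 * C p.1) * (k p.2 * C (p.1 + p.2) ^ 2)‖ₑ
        ≤ c * ENNReal.ofReal ε ^ 2 := by
  obtain ⟨c, hc, hr⟩ := exists_lintegral_conv_le (α := 5 / 2) (β := 2) (δ := 0) (γ := 2) hR.le
    (by norm_num) (by norm_num) (by norm_num) (by norm_num) (by norm_num) le_rfl (by norm_num)
    (by norm_num) (by norm_num)
  refine ⟨a ^ 5 * c, by finiteness, fun k C D ε h => ?_⟩
  have he := ofReal_mul_iw h.ε_pos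
  have hit : iw ε ^ (1 / 2 : ℝ) ≠ ⊤ :=
    ENNReal.rpow_ne_top_of_nonneg (by norm_num) (iw_ne_top h.ε_pos)
  set e := ENNReal.ofReal ε
  have e4 := h.C_pow_le 2
  simp_rw [enorm_mul (k _ * C _), enorm_mul (k _) (C _ ^ 2)]
  refine (hr ε _ a ((a * e) ^ 2) (fun u => ‖k u * C u‖ₑ) (fun u => ‖k u‖ₑ)
    (fun u => ‖C u ^ 2‖ₑ) h.ε_pos (by finiteness) ha (by finiteness) h.k_mul_C_ind_le h.k_ind_le
    (fun u => by exact_mod_cast e4 u)).trans_eq ?_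
  rw [show (5 / 2 : ℝ) + 2 + 0 + 2 - 6 = 1 / 2 by norm_num]
  have := iw_half_mul_half e (s := 1 / 2) (by norm_num) 1 (by norm_num) he
  calc _ = a ^ 5 * c * e ^ 2 * (e ^ 1 * (iw ε ^ (1 / 2 : ℝ) * iw ε ^ (1 / 2 : ℝ))) := by ring
    _ = _ := by rw [this, mul_one]

lemma exists_lintegral_error_three_le (hR : 0 < R) (ha : a ≠ ⊤) :
    ∃ c : ℝ≥0∞, c ≠ ⊤ ∧ ∀ (k C D : ℝ × ℝ → ℝ) (ε : ℝ), CovKernel k C D R ε a →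
      ∫⁻ p : (ℝ × ℝ) × (ℝ × ℝ), ‖k p.1 * ((k p.2 * C p.2) * C (p.1 + p.2) ^ 3)‖ₑ
        ≤ c * ENNReal.ofReal ε ^ 2 := by
  obtain ⟨c, hc, hr⟩ := exists_lintegral_conv_le (α := 2) (β := 5 / 2) (δ := 0) (γ := 3) hR.le
    (by norm_num) (by norm_num) (by norm_num) (by norm_num) (by norm_num) le_rfl (by norm_num)
    (by norm_num) (by norm_num)
  refine ⟨a ^ 6 * c, by finiteness, fun k C D ε h => ?_⟩
  have he := ofReal_mul_iw h.ε_pos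
  have hit : iw ε ^ (1 / 2 : ℝ) ≠ ⊤ :=
    ENNReal.rpow_ne_top_of_nonneg (by norm_num) (iw_ne_top h.ε_pos)
  set e := ENNReal.ofReal ε
  have e4 := h.C_pow_le 3
  simp_rw [enorm_mul (k _) (_ * _), enorm_mul (k _ * C _)]
  refine (hr ε a _ ((a * e) ^ 3) (fun u => ‖k u‖ₑ) (fun u => ‖k u * C u‖ₑ)
    (fun u => ‖C u ^ 3‖ₑ) h.ε_pos ha (by finiteness) (by finiteness) h.k_ind_le h.k_mul_C_ind_le
    (fun u => by exact_mod_cast e4 u)).trans_eq ?_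
  rw [show (2 : ℝ) + 5 / 2 + 0 + 3 - 6 = 3 / 2 by norm_num]
  have := iw_half_mul_half e (s := 3 / 2) (by norm_num) 2 (by norm_num) he
  calc _ = a ^ 6 * c * e ^ 2 * (e ^ 2 * (iw ε ^ (1 / 2 : ℝ) * iw ε ^ (3 / 2 : ℝ))) := by ring
    _ = _ := by rw [this, mul_one]

/-- Here the most singular factor is the one at the point `u`, which becomes the outer variable of
integration. -/
lemma exists_lintegral_error_mixed_le (hR : 0 < R) (ha : a ≠ ⊤) :
    ∃ c : ℝ≥0∞, c ≠ ⊤ ∧ ∀ (k C D : ℝ × ℝ → ℝ) (ε : ℝ), CovKernel k C D R ε a →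
      ∫⁻ p : (ℝ × ℝ) × (ℝ × ℝ), ‖(k p.1 * C p.1 ^ 2) * ((k p.2 * C p.2) * C (p.1 + p.2))‖ₑ
        ≤ c * ENNReal.ofReal ε ^ 2 := by
  obtain ⟨c, hc, hr⟩ := exists_lintegral_conv_le (R := 2 * R) (α := 5 / 2) (β := 1) (δ := 2)
    (γ := 2) (by positivity)
    (by norm_num) (by norm_num) (by norm_num) (by norm_num) (by norm_num) two_pos.le (by norm_num)
    (by norm_num) (by norm_num)
  refine ⟨a ^ 6 * c, by finiteness, fun k C D ε h => ?_⟩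
  have he := ofReal_mul_iw h.ε_pos
  have hit : iw ε ^ (1 / 2 : ℝ) ≠ ⊤ :=
    ENNReal.rpow_ne_top_of_nonneg (by norm_num) (iw_ne_top h.ε_pos)
  have hk := h.k_mul_C_ind_le
  set e := ENNReal.ofReal ε
  have hsub : box R ⊆ box (2 * R) := fun z hz =>
    ⟨⟨by linarith [hz.1.1], by linarith [hz.1.2]⟩, ⟨by linarith [hz.2.1], by linarith [hz.2.2]⟩⟩
  set g : ℝ × ℝ → ℝ≥0∞ := (box (2 * R)).indicator fun z => ‖C z‖ₑ with hg
  have mg : Measurable g := h.C_cont.measurable.enorm.indicator (measurableSet_box _)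
  have hmp : MeasurePreserving (fun p : (ℝ × ℝ) × (ℝ × ℝ) => (-p.2, p.2 + p.1)) := by
    rw [Measure.volume_eq_prod]
    exact ((Measure.measurePreserving_neg _).prod (MeasurePreserving.id _)).comp
      (measurePreserving_prod_add_swap (volume : Measure (ℝ × ℝ)) volume)
  set Ψ : (ℝ × ℝ) × (ℝ × ℝ) → ℝ≥0∞ := fun q =>
    ‖k (-q.1) * C (-q.1)‖ₑ * (g q.2 * ‖k (q.1 + q.2) * C (q.1 + q.2) ^ 2‖ₑ) with hΨ
  have mk := h.k_meas
  have mC := h.C_cont.measurable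
  have mΨ : Measurable Ψ := by
    have m1 : Measurable fun z => ‖k (-z) * C (-z)‖ₑ :=
      ((mk.comp measurable_neg).mul (mC.comp measurable_neg)).enorm
    have m2 : Measurable fun z => ‖k z * C z ^ 2‖ₑ := (mk.mul (mC.pow_const 2)).enorm
    exact (m1.comp measurable_fst).mul ((mg.comp measurable_snd).mul
      (m2.comp (measurable_fst.add measurable_snd)))
  calc _ ≤ ∫⁻ p : (ℝ × ℝ) × (ℝ × ℝ), Ψ (-p.2, p.2 + p.1) := by
        refine lintegral_mono fun p => ?_
        simp only [hΨ, neg_neg, neg_add_cancel_left]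
        by_cases h1 : p.1 ∈ box R
        · by_cases h2 : p.2 ∈ box R
          · have h3 : p.2 + p.1 ∈ box (2 * R) := by rw [two_mul]; exact box_add h2 h1
            rw [hg, indicator_of_mem h3, enorm_mul, enorm_mul (k p.2 * C p.2), add_comm p.1]
            exact le_of_eq (by ring)
          · simp [h.k_supp _ h2]
        · simp [h.k_supp _ h1]
    _ = ∫⁻ q, Ψ q := hmp.lintegral_comp mΨ
    _ ≤ (a * a * e * iw ε ^ (1 / 2 : ℝ)) * (a * e) * (a * (a * e) ^ 2) * c
          * iw ε ^ ((5 / 2 : ℝ) + 1 + 2 + 2 - 6) := by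
        refine hr ε (a * a * e * iw ε ^ (1 / 2 : ℝ)) (a * e) (a * (a * e) ^ 2)
          (fun u => ‖k (-u) * C (-u)‖ₑ) g (fun u => ‖k u * C u ^ 2‖ₑ) h.ε_pos (by finiteness)
          (by finiteness) (by finiteness) (fun u => ?_) (fun u => ?_) fun u => ?_
        · refine (hk (-u)).trans ?_
          by_cases hu : -u ∈ box R
          · have : u ∈ box R := by simpa using box_neg hu
            rw [indicator_of_mem hu, indicator_of_mem (hsub this), pd_neg]
          · rw [indicator_of_notMem hu]; exact bot_le
        · by_cases hu : u ∈ box (2 * R)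
          · rw [hg, indicator_of_mem hu, indicator_of_mem hu]; exact h.C_le_pd u
          · rw [hg, indicator_of_notMem hu, indicator_of_notMem hu]
        · rw [enorm_mul]
          refine (mul_le_mul' (h.k_le_pd u) (h.C_pow_le 2 u)).trans_eq ?_
          rw [ENNReal.rpow_zero, Nat.cast_ofNat]; ring
    _ = a ^ 6 * c * e ^ 2 * (e ^ 2 * (iw ε ^ (1 / 2 : ℝ) * iw ε ^ (3 / 2 : ℝ))) := by
        rw [show (5 / 2 : ℝ) + 1 + 2 + 2 - 6 = 3 / 2 by norm_num]; ring
    _ = _ := by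
        rw [iw_half_mul_half e (s := 3 / 2) (by norm_num) 2 (by norm_num) he, mul_one]

/-- The factor `C(w)³` is not compensated by the singularity at `u + w`, and the increment under the
reflection of `w` is needed. -/
lemma exists_lintegral_error_reflect_le (hR : 0 < R) (ha : a ≠ ⊤) :
    ∃ c : ℝ≥0∞, c ≠ ⊤ ∧ ∀ (k C D : ℝ × ℝ → ℝ) (ε : ℝ), CovKernel k C D R ε a →
      ∫⁻ p : (ℝ × ℝ) × (ℝ × ℝ),
        ‖k p.1 * ((k p.2 * C p.2 ^ 3) * (C (p.1 + p.2) - C (p.1 + xrefl p.2)))‖ₑ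
        ≤ c * ENNReal.ofReal ε ^ 2 := by
  obtain ⟨c₁, hc₁, h₁⟩ := exists_lintegral_k_mul_reflect_le hR ha
  obtain ⟨c₂, hc₂, h₂⟩ := exists_lintegral_box_reg_le (α := 2) (β := 3) hR.le (by norm_num)
    (by norm_num) (by norm_num) (by norm_num)
  refine ⟨a ^ 4 * c₁ * c₂, by finiteness, fun k C D ε h => ?_⟩
  have he := ofReal_mul_iw h.ε_pos
  have h₁' := h₁ k C D ε h
  have h₂' := h₂ ε h.ε_pos
  have hC3 := h.C_pow_le 3
  have mk := h.k_meas
  have mC := h.C_cont.measurable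
  have mx : Measurable (xrefl : ℝ × ℝ → ℝ × ℝ) := measurableEmbedding_xrefl.measurable
  set e := ENNReal.ofReal ε
  have hm : Measurable fun p : (ℝ × ℝ) × (ℝ × ℝ) =>
      ‖k p.1 * ((k p.2 * C p.2 ^ 3) * (C (p.1 + p.2) - C (p.1 + xrefl p.2)))‖ₑ := by
    have m1 : Measurable fun z => k z * C z ^ 3 := mk.mul (mC.pow_const 3)
    exact ((mk.comp measurable_fst).mul ((m1.comp measurable_snd).mul
      ((mC.comp (measurable_fst.add measurable_snd)).sub
        (mC.comp (measurable_fst.add (mx.comp measurable_snd)))))).enorm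
  rw [Measure.volume_eq_prod, lintegral_prod_symm _ hm.aemeasurable]
  calc _ = ∫⁻ w, ‖k w‖ₑ * (‖C w ^ 3‖ₑ
        * ∫⁻ u, ‖k u‖ₑ * ‖C (u + w) - C (u + xrefl w)‖ₑ) := by
        congr with w
        rw [← mul_assoc, ← lintegral_const_mul' _ _ (by finiteness)]
        congr with u
        simp only [enorm_mul]; ring
    _ ≤ ∫⁻ w in box R, (a * iw (pd w) ^ (2 : ℝ)) * ((a * e) ^ 3 * (iw (pd w + ε) ^ (3 : ℝ))
          * (c₁ * e)) := by
        rw [h.lintegral_k_mul_eq]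
        refine lintegral_mono fun w => mul_le_mul' (h.k_le_pd w) (mul_le_mul' ?_ (h₁' w))
        refine (hC3 w).trans_eq ?_
        rw [ENNReal.rpow_zero, one_mul, Nat.cast_ofNat]
    _ = ∫⁻ w in box R, a ^ 4 * c₁ * e ^ 4 * (iw (pd w) ^ (2 : ℝ) * iw (pd w + ε) ^ (3 : ℝ)) := by
        congr with w; ring
    _ ≤ a ^ 4 * c₁ * e ^ 4 * (c₂ * iw ε ^ ((2 : ℝ) + 3 - 3)) := by
        rw [lintegral_const_mul' _ _ (by finiteness)]; gcongr
    _ = a ^ 4 * c₁ * c₂ * e ^ 2 * (e * iw ε) ^ 2 := by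
        rw [show (2 : ℝ) + 3 - 3 = (2 : ℕ) by norm_num, ENNReal.rpow_natCast]; ring
    _ = _ := by rw [he]; ring

end Errors

/-! ### The leading terms of the two integrals -/

lemma abs_le_of_enorm_le {x e : ℝ} {c : ℝ≥0∞} (hc : c ≠ ⊤) (he : 0 ≤ e) (n : ℕ)
    (h : ‖x‖ₑ ≤ c * ENNReal.ofReal e ^ n) : |x| ≤ c.toReal * e ^ n := by
  rw [← Real.norm_eq_abs, ← toReal_enorm]
  have := ENNReal.toReal_mono (by finiteness) h
  rwa [ENNReal.toReal_mul, ENNReal.toReal_pow, ENNReal.toReal_ofReal he] at this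

/-- The reflection of the second of two space-time points. -/
def reflSnd (p : (ℝ × ℝ) × (ℝ × ℝ)) : (ℝ × ℝ) × (ℝ × ℝ) := (p.1, xrefl p.2)

lemma measurePreserving_reflSnd : MeasurePreserving reflSnd := by
  rw [Measure.volume_eq_prod]
  exact (MeasurePreserving.id _).prod measurePreserving_xrefl

lemma measurableEmbedding_reflSnd : MeasurableEmbedding reflSnd :=
  MeasurableEmbedding.id.prodMap measurableEmbedding_xrefl

lemma integral_reflSnd (f : (ℝ × ℝ) × (ℝ × ℝ) → ℝ) : ∫ p, f (reflSnd p) = ∫ p, f p :=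
  measurePreserving_reflSnd.integral_comp measurableEmbedding_reflSnd f

lemma lintegral_reflSnd (f : (ℝ × ℝ) × (ℝ × ℝ) → ℝ≥0∞) : ∫⁻ p, f (reflSnd p) = ∫⁻ p, f p :=
  measurePreserving_reflSnd.lintegral_comp_emb measurableEmbedding_reflSnd f

namespace CovKernel

variable {k C D : ℝ × ℝ → ℝ} {R ε : ℝ} {a : ℝ≥0∞}

lemma integrable_k_mul_k_mul (h : CovKernel k C D R ε a) {T : (ℝ × ℝ) × (ℝ × ℝ) → ℝ}
    (hT : Measurable T) (hb : ∃ M : ℝ, ∀ p, |T p| ≤ M) :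
    Integrable fun p : (ℝ × ℝ) × (ℝ × ℝ) => k p.1 * k p.2 * T p := by
  obtain ⟨M, hM⟩ := hb
  have h1 : Integrable fun p : (ℝ × ℝ) × (ℝ × ℝ) => k p.1 * k p.2 := by
    rw [Measure.volume_eq_prod]
    exact h.integrable_k.mul_prod h.integrable_k
  refine (h1.abs.mul_const M).mono' (h1.aestronglyMeasurable.mul hT.aestronglyMeasurable)
    (ae_of_all _ fun p => ?_)
  rw [norm_mul, Real.norm_eq_abs, Real.norm_eq_abs]
  gcongr
  exact hM p

/-- The leading term of the first integral as a single integral. -/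
lemma integral_k_mul_k_mul_sq (h : CovKernel k C D R ε a) :
    ∫ p : (ℝ × ℝ) × (ℝ × ℝ), k p.1 * k p.2 * C (p.1 - p.2) ^ 2 = ∫ w, C w ^ 2 * corrKK k w := by
  have mC := h.C_cont.measurable
  have mk := h.k_meas
  obtain ⟨M, hM⟩ := h.C_bdd
  have hi := h.integrable_k_mul_k_mul (T := fun p => C (p.1 - p.2) ^ 2)
    ((mC.comp (measurable_fst.sub measurable_snd)).pow_const 2)
    ⟨M ^ 2, fun p => by rw [abs_pow]; gcongr; exact hM _⟩
  have hmp : MeasurePreserving (MeasurableEquiv.shearAddRight (ℝ × ℝ)) := by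
    rw [Measure.volume_eq_prod]
    exact measurePreserving_prod_add (volume : Measure (ℝ × ℝ)) volume
  -- the change of variables `(u, w) ↦ (u, u + w)`, followed by `w ↦ -w`
  have e1 := hmp.integral_comp' (fun p : (ℝ × ℝ) × (ℝ × ℝ) => k p.1 * k p.2 * C (p.1 - p.2) ^ 2)
  have i1 := hmp.integrable_comp_of_integrable hi
  rw [← e1]
  have e2 : ∀ p : (ℝ × ℝ) × (ℝ × ℝ), MeasurableEquiv.shearAddRight (ℝ × ℝ) p = (p.1, p.1 + p.2) :=
    fun p => rfl
  have e3 : ((fun p : (ℝ × ℝ) × (ℝ × ℝ) => k p.1 * k p.2 * C (p.1 - p.2) ^ 2)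
      ∘ MeasurableEquiv.shearAddRight (ℝ × ℝ))
      = fun p => k p.1 * k (p.1 + p.2) * C (p.1 - (p.1 + p.2)) ^ 2 := rfl
  rw [e3] at i1
  simp only [e2]
  rw [Measure.volume_eq_prod] at i1 ⊢
  rw [integral_prod_symm _ i1, ← integral_neg_eq_self]
  refine integral_congr_ae (ae_of_all _ fun w => ?_)
  dsimp only
  rw [corrKK, ← integral_const_mul]
  refine integral_congr_ae (ae_of_all _ fun u => ?_)
  dsimp only
  rw [show u - (u + -w) = w by abel, ← sub_eq_add_neg]
  ring

/-- The leading term of the second integral as a single integral. -/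
lemma integral_k_mul_k_mul_mul (h : CovKernel k C D R ε a) :
    ∫ p : (ℝ × ℝ) × (ℝ × ℝ), k p.1 * k p.2 * (C p.2 * C (p.1 + p.2))
      = ∫ w, k w * (C w * corrK k C w) := by
  have mC := h.C_cont.measurable
  obtain ⟨M, hM⟩ := h.C_bdd
  have hi := h.integrable_k_mul_k_mul (T := fun p => C p.2 * C (p.1 + p.2))
    ((mC.comp measurable_snd).mul (mC.comp (measurable_fst.add measurable_snd)))
    ⟨M * M, fun p => by
      have := hM p.2
      rw [abs_mul]
      exact mul_le_mul this (hM _) (abs_nonneg _) ((abs_nonneg _).trans this)⟩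
  rw [Measure.volume_eq_prod] at hi ⊢
  rw [integral_prod_symm _ hi]
  refine integral_congr_ae (ae_of_all _ fun w => ?_)
  dsimp only
  rw [corrK, ← mul_assoc, ← integral_const_mul]
  refine integral_congr_ae (ae_of_all _ fun u => ?_)
  dsimp only
  ring

end CovKernel

section Leading

variable {R : ℝ} {a : ℝ≥0∞}

/-- The first integral, for an integrand `T` with the expansion of a covariance. -/
lemma exists_abs_integral_sub_sq_le (hR : 0 < R) (ha : a ≠ ⊤) :
    ∃ c : ℝ, 0 ≤ c ∧ ∀ (k C D : ℝ × ℝ → ℝ) (ε A b : ℝ) (T : (ℝ × ℝ) × (ℝ × ℝ) → ℝ),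
      CovKernel k C D R ε a → 0 ≤ A → Measurable T → (∃ M : ℝ, ∀ p, |T p| ≤ M) →
      (∀ p, |T p - b * C (p.1 - p.2) ^ 2| ≤ A * C (p.1 - p.2) ^ 4) →
      |(∫ p, k p.1 * k p.2 * T p) - b * ∫ w, C w ^ 2 * corrKK k w| ≤ A * c * ε ^ 2 := by
  obtain ⟨c, hc, hE⟩ := exists_lintegral_error_four_le hR ha
  refine ⟨c.toReal, ENNReal.toReal_nonneg, fun k C D ε A b T h hA hT hb hTC => ?_⟩
  obtain ⟨M, hM⟩ := h.C_bdd
  have mC := h.C_cont.measurable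
  have i1 := h.integrable_k_mul_k_mul hT hb
  have i2 := h.integrable_k_mul_k_mul (T := fun p => C (p.1 - p.2) ^ 2)
    ((mC.comp (measurable_fst.sub measurable_snd)).pow_const 2)
    ⟨M ^ 2, fun p => by rw [abs_pow]; gcongr; exact hM _⟩
  rw [← h.integral_k_mul_k_mul_sq, ← integral_const_mul, ← integral_sub i1 (i2.const_mul b)]
  have key := abs_le_of_enorm_le (c := ENNReal.ofReal A * c) (by finiteness) h.ε_pos.le 2
    (x := ∫ p, (k p.1 * k p.2 * T p - b * (k p.1 * k p.2 * C (p.1 - p.2) ^ 2))) ?_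
  · rwa [ENNReal.toReal_mul, ENNReal.toReal_ofReal hA] at key
  refine (enorm_integral_le_lintegral_enorm _).trans ?_
  calc _ ≤ ∫⁻ p : (ℝ × ℝ) × (ℝ × ℝ),
        ENNReal.ofReal A * ‖k p.1 * (k p.2 * C (p.1 - p.2) ^ 4)‖ₑ := by
        refine lintegral_mono fun p => ?_
        rw [show k p.1 * k p.2 * T p - b * (k p.1 * k p.2 * C (p.1 - p.2) ^ 2)
          = (k p.1 * k p.2) * (T p - b * C (p.1 - p.2) ^ 2) by ring, ← mul_assoc (k p.1),
          enorm_mul, enorm_mul _ (C _ ^ 4), mul_left_comm]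
        gcongr
        rw [← Real.enorm_eq_ofReal hA, ← enorm_mul, enorm_le_iff_norm_le, Real.norm_eq_abs,
          Real.norm_eq_abs]
        exact (hTC p).trans (le_abs_self _)
    _ = ENNReal.ofReal A * ∫⁻ p : (ℝ × ℝ) × (ℝ × ℝ), ‖k p.1 * (k p.2 * C (p.1 - p.2) ^ 4)‖ₑ :=
        lintegral_const_mul' _ _ (by finiteness)
    _ ≤ ENNReal.ofReal A * (c * ENNReal.ofReal ε ^ 2) := by gcongr; exact hE k C D ε h
    _ = _ := by ring

/-- The error of the expansion, split into monomials with at least three factors; the increment is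
kept only in the last one. -/
lemma abs_error_le (p q r s : ℝ) :
    |s - q| * (|p| * (|q| + |s|) + |r| * (p ^ 2 + q ^ 2 + s ^ 2 + r ^ 2))
      ≤ (2 * (|p| * s ^ 2) + p ^ 2 * |r| * |s| + 2 * (|r| * |s| ^ 3))
        + (2 * (|p| * q ^ 2) + p ^ 2 * |r| * |q| + 2 * (|r| * |q| ^ 3)) + |r| ^ 3 * |s - q| := by
  have key : ∀ p q r s d : ℝ, 0 ≤ p → 0 ≤ q → 0 ≤ r → 0 ≤ s → d ≤ q + s →
      d * (p * (q + s) + r * (p ^ 2 + q ^ 2 + s ^ 2 + r ^ 2))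
        ≤ (2 * (p * s ^ 2) + p ^ 2 * r * s + 2 * (r * s ^ 3))
          + (2 * (p * q ^ 2) + p ^ 2 * r * q + 2 * (r * q ^ 3)) + r ^ 3 * d := by
    intro p q r s d hp hq hr hs h1
    have e1 : d * (p * (q + s)) ≤ (q + s) * (p * (q + s)) := by gcongr
    have e2 : d * (r * (p ^ 2 + q ^ 2 + s ^ 2)) ≤ (q + s) * (r * (p ^ 2 + q ^ 2 + s ^ 2)) := by
      gcongr
    have e3 : 0 ≤ p * (q - s) ^ 2 := by positivity
    have e4 : 0 ≤ r * ((q + s) * (q - s) ^ 2) := by positivity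
    nlinarith
  rw [← sq_abs p, ← sq_abs q, ← sq_abs s, ← sq_abs r]
  exact key _ _ _ _ _ (abs_nonneg p) (abs_nonneg q) (abs_nonneg r) (abs_nonneg s)
    (by rw [add_comm]; exact abs_sub s q)

/-- The second integral. The expansion of `T` is only needed for its increments under the reflection
of `w`, since `k` is odd. -/
lemma exists_abs_integral_sub_mul_le (hR : 0 < R) (ha : a ≠ ⊤) :
    ∃ c : ℝ, 0 ≤ c ∧ ∀ (k C D : ℝ × ℝ → ℝ) (ε A b : ℝ) (T : (ℝ × ℝ) × (ℝ × ℝ) → ℝ),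
      CovKernel k C D R ε a → 0 ≤ A → Measurable T → (∃ M : ℝ, ∀ p, |T p| ≤ M) →
      (∀ u w, |T (u, w) - T (u, xrefl w) - b * C w * (C (u + w) - C (u + xrefl w))|
        ≤ A * (|C (u + w) - C (u + xrefl w)| * (|C u| * (|C (u + xrefl w)| + |C (u + w)|)
          + |C w| * (C u ^ 2 + C (u + xrefl w) ^ 2 + C (u + w) ^ 2 + C w ^ 2)))) →
      |(∫ p, k p.1 * k p.2 * T p) - b * ∫ w, k w * (C w * corrK k C w)| ≤ A * c * ε ^ 2 := by
  obtain ⟨c₁, hc₁, h₁⟩ := exists_lintegral_error_two_le hR ha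
  obtain ⟨c₂, hc₂, h₂⟩ := exists_lintegral_error_mixed_le hR ha
  obtain ⟨c₃, hc₃, h₃⟩ := exists_lintegral_error_three_le hR ha
  obtain ⟨c₄, hc₄, h₄⟩ := exists_lintegral_error_reflect_le hR ha
  set c := (2 * c₁ + c₂ + 2 * c₃) + (2 * c₁ + c₂ + 2 * c₃) + c₄ with hcdef
  have hc : c ≠ ⊤ := by finiteness
  refine ⟨c.toReal, ENNReal.toReal_nonneg, fun k C D ε A b T h hA hT hb hTC => ?_⟩
  obtain ⟨M, hM⟩ := h.C_bdd
  have mC := h.C_cont.measurable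
  have mk := h.k_meas
  have i1 := h.integrable_k_mul_k_mul hT hb
  have i2 := h.integrable_k_mul_k_mul (T := fun p => C p.2 * C (p.1 + p.2))
    ((mC.comp measurable_snd).mul (mC.comp (measurable_fst.add measurable_snd)))
    ⟨M * M, fun p => by
      have := hM p.2
      rw [abs_mul]
      exact mul_le_mul this (hM _) (abs_nonneg _) ((abs_nonneg _).trans this)⟩
  set f : (ℝ × ℝ) × (ℝ × ℝ) → ℝ := fun p =>
    k p.1 * k p.2 * T p - b * (k p.1 * k p.2 * (C p.2 * C (p.1 + p.2))) with hf
  have hfi : Integrable f := i1.sub (i2.const_mul b)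
  have hfi' : Integrable fun p => f (reflSnd p) :=
    measurePreserving_reflSnd.integrable_comp_of_integrable hfi
  rw [← h.integral_k_mul_k_mul_mul, ← integral_const_mul, ← integral_sub i1 (i2.const_mul b)]
  -- average over the reflection of `w`, under which `k(w)` is odd
  have e1 : ∫ p, f p = 1 / 2 * ∫ p, (f p + f (reflSnd p)) := by
    rw [integral_add hfi hfi', integral_reflSnd]; ring
  set t₁ : (ℝ × ℝ) × (ℝ × ℝ) → ℝ := fun p => (k p.1 * C p.1) * (k p.2 * C (p.1 + p.2) ^ 2)
  set t₂ : (ℝ × ℝ) × (ℝ × ℝ) → ℝ := fun p =>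
    (k p.1 * C p.1 ^ 2) * ((k p.2 * C p.2) * C (p.1 + p.2))
  set t₃ : (ℝ × ℝ) × (ℝ × ℝ) → ℝ := fun p => k p.1 * ((k p.2 * C p.2) * C (p.1 + p.2) ^ 3)
  set t₄ : (ℝ × ℝ) × (ℝ × ℝ) → ℝ := fun p =>
    k p.1 * ((k p.2 * C p.2 ^ 3) * (C (p.1 + p.2) - C (p.1 + xrefl p.2)))
  set S : (ℝ × ℝ) × (ℝ × ℝ) → ℝ≥0∞ := fun p => 2 * ‖t₁ p‖ₑ + ‖t₂ p‖ₑ + 2 * ‖t₃ p‖ₑ with hS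
  have m₁ : Measurable fun p => ‖t₁ p‖ₑ := (((mk.mul mC).comp measurable_fst).mul
    ((mk.comp measurable_snd).mul ((mC.comp (measurable_fst.add measurable_snd)).pow_const 2))).enorm
  have m₂ : Measurable fun p => ‖t₂ p‖ₑ := (((mk.mul (mC.pow_const 2)).comp measurable_fst).mul
    (((mk.mul mC).comp measurable_snd).mul (mC.comp (measurable_fst.add measurable_snd)))).enorm
  have m₃ : Measurable fun p => ‖t₃ p‖ₑ := ((mk.comp measurable_fst).mul
    (((mk.mul mC).comp measurable_snd).mul
      ((mC.comp (measurable_fst.add measurable_snd)).pow_const 3))).enorm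
  have mS : Measurable S := ((m₁.const_mul 2).add m₂).add (m₃.const_mul 2)
  have hpt : ∀ p, ‖f p + f (reflSnd p)‖ₑ ≤ ENNReal.ofReal A * (S p + S (reflSnd p) + ‖t₄ p‖ₑ) := by
    rintro ⟨u, w⟩
    have e2 : f (u, w) + f (reflSnd (u, w)) = (k u * k w)
        * (T (u, w) - T (u, xrefl w) - b * C w * (C (u + w) - C (u + xrefl w))) := by
      simp only [hf, reflSnd, h.k_odd, h.C_refl]; ring
    have e3 : |f (u, w) + f (reflSnd (u, w))| ≤ A * ((2 * |t₁ (u, w)| + |t₂ (u, w)|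
        + 2 * |t₃ (u, w)|) + (2 * |t₁ (reflSnd (u, w))| + |t₂ (reflSnd (u, w))|
        + 2 * |t₃ (reflSnd (u, w))|) + |t₄ (u, w)|) := by
      rw [e2, abs_mul]
      refine (mul_le_mul_of_nonneg_left (hTC u w) (abs_nonneg _)).trans ?_
      rw [mul_left_comm]
      refine mul_le_mul_of_nonneg_left ?_ hA
      refine (mul_le_mul_of_nonneg_left (abs_error_le (C u) (C (u + xrefl w)) (C w) (C (u + w)))
        (abs_nonneg _)).trans_eq ?_
      simp only [t₁, t₂, t₃, t₄, reflSnd, h.k_odd, h.C_refl, abs_mul, abs_neg, abs_pow, sq_abs]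
      ring
    rw [Real.enorm_eq_ofReal_abs]
    refine (ENNReal.ofReal_le_ofReal e3).trans_eq ?_
    rw [ENNReal.ofReal_mul hA, ENNReal.ofReal_add (by positivity) (by positivity),
      ENNReal.ofReal_add (by positivity) (by positivity)]
    have e4 : ∀ x y z : ℝ, ENNReal.ofReal (2 * |x| + |y| + 2 * |z|)
        = 2 * ‖x‖ₑ + ‖y‖ₑ + 2 * ‖z‖ₑ := fun x y z => by
      rw [ENNReal.ofReal_add (by positivity) (by positivity),
        ENNReal.ofReal_add (by positivity) (by positivity), ENNReal.ofReal_mul zero_le_two,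
        ENNReal.ofReal_mul zero_le_two, ENNReal.ofReal_ofNat, Real.enorm_eq_ofReal_abs,
        Real.enorm_eq_ofReal_abs, Real.enorm_eq_ofReal_abs]
    rw [e4, e4, Real.enorm_eq_ofReal_abs (t₄ _)]
  have hSle : ∫⁻ p, S p ≤ (2 * c₁ + c₂ + 2 * c₃) * ENNReal.ofReal ε ^ 2 := by
    simp only [hS]
    rw [lintegral_add_right _ (m₃.const_mul 2), lintegral_add_right _ m₂,
      lintegral_const_mul' _ _ (by finiteness), lintegral_const_mul' _ _ (by finiteness)]
    calc _ ≤ 2 * (c₁ * ENNReal.ofReal ε ^ 2) + c₂ * ENNReal.ofReal ε ^ 2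
          + 2 * (c₃ * ENNReal.ofReal ε ^ 2) := by
          gcongr
          · exact h₁ k C D ε h
          · exact h₂ k C D ε h
          · exact h₃ k C D ε h
      _ = _ := by ring
  have key := abs_le_of_enorm_le (c := ENNReal.ofReal A * c) (by finiteness) h.ε_pos.le 2
    (x := ∫ p, (f p + f (reflSnd p))) ?_
  · rw [ENNReal.toReal_mul, ENNReal.toReal_ofReal hA] at key
    change |∫ p, f p| ≤ _
    rw [e1, abs_mul, abs_of_pos (by norm_num : (0 : ℝ) < 1 / 2)]
    have := (abs_nonneg _).trans key
    linarith
  refine (enorm_integral_le_lintegral_enorm _).trans ?_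
  calc _ ≤ ∫⁻ p, ENNReal.ofReal A * (S p + S (reflSnd p) + ‖t₄ p‖ₑ) := lintegral_mono hpt
    _ ≤ ENNReal.ofReal A * ((2 * c₁ + c₂ + 2 * c₃) * ENNReal.ofReal ε ^ 2
        + (2 * c₁ + c₂ + 2 * c₃) * ENNReal.ofReal ε ^ 2 + c₄ * ENNReal.ofReal ε ^ 2) := by
        have mS' : Measurable fun p => S p + S (reflSnd p) :=
          mS.add (mS.comp measurableEmbedding_reflSnd.measurable)
        rw [lintegral_const_mul' _ _ (by finiteness), lintegral_add_left mS', lintegral_add_left mS,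
          lintegral_reflSnd]
        gcongr
        exact h₄ k C D ε h
    _ = _ := by rw [hcdef]; ring

/-- The elementary step from the leading terms to the renormalisation constants. -/
lemma abs_combination_le {b G I J L M ε c : ℝ} (hb : b ≠ 0) (hε : 0 < ε) (hε1 : ε ≤ 1) (hc : 0 ≤ c)
    (hG : |G - 2 * b| ≤ c * ε) (hI : |I - G ^ 2 / 2 * L| ≤ c * ε ^ 2)
    (hJ : |J - G ^ 3 * M| ≤ c * ε ^ 2) (hLM : |L + 4 * M| ≤ c * ε ^ 2) (hL : |L| ≤ c * ε)
    (hM : |M| ≤ c * ε) :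
    |1 / (b ^ 2 * ε ^ 2) * I + 4 * (1 / (4 * b ^ 3 * ε ^ 2) * J)|
      ≤ c / b ^ 2 + c / |b| ^ 3 + 2 * c + c ^ 2 * (c + 4 * |b|) / (2 * b ^ 2)
        + c ^ 2 * (3 * (c + 2 * |b|) ^ 2) / |b| ^ 3 := by
  have hGb : |G| ≤ c + 2 * |b| := by
    have h1 := abs_sub_abs_le_abs_sub G (2 * b)
    rw [abs_mul, abs_of_pos (two_pos : (0 : ℝ) < 2)] at h1
    nlinarith
  have hbpos : 0 < |b| := abs_pos.2 hb
  have h2 : |G ^ 2 - 4 * b ^ 2| ≤ (c + 4 * |b|) * (c * ε) := by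
    rw [show G ^ 2 - 4 * b ^ 2 = (G + 2 * b) * (G - 2 * b) by ring, abs_mul]
    gcongr
    calc |G + 2 * b| ≤ |G| + |2 * b| := abs_add_le _ _
      _ ≤ _ := by rw [abs_mul, abs_of_pos (two_pos : (0 : ℝ) < 2)]; linarith
  have h3 : |G ^ 3 - 8 * b ^ 3| ≤ 3 * (c + 2 * |b|) ^ 2 * (c * ε) := by
    rw [show G ^ 3 - 8 * b ^ 3 = (G ^ 2 + G * (2 * b) + (2 * b) ^ 2) * (G - 2 * b) by ring, abs_mul]
    gcongr
    have hb2 : |2 * b| ≤ c + 2 * |b| := by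
      rw [abs_mul, abs_of_pos (two_pos : (0 : ℝ) < 2)]; linarith
    calc _ ≤ |G ^ 2| + |G * (2 * b)| + |(2 * b) ^ 2| := abs_add_three _ _ _
      _ = |G| ^ 2 + |G| * |2 * b| + |2 * b| ^ 2 := by rw [abs_pow, abs_mul, abs_pow]
      _ ≤ (c + 2 * |b|) ^ 2 + (c + 2 * |b|) * (c + 2 * |b|) + (c + 2 * |b|) ^ 2 := by gcongr
      _ = _ := by ring
  have e : 1 / (b ^ 2 * ε ^ 2) * I + 4 * (1 / (4 * b ^ 3 * ε ^ 2) * J)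
      = (I - G ^ 2 / 2 * L) / ε ^ 2 / b ^ 2 + (J - G ^ 3 * M) / ε ^ 2 / b ^ 3
        + 2 * ((L + 4 * M) / ε ^ 2) + ((G ^ 2 - 4 * b ^ 2) * L) / ε ^ 2 / (2 * b ^ 2)
        + ((G ^ 3 - 8 * b ^ 3) * M) / ε ^ 2 / b ^ 3 := by
    field_simp
    ring
  have hε2 : 0 < ε ^ 2 := by positivity
  have d : ∀ {x y : ℝ}, |x| ≤ y * ε ^ 2 → |x / ε ^ 2| ≤ y := fun {x y} hx => by
    rw [abs_div, abs_of_pos hε2, div_le_iff₀ hε2]; exact hx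
  have l4 : |(G ^ 2 - 4 * b ^ 2) * L| ≤ (c ^ 2 * (c + 4 * |b|)) * ε ^ 2 := by
    rw [abs_mul]
    calc _ ≤ (c + 4 * |b|) * (c * ε) * (c * ε) := by gcongr
      _ = _ := by ring
  have l5 : |(G ^ 3 - 8 * b ^ 3) * M| ≤ (c ^ 2 * (3 * (c + 2 * |b|) ^ 2)) * ε ^ 2 := by
    rw [abs_mul]
    calc _ ≤ 3 * (c + 2 * |b|) ^ 2 * (c * ε) * (c * ε) := by gcongr
      _ = _ := by ring
  have b2 : |b ^ 2| = b ^ 2 := abs_of_pos (by positivity)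
  rw [e]
  refine (abs_add_le _ _).trans (add_le_add ((abs_add_le _ _).trans (add_le_add
    ((abs_add_le _ _).trans (add_le_add ((abs_add_le _ _).trans (add_le_add ?_ ?_)) ?_)) ?_)) ?_)
  · rw [abs_div, b2]; gcongr; exact d hI
  · rw [abs_div, abs_pow]; gcongr; exact d hJ
  · rw [abs_mul, abs_of_pos (two_pos : (0 : ℝ) < 2)]; gcongr; exact d hLM
  · rw [abs_div, abs_mul, b2, abs_of_pos (two_pos : (0 : ℝ) < 2)]; gcongr; exact d l4
  · rw [abs_div, abs_pow]; gcongr; exact d l5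

end Leading

/-! ### The renormalisation constants -/

lemma deriv_odd_of_even {f : ℝ → ℝ} (h : ∀ u, f (-u) = f u) (u : ℝ) :
    deriv f (-u) = -deriv f u := by
  have e : f = fun u => f (-u) := funext fun u => (h u).symm
  conv_rhs => rw [e]
  rw [deriv_comp_neg, neg_neg]

lemma deriv_even_of_odd {f : ℝ → ℝ} (h : ∀ u, f (-u) = -f u) (u : ℝ) :
    deriv f (-u) = deriv f u := by
  have e : f = fun u => -f (-u) := funext fun u => by rw [h, neg_neg]
  conv_rhs => rw [e]
  rw [deriv.fun_neg, deriv_comp_neg, neg_neg]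

lemma IsAdmissibleNonlinearity.polyC {F : ℝ → ℝ} (hF : IsAdmissibleNonlinearity F) : PolyC 7 F := by
  refine ⟨by exact_mod_cast hF.contDiff, fun l hl => ?_⟩
  obtain ⟨-, c, M, -, -, hc, -, h, -⟩ := hF.growth
  refine ⟨c, ⌈M⌉₊, fun u => (h l hl u).trans ?_⟩
  rw [← Real.rpow_natCast]
  gcongr
  · linarith [abs_nonneg u]
  · exact Nat.le_ceil M

section Probability

variable {Ω : Type u} [MeasurableSpace Ω] {μ : Measure Ω} {ρ : ℝ × ℝ → ℝ}
  {ξ : (ℝ × ℝ → ℝ) → Ω → ℝ} {ε : ℝ} {f g h F : ℝ → ℝ}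

/-- The covariances depend continuously on the points, and the expectations on the covariances. -/
lemma continuous_gExp_scaledField (hξ : IsWhiteNoise circleVolume μ ξ) (hr : Continuous ρ)
    (hc : HasCompactSupport ρ) (hε : 0 < ε) (hf : PolyC 2 f) (hg : PolyC 2 g) (hh : PolyC 2 h)
    {E : Type*} [TopologicalSpace E] {P₁ P₂ P₃ : E → ℝ × ℝ} (h₁ : Continuous P₁)
    (h₂ : Continuous P₂) (h₃ : Continuous P₃) :
    Continuous fun p => gExp μ (scaledField ρ ξ ε (P₁ p)) (scaledField ρ ξ ε (P₂ p))
      (scaledField ρ ξ ε (P₃ p)) f g h := by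
  obtain ⟨A, -, hA⟩ := exists_abs_gExp_sub_le.{u} (covFun ρ ε 0) hf hg hh
  have hC := continuous_covFun hr hc hε
  refine continuous_iff_continuousAt.2 fun p₀ => ?_
  refine tendsto_iff_norm_sub_tendsto_zero.2 (squeeze_zero (fun _ => norm_nonneg _) (fun p =>
    hA Ω μ _ _ _ _ _ _ _ _ _ _ _ _ _ (gTriple_scaledField hξ hr hc hε _ _ _)
      (gTriple_scaledField hξ hr hc hε _ _ _) le_rfl) ?_)
  refine Continuous.tendsto' (by fun_prop) _ _ ?_
  simp

lemma exists_abs_gExp_scaledField_le (hξ : IsWhiteNoise circleVolume μ ξ) (hr : Continuous ρ)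
    (hc : HasCompactSupport ρ) (hε : 0 < ε) (hf : PolyC 0 f) (hg : PolyC 0 g) (hh : PolyC 0 h) :
    ∃ M : ℝ, ∀ x y z : ℝ × ℝ, |gExp μ (scaledField ρ ξ ε x) (scaledField ρ ξ ε y)
      (scaledField ρ ξ ε z) f g h| ≤ M := by
  obtain ⟨M, -, hM⟩ := exists_gExp_le.{u} (covFun ρ ε 0) hf hg hh
  exact ⟨M, fun x y z => hM Ω μ _ _ _ _ _ _ _ (gTriple_scaledField hξ hr hc hε x y z) le_rfl⟩

lemma allLp_scaledField [IsProbabilityMeasure μ] (hξ : IsWhiteNoise circleVolume μ ξ)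
    (hr : Continuous ρ) (hc : HasCompactSupport ρ) (hε : 0 < ε) (hf : PolyC 0 f) (z : ℝ × ℝ) :
    AllLp μ fun η => f (scaledField ρ ξ ε z η) :=
  (gTriple_scaledField hξ hr hc hε z z z).allLpX.comp hf.growth hf.continuous

lemma integral_scaledField_eq_gMean (hξ : IsWhiteNoise circleVolume μ ξ) (hr : Continuous ρ)
    (hc : HasCompactSupport ρ) (hε : 0 < ε) (hf : Continuous f) (z : ℝ × ℝ) :
    ∫ η, f (scaledField ρ ξ ε z η) ∂μ = gMean f (covFun ρ ε 0) := by
  have h := gTriple_scaledField hξ hr hc hε z z z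
  exact integral_comp_of_centred h.law.fst h.mX h.vX hf

lemma integral_centred_mul_centred [IsProbabilityMeasure μ] (hξ : IsWhiteNoise circleVolume μ ξ)
    (hr : Continuous ρ) (hc : HasCompactSupport ρ) (hε : 0 < ε) (hF : PolyC 0 F) (y z : ℝ × ℝ) :
    ∫ η, centred μ (fun η' => F (scaledField ρ ξ ε y η')) η
        * centred μ (fun η' => F (scaledField ρ ξ ε z η')) η ∂μ
      = gExp μ (scaledField ρ ξ ε z) (scaledField ρ ξ ε y) (scaledField ρ ξ ε z) (fun _ => 1) F F
        - gMean F (covFun ρ ε 0) * gMean F (covFun ρ ε 0) := by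
  have hY := allLp_scaledField hξ hr hc hε hF y
  have hZ := allLp_scaledField hξ hr hc hε hF z
  have eY := integral_scaledField_eq_gMean hξ hr hc hε hF.continuous y
  have eZ := integral_scaledField_eq_gMean hξ hr hc hε hF.continuous z
  unfold centred gExp
  rw [eY, eZ]
  set m := gMean F (covFun ρ ε 0)
  have e : ∀ η, (F (scaledField ρ ξ ε y η) - m) * (F (scaledField ρ ξ ε z η) - m)
      = 1 * F (scaledField ρ ξ ε y η) * F (scaledField ρ ξ ε z η)
        - (m * F (scaledField ρ ξ ε y η) + m * (F (scaledField ρ ξ ε z η) - m)) := fun η => by ring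
  have i1 : Integrable (fun η => 1 * F (scaledField ρ ξ ε y η) * F (scaledField ρ ξ ε z η)) μ := by
    simp only [one_mul]; exact (hY.mul hZ).integrable
  have i2 : Integrable (fun η => F (scaledField ρ ξ ε z η) - m) μ :=
    hZ.integrable.sub (integrable_const m)
  have i3 : Integrable (fun η => m * F (scaledField ρ ξ ε y η)
      + m * (F (scaledField ρ ξ ε z η) - m)) μ := (hY.integrable.const_mul m).add (i2.const_mul m)
  simp_rw [e]
  rw [integral_sub i1 i3, integral_add (hY.integrable.const_mul m) (i2.const_mul m), integral_const_mul,
    integral_const_mul, integral_sub hZ.integrable (integrable_const m), eY, eZ]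
  simp

lemma integral_mul_mul_centred [IsProbabilityMeasure μ] (hξ : IsWhiteNoise circleVolume μ ξ)
    (hr : Continuous ρ) (hc : HasCompactSupport ρ) (hε : 0 < ε) (hF : PolyC 0 F)
    (hg : PolyC 0 g) (x y z : ℝ × ℝ) :
    ∫ η, g (scaledField ρ ξ ε x η) * g (scaledField ρ ξ ε y η)
        * centred μ (fun η' => F (scaledField ρ ξ ε z η')) η ∂μ
      = gExp μ (scaledField ρ ξ ε x) (scaledField ρ ξ ε y) (scaledField ρ ξ ε z) g g F
        - gMean F (covFun ρ ε 0)
          * ∫ η, g (scaledField ρ ξ ε x η) * g (scaledField ρ ξ ε y η) ∂μ := by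
  have hX := allLp_scaledField hξ hr hc hε hg x
  have hY := allLp_scaledField hξ hr hc hε hg y
  have hZ := allLp_scaledField hξ hr hc hε hF z
  have eZ := integral_scaledField_eq_gMean hξ hr hc hε hF.continuous z
  unfold centred gExp
  rw [eZ]
  simp_rw [mul_sub]
  rw [integral_sub ((hX.mul hY).mul hZ).integrable ((hX.mul hY).integrable.mul_const _),
    integral_mul_const, mul_comm (gMean _ _)]

end Probability

section ChangeOfVariables

lemma measurePreserving_sub_sub (x : ℝ × ℝ) :
    MeasurePreserving fun p : (ℝ × ℝ) × (ℝ × ℝ) => (x - p.1, x - p.2) := by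
  rw [Measure.volume_eq_prod]
  exact (Measure.measurePreserving_sub_left volume x).prod (Measure.measurePreserving_sub_left volume x)

lemma measurableEmbedding_sub_sub (x : ℝ × ℝ) :
    MeasurableEmbedding fun p : (ℝ × ℝ) × (ℝ × ℝ) => (x - p.1, x - p.2) :=
  (MeasurableEquiv.subLeft x).measurableEmbedding.prodMap
    (MeasurableEquiv.subLeft x).measurableEmbedding

lemma measurePreserving_sub_sub_add (x : ℝ × ℝ) :
    MeasurePreserving fun p : (ℝ × ℝ) × (ℝ × ℝ) => (x - p.1, x - (p.1 + p.2)) := by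
  refine (measurePreserving_sub_sub x).comp (g := fun p => (x - p.1, x - p.2))
    (f := fun p : (ℝ × ℝ) × (ℝ × ℝ) => (p.1, p.1 + p.2)) ?_
  rw [Measure.volume_eq_prod]
  exact measurePreserving_prod_add volume volume

lemma measurableEmbedding_sub_sub_add (x : ℝ × ℝ) :
    MeasurableEmbedding fun p : (ℝ × ℝ) × (ℝ × ℝ) => (x - p.1, x - (p.1 + p.2)) :=
  (measurableEmbedding_sub_sub x).comp
    (MeasurableEquiv.shearAddRight (ℝ × ℝ)).measurableEmbedding

end ChangeOfVariables

section Asymptotics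

variable {ρ : ℝ × ℝ → ℝ} {F : ℝ → ℝ} {R : ℝ} {a : ℝ≥0∞}

/-- The integral in `C_{2'2'0}`: it converges, and it equals `2 a_ε² ∫ C² (k ⋆ k)` up to an error of
order `ε²`, where `a_ε = ½ E F''(Φ)`. -/
lemma exists_integrand220_bound (hF : IsAdmissibleNonlinearity F) (hr : Continuous ρ)
    (hc : HasCompactSupport ρ) (hR : 0 < R) (ha : a ≠ ⊤) (V : ℝ) :
    ∃ c : ℝ, 0 ≤ c ∧ ∀ (Ω : Type u) [MeasurableSpace Ω] (μ : Measure Ω) [IsProbabilityMeasure μ]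
      (ξ : (ℝ × ℝ → ℝ) → Ω → ℝ) (K : ℝ × ℝ → ℝ) (ε : ℝ) (x : ℝ × ℝ),
      IsWhiteNoise circleVolume μ ξ →
      CovKernel (spaceDeriv K) (covFun ρ ε) (covDer ρ ε) R ε a → covFun ρ ε 0 ≤ V →
      Integrable (integrand220 μ F K (scaledField ρ ξ ε) x) ∧
      |(∫ p, integrand220 μ F K (scaledField ρ ξ ε) x p)
        - gMean (iteratedDeriv 2 F) (covFun ρ ε 0) ^ 2 / 2
          * ∫ w, covFun ρ ε w ^ 2 * corrKK (spaceDeriv K) w| ≤ c * ε ^ 2 := by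
  have hP := hF.polyC
  have o1 := deriv_odd_of_even hF.even
  have o3 := deriv_odd_of_even (deriv_even_of_odd o1)
  have e2 : iteratedDeriv 2 F = deriv (deriv F) := by
    rw [iteratedDeriv_succ, iteratedDeriv_one]
  obtain ⟨A, hA, hexp⟩ := gExpansion_covariance.{u} (V := V) (hP.mono (by norm_num)) o1 o3
  obtain ⟨c, hc0, hmain⟩ := exists_abs_integral_sub_sq_le hR ha
  refine ⟨2 * A * c, by positivity, fun Ω _ μ _ ξ K ε x hξ h hV => ?_⟩
  have hε := h.ε_pos
  set Φ := scaledField ρ ξ ε with hΦ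
  set C := covFun ρ ε with hC
  set m := gMean F (C 0)
  set T : (ℝ × ℝ) × (ℝ × ℝ) → ℝ := fun p =>
    gExp μ (Φ (x - p.2)) (Φ (x - p.1)) (Φ (x - p.2)) (fun _ => 1) F F - m * m with hT
  have cT : Continuous T := (continuous_gExp_scaledField hξ hr hc hε PolyC.one_fun
    (hP.mono (by norm_num)) (hP.mono (by norm_num)) (by fun_prop) (by fun_prop)
    (by fun_prop)).sub continuous_const
  have bT : ∃ M : ℝ, ∀ p, |T p| ≤ M := by
    obtain ⟨M, hM⟩ := exists_abs_gExp_scaledField_le (f := fun _ => 1) (g := F) (h := F) hξ hr hc hε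
      PolyC.one_fun (hP.mono (by norm_num)) (hP.mono (by norm_num))
    exact ⟨M + |m * m|, fun p => (abs_sub _ _).trans (by gcongr; exact hM _ _ _)⟩
  have hTC : ∀ p, |T p - gMean (iteratedDeriv 2 F) (C 0) ^ 2 / 2 * C (p.1 - p.2) ^ 2|
      ≤ 2 * A * C (p.1 - p.2) ^ 4 := by
    intro p
    have h1 := hexp Ω μ _ _ _ _ _ _ _
      (gTriple_scaledField hξ hr hc hε (x - p.2) (x - p.1) (x - p.2)) hV
    rw [show x - p.2 - (x - p.1) = p.1 - p.2 by abel,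
      show x - p.1 - (x - p.2) = -(p.1 - p.2) by abel, covFun_neg, ← e2] at h1
    rw [show T p - gMean (iteratedDeriv 2 F) (C 0) ^ 2 / 2 * C (p.1 - p.2) ^ 2
      = gExp μ (Φ (x - p.2)) (Φ (x - p.1)) (Φ (x - p.2)) (fun _ => 1) F F
        - (m * m + gMean (iteratedDeriv 2 F) (C 0) ^ 2 / 2 * C (p.1 - p.2) ^ 2) by
      simp only [hT]; ring]
    refine h1.trans_eq ?_
    rw [← Even.pow_abs (by decide : Even 4) (C (p.1 - p.2))]
    ring
  have e : ∀ p : (ℝ × ℝ) × (ℝ × ℝ), integrand220 μ F K Φ x (x - p.1, x - p.2)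
      = spaceDeriv K p.1 * spaceDeriv K p.2 * T p := by
    intro p
    simp only [integrand220, sub_sub_cancel]
    rw [integral_centred_mul_centred hξ hr hc hε (hP.mono (by norm_num))]
  have hi := h.integrable_k_mul_k_mul cT.measurable bT
  constructor
  · rw [← (measurePreserving_sub_sub x).integrable_comp_emb (measurableEmbedding_sub_sub x)]
    exact hi.congr (ae_of_all _ fun p => (e p).symm)
  · rw [← (measurePreserving_sub_sub x).integral_comp (measurableEmbedding_sub_sub x)]
    simp_rw [e]
    exact hmain _ _ _ ε (2 * A) _ T h (by positivity) cT.measurable bT hTC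

/-- The integral in `C_{2'1'1'}`: it converges, and it equals `8 a_ε³ ∫ k C (k ⋆ C)` up to an error
of order `ε²`, where `a_ε = ½ E F''(Φ)`. -/
lemma exists_integrand211_bound (hF : IsAdmissibleNonlinearity F) (hr : Continuous ρ)
    (hc : HasCompactSupport ρ) (hR : 0 < R) (ha : a ≠ ⊤) (V : ℝ) :
    ∃ c : ℝ, 0 ≤ c ∧ ∀ (Ω : Type u) [MeasurableSpace Ω] (μ : Measure Ω) [IsProbabilityMeasure μ]
      (ξ : (ℝ × ℝ → ℝ) → Ω → ℝ) (K : ℝ × ℝ → ℝ) (ε : ℝ) (x : ℝ × ℝ),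
      IsWhiteNoise circleVolume μ ξ →
      CovKernel (spaceDeriv K) (covFun ρ ε) (covDer ρ ε) R ε a → covFun ρ ε 0 ≤ V →
      Integrable (integrand211 μ F K (scaledField ρ ξ ε) x) ∧
      |(∫ p, integrand211 μ F K (scaledField ρ ξ ε) x p)
        - gMean (iteratedDeriv 2 F) (covFun ρ ε 0) ^ 3
          * ∫ w, spaceDeriv K w * (covFun ρ ε w * corrK (spaceDeriv K) (covFun ρ ε) w)|
        ≤ c * ε ^ 2 := by
  have hP := hF.polyC
  have o1 := deriv_odd_of_even hF.even
  have o3 := deriv_odd_of_even (deriv_even_of_odd o1)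
  have e2 : iteratedDeriv 2 F = deriv (deriv F) := by
    rw [iteratedDeriv_succ, iteratedDeriv_one]
  have hP' : PolyC 6 (deriv F) := hP.deriv
  obtain ⟨A, hA, hexp⟩ := exists_abs_gExp_sub_le_of_cov.{u} V hP' o1 o3 hP rfl
  obtain ⟨c, hc0, hmain⟩ := exists_abs_integral_sub_mul_le hR ha
  refine ⟨A * c, by positivity, fun Ω _ μ _ ξ K ε x hξ h hV => ?_⟩
  have hε := h.ε_pos
  set Φ := scaledField ρ ξ ε with hΦ
  set C := covFun ρ ε with hC
  set m := gMean F (C 0)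
  set I : ℝ × ℝ → ℝ := fun u => ∫ η, deriv F (Φ x η) * deriv F (Φ (x - u) η) ∂μ with hI
  have eI : ∀ u, I u
      = gExp μ (Φ x) (Φ (x - u)) (Φ x) (deriv F) (deriv F) (fun _ => 1) := fun u => by
    simp [hI, gExp]
  set T : (ℝ × ℝ) × (ℝ × ℝ) → ℝ := fun p =>
    gExp μ (Φ x) (Φ (x - p.1)) (Φ (x - (p.1 + p.2))) (deriv F) (deriv F) F - m * I p.1 with hT
  have cT : Continuous T := by
    have cI : Continuous fun p : (ℝ × ℝ) × (ℝ × ℝ) => I p.1 := by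
      simp_rw [eI]
      exact continuous_gExp_scaledField hξ hr hc hε (hP'.mono (by norm_num))
        (hP'.mono (by norm_num)) PolyC.one_fun (by fun_prop) (by fun_prop) (by fun_prop)
    exact (continuous_gExp_scaledField hξ hr hc hε (hP'.mono (by norm_num))
      (hP'.mono (by norm_num)) (hP.mono (by norm_num)) (by fun_prop) (by fun_prop)
      (by fun_prop)).sub (continuous_const.mul cI)
  have bT : ∃ M : ℝ, ∀ p, |T p| ≤ M := by
    obtain ⟨M, hM⟩ := exists_abs_gExp_scaledField_le (f := deriv F) (g := deriv F) (h := F) hξ hr hc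
      hε (hP'.mono (by norm_num)) (hP'.mono (by norm_num)) (hP.mono (by norm_num))
    obtain ⟨M₁, hM₁⟩ := exists_abs_gExp_scaledField_le (f := deriv F) (g := deriv F)
      (h := fun _ => 1) hξ hr hc hε (hP'.mono (by norm_num)) (hP'.mono (by norm_num)) PolyC.one_fun
    refine ⟨M + |m| * M₁, fun p => (abs_sub _ _).trans ?_⟩
    rw [abs_mul, eI]
    gcongr
    · exact hM _ _ _
    · exact hM₁ _ _ _
  have hTC : ∀ u w, |T (u, w) - T (u, xrefl w)
      - gMean (iteratedDeriv 2 F) (C 0) ^ 3 * C w * (C (u + w) - C (u + xrefl w))|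
      ≤ A * (|C (u + w) - C (u + xrefl w)| * (|C u| * (|C (u + xrefl w)| + |C (u + w)|)
        + |C w| * (C u ^ 2 + C (u + xrefl w) ^ 2 + C (u + w) ^ 2 + C w ^ 2))) := by
    intro u w
    have hrefl : covFun ρ ε (xrefl w) = covFun ρ ε w := h.C_refl w
    have g1 := gTriple_scaledField hξ hr hc hε x (x - u) (x - (u + w))
    have g0 := gTriple_scaledField hξ hr hc hε x (x - u) (x - (u + xrefl w))
    rw [sub_sub_cancel, sub_sub_cancel,
      show x - u - (x - (u + w)) = w by abel] at g1
    rw [sub_sub_cancel, sub_sub_cancel,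
      show x - u - (x - (u + xrefl w)) = xrefl w by abel, hrefl] at g0
    have h1 := hexp Ω μ _ _ _ _ _ _ _ _ _ _ _ g0 g1 hV
    rw [← e2] at h1
    have e3 : T (u, w) - T (u, xrefl w)
        = gExp μ (Φ x) (Φ (x - u)) (Φ (x - (u + w))) (deriv F) (deriv F) F
          - gExp μ (Φ x) (Φ (x - u)) (Φ (x - (u + xrefl w))) (deriv F) (deriv F) F := by
      simp only [hT]; ring
    rw [e3]
    exact h1
  have e : ∀ p : (ℝ × ℝ) × (ℝ × ℝ), integrand211 μ F K Φ x (x - p.1, x - (p.1 + p.2))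
      = spaceDeriv K p.1 * spaceDeriv K p.2 * T p := by
    intro p
    simp only [integrand211, sub_sub_cancel]
    rw [show x - p.1 - (x - (p.1 + p.2)) = p.2 by abel,
      integral_mul_mul_centred hξ hr hc hε (hP.mono (by norm_num)) (hP'.mono (by norm_num))]
  have hi := h.integrable_k_mul_k_mul cT.measurable bT
  constructor
  · rw [← (measurePreserving_sub_sub_add x).integrable_comp_emb (measurableEmbedding_sub_sub_add x)]
    exact hi.congr (ae_of_all _ fun p => (e p).symm)
  · rw [← (measurePreserving_sub_sub_add x).integral_comp (measurableEmbedding_sub_sub_add x)]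
    simp_rw [e]
    exact hmain _ _ _ ε A _ T h hA cT.measurable bT hTC

end Asymptotics

theorem mainTheorem7 {Ω : Type*} [MeasurableSpace Ω] (μ : Measure Ω) [IsProbabilityMeasure μ]
    (F : ℝ → ℝ) (hF : IsAdmissibleNonlinearity F)
    (ρ : ℝ × ℝ → ℝ) (hρ : IsNoiseMollifier ρ)
    (K : ℝ × ℝ → ℝ) (hK : IsTruncation heatKernelCircle K ∨ IsTruncation heatKernelLine K)
    (ξline : (ℝ × ℝ → ℝ) → Ω → ℝ) (hξline : IsWhiteNoise volume μ ξline)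
    (ξ : (ℝ × ℝ → ℝ) → Ω → ℝ) (hξ : IsWhiteNoise circleVolume μ ξ)
    (a : ℝ) (ha : a = couplingConst μ F ρ ξline) (ha0 : a ≠ 0) :
    ∃ B : ℝ, ∀ ε : ℝ, 0 < ε → ε < 1 → ∀ x : ℝ × ℝ,
      Integrable (integrand220 μ F K (scaledField ρ ξ ε) x) ∧
      Integrable (integrand211 μ F K (scaledField ρ ξ ε) x) ∧
      |renormConst220 μ F K ρ ξ a ε x + 4 * renormConst211 μ F K ρ ξ a ε x| ≤ B := by
  have hr : Continuous ρ := hρ.contDiff.continuous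
  have hc := hρ.compactSupport
  have hP := hF.polyC
  have e2 : iteratedDeriv 2 F = deriv (deriv F) := by
    rw [iteratedDeriv_succ, iteratedDeriv_one]
  have hP2 : PolyC 2 (iteratedDeriv 2 F) := by
    have h5 : PolyC 5 (deriv (deriv F)) := hP.deriv.deriv
    rw [e2]; exact h5.mono (by norm_num)
  obtain ⟨R, A₀, hR, hA₀, hk⟩ : ∃ R A : ℝ, 0 < R ∧ 0 < A ∧ IsTruncatedDeriv (spaceDeriv K) R A := by
    rcases hK with hK | hK
    · exact hK.exists_isTruncatedDeriv (Or.inl rfl)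
    · exact hK.exists_isTruncatedDeriv (Or.inr rfl)
  obtain ⟨α, hα⟩ := exists_covKernel hR hA₀ hk hr hc (fun z => hρ.symm z.1 z.2) hρ.integral_eq_one
  have hαt : α ≠ ⊤ := (hα 1 one_pos le_rfl).a_ne
  set s := ∫ v, autocorr ρ v * lineQ (0 - v) with hs
  -- the coupling constant at scale `ε` is at distance `O(ε)` from `a`
  have haG : 2 * a = gMean (iteratedDeriv 2 F) s := by
    rw [ha, couplingConst_eq_gMean hP2.continuous hξline hr hc]; ring
  obtain ⟨A₁, hA₁, hvar⟩ := exists_covFun_zero_sub_le hr hc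
  set V := |s| + A₁ with hV
  -- `s` is a limit of variances.
  have hs0 : 0 ≤ s := by
    refine le_of_forall_pos_le_add fun δ hδ => ?_
    set ε := min 1 (δ / (A₁ + 1)) with hε
    have hε0 : 0 < ε := lt_min one_pos (by positivity)
    have h1 := (gTriple_scaledField hξ hr hc hε0 0 0 0).var_nonneg
    have h2 := (abs_le.1 (hvar ε hε0 (min_le_left _ _))).2
    have h3 : ε * (A₁ + 1) ≤ δ := by
      rw [← le_div_iff₀ (by positivity)]; exact min_le_right _ _
    nlinarith
  have hCV : ∀ ε : ℝ, 0 < ε → ε ≤ 1 → covFun ρ ε 0 ≤ V := fun ε hε hε1 => by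
    have h2 := (abs_le.1 (hvar ε hε hε1)).2
    have : A₁ * ε ≤ A₁ := mul_le_of_le_one_right hA₁ hε1
    linarith [le_abs_self s]
  obtain ⟨A₂, hA₂, hmean⟩ := exists_abs_gMean_sub_le V hP2
  obtain ⟨c₁, hc₁, h₁⟩ := exists_integrand220_bound hF hr hc hR hαt V
  obtain ⟨c₂, hc₂, h₂⟩ := exists_integrand211_bound hF hr hc hR hαt V
  obtain ⟨c₃, hc₃, h₃⟩ := exists_cancellation hR hαt
  obtain ⟨c₄, hc₄, h₄⟩ := exists_lintegral_sq_mul_corrKK_le hR hαt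
  obtain ⟨c₅, hc₅, h₅⟩ := exists_lintegral_k_mul_corrK_le hR hαt
  set c := A₂ * A₁ + c₁ + c₂ + c₃.toReal + c₄.toReal + c₅.toReal with hcdef
  have p0 : 0 ≤ A₂ * A₁ := by positivity
  have p3 : 0 ≤ c₃.toReal := ENNReal.toReal_nonneg
  have p4 : 0 ≤ c₄.toReal := ENNReal.toReal_nonneg
  have p5 : 0 ≤ c₅.toReal := ENNReal.toReal_nonneg
  refine ⟨c / a ^ 2 + c / |a| ^ 3 + 2 * c + c ^ 2 * (c + 4 * |a|) / (2 * a ^ 2)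
    + c ^ 2 * (3 * (c + 2 * |a|) ^ 2) / |a| ^ 3, fun ε hε hε1 x => ?_⟩
  have h := hα ε hε hε1.le
  obtain ⟨i1, b1⟩ := h₁ _ μ ξ K ε x hξ h (hCV ε hε hε1.le)
  obtain ⟨i2, b2⟩ := h₂ _ μ ξ K ε x hξ h (hCV ε hε hε1.le)
  refine ⟨i1, i2, ?_⟩
  have b3 := abs_le_of_enorm_le hc₃ hε.le 2 (h₃ _ _ _ ε h)
  have b4 := abs_le_of_enorm_le hc₄ hε.le 1
    ((enorm_integral_le_lintegral_enorm _).trans ((h₄ _ _ _ ε h).trans_eq (by rw [pow_one])))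
  have b5 := abs_le_of_enorm_le hc₅ hε.le 1
    ((enorm_integral_le_lintegral_enorm _).trans ((h₅ _ _ _ ε h).trans_eq (by rw [pow_one])))
  rw [pow_one] at b4 b5
  have b0 : |gMean (iteratedDeriv 2 F) (covFun ρ ε 0) - 2 * a| ≤ A₂ * A₁ * ε := by
    rw [haG, mul_assoc]
    refine (hmean s (covFun ρ ε 0) hs0 (gTriple_scaledField hξ hr hc hε 0 0 0).var_nonneg ?_
      (hCV ε hε hε1.le)).trans ?_
    · rw [hV]; linarith [le_abs_self s]
    · gcongr
      exact hvar ε hε hε1.le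
  have hε2 : 0 ≤ ε ^ 2 := by positivity
  exact abs_combination_le ha0 hε hε1.le (c := c) (by positivity)
    (b0.trans (by gcongr; linarith)) (b1.trans (by gcongr; linarith))
    (b2.trans (by gcongr; linarith)) (b3.trans (by gcongr; linarith))
    (b4.trans (by gcongr; linarith)) (b5.trans (by gcongr; linarith))
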